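/- **Setting.** Let $\Delta\subset\mathbb R^N$ be a reflexive lattice polytope with interior lattice point $0$ (so $0\in\operatorname{int}\Delta$ and $\Delta$ and its polar are integral), nonsingular: exactly $N$ edges emanate from each vertex and their lattice points generate $\mathbb Z^N$ as an affine lattice. Let $A\subset\Delta\cap\mathbb Z^N$ contain $0$ and have convex hull $\Delta$. Let $T$ be a triangulation of $\Delta$ with vertices in $A$ all of whose maximal simplices contain $0$. Let $\lambda:A\to\mathbb Z$ be such that the function $\psi$ that is affine on the simplices of $T$ and equal to $\lambda$ at the vertices of $T$ is concave on $\Delta$, has the maximal simplices as its maximal domains of linearity, and satisfies $\psi(\omega)>\lambda(\omega)$ for each $\omega\in A$ that is not a vertex of $T$. Let $X_\Delta$ be the projective toric variety of $\Delta$, i.e. the closure of $\{[x^\omega]_{\omega\in\Delta\cap\mathbb Z^N}:x\in(\mathbb C^*)^N\}$ in projective space, and for $t\in\mathbb C^*$ let $$\mu_t(x)=\frac{\sum_{\omega\in A}|t^{\lambda(\omega)}||x^\omega|\,\omega}{\sum_{\omega\in A}|t^{\lambda(\omega)}||x^\omega|},\qquad \mu_t:X_\Delta\to\Delta .$$ *Coordinates.*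 Let $\partial T$ be the set of simplices of $T$ lying in $\partial\Delta$. For $\tau\in\partial T$ let $k=\dim\tau$, let $\Theta_\tau$ be the minimal face of $\Delta$ containing $\tau$ and $l=\dim\Theta_\tau$. $\tau$-associated coordinates are $y_i=x^{b_i}$, $1\le i\le N$, where $\Omega$ is a vertex of $\tau$, $b_1,\dots,b_N$ is a basis of $\mathbb Z^N$, $b_1,\dots,b_k$ span the lattice vectors parallel to $\tau$, $b_1,\dots,b_l$ span those parallel to $\Theta_\tau$, $\sum_{i>l}b_i=-\Omega$, and for each $i>l$ there is a facet $\Sigma=\{m\in\Delta:\langle u,m\rangle=-1\}\supseteq\Theta_\tau$ with $\langle u,b_j\rangle=\delta_{ij}$ for all $j$. They identify the open set of $X_\Delta$ where the divisors of the facets not containing $\Theta_\tau$ are removed with $(\mathbb C^*)^l\times\mathbb C^{N-l}$. Since $\mu_t$ restricts to a homeomorphism from the nonnegative real part of $X_\Delta$ to $\Delta$, the functions $|y_i|$ are also coordinates on the corresponding part of $\Delta$; write $m_i=|y_i|(m)$. *Intervals.* Let $B=\{|m|<\beta\}$ be a ball and $\Delta'=\varepsilon\Delta\subset B$. For $s'$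 in the relative interior of a proper face $\Theta'=\varepsilon\Theta$ of $\Delta'$, $\dim\Theta=l'$, and $\tau$-associated coordinates with $\Theta_\tau=\Theta$, let $n(s')=\{m:m_i=s'_i\ (i\le l'),\ m_i\le s'_i\ (i>l')\}$. For $s\in\partial\Delta$ let $I_s$ be the part outside $B$ of the segment, straight in the coordinates $m_i$, that joins $s$ to the $s'\in\partial\Delta'$ with $s\in n(s')$. *Cells.* Let $V^0_\tau$ be the union of the simplices of the second barycentric subdivision of $\partial T$ that have the barycenter of $\tau$ as a vertex. Let $V_\tau\supseteq V^0_\tau$ be small open neighbourhoods in $\partial\Delta$, small meaning that $V_\tau\cap V_{\tau'}\ne\emptyset$ only if $\tau\subseteq\tau'$ or $\tau'\subseteq\tau$, and that $\overline V_\tau$ misses every simplex of $\partial T$ not containing $\tau$. Put $W_\tau=\overline V_\tau\setminus\bigcup_{\tau'\supsetneq\tau}V_{\tau'}$. *Auxiliary hypersurface.* Let $\{\rho^0_\tau\}$ be a (continuous) partition of unity on $\partial\Delta$ subordinate to $\{V_\tau\}$, $\rho_0\equiv1$ and $\rho_\omega=\sum_{\tau\ni\omega}\rho^0_\tau$ for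 $\omega\ne0$ (sum over the $\tau\in\partial T$ with vertex $\omega$), extended to be constant along every $I_s$. Let $H_t\subset\mu_t^{-1}(\bigcup_sI_s)$ be given by $$t^{\lambda(0)}x^{0}-\sum_{\omega\in A\cap\partial\Delta}\rho_\omega t^{\lambda(\omega)}x^\omega=0,$$ where $x^0$ is the projective coordinate of the lattice point $0$. Let $T_s=H_t\cap\mu_t^{-1}(I_s)$. **Proposition 3.2.** There is $\beta_0>0$ such that for all $0<\beta<\beta_0$, all $\varepsilon>0$ with $\varepsilon\Delta\subset B$, and all $\{V_\tau\}$ as above there is $R>0$ such that for all $\{\rho^0_\tau\}$ as above, all $|t|\ge R$, all $\tau\in\partial T$ and all $s\in W_\tau$ the following holds. Let $s$ be in the relative interior of the $L$-dimensional face $F$ of $\Delta$, and $l=\dim\Theta_\tau$. Then $l\le L\le N-1$ and $\tau$-associated coordinates exist. For any choice of them $s_i=|y_i|(s)$ is defined; let $T^l=\{(y_1,\dots,y_l):|y_i|=s_i\}$ and $$D_{\tau,s}=\Big\{Y\in T^l:\ P_t(Y)=\sum_{\omega\in\tau}\rho_\omega(s)\,t^{\lambda(\omega)}x^{\omega-\Omega}=0\Big\}$$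 (a Laurent polynomial in $y_1,\dots,y_k$). Then: 1. $T_s$ lies in the domain of the coordinates, and $p_s=(y_1,\dots,y_l)$ is a continuous map $T_s\to T^l$. The set $T^l\setminus D_{\tau,s}$ is open and dense in $T^l$; over it $p_s$ is a trivial fibration with fiber $T^{N-1-l}$, and over $D_{\tau,s}$ it is a trivial fibration with fiber $T^{L-l}$. 2. $T_s$ is homeomorphic, compatibly with the maps to $T^l$, to $T^{L-l}\times\big((T^l\times T^{N-1-L})/\!\sim\big)$, where $(d,t_1)\sim(d,t_2)$ for $d\in D_{\tau,s}$. 3. If $s$ is interior to a facet ($L=N-1$), then $T_s$ is a nondegenerate $(N-1)$-torus: there is a homeomorphism $T^{N-1}\to T_s$ which, in the coordinates $y$, is a $C^\infty$ immersion at every point not lying over $D_{\tau,s}$, and at every point if $s\in n(s')$ for some $s'$ in the relative interior of the facet $\varepsilon F$ of $\Delta'$. -/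

import Mathlib

open scoped Pointwise LinearAlgebra.Projectivization ContDiff Topology

noncomputable section

namespace TorusFib

/-- The inclusion of the lattice `ℤ^N` in `M = ℝ^N`. -/
def emb {N : ℕ} (w : Fin N → ℤ) : Fin N → ℝ := fun i => (w i : ℝ)

/-! ### Polytopes and their faces -/

/-- The nonempty faces of a polytope `P` (including `P` itself). -/
def IsFace {N : ℕ} (P F : Set (Fin N → ℝ)) : Prop := F.Nonempty ∧ IsExposed ℝ P F

/-- The dimension of (the affine hull of) a nonempty set. -/
def dim {N : ℕ} (F : Set (Fin N → ℝ)) : ℕ := Module.finrank ℝ (vectorSpan ℝ F)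

/-- The minimal face of `P` containing `S`. -/
def minFace {N : ℕ} (P S : Set (Fin N → ℝ)) : Set (Fin N → ℝ) :=
  ⋂₀ {F | IsFace P F ∧ S ⊆ F}

/-- The polar polyhedron `{u : ⟨u, m⟩ ≥ -1 for all m ∈ P}`. -/
def polar {N : ℕ} (P : Set (Fin N → ℝ)) : Set (Fin N → ℝ) :=
  {u | ∀ m ∈ P, -1 ≤ ∑ i, u i * m i}

/-- An integral polytope: the convex hull of finitely many lattice points. -/
def IsIntegral {N : ℕ} (P : Set (Fin N → ℝ)) : Prop :=
  ∃ B : Finset (Fin N → ℤ), P = convexHull ℝ (emb '' (B : Set (Fin N → ℤ)))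

/-- Reflexive polytopes (with the origin as the distinguished lattice point). -/
def IsReflexive {N : ℕ} (P : Set (Fin N → ℝ)) : Prop :=
  IsIntegral P ∧ 0 ∈ interior P ∧ IsIntegral (polar P)

/-- The edges of `P` emanating from `v`. -/
def edgesAt {N : ℕ} (P : Set (Fin N → ℝ)) (v : Fin N → ℝ) : Set (Set (Fin N → ℝ)) :=
  {e | IsFace P e ∧ dim e = 1 ∧ v ∈ e}

/-- Nonsingular polytopes: exactly `N` edges emanate from each vertex, and the lattice points on
these edges generate `ℤ^N` (as an affine lattice, so differences from the vertex generate). -/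
def IsNonsingular {N : ℕ} (P : Set (Fin N → ℝ)) : Prop :=
  ∀ v : Fin N → ℤ, emb v ∈ P.extremePoints ℝ →
    (edgesAt P (emb v)).ncard = N ∧
    AddSubgroup.closure {w : Fin N → ℤ | ∃ e ∈ edgesAt P (emb v), emb (v + w) ∈ e} = ⊤

/-- The facet of `P` cut out by `⟨u, m⟩ = -1`. -/
def facetOf {N : ℕ} (P : Set (Fin N → ℝ)) (u : Fin N → ℤ) : Set (Fin N → ℝ) :=
  {m ∈ P | ∑ i, (u i : ℝ) * m i = -1}

/-- `u` is the (integral) normal vector `u_Σ` of a facet `Σ` of `P`. -/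
def IsFacetNormal {N : ℕ} (P : Set (Fin N → ℝ)) (u : Fin N → ℤ) : Prop :=
  emb u ∈ polar P ∧ (facetOf P u).Nonempty ∧ dim (facetOf P u) + 1 = N

/-! ### The data of the family -/

/-- The fixed data: a nonsingular reflexive polytope `Δ`, given as the convex hull of a set `A` of
its lattice points with `0 ∈ A`; a central triangulation `T` of `(Δ, A)`; and an integral vector
`lam` in the interior of the secondary cone `C(T)` (whose characteristic function `psi` makes `T`
coherent). -/
structure FamilyData (N : ℕ) where
  A : Finset (Fin N → ℤ)
  zero_mem : (0 : Fin N → ℤ) ∈ A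
  reflexive : IsReflexive (convexHull ℝ (emb '' (A : Set (Fin N → ℤ))))
  nonsingular : IsNonsingular (convexHull ℝ (emb '' (A : Set (Fin N → ℤ))))
  T : Geometry.SimplicialComplex ℝ (Fin N → ℝ)
  T_space : T.space = convexHull ℝ (emb '' (A : Set (Fin N → ℤ)))
  T_vertices : T.vertices ⊆ emb '' (A : Set (Fin N → ℤ))
  T_central : ∀ C ∈ T.facets, (0 : Fin N → ℝ) ∈ C
  lam : (Fin N → ℤ) → ℤ
  lam_interior : ∃ psi : (Fin N → ℝ) → ℝ,
    -- `psi` is the characteristic function: affine on simplices, equal to `lam` at vertices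
    (∀ C ∈ T.faces, ∃ g : (Fin N → ℝ) →ᵃ[ℝ] ℝ,
      Set.EqOn psi g (convexHull ℝ (C : Set (Fin N → ℝ)))) ∧
    (∀ w ∈ A, emb w ∈ T.vertices → psi (emb w) = lam w) ∧
    -- it lies strictly above `lam` at the points of `A` that are not vertices
    (∀ w ∈ A, emb w ∉ T.vertices → (lam w : ℝ) < psi (emb w)) ∧
    -- it is convex in the sense `psi (a x + b y) ≥ a psi x + b psi y`
    ConcaveOn ℝ (convexHull ℝ (emb '' (A : Set (Fin N → ℤ)))) psi ∧
    -- and strictly so: the maximal simplices are the maximal domains of linearity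
    (∀ C ∈ T.facets, ∀ g : (Fin N → ℝ) →ᵃ[ℝ] ℝ,
      Set.EqOn psi g (convexHull ℝ (C : Set (Fin N → ℝ))) →
      ∀ x ∈ convexHull ℝ (emb '' (A : Set (Fin N → ℤ))), psi x = g x →
        x ∈ convexHull ℝ (C : Set (Fin N → ℝ)))

variable {N : ℕ}

namespace FamilyData

/-- The polytope `Δ`. -/
def Delta (D : FamilyData N) : Set (Fin N → ℝ) :=
  convexHull ℝ (emb '' (D.A : Set (Fin N → ℤ)))

open Classical in
/-- The triangulation `∂T`: the simplices of `T` lying in `∂Δ`. -/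
def bdry (D : FamilyData N) : Finset (Finset (Fin N → ℝ)) :=
  (D.A.image emb).powerset.filter
    (fun τ => τ ∈ D.T.faces ∧ convexHull ℝ (τ : Set (Fin N → ℝ)) ⊆ frontier D.Delta)

/-- The minimal face `Θ_τ` of `Δ` containing the simplex `τ`. -/
def Theta (D : FamilyData N) (τ : Finset (Fin N → ℝ)) : Set (Fin N → ℝ) :=
  minFace D.Delta (τ : Set (Fin N → ℝ))

/-- The lattice points `Δ(ℤ)`. -/
abbrev LatticePt (D : FamilyData N) : Type := {w : Fin N → ℤ // emb w ∈ D.Delta}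

end FamilyData

/-! ### The toric variety -/

/-- The usual (quotient) topology on a complex projective space. -/
instance projTop {ι : Type} : TopologicalSpace (ℙ ℂ (ι → ℂ)) :=
  TopologicalSpace.coinduced (Projectivization.mk' ℂ) inferInstance

/-- The monomial map `x ↦ (x^w)_{w ∈ Δ(ℤ)}` on `(ℂ^*)^N`. -/
def torusMap (D : FamilyData N) (x : Fin N → ℂˣ) : ℙ ℂ (D.LatticePt → ℂ) :=
  Projectivization.mk ℂ (fun w => ((∏ i, x i ^ (w.1 i) : ℂˣ) : ℂ)) (by
    have h0 : emb (0 : Fin N → ℤ) ∈ D.Delta :=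
      subset_convexHull ℝ _ ⟨0, D.zero_mem, rfl⟩
    intro h
    exact Units.ne_zero _ (congrFun h ⟨0, h0⟩))

/-- The toric variety `X_Δ` in its projective embedding by all lattice points of `Δ`. -/
def toricVariety (D : FamilyData N) : Set (ℙ ℂ (D.LatticePt → ℂ)) :=
  closure (Set.range (torusMap D))

open Classical in
/-- The homogeneous coordinate `x^w`. -/
def hom (D : FamilyData N) (v : D.LatticePt → ℂ) (w : Fin N → ℤ) : ℂ :=
  if h : emb w ∈ D.Delta then v ⟨w, h⟩ else 0

/-- The weighted moment map in homogeneous coordinates. -/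
def momentHom (D : FamilyData N) (t : ℂ) (v : D.LatticePt → ℂ) : Fin N → ℝ :=
  (∑ w ∈ D.A, ‖t ^ D.lam w‖ * ‖hom D v w‖)⁻¹ •
    ∑ w ∈ D.A, (‖t ^ D.lam w‖ * ‖hom D v w‖) • emb w

/-- The weighted moment map `μ_t` (the formula is homogeneous of degree `0`, so it does not depend on
the chosen homogeneous coordinates). -/
def moment (D : FamilyData N) (t : ℂ) (x : ℙ ℂ (D.LatticePt → ℂ)) : Fin N → ℝ :=
  momentHom D t x.rep

/-! ### Coordinates associated with a simplex -/

/-- A system of `τ`-associated coordinates `y_i = x^{b_i}`, `b_i = ω_i - Ω`, for a simplex `τ` of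
`∂T`: `Ω` is a vertex of
`τ`; the `b_i` form a basis of `ℤ^N`; the first `k = dim τ` of them span the lattice vectors
parallel to `τ` and the first `l = dim Θ_τ` those parallel to `Θ_τ`; the others add up to `0 - Ω`,
and they are dual to the normals of the facets through `Θ_τ`, so that `y_{l+1}, …, y_N` extend as
the equations of the corresponding divisors. -/
structure TauCoords (D : FamilyData N) (τ : Finset (Fin N → ℝ)) where
  mem_bdry : τ ∈ D.bdry
  Om : Fin N → ℤ
  Om_mem : emb Om ∈ τ
  b : Module.Basis (Fin N) ℤ (Fin N → ℤ)
  span_tau : (Submodule.span ℤ (b '' {i | (i : ℕ) + 1 < τ.card}) : Set (Fin N → ℤ)) =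
    {v | emb v ∈ vectorSpan ℝ (τ : Set (Fin N → ℝ))}
  span_Theta : (Submodule.span ℤ (b '' {i | (i : ℕ) < dim (D.Theta τ)}) : Set (Fin N → ℤ)) =
    {v | emb v ∈ vectorSpan ℝ (D.Theta τ)}
  sum_eq : ∑ i ∈ Finset.univ.filter (fun i : Fin N => dim (D.Theta τ) ≤ (i : ℕ)), b i = -Om
  normal : ∀ i : Fin N, dim (D.Theta τ) ≤ (i : ℕ) →
    ∃ u : Fin N → ℤ, IsFacetNormal D.Delta u ∧ D.Theta τ ⊆ facetOf D.Delta u ∧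
      ∀ j, ∑ a, u a * b j a = if j = i then 1 else 0

variable {D : FamilyData N} {τ : Finset (Fin N → ℝ)}

/-- The exponents of `x^{w - Ω}` as a monomial in `y_1, …, y_N`. -/
def TauCoords.expo (c : TauCoords D τ) (w : Fin N → ℤ) (i : Fin N) : ℤ := c.b.repr (w - c.Om) i

/-- The point of projective space with coordinates `y`; its homogeneous coordinates, normalized by
`x^Ω = 1`, are the monomials `x^{w - Ω}` in `y`. For `y_1, …, y_l ≠ 0` it lies in `X_Δ`. -/
def TauCoords.chart (c : TauCoords D τ) (y : Fin N → ℂ) : ℙ ℂ (D.LatticePt → ℂ) :=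
  Projectivization.mk ℂ (fun w => ∏ i, y i ^ c.expo w.1 i) (by
    have hm : emb c.Om ∈ D.Delta := by
      classical
      have h1 := (Finset.mem_filter.mp c.mem_bdry).1
      obtain ⟨w, hw, he⟩ := Finset.mem_image.mp (Finset.mem_powerset.mp h1 c.Om_mem)
      exact subset_convexHull ℝ _ ⟨w, hw, he⟩
    intro h
    have := congrFun h ⟨c.Om, hm⟩
    simp [TauCoords.expo] at this)

/-- `y` is the vector of `τ`-associated coordinates of the point `x`. -/
def TauCoords.IsCoord (c : TauCoords D τ) (x : ℙ ℂ (D.LatticePt → ℂ)) (y : Fin N → ℂ) : Prop :=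
  (∀ i : Fin N, (i : ℕ) < dim (D.Theta τ) → y i ≠ 0) ∧ x = c.chart y

/-- `r = (|y_1|(m), …, |y_N|(m))` are the coordinates of the point `m` of `Δ`, where `Δ` is
identified with the nonnegative real part of `X_Δ` by means of `μ_t`. -/
def TauCoords.IsAbsCoord (c : TauCoords D τ) (t : ℂ) (m : Fin N → ℝ) (r : Fin N → ℝ) : Prop :=
  (∀ i, 0 ≤ r i) ∧ (∀ i : Fin N, (i : ℕ) < dim (D.Theta τ) → 0 < r i) ∧
    moment D t (c.chart (fun i => (r i : ℂ))) = m

/-! ### The trivialization of `Δ⁰` -/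

/-- The central ball `B`. -/
def centralBall (N : ℕ) (β : ℝ) : Set (Fin N → ℝ) := {m | ∑ i, m i ^ 2 < β ^ 2}

/-- In the coordinates `c`, the point `m` with coordinates `r` lies in the curved normal cone
`n(s')` to the polytope `Δ' = ε Δ` at the point `s'` (with coordinates `r'`) interior to its
face `Θ'_τ = ε Θ_τ`. -/
def TauCoords.InCone (c : TauCoords D τ) (t : ℂ) (ε : ℝ) (s' m r' r : Fin N → ℝ) : Prop :=
  s' ∈ intrinsicInterior ℝ (ε • D.Theta τ) ∧ c.IsAbsCoord t s' r' ∧ c.IsAbsCoord t m r ∧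
    (∀ i : Fin N, (i : ℕ) < dim (D.Theta τ) → r i = r' i) ∧
    (∀ i : Fin N, dim (D.Theta τ) ≤ (i : ℕ) → r i ≤ r' i)

/-- The curved normal cone `n(s')`. -/
def curvedCone (D : FamilyData N) (t : ℂ) (ε : ℝ) (s' : Fin N → ℝ) : Set (Fin N → ℝ) :=
  {m | ∃ τ ∈ D.bdry, ∃ c : TauCoords D τ, ∃ r' r, c.InCone t ε s' m r' r}

/-- The interval `I_s` in `Δ⁰ = Δ ∖ B`: the point `s ∈ ∂Δ` is joined to the points `s' ∈ ∂Δ'` with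
`s ∈ n(s')` by the line segment in the coordinates `|y_i|`. -/
def interval (D : FamilyData N) (t : ℂ) (β ε : ℝ) (s : Fin N → ℝ) : Set (Fin N → ℝ) :=
  {m | m ∉ centralBall N β ∧ ∃ τ ∈ D.bdry, ∃ c : TauCoords D τ, ∃ s' r' r,
    c.InCone t ε s' s r' r ∧
    ∃ u ∈ Set.Icc (0 : ℝ) 1, c.IsAbsCoord t m (fun i => (1 - u) * r i + u * r' i)}

/-! ### The covers of `∂Δ` -/

/-- The center `O(τ)` of a simplex. -/
def center (s : Finset (Fin N → ℝ)) : Fin N → ℝ := (s.card : ℝ)⁻¹ • ∑ x ∈ s, x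

open Classical in
/-- The first barycentric subdivision of a collection of simplices (given by their vertex sets):
its simplices are spanned by the centers of the members of a nonempty chain. -/
def bary (K : Set (Finset (Fin N → ℝ))) : Set (Finset (Fin N → ℝ)) :=
  {q | ∃ ch : Finset (Finset (Fin N → ℝ)), ch.Nonempty ∧ (∀ x ∈ ch, x ∈ K) ∧
    IsChain (· ⊆ ·) (ch : Set (Finset (Fin N → ℝ))) ∧ q = ch.image center}

/-- `V⁰_τ`: the union of the simplices of the second barycentric subdivision of `∂T` having
`O(τ)` as a vertex. -/
def V0 (D : FamilyData N) (τ : Finset (Fin N → ℝ)) : Set (Fin N → ℝ) :=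
  ⋃ q ∈ {q ∈ bary (bary (D.bdry : Set (Finset (Fin N → ℝ)))) | center τ ∈ q},
    convexHull ℝ (q : Set (Fin N → ℝ))

/-- `V` is a system of small open neighbourhoods `V_τ` of `V⁰_τ` in `∂Δ`: `V_τ` and `V_τ'` meet only
if `τ ⊆ τ'` or `τ' ⊆ τ`, and the closure of `V_τ` stays (as `V⁰_τ` does) in the open star of `τ`,
that is, it misses the simplices of `∂T` that do not contain `τ`. -/
structure IsSmallCover (D : FamilyData N) (V : Finset (Fin N → ℝ) → Set (Fin N → ℝ)) : Prop where
  isOpen : ∀ τ ∈ D.bdry, ∃ O : Set (Fin N → ℝ), IsOpen O ∧ V τ = O ∩ frontier D.Delta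
  V0_subset : ∀ τ ∈ D.bdry, V0 D τ ⊆ V τ
  nested : ∀ τ ∈ D.bdry, ∀ τ' ∈ D.bdry, (V τ ∩ V τ').Nonempty → τ ⊆ τ' ∨ τ' ⊆ τ
  star : ∀ τ ∈ D.bdry, ∀ τ' ∈ D.bdry, ¬ τ ⊆ τ' →
    Disjoint (closure (V τ)) (convexHull ℝ (τ' : Set (Fin N → ℝ)))

/-- The cell `W_τ`. -/
def W (D : FamilyData N) (V : Finset (Fin N → ℝ) → Set (Fin N → ℝ)) (τ : Finset (Fin N → ℝ)) :
    Set (Fin N → ℝ) :=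
  closure (V τ) \ ⋃ τ' ∈ {τ' ∈ (D.bdry : Set (Finset (Fin N → ℝ))) | τ ⊂ τ'}, V τ'

/-- `ρ⁰` is a partition of unity on `∂Δ` subordinate to the cover `V`. -/
structure IsPartition (D : FamilyData N) (V : Finset (Fin N → ℝ) → Set (Fin N → ℝ))
    (ρ0 : Finset (Fin N → ℝ) → (Fin N → ℝ) → ℝ) : Prop where
  cont : ∀ τ ∈ D.bdry, ContinuousOn (ρ0 τ) (frontier D.Delta)
  nonneg : ∀ τ ∈ D.bdry, ∀ s ∈ frontier D.Delta, 0 ≤ ρ0 τ s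
  sum_one : ∀ s ∈ frontier D.Delta, ∑ τ ∈ D.bdry, ρ0 τ s = 1
  subord : ∀ τ ∈ D.bdry, closure {s ∈ frontier D.Delta | ρ0 τ s ≠ 0} ⊆ V τ

open Classical in
/-- The cut-off functions `ρ_w` on `∂Δ`: `1` for `w = 0`, and otherwise the sum of the `ρ⁰_τ` over
the simplices `τ` with vertex `w` (so `0` if `w` is not a vertex of the triangulation). -/
def rho (D : FamilyData N) (ρ0 : Finset (Fin N → ℝ) → (Fin N → ℝ) → ℝ) (w : Fin N → ℤ)
    (s : Fin N → ℝ) : ℝ :=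
  if w = 0 then 1 else ∑ τ ∈ D.bdry.filter (fun τ => emb w ∈ τ), ρ0 τ s

/-! ### The auxiliary hypersurface and its fibers -/

open Classical in
/-- The left-hand side of the equation of the auxiliary hypersurface in homogeneous coordinates,
where the cut-off functions take their values at `s`. -/
def auxEq (D : FamilyData N) (ρ0 : Finset (Fin N → ℝ) → (Fin N → ℝ) → ℝ) (t : ℂ)
    (s : Fin N → ℝ) (v : D.LatticePt → ℂ) : ℂ :=
  (rho D ρ0 0 s : ℂ) * t ^ D.lam 0 * hom D v 0 -
    ∑ w ∈ D.A.filter (fun w => emb w ∈ frontier D.Delta),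
      (rho D ρ0 w s : ℂ) * t ^ D.lam w * hom D v w

/-- The auxiliary hypersurface `H_t`; the cut-off functions are constant along each `I_s`. -/
def auxHyp (D : FamilyData N) (ρ0 : Finset (Fin N → ℝ) → (Fin N → ℝ) → ℝ) (t : ℂ) (β ε : ℝ) :
    Set (ℙ ℂ (D.LatticePt → ℂ)) :=
  {x ∈ toricVariety D | ∃ s ∈ frontier D.Delta,
    moment D t x ∈ interval D t β ε s ∧ auxEq D ρ0 t s x.rep = 0}

/-- The fiber `T_s` of the auxiliary hypersurface over `s`. -/
def fiber (D : FamilyData N) (ρ0 : Finset (Fin N → ℝ) → (Fin N → ℝ) → ℝ) (t : ℂ) (β ε : ℝ)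
    (s : Fin N → ℝ) : Set (ℙ ℂ (D.LatticePt → ℂ)) :=
  {x ∈ auxHyp D ρ0 t β ε | moment D t x ∈ interval D t β ε s}

/-- The torus `T^l ⊆ (ℂ^*)^l` given by `|y_i| = r_i`, `i = 1, …, l`. -/
def baseTorus (l : ℕ) (r : Fin N → ℝ) : Set ({i : Fin N // (i : ℕ) < l} → ℂ) :=
  {Y | ∀ i, ‖Y i‖ = r i.1}

open Classical in
/-- The polynomial `P = ∑_{w ∈ τ} ρ_w t^{λ(w)} x^{w - Ω}` in the local coordinates. (Only the first
`dim τ` coordinates actually occur.) -/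
def TauCoords.poly (c : TauCoords D τ) (ρ0 : Finset (Fin N → ℝ) → (Fin N → ℝ) → ℝ) (t : ℂ)
    (s : Fin N → ℝ) {l : ℕ} (Y : {i : Fin N // (i : ℕ) < l} → ℂ) : ℂ :=
  ∑ w ∈ D.A.filter (fun w => emb w ∈ τ),
    (rho D ρ0 w s : ℂ) * t ^ D.lam w * ∏ i, Y i ^ c.expo w i.1

/-- The discriminant locus `D_{τ,s} ⊆ T^l`. -/
def TauCoords.disc (c : TauCoords D τ) (ρ0 : Finset (Fin N → ℝ) → (Fin N → ℝ) → ℝ) (t : ℂ)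
    (s : Fin N → ℝ) (l : ℕ) (r : Fin N → ℝ) : Set (baseTorus l r) :=
  {Y | c.poly ρ0 t s Y.1 = 0}

/-- The standard torus `T^n`. -/
abbrev Torus (n : ℕ) : Type := Fin n → Circle

/-- The equivalence relation on `B × F` generated by `(d, t₁) ∼ (d, t₂)` for `d ∈ S`. -/
def collapse {B : Type*} (S : Set B) (F : Type*) : Setoid (B × F) where
  r p q := p.1 = q.1 ∧ (p.1 ∈ S ∨ p.2 = q.2)
  iseqv := by
    refine ⟨fun _ => ⟨rfl, Or.inr rfl⟩, ?_, ?_⟩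
    · rintro p q ⟨h1, h2 | h2⟩
      · exact ⟨h1.symm, Or.inl (h1 ▸ h2)⟩
      · exact ⟨h1.symm, Or.inr h2.symm⟩
    · rintro p q z ⟨h1, h2 | h2⟩ ⟨h3, h4⟩
      · exact ⟨h1.trans h3, Or.inl h2⟩
      · rcases h4 with h4 | h4
        · exact ⟨h1.trans h3, Or.inl (h1 ▸ h4)⟩
        · exact ⟨h1.trans h3, Or.inr (h2.trans h4)⟩

/-- The projection `(B × F)/∼ → B`. -/
def collapseBase {B : Type*} (S : Set B) (F : Type*) (z : Quotient (collapse S F)) : B :=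
  Quotient.lift (fun p : B × F => p.1)
    (fun p q (h : p.1 = q.1 ∧ (p.1 ∈ S ∨ p.2 = q.2)) => h.1) z

end TorusFib

end

/-! Logarithms of absolute values turn the moment map into a Gibbs mean. If |x^w| is proportional to
exp(ξ·w) on the points of A in a face and zero at the other points of A, then μ_t(x) is the mean of
the measure on those points with weights |t^λ(w)| exp(ξ·w). The mean is a strictly monotone function
of ξ modulo functionals constant on the face (`gibbs_mono`), and a minimax argument produces
parameters with prescribed means (`exists_gibbs`). The combinatorial input is that a nonsingular
reflexive polytope has, at each vertex, a lattice basis of edge vectors whose dual basis consists of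
the facet normals (`exists_vertex_basis`). Hence a face is recorded by its set `D.nrm` of normals,
and its codimension is their number.

The interval I_s is the part outside B of a normal ray of the convex body εΔ, in the sense of convex
duality: the parameters ξ of s and ξ' of the foot εs' satisfy the variational inequality that ξ - ξ'
is maximal at s' on the face of s. Monotonicity gives uniqueness of the foot and disjointness of the
intervals (`IsRay.unique`, `IsRay.disjoint`), as for nearest point projections; minimization gives
existence (`exists_isRay`).

Large |t| enters through concentration. A Gibbs measure with mean m differs from the barycentric
coordinates of m in T by O(1/log|t|), as one sees by comparing the averages of the logarithm of the
density (`exists_concentration`). This has two consequences. The foot of the ray through s in W_τ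
has a carrier containing τ, so the whole ray lies in a single τ-chart (`exists_isRay_of_mem_W`).
Over B the term of the lattice point 0 dominates (`norm_poly_lt`), so no solution is lost when the
ray is cut off at B.

On W_τ the cut-off functions leave only the vertices of τ and 0, and the equation becomes t^λ(0)
∏_{i>l} y_i = P_t(y_1,…,y_l) (`auxEq_vec`). Along the ray |y_1|,…,|y_l| are constant, while the
product of the other radii increases strictly from 0 to a value too large for a solution. So |P_t|
determines the point of the ray, and the arguments of the N-l normal coordinates satisfy one
relation: N-1-l circles are free. Where P_t vanishes the point of the ray is s itself, and the
circles of the coordinates vanishing at s collapse; L-l circles remain. This local picture is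
`Model`, and `IsRay.exists_homeo_model` identifies it with T_s. Over a facet interior only one
normal coordinate vanishes at s. It is a smooth quotient of P_t by the others wherever the radii are
smooth, which gives the immersion. -/

namespace TorusFib

/-! ### Gibbs measures on finite sets of vectors -/

-- Normalized to mass one, the two measures satisfy p = q·exp(E) with E affine in x, and the sum of
-- (p - q)E is the pairing of the differences of parameters and means. Each term is nonnegative
-- because (exp(E) - 1)E ≥ 0, so a nonpositive pairing forces E = 0. Means are encoded by the
-- vanishing of a weighted sum to avoid normalization.
open Real in
theorem gibbs_mono {ι : Type*} {n : ℕ} {S : Finset ι} (hS : S.Nonempty) {x : ι → Fin n → ℝ}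
    {a : ι → ℝ} (ha : ∀ i ∈ S, 0 < a i) {η₁ η₂ m₁ m₂ : Fin n → ℝ}
    (h₁ : ∑ i ∈ S, (a i * exp (η₁ ⬝ᵥ x i)) • (x i - m₁) = 0)
    (h₂ : ∑ i ∈ S, (a i * exp (η₂ ⬝ᵥ x i)) • (x i - m₂) = 0)
    (h : (η₁ - η₂) ⬝ᵥ (m₁ - m₂) ≤ 0) :
    m₁ = m₂ ∧ ∀ i ∈ S, ∀ j ∈ S, (η₁ - η₂) ⬝ᵥ x i = (η₁ - η₂) ⬝ᵥ x j := by
  have key : ∀ (η m : Fin n → ℝ), ∑ i ∈ S, (a i * exp (η ⬝ᵥ x i)) • (x i - m) = 0 →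
      ∃ Z : ℝ, (∑ i ∈ S, a i * exp (η ⬝ᵥ x i - Z) = 1) ∧
        ∑ i ∈ S, (a i * exp (η ⬝ᵥ x i - Z)) • x i = m := by
    intro η m hm
    have hZ : 0 < ∑ i ∈ S, a i * exp (η ⬝ᵥ x i) :=
      Finset.sum_pos (fun i hi => mul_pos (ha i hi) (exp_pos _)) hS
    have e : ∀ i, a i * exp (η ⬝ᵥ x i - log (∑ i ∈ S, a i * exp (η ⬝ᵥ x i))) =
        (∑ i ∈ S, a i * exp (η ⬝ᵥ x i))⁻¹ * (a i * exp (η ⬝ᵥ x i)) := by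
      intro i
      rw [exp_sub, exp_log hZ]; field_simp
    refine ⟨log (∑ i ∈ S, a i * exp (η ⬝ᵥ x i)), ?_, ?_⟩
    · simp_rw [e]
      rw [← Finset.mul_sum, inv_mul_cancel₀ hZ.ne']
    · simp_rw [e, mul_smul]
      rw [← Finset.smul_sum]
      simp_rw [smul_sub] at hm
      rw [Finset.sum_sub_distrib, sub_eq_zero, ← Finset.sum_smul] at hm
      simp_rw [← mul_smul]
      rw [hm, smul_smul, inv_mul_cancel₀ hZ.ne', one_smul]
  obtain ⟨Z₁, hp1, hpm⟩ := key η₁ m₁ h₁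
  obtain ⟨Z₂, hq1, hqm⟩ := key η₂ m₂ h₂
  set p : ι → ℝ := fun i => a i * exp (η₁ ⬝ᵥ x i - Z₁) with hp
  set q : ι → ℝ := fun i => a i * exp (η₂ ⬝ᵥ x i - Z₂) with hq
  set E : ι → ℝ := fun i => (η₁ - η₂) ⬝ᵥ x i - (Z₁ - Z₂) with hE
  have hpq : ∀ i, p i = q i * exp (E i) := by
    intro i
    simp only [hp, hq, hE, mul_assoc, ← exp_add, sub_dotProduct]
    congr 2; ring
  -- The constant Z₁ - Z₂ in E drops out because p and q have equal mass.
  have hsum : ∑ i ∈ S, (p i - q i) * E i = (η₁ - η₂) ⬝ᵥ (m₁ - m₂) := by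
    have : (η₁ - η₂) ⬝ᵥ (m₁ - m₂) = ∑ i ∈ S, (p i - q i) * ((η₁ - η₂) ⬝ᵥ x i) := by
      rw [← hpm, ← hqm, ← Finset.sum_sub_distrib, dotProduct_sum]
      refine Finset.sum_congr rfl fun i _ => ?_
      rw [← sub_smul, dotProduct_smul, smul_eq_mul]
    rw [this]
    simp only [hE, mul_sub, Finset.sum_sub_distrib, ← Finset.sum_mul]
    simp only [hp, hq] at *
    rw [hp1, hq1]; ring
  have hnn : ∀ i ∈ S, 0 ≤ (p i - q i) * E i := by
    intro i hi
    have hqi : 0 < q i := mul_pos (ha i hi) (exp_pos _)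
    rw [hpq i]
    have : (q i * exp (E i) - q i) * E i = q i * ((exp (E i) - 1) * E i) := by ring
    rw [this]
    refine mul_nonneg hqi.le ?_
    rcases le_total 0 (E i) with h0 | h0
    · exact mul_nonneg (by linarith [one_le_exp h0]) h0
    · exact mul_nonneg_of_nonpos_of_nonpos (by linarith [exp_le_one_iff.2 h0]) h0
  have hE0 : ∀ i ∈ S, E i = 0 := by
    intro i hi
    have hz : ∑ i ∈ S, (p i - q i) * E i = 0 :=
      le_antisymm (hsum ▸ h) (Finset.sum_nonneg hnn)
    have := (Finset.sum_eq_zero_iff_of_nonneg hnn).1 hz i hi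
    have hqi : 0 < q i := mul_pos (ha i hi) (exp_pos _)
    rcases mul_eq_zero.1 this with h0 | h0
    · rw [hpq i] at h0
      have : exp (E i) = 1 := by
        have : q i * (exp (E i) - 1) = 0 := by linarith
        rcases mul_eq_zero.1 this with h | h
        · exact absurd h hqi.ne'
        · linarith
      exact exp_eq_one_iff _ |>.1 this
    · exact h0
  refine ⟨?_, fun i hi j hj => ?_⟩
  · rw [← hpm, ← hqm]
    refine Finset.sum_congr rfl fun i hi => ?_
    change p i • x i = q i • x i
    rw [hpq i, hE0 i hi, exp_zero, mul_one]
  · have h1 := hE0 i hi; have h2 := hE0 j hj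
    simp only [hE] at h1 h2; linarith

theorem exists_lt_of_hasDerivAt_neg {f : ℝ → ℝ} {f' : ℝ} (hf : HasDerivAt f f' 0) (h : f' < 0) :
    ∀ᶠ θ in 𝓝[>] (0 : ℝ), f θ < f 0 := by
  have h1 := (hasDerivAt_iff_tendsto_slope.1 hf).mono_left (nhdsGT_le_nhdsNE 0)
  filter_upwards [h1.eventually (eventually_lt_nhds h), self_mem_nhdsWithin] with θ h2 h3
  rw [slope_def_field, sub_zero, div_neg_iff] at h2
  rcases h2 with h2 | h2
  · exact absurd h3 (not_lt.2 h2.2.le)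
  · linarith [h2.1]

/-- The vector representing a linear functional through the dot product. -/
theorem exists_dotProduct_eq {n : ℕ} (f : (Fin n → ℝ) →ₗ[ℝ] ℝ) :
    ∃ d : Fin n → ℝ, ∀ y, f y = d ⬝ᵥ y := by
  refine ⟨fun i => f (Pi.single i 1), fun y => ?_⟩
  conv_lhs => rw [pi_eq_sum_univ' y]
  simp [dotProduct, map_sum, mul_comm]

theorem continuous_dotProduct_left {n : ℕ} (y : Fin n → ℝ) :
    Continuous fun η : Fin n → ℝ => η ⬝ᵥ y := by
  unfold dotProduct; fun_prop

theorem continuous_dotProduct_right {n : ℕ} (y : Fin n → ℝ) :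
    Continuous fun η : Fin n → ℝ => y ⬝ᵥ η := by
  unfold dotProduct; fun_prop

-- Minimax: with Z(η) the total weight, minimize the largest of the numbers Z(η)·exp((ξ - η)·k), k
-- in V. At a minimum the mean lies in the hull of those k that realize the largest value, and these
-- are the k maximizing (ξ - η)·k. The hypothesis `hco` says that the problem is coercive up to
-- directions in which nothing changes. With V a single point this prescribes the mean; with V the
-- corners of a shrunken face it finds the foot of a normal ray.
open Real in
theorem exists_gibbs {ι : Type*} {n : ℕ} {S : Finset ι} (hS : S.Nonempty) (x : ι → Fin n → ℝ)
    {a : ι → ℝ} (ha : ∀ i ∈ S, 0 < a i) (V : Finset (Fin n → ℝ)) {k₀ : Fin n → ℝ} (hk₀ : k₀ ∈ V)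
    (ξ : Fin n → ℝ)
    (hco : ∀ η : Fin n → ℝ, (∃ i ∈ S, η ⬝ᵥ k₀ < η ⬝ᵥ x i) ∨
      ((∀ i ∈ S, η ⬝ᵥ x i = η ⬝ᵥ k₀) ∧ ∀ k ∈ V, η ⬝ᵥ k = η ⬝ᵥ k₀)) :
    ∃ η m : Fin n → ℝ, ∑ i ∈ S, (a i * exp (η ⬝ᵥ x i)) • (x i - m) = 0 ∧
      m ∈ convexHull ℝ (V : Set (Fin n → ℝ)) ∧ ∀ k ∈ V, (ξ - η) ⬝ᵥ k ≤ (ξ - η) ⬝ᵥ m := by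
  classical
  have hV : V.Nonempty := ⟨k₀, hk₀⟩
  let H : (Fin n → ℝ) → (Fin n → ℝ) → ℝ := fun k η =>
    ∑ i ∈ S, a i * exp (η ⬝ᵥ (x i - k) + ξ ⬝ᵥ k)
  have hHc : ∀ k, Continuous (H k) := by
    intro k
    refine continuous_finsetSum _ fun i _ => ?_
    exact continuous_const.mul (continuous_exp.comp
      ((continuous_dotProduct_left _).add continuous_const))
  let Φ : (Fin n → ℝ) → ℝ := fun η => V.sup' hV fun k => H k η
  have hΦc : Continuous Φ := Continuous.finset_sup'_apply hV fun k _ => hHc k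
  -- The directions along which Φ is constant; the minimization takes place on a complement.
  let W : Submodule ℝ (Fin n → ℝ) :=
    { carrier := {η | (∀ i ∈ S, η ⬝ᵥ x i = η ⬝ᵥ k₀) ∧ ∀ k ∈ V, η ⬝ᵥ k = η ⬝ᵥ k₀}
      zero_mem' := by simp
      add_mem' := by
        rintro u v ⟨hu, hu'⟩ ⟨hv, hv'⟩
        exact ⟨fun i hi => by rw [add_dotProduct, add_dotProduct, hu i hi, hv i hi],
          fun k hk => by rw [add_dotProduct, add_dotProduct, hu' k hk, hv' k hk]⟩
      smul_mem' := by
        rintro c u ⟨hu, hu'⟩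
        exact ⟨fun i hi => by rw [smul_dotProduct, smul_dotProduct, hu i hi],
          fun k hk => by rw [smul_dotProduct, smul_dotProduct, hu' k hk]⟩ }
  obtain ⟨W', hW'⟩ := W.exists_isCompl
  have hinv : ∀ w ∈ W, ∀ η, Φ (η + w) = Φ η := by
    intro w hw η
    refine Finset.sup'_congr hV rfl fun k hk => ?_
    refine Finset.sum_congr rfl fun i hi => ?_
    rw [add_dotProduct, dotProduct_sub w, hw.1 i hi, hw.2 k hk, sub_self, add_zero]
  -- Compactness of the unit sphere of the complement turns `hco` into a uniform linear bound.
  have hδ : ∃ δ > 0, ∀ η : W', ∃ i ∈ S, δ * ‖η‖ ≤ (η : Fin n → ℝ) ⬝ᵥ (x i - k₀) := by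
    let g : W' → ℝ := fun η => S.sup' hS fun i => (η : Fin n → ℝ) ⬝ᵥ (x i - k₀)
    have hg : Continuous g := Continuous.finset_sup'_apply hS fun i _ =>
      (continuous_dotProduct_left _).comp continuous_subtype_val
    rcases (Metric.sphere (0 : W') 1).eq_empty_or_nonempty with he | hne
    · refine ⟨1, one_pos, fun η => ?_⟩
      have : η = 0 := by
        by_contra h0
        have : ‖η‖⁻¹ • η ∈ Metric.sphere (0 : W') 1 := by
          rw [mem_sphere_zero_iff_norm, norm_smul, norm_inv, norm_norm,
            inv_mul_cancel₀ (norm_ne_zero_iff.2 h0)]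
        rw [he] at this; exact this
      obtain ⟨i, hi⟩ := hS
      exact ⟨i, hi, by simp [this]⟩
    · obtain ⟨η₀, hη₀, hmin⟩ := (isCompact_sphere (0 : W') 1).exists_isMinOn hne hg.continuousOn
      have hpos : 0 < g η₀ := by
        rcases hco η₀ with ⟨i, hi, hlt⟩ | h0
        · exact (Finset.lt_sup'_iff hS).2 ⟨i, hi, by rw [dotProduct_sub]; linarith⟩
        · exfalso
          have : (η₀ : Fin n → ℝ) ∈ W ⊓ W' := ⟨h0, η₀.2⟩
          rw [hW'.inf_eq_bot, Submodule.mem_bot] at this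
          have : η₀ = 0 := Subtype.ext this
          rw [this] at hη₀; simp at hη₀
      refine ⟨g η₀, hpos, fun η => ?_⟩
      by_cases h0 : η = 0
      · obtain ⟨i, hi⟩ := hS
        exact ⟨i, hi, by simp [h0]⟩
      have hn : 0 < ‖η‖ := norm_pos_iff.2 h0
      have hmem : ‖η‖⁻¹ • η ∈ Metric.sphere (0 : W') 1 := by
        rw [mem_sphere_zero_iff_norm, norm_smul, norm_inv, norm_norm, inv_mul_cancel₀ hn.ne']
      have hle : g η₀ ≤ g (‖η‖⁻¹ • η) := hmin hmem
      obtain ⟨i, hi, hle'⟩ := (Finset.le_sup'_iff hS).1 hle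
      refine ⟨i, hi, ?_⟩
      simp only [Submodule.coe_smul, smul_dotProduct, smul_eq_mul] at hle'
      calc g η₀ * ‖η‖ ≤ (‖η‖⁻¹ * ((η : Fin n → ℝ) ⬝ᵥ (x i - k₀))) * ‖η‖ := by gcongr
        _ = _ := by field_simp
  obtain ⟨δ, hδ0, hδ⟩ := hδ
  obtain ⟨a₀, ha₀, hale⟩ : ∃ a₀ > 0, ∀ i ∈ S, a₀ ≤ a i := by
    obtain ⟨i, hi, h⟩ := S.exists_min_image a hS
    exact ⟨a i, ha i hi, h⟩
  have hlow : ∀ η : W', a₀ * exp (ξ ⬝ᵥ k₀) * (δ * ‖η‖) ≤ Φ η := by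
    intro η
    obtain ⟨i, hi, h⟩ := hδ η
    calc a₀ * exp (ξ ⬝ᵥ k₀) * (δ * ‖η‖) ≤ a₀ * exp (ξ ⬝ᵥ k₀) * exp (δ * ‖η‖) := by
          gcongr; linarith [add_one_le_exp (δ * ‖η‖)]
      _ = a₀ * exp (δ * ‖η‖ + ξ ⬝ᵥ k₀) := by rw [exp_add]; ring
      _ ≤ a i * exp ((η : Fin n → ℝ) ⬝ᵥ (x i - k₀) + ξ ⬝ᵥ k₀) := by
          exact mul_le_mul_of_nonneg_right (hale i hi) (exp_pos _).le |>.trans (by gcongr; exact (ha i hi).le)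
      _ ≤ H k₀ η := Finset.single_le_sum
          (f := fun i => a i * exp ((η : Fin n → ℝ) ⬝ᵥ (x i - k₀) + ξ ⬝ᵥ k₀))
          (fun j hj => (mul_pos (ha j hj) (exp_pos _)).le) hi
      _ ≤ Φ η := Finset.le_sup' (fun k => H k (η : Fin n → ℝ)) hk₀
  have htend : Filter.Tendsto (fun η : W' => Φ η) (Filter.cocompact W') Filter.atTop := by
    refine Filter.tendsto_atTop_mono hlow ?_
    simp_rw [← mul_assoc]
    exact (tendsto_norm_cocompact_atTop).const_mul_atTop (by positivity)
  obtain ⟨η', hη'⟩ := (hΦc.comp continuous_subtype_val).exists_forall_le htend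
  set η : Fin n → ℝ := (η' : Fin n → ℝ) with hη
  have hmin : ∀ ζ, Φ η ≤ Φ ζ := by
    intro ζ
    have : ζ ∈ W ⊔ W' := by rw [hW'.sup_eq_top]; trivial
    obtain ⟨w, hw, w', hw', rfl⟩ := Submodule.mem_sup.1 this
    rw [add_comm, hinv w hw]
    exact hη' ⟨w', hw'⟩
  have hZ : 0 < ∑ i ∈ S, a i * exp (η ⬝ᵥ x i) :=
    Finset.sum_pos (fun i hi => mul_pos (ha i hi) (exp_pos _)) hS
  set Z : ℝ := ∑ i ∈ S, a i * exp (η ⬝ᵥ x i) with hZdef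
  set m : Fin n → ℝ := Z⁻¹ • ∑ i ∈ S, (a i * exp (η ⬝ᵥ x i)) • x i with hm
  have hHZ : ∀ k, H k η = exp ((ξ - η) ⬝ᵥ k) * Z := by
    intro k
    simp only [H, hZdef, Finset.mul_sum]
    refine Finset.sum_congr rfl fun i _ => ?_
    rw [dotProduct_sub, sub_dotProduct, show η ⬝ᵥ x i - η ⬝ᵥ k + ξ ⬝ᵥ k =
      (ξ ⬝ᵥ k - η ⬝ᵥ k) + η ⬝ᵥ x i by ring, exp_add]
    ring
  have hmZ : Z • m = ∑ i ∈ S, (a i * exp (η ⬝ᵥ x i)) • x i := by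
    rw [hm, smul_smul, mul_inv_cancel₀ hZ.ne', one_smul]
  -- Otherwise some direction d satisfies d·m < d·k for all active k. The derivative of each active
  -- term along d is a positive multiple of d·m - d·k, so all active terms decrease, while the
  -- inactive ones stay below the maximum by continuity.
  have hmem : m ∈ convexHull ℝ ((V.filter fun k => H k η = Φ η : Finset (Fin n → ℝ)) :
      Set (Fin n → ℝ)) := by
    by_contra hnot
    obtain ⟨f, u, hfm, hfu⟩ := geometric_hahn_banach_point_closed (convex_convexHull ℝ _)
      ((Finset.finite_toSet _).isClosed_convexHull ℝ) hnot
    obtain ⟨d, hd⟩ := exists_dotProduct_eq (f : (Fin n → ℝ) →ₗ[ℝ] ℝ)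
    have hd' : ∀ y, f y = d ⬝ᵥ y := hd
    have hev : ∀ k ∈ V, ∀ᶠ θ in 𝓝[>] (0 : ℝ), H k (η + θ • d) < Φ η := by
      intro k hk
      by_cases hact : H k η = Φ η
      · have hlt : d ⬝ᵥ m < d ⬝ᵥ k := by
          rw [← hd', ← hd']
          exact hfm.trans (hfu k (subset_convexHull ℝ _ (by simp [hk, hact])))
        have hder : HasDerivAt (fun θ : ℝ => H k (η + θ • d))
            (∑ i ∈ S, a i * (exp (η ⬝ᵥ (x i - k) + ξ ⬝ᵥ k) * (d ⬝ᵥ (x i - k)))) 0 := by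
          refine HasDerivAt.fun_sum fun i _ => ?_
          have h1 : HasDerivAt (fun θ : ℝ => (η + θ • d) ⬝ᵥ (x i - k) + ξ ⬝ᵥ k)
              (d ⬝ᵥ (x i - k)) 0 := by
            have : (fun θ : ℝ => (η + θ • d) ⬝ᵥ (x i - k) + ξ ⬝ᵥ k) =
                fun θ : ℝ => θ * (d ⬝ᵥ (x i - k)) + (η ⬝ᵥ (x i - k) + ξ ⬝ᵥ k) := by
              funext θ; rw [add_dotProduct, smul_dotProduct, smul_eq_mul]; ring
            rw [this]
            simpa using ((hasDerivAt_id (0 : ℝ)).mul_const (d ⬝ᵥ (x i - k))).add_const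
              (η ⬝ᵥ (x i - k) + ξ ⬝ᵥ k)
          have h2 := (h1.exp).const_mul (a i)
          simpa using h2
        have hval : (∑ i ∈ S, a i * (exp (η ⬝ᵥ (x i - k) + ξ ⬝ᵥ k) * (d ⬝ᵥ (x i - k)))) =
            exp ((ξ - η) ⬝ᵥ k) * (Z * (d ⬝ᵥ m - d ⬝ᵥ k)) := by
          have e1 : Z * (d ⬝ᵥ m) = ∑ i ∈ S, (a i * exp (η ⬝ᵥ x i)) * (d ⬝ᵥ x i) := by
            rw [← smul_eq_mul, ← dotProduct_smul, hmZ, dotProduct_sum]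
            exact Finset.sum_congr rfl fun i _ => by rw [dotProduct_smul, smul_eq_mul]
          rw [mul_sub, e1, hZdef, Finset.sum_mul, ← Finset.sum_sub_distrib, Finset.mul_sum]
          refine Finset.sum_congr rfl fun i _ => ?_
          rw [dotProduct_sub, dotProduct_sub, sub_dotProduct, show η ⬝ᵥ x i - η ⬝ᵥ k + ξ ⬝ᵥ k =
            (ξ ⬝ᵥ k - η ⬝ᵥ k) + η ⬝ᵥ x i by ring, exp_add]
          ring
        have hneg : exp ((ξ - η) ⬝ᵥ k) * (Z * (d ⬝ᵥ m - d ⬝ᵥ k)) < 0 :=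
          mul_neg_of_pos_of_neg (exp_pos _) (mul_neg_of_pos_of_neg hZ (by linarith))
        rw [hval] at hder
        have := exists_lt_of_hasDerivAt_neg hder hneg
        simpa [hact] using this
      · have hlt : H k η < Φ η :=
          lt_of_le_of_ne (Finset.le_sup' (fun k => H k η) hk) hact
        have hcont : Continuous fun θ : ℝ => H k (η + θ • d) := (hHc k).comp (by fun_prop)
        have h0 : Filter.Tendsto (fun θ : ℝ => H k (η + θ • d)) (𝓝[>] 0) (𝓝 (H k η)) := by
          have := (hcont.tendsto 0).mono_left (nhdsWithin_le_nhds (s := Set.Ioi 0))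
          simpa using this
        exact h0.eventually (eventually_lt_nhds hlt)
    have hall := (Filter.eventually_all_finset V).2 hev
    obtain ⟨θ, hθ⟩ := hall.exists
    have : Φ (η + θ • d) < Φ η := (Finset.sup'_lt_iff hV).2 hθ
    exact absurd (hmin (η + θ • d)) (not_le.2 this)
  refine ⟨η, m, ?_, convexHull_mono (Finset.coe_subset.2 (Finset.filter_subset _ _)) hmem, fun k hk => ?_⟩
  · simp_rw [smul_sub]
    rw [Finset.sum_sub_distrib, ← Finset.sum_smul, ← hmZ, sub_self]
  · have hhalf : Convex ℝ {y : Fin n → ℝ | (ξ - η) ⬝ᵥ k ≤ (ξ - η) ⬝ᵥ y} :=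
      convex_halfSpace_ge ⟨fun u v => dotProduct_add _ _ _, fun c u => dotProduct_smul _ _ _⟩ _
    refine convexHull_min ?_ hhalf hmem
    intro k' hk'
    rw [Finset.mem_coe, Finset.mem_filter] at hk'
    have h1 : H k η ≤ H k' η := by
      rw [hk'.2]; exact Finset.le_sup' (fun k => H k η) hk
    rw [hHZ, hHZ] at h1
    exact exp_le_exp.1 (le_of_mul_le_mul_right h1 hZ)

end TorusFib

namespace TorusFib

variable {N : ℕ}

/-! ### Lattice vectors and dual bases -/

@[simp] theorem emb_zero : emb (0 : Fin N → ℤ) = 0 := by ext; simp [emb]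
theorem emb_add (v w : Fin N → ℤ) : emb (v + w) = emb v + emb w := by ext; simp [emb]
theorem emb_sub (v w : Fin N → ℤ) : emb (v - w) = emb v - emb w := by ext; simp [emb]
theorem emb_smul (n : ℤ) (v : Fin N → ℤ) : emb (n • v) = (n : ℝ) • emb v := by ext; simp [emb]
theorem emb_sum {ι : Type*} (s : Finset ι) (f : ι → Fin N → ℤ) :
    emb (∑ i ∈ s, f i) = ∑ i ∈ s, emb (f i) := by
  ext; simp [emb]
theorem emb_injective : Function.Injective (emb : (Fin N → ℤ) → Fin N → ℝ) := by
  intro v w h; ext i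
  have := congrFun h i
  simpa [emb] using this
theorem emb_dotProduct (u w : Fin N → ℤ) : emb u ⬝ᵥ emb w = ((u ⬝ᵥ w : ℤ) : ℝ) := by
  simp [emb, dotProduct]

/-- The vectors of the basis of `ℤ^N` dual to `b`. -/
noncomputable def dualVec (b : Module.Basis (Fin N) ℤ (Fin N → ℤ)) (i : Fin N) : Fin N → ℤ :=
  fun a => b.repr (Pi.single a 1) i

theorem dualVec_dotProduct (b : Module.Basis (Fin N) ℤ (Fin N → ℤ)) (i : Fin N) (x : Fin N → ℤ) :
    dualVec b i ⬝ᵥ x = b.repr x i := by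
  have h := congrArg (b.coord i) (pi_eq_sum_univ' x)
  simp_rw [map_sum, map_smul, Module.Basis.coord_apply, smul_eq_mul] at h
  rw [h]
  simp_rw [dotProduct, dualVec]
  exact Finset.sum_congr rfl fun a _ => mul_comm _ _

theorem dualVec_dotProduct_basis (b : Module.Basis (Fin N) ℤ (Fin N → ℤ)) (i j : Fin N) :
    dualVec b i ⬝ᵥ b j = if i = j then 1 else 0 := by
  rw [dualVec_dotProduct, b.repr_self, Finsupp.single_apply]
  simp [eq_comm]

theorem eq_of_dotProduct_basis (b : Module.Basis (Fin N) ℤ (Fin N → ℤ)) {u w : Fin N → ℤ}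
    (h : ∀ j, u ⬝ᵥ b j = w ⬝ᵥ b j) : u = w := by
  let f : (Fin N → ℤ) → (Fin N → ℤ) →ₗ[ℤ] ℤ := fun u =>
    { toFun := fun x => u ⬝ᵥ x
      map_add' := fun x y => dotProduct_add _ _ _
      map_smul' := fun c x => dotProduct_smul c u x }
  have hf : f u = f w := b.ext h
  ext i
  have := LinearMap.congr_fun hf (Pi.single i 1)
  simpa [f] using this

theorem sum_emb_dualVec (b : Module.Basis (Fin N) ℤ (Fin N → ℤ)) (m : Fin N → ℝ) :
    ∑ i, (emb (dualVec b i) ⬝ᵥ m) • emb (b i) = m := by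
  have h1 : ∀ a : Fin N, ∑ i, (emb (dualVec b i) ⬝ᵥ Pi.single a (1 : ℝ)) • emb (b i) =
      Pi.single a 1 := by
    intro a
    have : ∑ i, b.repr (Pi.single a (1 : ℤ)) i • b i = Pi.single a 1 := b.sum_repr _
    have h2 := congrArg emb this
    rw [emb_sum] at h2
    simp_rw [emb_smul] at h2
    have h3 : emb (Pi.single a (1 : ℤ)) = (Pi.single a (1 : ℝ) : Fin N → ℝ) := by
      ext i; by_cases h : i = a
      · subst h; simp [emb]
      · simp [emb, h]
    rw [h3] at h2
    rw [← h2]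
    refine Finset.sum_congr rfl fun i _ => ?_
    rw [h2, dotProduct_single_one]
    rfl
  conv_rhs => rw [pi_eq_sum_univ' m]
  conv_lhs => rw [pi_eq_sum_univ' m]
  simp_rw [dotProduct_sum, Finset.sum_smul]
  rw [Finset.sum_comm]
  refine Finset.sum_congr rfl fun a _ => ?_
  simp_rw [dotProduct_smul, smul_assoc]
  rw [← Finset.smul_sum, h1]

theorem dotProduct_eq_sum_basis (b : Module.Basis (Fin N) ℤ (Fin N → ℤ)) (ξ m : Fin N → ℝ) :
    ξ ⬝ᵥ m = ∑ i, (emb (dualVec b i) ⬝ᵥ m) * (ξ ⬝ᵥ emb (b i)) := by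
  conv_lhs => rw [← sum_emb_dualVec b m]
  simp_rw [dotProduct_sum, dotProduct_smul, smul_eq_mul]

theorem dotProduct_emb_eq_sum_repr (b : Module.Basis (Fin N) ℤ (Fin N → ℤ)) (ξ : Fin N → ℝ)
    (w : Fin N → ℤ) : ξ ⬝ᵥ emb w = ∑ i, (b.repr w i : ℝ) * (ξ ⬝ᵥ emb (b i)) := by
  rw [dotProduct_eq_sum_basis b]
  simp_rw [emb_dotProduct, dualVec_dotProduct]

theorem exists_dotProduct_basis (b : Module.Basis (Fin N) ℤ (Fin N → ℤ)) (x : Fin N → ℝ) :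
    ∃ ξ : Fin N → ℝ, ∀ i, ξ ⬝ᵥ emb (b i) = x i := by
  refine ⟨∑ j, x j • emb (dualVec b j), fun i => ?_⟩
  simp_rw [sum_dotProduct, smul_dotProduct, emb_dotProduct, dualVec_dotProduct_basis]
  simp

theorem linearIndependent_emb_basis (b : Module.Basis (Fin N) ℤ (Fin N → ℤ)) :
    LinearIndependent ℝ fun i => emb (b i) := by
  rw [Fintype.linearIndependent_iff]
  intro g hg i
  have := congrArg (fun m => emb (dualVec b i) ⬝ᵥ m) hg
  simp only [dotProduct_sum, dotProduct_smul, emb_dotProduct, dualVec_dotProduct_basis,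
    dotProduct_zero, smul_eq_mul] at this
  simpa using this

/-- The common kernel of the dual vectors with index in I is spanned by the basis vectors with index
outside I. -/
theorem finrank_ker_dualVec (b : Module.Basis (Fin N) ℤ (Fin N → ℤ)) (W : Submodule ℝ (Fin N → ℝ))
    (I : Finset (Fin N)) (hW : ∀ d, d ∈ W ↔ ∀ i ∈ I, emb (dualVec b i) ⬝ᵥ d = 0) :
    Module.finrank ℝ W + I.card = N := by
  classical
  have hspan : W = Submodule.span ℝ (Set.range fun j : {j // j ∉ I} => emb (b j)) := by
    apply le_antisymm
    · intro d hd
      rw [← sum_emb_dualVec b d]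
      refine Submodule.sum_mem _ fun i _ => ?_
      by_cases hi : i ∈ I
      · rw [(hW d).1 hd i hi, zero_smul]; exact Submodule.zero_mem _
      · exact Submodule.smul_mem _ _ (Submodule.subset_span ⟨⟨i, hi⟩, rfl⟩)
    · rw [Submodule.span_le]
      rintro _ ⟨⟨j, hj⟩, rfl⟩
      rw [SetLike.mem_coe, hW]
      intro i hi
      rw [emb_dotProduct, dualVec_dotProduct_basis, if_neg (by rintro rfl; exact hj hi)]
      simp
  have hli : LinearIndependent ℝ fun j : {j // j ∉ I} => emb (b j) :=
    (linearIndependent_emb_basis b).comp _ Subtype.val_injective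
  rw [hspan, finrank_span_eq_card hli, Fintype.card_subtype_compl, Fintype.card_coe,
    Fintype.card_fin]
  have := I.card_le_univ
  rw [Fintype.card_fin] at this
  omega

/-- The basis of `ℤ^N` given by `N` generators. -/
theorem exists_basis_of_generators (g : Fin N → Fin N → ℤ)
    (h : Submodule.span ℤ (Set.range g) = ⊤) :
    ∃ b : Module.Basis (Fin N) ℤ (Fin N → ℤ), ∀ i, b i = g i := by
  have hsurj : Function.Surjective (Fintype.linearCombination ℤ g) := by
    rw [← LinearMap.range_eq_top, Fintype.range_linearCombination, h]
  have hinj := OrzechProperty.injective_of_surjective_endomorphism _ hsurj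
  have hli : LinearIndependent ℤ g := by
    exact linearIndependent_iff_injective_fintypeLinearCombination.2 hinj
  exact ⟨Module.Basis.mk hli h.ge, fun i => by simp⟩

/-! ### The normals of a reflexive polytope -/

namespace FamilyData

variable (D : FamilyData N)

/-- The lattice points of the polar polytope that define nonempty faces. -/
def normals : Set (Fin N → ℤ) :=
  {u | emb u ∈ polar D.Delta ∧ (facetOf D.Delta u).Nonempty}

/-- The normals of the facets containing `X`. -/
def nrm (X : Set (Fin N → ℝ)) : Set (Fin N → ℤ) :=
  {u ∈ D.normals | ∀ x ∈ X, emb u ⬝ᵥ x = -1}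

/-- The smallest face containing `X`. -/
def fc (X : Set (Fin N → ℝ)) : Set (Fin N → ℝ) :=
  {m ∈ D.Delta | ∀ u ∈ D.nrm X, emb u ⬝ᵥ m = -1}

theorem isCompact_Delta : IsCompact D.Delta := by
  exact (D.A.finite_toSet.image emb).isCompact_convexHull ℝ

theorem convex_Delta : Convex ℝ D.Delta := convex_convexHull ℝ _

theorem zero_mem_interior : (0 : Fin N → ℝ) ∈ interior D.Delta := D.reflexive.2.1

theorem emb_mem_Delta {w : Fin N → ℤ} (hw : w ∈ D.A) : emb w ∈ D.Delta :=
  subset_convexHull ℝ _ ⟨w, hw, rfl⟩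

theorem zero_mem_Delta : (0 : Fin N → ℝ) ∈ D.Delta := interior_subset D.zero_mem_interior

variable {D}

theorem normals_ge {u : Fin N → ℤ} (hu : u ∈ D.normals) {m : Fin N → ℝ} (hm : m ∈ D.Delta) :
    -1 ≤ emb u ⬝ᵥ m := hu.1 m hm

theorem nrm_subset_normals {X : Set (Fin N → ℝ)} : D.nrm X ⊆ D.normals := fun _ h => h.1

theorem nrm_anti {X Y : Set (Fin N → ℝ)} (h : X ⊆ Y) : D.nrm Y ⊆ D.nrm X :=
  fun _ hu => ⟨hu.1, fun x hx => hu.2 x (h hx)⟩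

theorem subset_fc {X : Set (Fin N → ℝ)} (h : X ⊆ D.Delta) : X ⊆ D.fc X :=
  fun x hx => ⟨h hx, fun _ hu => hu.2 x hx⟩

theorem eventually_smul_mem_of_interior {x : Fin N → ℝ} (hx : x ∈ interior D.Delta)
    (d : Fin N → ℝ) : ∀ᶠ δ in 𝓝[>] (0 : ℝ), x + δ • d ∈ D.Delta := by
  have hc : Filter.Tendsto (fun δ : ℝ => x + δ • d) (𝓝[>] 0) (𝓝 x) := by
    have : Continuous fun δ : ℝ => x + δ • d := by fun_prop
    have := (this.tendsto 0).mono_left (nhdsWithin_le_nhds (s := Set.Ioi 0))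
    simpa using this
  exact hc (mem_interior_iff_mem_nhds.1 hx)

/-- This is where reflexivity enters: h/γ lies in the polar, which is the hull of lattice points,
and every lattice point with positive weight must be tight wherever h attains its minimum. Thus all
supporting hyperplanes come from lattice normals at height -1. -/
theorem exists_normals_of_min {h : Fin N → ℝ} {γ : ℝ} (hγ : 0 < γ)
    (hle : ∀ m ∈ D.Delta, -γ ≤ h ⬝ᵥ m) {x : Fin N → ℝ} (hx : x ∈ D.Delta) (hxγ : h ⬝ᵥ x = -γ) :
    ∃ (B : Finset (Fin N → ℤ)) (c : (Fin N → ℤ) → ℝ), (∀ b ∈ B, 0 < c b) ∧ ∑ b ∈ B, c b = 1 ∧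
      h = γ • ∑ b ∈ B, c b • emb b ∧ (∀ b ∈ B, b ∈ D.normals) ∧
      ∀ m ∈ D.Delta, h ⬝ᵥ m = -γ → ∀ b ∈ B, emb b ⬝ᵥ m = -1 := by
  classical
  obtain ⟨B₀, hB₀⟩ := D.reflexive.2.2
  have hpol : γ⁻¹ • h ∈ polar D.Delta := by
    intro m hm
    change -1 ≤ (γ⁻¹ • h) ⬝ᵥ m
    rw [smul_dotProduct, smul_eq_mul]
    have := hle m hm
    rw [inv_mul_eq_div, le_div_iff₀ hγ]; linarith
  have hmem : γ⁻¹ • h ∈ convexHull ℝ ((B₀.image emb : Finset (Fin N → ℝ)) : Set (Fin N → ℝ)) := by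
    rw [Finset.coe_image]; exact hB₀ ▸ hpol
  obtain ⟨w, hw0, hw1, hw⟩ := (Finset.mem_convexHull').1 hmem
  rw [Finset.sum_image (fun a _ b _ h => emb_injective h)] at hw1 hw
  have hB₀pol : ∀ b ∈ B₀, emb b ∈ polar D.Delta := fun b hb => by
    have : emb b ∈ convexHull ℝ (emb '' (B₀ : Set (Fin N → ℤ))) :=
      subset_convexHull ℝ _ ⟨b, hb, rfl⟩
    rw [← hB₀] at this; exact this
  set B := B₀.filter fun b => w (emb b) ≠ 0 with hB
  have hpos : ∀ b ∈ B, 0 < w (emb b) := fun b hb => by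
    rw [hB, Finset.mem_filter] at hb
    exact lt_of_le_of_ne (hw0 _ (Finset.mem_image_of_mem _ hb.1)) hb.2.symm
  have hs1 : ∑ b ∈ B, w (emb b) = 1 := by
    rw [← hw1, hB, Finset.sum_filter_ne_zero]
  have hs2 : ∑ b ∈ B, w (emb b) • emb b = γ⁻¹ • h := by
    rw [← hw, hB]
    refine Finset.sum_filter_of_ne fun b _ hb h0 => hb (by rw [h0, zero_smul])
  have htight : ∀ m ∈ D.Delta, h ⬝ᵥ m = -γ → ∀ b ∈ B, emb b ⬝ᵥ m = -1 := by
    intro m hm hmγ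
    have e : ∑ b ∈ B, w (emb b) * (emb b ⬝ᵥ m + 1) = 0 := by
      have : (γ⁻¹ • h) ⬝ᵥ m = -1 := by
        rw [smul_dotProduct, hmγ, smul_eq_mul]; field_simp
      rw [← hs2, sum_dotProduct] at this
      simp_rw [smul_dotProduct, smul_eq_mul] at this
      simp_rw [mul_add, mul_one, Finset.sum_add_distrib]
      rw [this, hs1]; ring
    intro b hb
    have hb' : b ∈ B₀ := (Finset.mem_filter.1 hb).1
    have := (Finset.sum_eq_zero_iff_of_nonneg (fun b hb => mul_nonneg (hpos b hb).le (by
      have := hB₀pol b (Finset.mem_filter.1 hb).1 m hm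
      change -1 ≤ emb b ⬝ᵥ m at this
      linarith))).1 e b hb
    rcases mul_eq_zero.1 this with h0 | h0
    · exact absurd h0 (hpos b hb).ne'
    · linarith
  refine ⟨B, fun b => w (emb b), hpos, hs1, ?_, fun b hb => ?_, htight⟩
  · rw [hs2, smul_smul, mul_inv_cancel₀ hγ.ne', one_smul]
  · exact ⟨hB₀pol b (Finset.mem_filter.1 hb).1, x, hx, htight x hx hxγ b hb⟩

/-- A functional separating a point from Δ is, after rescaling by its minimum on Δ, a convex
combination of normals; if none of them were violated at the point, neither would be the
combination. -/
theorem mem_Delta_iff {m : Fin N → ℝ} : m ∈ D.Delta ↔ ∀ u ∈ D.normals, -1 ≤ emb u ⬝ᵥ m := by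
  refine ⟨fun hm u hu => normals_ge hu hm, fun hm => ?_⟩
  by_contra hnot
  obtain ⟨f, c, hfm, hfc⟩ := geometric_hahn_banach_point_closed D.convex_Delta
    D.isCompact_Delta.isClosed hnot
  obtain ⟨h, hh⟩ := exists_dotProduct_eq (f : (Fin N → ℝ) →ₗ[ℝ] ℝ)
  have hh' : ∀ y, f y = h ⬝ᵥ y := hh
  obtain ⟨x, hx, hmin⟩ := D.isCompact_Delta.exists_isMinOn ⟨0, D.zero_mem_Delta⟩
    (f.continuous.continuousOn)
  have hm0 : f m < 0 := by
    have := hfc 0 D.zero_mem_Delta; rw [map_zero] at this; linarith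
  -- Since 0 is interior, a small positive multiple of m lies in Δ, and f is negative there.
  have hx0 : f x < 0 := by
    obtain ⟨δ, hδ, hδ0⟩ := ((eventually_smul_mem_of_interior D.zero_mem_interior m).and
      self_mem_nhdsWithin).exists
    have h1 : f x ≤ f (0 + δ • m) := hmin hδ
    rw [zero_add, map_smul, smul_eq_mul] at h1
    have := mul_neg_of_pos_of_neg (Set.mem_Ioi.1 hδ0) hm0
    linarith
  obtain ⟨B, w, hw, hw1, hB, hBn, -⟩ := exists_normals_of_min (D := D) (h := h) (γ := -f x)
    (by linarith) (fun y hy => by rw [neg_neg, ← hh']; exact hmin hy) hx (by rw [neg_neg, hh'])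
  have hxm : f m < f x := hfm.trans (hfc x hx)
  have h1 : f m = -f x * ∑ b ∈ B, w b * (emb b ⬝ᵥ m) := by
    rw [hh' m]
    conv_lhs => rw [hB]
    rw [smul_dotProduct, sum_dotProduct, smul_eq_mul]
    simp_rw [smul_dotProduct, smul_eq_mul]
  have h2 : -1 ≤ ∑ b ∈ B, w b * (emb b ⬝ᵥ m) := by
    have : ∑ b ∈ B, w b * (-1) ≤ ∑ b ∈ B, w b * (emb b ⬝ᵥ m) :=
      Finset.sum_le_sum fun b hb => mul_le_mul_of_nonneg_left (hm b (hBn b hb)) (hw b hb).le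
    rw [← Finset.sum_mul, hw1] at this
    linarith
  nlinarith

theorem finite_normals : (D.normals).Finite := by
  obtain ⟨B₀, hB₀⟩ := D.reflexive.2.2
  have hb : Bornology.IsBounded (polar D.Delta) := by
    change Bornology.IsBounded (polar (convexHull ℝ (emb '' (D.A : Set (Fin N → ℤ)))))
    rw [hB₀]
    exact ((B₀.finite_toSet.image emb).isCompact_convexHull ℝ).isBounded
  obtain ⟨R, hR⟩ := hb.exists_norm_le
  refine (Set.finite_Icc (fun _ : Fin N => -⌈R⌉) (fun _ => ⌈R⌉)).subset fun u hu => ?_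
  have h1 : ∀ i, |(u i : ℝ)| ≤ R := fun i => (norm_le_pi_norm (emb u) i).trans (hR _ hu.1)
  have h2 : ∀ i, |u i| ≤ ⌈R⌉ := fun i => by
    have := (h1 i).trans (Int.le_ceil R)
    exact_mod_cast this
  exact ⟨fun i => (abs_le.1 (h2 i)).1, fun i => (abs_le.1 (h2 i)).2⟩

theorem finite_nrm {X : Set (Fin N → ℝ)} : (D.nrm X).Finite :=
  finite_normals.subset nrm_subset_normals

/-- Directions pointing into the polytope. -/
theorem eventually_smul_mem {x d : Fin N → ℝ} (hx : x ∈ D.Delta)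
    (hd : ∀ u ∈ D.nrm {x}, 0 ≤ emb u ⬝ᵥ d) : ∀ᶠ δ in 𝓝[>] (0 : ℝ), x + δ • d ∈ D.Delta := by
  simp_rw [mem_Delta_iff]
  refine (Filter.eventually_all_finite finite_normals).2 fun u hu => ?_
  by_cases htight : emb u ⬝ᵥ x = -1
  · filter_upwards [self_mem_nhdsWithin] with δ hδ
    rw [dotProduct_add, dotProduct_smul, smul_eq_mul, htight]
    have := mul_nonneg (Set.mem_Ioi.1 hδ).le (hd u ⟨hu, by simpa using htight⟩)
    linarith
  · have hlt : -1 < emb u ⬝ᵥ x := lt_of_le_of_ne (normals_ge hu hx) (Ne.symm htight)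
    have hc : Filter.Tendsto (fun δ : ℝ => emb u ⬝ᵥ (x + δ • d)) (𝓝[>] 0) (𝓝 (emb u ⬝ᵥ x)) := by
      have : Continuous fun δ : ℝ => emb u ⬝ᵥ (x + δ • d) :=
        (continuous_dotProduct_right _).comp (by fun_prop)
      have := (this.tendsto 0).mono_left (nhdsWithin_le_nhds (s := Set.Ioi 0))
      simpa using this
    exact (hc.eventually (eventually_gt_nhds hlt)).mono fun δ h => h.le

/-- Minus the sum of the normals tight on X is bounded on Δ by their number, with equality exactly
where all of them are tight. -/
theorem isFace_fc {X : Set (Fin N → ℝ)} (hX : X.Nonempty) (hXD : X ⊆ D.Delta) :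
    IsFace D.Delta (D.fc X) := by
  classical
  refine ⟨hX.mono (subset_fc hXD), fun _ => ?_⟩
  let U := (finite_nrm (D := D) (X := X)).toFinset
  let l : (Fin N → ℝ) →ₗ[ℝ] ℝ :=
    { toFun := fun y => -∑ u ∈ U, emb u ⬝ᵥ y
      map_add' := fun x y => by simp_rw [dotProduct_add, Finset.sum_add_distrib]; ring
      map_smul' := fun c x => by
        simp_rw [dotProduct_smul, smul_eq_mul, ← Finset.mul_sum]; simp }
  have hl : ∀ y, l y = -∑ u ∈ U, emb u ⬝ᵥ y := fun _ => rfl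
  have hUn : ∀ u ∈ U, u ∈ D.nrm X := fun u hu => by simpa [U] using hu
  have hmax : ∀ y ∈ D.Delta, l y ≤ U.card := by
    intro y hy
    rw [hl]
    have : ∑ u ∈ U, (-1 : ℝ) ≤ ∑ u ∈ U, emb u ⬝ᵥ y :=
      Finset.sum_le_sum fun u hu => normals_ge (hUn u hu).1 hy
    simp at this; linarith
  have heq : ∀ y, (∀ u ∈ D.nrm X, emb u ⬝ᵥ y = -1) → l y = U.card := by
    intro y hy
    rw [hl, Finset.sum_congr rfl fun u hu => hy u (hUn u hu)]
    simp
  refine ⟨LinearMap.toContinuousLinearMap l, ?_⟩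
  ext m
  constructor
  · rintro ⟨hm, hm'⟩
    refine ⟨hm, fun y hy => ?_⟩
    change l y ≤ l m
    rw [heq m hm']; exact hmax y hy
  · rintro ⟨hm, hm'⟩
    refine ⟨hm, fun u hu => ?_⟩
    obtain ⟨x, hx⟩ := hX
    have h1 : l x ≤ l m := hm' x (hXD hx)
    rw [heq x fun u hu => hu.2 x hx, hl] at h1
    have h2 : ∑ u ∈ U, (emb u ⬝ᵥ m + 1) ≤ 0 := by
      rw [Finset.sum_add_distrib]; simp; linarith
    have h3 : ∀ u ∈ U, 0 ≤ emb u ⬝ᵥ m + 1 := fun u hu => by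
      linarith [normals_ge (hUn u hu).1 hm]
    have := (Finset.sum_eq_zero_iff_of_nonneg h3).1
      (le_antisymm h2 (Finset.sum_nonneg h3)) u (by simpa [U] using hu)
    linarith

/-- The functional exposing F is a multiple of a convex combination of normals, each of them tight
on F, so tightness of these normals at m already makes m a maximum point. -/
theorem IsFace.eq_fc {F : Set (Fin N → ℝ)} (hF : IsFace D.Delta F) : F = D.fc F := by
  refine le_antisymm (subset_fc hF.2.subset) fun m hm => ?_
  obtain ⟨l, hl⟩ := hF.2 hF.1
  obtain ⟨x, hx⟩ := hF.1
  have hx' := hx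
  rw [hl] at hx' ⊢
  refine ⟨hm.1, fun y hy => ?_⟩
  obtain ⟨h, hh⟩ := exists_dotProduct_eq (l : (Fin N → ℝ) →ₗ[ℝ] ℝ)
  have hh' : ∀ y, l y = h ⬝ᵥ y := hh
  -- A nonpositive maximum forces l = 0, because 0 is interior to Δ; then every point of Δ is a
  -- maximum point.
  rcases le_or_gt (l x) 0 with h0 | h0
  · have hnonpos : ∀ d, l d ≤ 0 := by
      intro d
      obtain ⟨δ, hδ, hδ0⟩ := ((eventually_smul_mem_of_interior D.zero_mem_interior d).and
        self_mem_nhdsWithin).exists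
      have := (hx'.2 _ hδ).trans h0
      rw [zero_add, map_smul, smul_eq_mul] at this
      by_contra hc
      exact absurd (mul_pos (Set.mem_Ioi.1 hδ0) (not_le.1 hc)) (not_lt.2 this)
    have h1 := hnonpos (-m)
    rw [map_neg] at h1
    linarith [hnonpos y]
  · obtain ⟨B, w, hw, hw1, hB, hBn, hBt⟩ := exists_normals_of_min (D := D) (h := -h) (γ := l x)
      h0 (fun y hy => by rw [neg_dotProduct, ← hh']; linarith [hx'.2 y hy]) hx'.1
      (by rw [neg_dotProduct, hh'])
    have htight : ∀ b ∈ B, emb b ⬝ᵥ m = -1 := fun b hb => by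
      refine hm.2 b ⟨hBn b hb, fun z hz => hBt z (hF.2.subset hz) ?_ b hb⟩
      have hz' := hz
      rw [hl] at hz'
      rw [neg_dotProduct, ← hh', le_antisymm (hx'.2 z hz'.1) (hz'.2 x hx'.1)]
    have : (-h) ⬝ᵥ m = -(l x) := by
      rw [hB, smul_dotProduct, sum_dotProduct, smul_eq_mul]
      simp_rw [smul_dotProduct, smul_eq_mul]
      rw [Finset.sum_congr rfl fun b hb => by rw [htight b hb], ← Finset.sum_mul, hw1]; ring
    rw [neg_dotProduct, ← hh'] at this
    have := hx'.2 y hy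
    linarith

theorem minFace_eq_fc {X : Set (Fin N → ℝ)} (hX : X.Nonempty) (hXD : X ⊆ D.Delta) :
    minFace D.Delta X = D.fc X := by
  apply le_antisymm
  · exact Set.sInter_subset_of_mem ⟨isFace_fc hX hXD, subset_fc hXD⟩
  · refine Set.subset_sInter ?_
    rintro F ⟨hF, hXF⟩
    rw [IsFace.eq_fc hF]
    exact fun m hm => ⟨hm.1, fun u hu => hm.2 u (nrm_anti hXF hu)⟩

end FamilyData

end TorusFib

namespace TorusFib

variable {N : ℕ}

/-! ### The vertices of a nonsingular polytope -/

theorem eq_zero_of_extreme {A : Set (Fin N → ℝ)} {x d : Fin N → ℝ} (hx : x ∈ A.extremePoints ℝ)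
    (h₁ : x + d ∈ A) (h₂ : x - d ∈ A) : d = 0 := by
  have := ((mem_extremePoints.1 hx).2 _ h₁ _ h₂ ⟨1 / 2, 1 / 2, by norm_num, by norm_num,
    by norm_num, by ext i; simp; ring⟩).1
  simpa using this

namespace FamilyData

variable {D : FamilyData N}

/-- A direction annihilated by all tight normals can be followed both ways inside Δ, contradicting
extremality unless it is zero. So the normals at a vertex span. -/
theorem eq_zero_of_vertex {v d : Fin N → ℝ} (hv : v ∈ D.Delta.extremePoints ℝ)
    (h : ∀ u ∈ D.nrm {v}, emb u ⬝ᵥ d = 0) : d = 0 := by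
  have hvD : v ∈ D.Delta := extremePoints_subset hv
  obtain ⟨δ, ⟨h1, h2⟩, hδ⟩ := (((eventually_smul_mem hvD fun u hu => (h u hu).ge).and
    (eventually_smul_mem (d := -d) hvD fun u hu => by
      rw [dotProduct_neg, h u hu, neg_zero])).and self_mem_nhdsWithin).exists
  have h0 := eq_zero_of_extreme hv h1 (by rwa [smul_neg, ← sub_eq_add_neg] at h2)
  exact (smul_eq_zero.1 h0).resolve_left (ne_of_gt (Set.mem_Ioi.1 hδ))

/-- The generator is a nonzero lattice step of least ℓ¹-norm. Any other step is a real multiple of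
it, nonnegative since v is an end of the edge, and a nonzero fractional part of the factor would
give a shorter step. -/
theorem exists_edge_generator {v : Fin N → ℤ} (hv : emb v ∈ D.Delta.extremePoints ℝ)
    {e : Set (Fin N → ℝ)} (he : e ∈ edgesAt D.Delta (emb v)) :
    ∃ g : Fin N → ℤ, (g = 0 ∨ emb (v + g) ∈ e) ∧ ∀ w, emb (v + w) ∈ e → ∃ n : ℤ, w = n • g := by
  classical
  obtain ⟨heF, hdim, hve⟩ := he
  -- An edge whose only lattice point is v gets the generator 0; `exists_vertex_basis` rules this
  -- out, since members of a basis are nonzero.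
  by_cases hall : ∀ w, emb (v + w) ∈ e → w = 0
  · exact ⟨0, Or.inl rfl, fun w hw => ⟨0, by simp [hall w hw]⟩⟩
  push Not at hall
  let f : (Fin N → ℤ) → ℕ := fun w => ∑ i, (w i).natAbs
  obtain ⟨w₀, ⟨hw₀e, hw₀⟩, hmin⟩ : ∃ w, (emb (v + w) ∈ e ∧ w ≠ 0) ∧
      ∀ w', (emb (v + w') ∈ e ∧ w' ≠ 0) → f w ≤ f w' := by
    obtain ⟨w, hw⟩ := hall
    have : ({w | emb (v + w) ∈ e ∧ w ≠ 0} : Set (Fin N → ℤ)).Nonempty := ⟨w, hw⟩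
    exact ⟨Function.argminOn f _ this, Function.argminOn_mem f _ this,
      fun w' hw' => Function.argminOn_le f _ hw'⟩
  refine ⟨w₀, Or.inr hw₀e, fun w hw => ?_⟩
  have hcv : Convex ℝ e := heF.2.convex D.convex_Delta
  have hmemspan : ∀ w, emb (v + w) ∈ e → emb w ∈ vectorSpan ℝ e := fun w hw => by
    have := vsub_mem_vectorSpan ℝ hw hve
    rwa [emb_add, vsub_eq_sub, add_sub_cancel_left] at this
  have hne : emb w₀ ≠ 0 := fun h => hw₀ (emb_injective (by rw [h, emb_zero]))
  obtain ⟨c, hc⟩ := (finrank_eq_one_iff_of_nonzero' (⟨emb w₀, hmemspan _ hw₀e⟩ : vectorSpan ℝ e)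
    (by simpa using hne)).1 hdim ⟨emb w, hmemspan _ hw⟩
  have hc' : emb w = c • emb w₀ := (congrArg Subtype.val hc).symm
  have hc0 : 0 ≤ c := by
    by_contra hneg
    have hneg := not_le.1 hneg
    have := ((mem_extremePoints.1 hv).2 _ (heF.2.subset hw₀e) _ (heF.2.subset hw)
      ⟨-c / (1 - c), 1 / (1 - c), div_pos (by linarith) (by linarith),
        div_pos one_pos (by linarith), by rw [← add_div, div_eq_one_iff_eq (by linarith)]; ring, by
          rw [emb_add, emb_add, hc']
          ext i
          have : (1 - c) ≠ 0 := by linarith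
          simp
          field_simp
          ring⟩).1
    rw [emb_add, add_eq_left] at this
    exact hne this
  refine ⟨⌊c⌋, ?_⟩
  by_contra hcon
  have hw1 : emb (w - ⌊c⌋ • w₀) = Int.fract c • emb w₀ := by
    rw [emb_sub, emb_smul, hc', ← sub_smul]; rfl
  have hmem1 : emb (v + (w - ⌊c⌋ • w₀)) ∈ e := by
    rw [emb_add, hw1]
    have := hcv hve hw₀e (sub_nonneg.2 (Int.fract_lt_one c).le) (Int.fract_nonneg c) (by ring)
    rw [emb_add] at this
    convert this using 1
    ext i; simp; ring
  have hlt := hmin _ ⟨hmem1, fun h => hcon (sub_eq_zero.1 h)⟩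
  have hf : ∀ w, (f w : ℝ) = ∑ i, |emb w i| := fun w => by
    simp only [f, emb, Nat.cast_sum, Nat.cast_natAbs, Int.cast_abs]
  have h1 : (f w₀ : ℝ) ≤ f (w - ⌊c⌋ • w₀) := by exact_mod_cast hlt
  rw [hf, hf, hw1] at h1
  simp only [Pi.smul_apply, smul_eq_mul, abs_mul, ← Finset.mul_sum,
    abs_of_nonneg (Int.fract_nonneg c)] at h1
  have hpos : 0 < ∑ i, |emb w₀ i| := by
    obtain ⟨i, hi⟩ := Function.ne_iff.1 hne
    exact Finset.sum_pos' (fun i _ => abs_nonneg _) ⟨i, Finset.mem_univ _, abs_pos.2 hi⟩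
  nlinarith [Int.fract_lt_one c]

/-- The tangent cone at v is the cone over the compact slice K on which the sum of the tight normals
equals 1. Extreme points of K point along edges, and there are finitely many edges, so K is the
convex hull of edge directions. -/
theorem vertex_slice (v : Fin N → ℤ) (hv : emb v ∈ D.Delta.extremePoints ℝ) :
    ∀ d, (∀ u ∈ D.nrm {emb v}, 0 ≤ emb u ⬝ᵥ d) →
      d ∈ Submodule.span NNReal {x | ∃ e ∈ edgesAt D.Delta (emb v), emb v + x ∈ e} := by
  classical
  have hvD : emb v ∈ D.Delta := extremePoints_subset hv
  rcases Nat.eq_zero_or_pos N with hN | hN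
  · subst hN
    intro d _
    rw [Subsingleton.elim d 0]
    exact Submodule.zero_mem _
  have hfin : (edgesAt D.Delta (emb v)).Finite :=
    Set.finite_of_ncard_pos (((D.nonsingular v hv).1.symm ▸ hN :))
  set U := (finite_nrm (D := D) (X := {emb v})).toFinset with hU
  have hUm : ∀ u, u ∈ U ↔ u ∈ D.nrm {emb v} := fun u => by simp [hU]
  set h : Fin N → ℝ := ∑ u ∈ U, emb u with hh
  have hdot : ∀ d, h ⬝ᵥ d = ∑ u ∈ U, emb u ⬝ᵥ d := fun d => by rw [hh, sum_dotProduct]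
  set K : Set (Fin N → ℝ) := {d | (∀ u ∈ U, 0 ≤ emb u ⬝ᵥ d) ∧ h ⬝ᵥ d = 1} with hK
  have hKclosed : IsClosed K := by
    have : K = (⋂ u ∈ U, {d | 0 ≤ emb u ⬝ᵥ d}) ∩ {d | h ⬝ᵥ d = 1} := by
      ext d; simp [hK]
    rw [this]
    exact (isClosed_biInter fun u _ => isClosed_le continuous_const
      (continuous_dotProduct_right _)).inter
      (isClosed_eq (continuous_dotProduct_right _) continuous_const)
  have hKconv : Convex ℝ K := by
    intro x hx y hy a b ha hb hab
    refine ⟨fun u hu => ?_, ?_⟩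
    · rw [dotProduct_add, dotProduct_smul, dotProduct_smul]
      exact add_nonneg (mul_nonneg ha (hx.1 u hu)) (mul_nonneg hb (hy.1 u hu))
    · rw [dotProduct_add, dotProduct_smul, dotProduct_smul, hx.2, hy.2]
      simpa using hab
  -- The tight normals embed the space into a Euclidean one, and on K their values lie between 0 and
  -- 1.
  have hKcpt : IsCompact K := by
    refine Metric.isCompact_of_isClosed_isBounded hKclosed ?_
    let f : (Fin N → ℝ) →ₗ[ℝ] (U → ℝ) :=
      { toFun := fun d u => emb u ⬝ᵥ d
        map_add' := fun x y => by ext u; simp [dotProduct_add]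
        map_smul' := fun c x => by ext u; simp [dotProduct_smul] }
    have hker : LinearMap.ker f = ⊥ := by
      rw [LinearMap.ker_eq_bot']
      intro d hd
      refine eq_zero_of_vertex hv fun u hu => ?_
      exact congrFun hd ⟨u, (hUm u).2 hu⟩
    obtain ⟨C, -, hC⟩ := LinearMap.exists_antilipschitzWith f hker
    refine (hC.isBounded_preimage (s := Metric.closedBall 0 1) Metric.isBounded_closedBall).subset ?_
    intro d hd
    rw [Set.mem_preimage, mem_closedBall_zero_iff, pi_norm_le_iff_of_nonneg zero_le_one]
    rintro ⟨u, hu⟩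
    change |emb u ⬝ᵥ d| ≤ 1
    rw [abs_of_nonneg (hd.1 u hu), ← hd.2, hdot]
    exact Finset.single_le_sum (f := fun u => emb u ⬝ᵥ d) (fun u hu => hd.1 u hu) hu
  -- an extreme point of the slice spans an edge
  have hline : ∀ d ∈ K.extremePoints ℝ, ∀ x, (∀ u ∈ U, emb u ⬝ᵥ d = 0 → emb u ⬝ᵥ x = 0) →
      x = (h ⬝ᵥ x) • d := by
    intro d hd x hx
    have hdK : d ∈ K := extremePoints_subset hd
    have key : ∀ y, (∀ u ∈ U, emb u ⬝ᵥ d = 0 → emb u ⬝ᵥ y = 0) → h ⬝ᵥ y = 0 →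
        ∀ᶠ δ in 𝓝[>] (0 : ℝ), d + δ • y ∈ K := by
      intro y hy hy0
      have : ∀ᶠ δ in 𝓝[>] (0 : ℝ), ∀ u ∈ U, 0 ≤ emb u ⬝ᵥ (d + δ • y) := by
        refine (Filter.eventually_all_finset U).2 fun u hu => ?_
        by_cases h0 : emb u ⬝ᵥ d = 0
        · exact Filter.Eventually.of_forall fun δ => by
            rw [dotProduct_add, dotProduct_smul, h0, hy u hu h0]; simp
        · have hlt : 0 < emb u ⬝ᵥ d := lt_of_le_of_ne (hdK.1 u hu) (Ne.symm h0)
          have hc : Filter.Tendsto (fun δ : ℝ => emb u ⬝ᵥ (d + δ • y)) (𝓝[>] 0)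
              (𝓝 (emb u ⬝ᵥ d)) := by
            have : Continuous fun δ : ℝ => emb u ⬝ᵥ (d + δ • y) :=
              (continuous_dotProduct_right _).comp (by fun_prop)
            have := (this.tendsto 0).mono_left (nhdsWithin_le_nhds (s := Set.Ioi 0))
            simpa using this
          exact (hc.eventually (eventually_gt_nhds hlt)).mono fun δ h => h.le
      filter_upwards [this] with δ hδ
      exact ⟨hδ, by rw [dotProduct_add, dotProduct_smul, hy0, hdK.2]; simp⟩
    set y := x - (h ⬝ᵥ x) • d with hy
    have hy1 : ∀ u ∈ U, emb u ⬝ᵥ d = 0 → emb u ⬝ᵥ y = 0 := fun u hu h0 => by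
      rw [hy, dotProduct_sub, dotProduct_smul, h0, hx u hu h0]; simp
    have hy2 : h ⬝ᵥ y = 0 := by
      rw [hy, dotProduct_sub, dotProduct_smul, hdK.2]; simp
    obtain ⟨δ, ⟨h1, h2⟩, hδ⟩ := (((key y hy1 hy2).and (key (-y)
      (fun u hu h0 => by rw [dotProduct_neg, hy1 u hu h0, neg_zero])
      (by rw [dotProduct_neg, hy2, neg_zero]))).and self_mem_nhdsWithin).exists
    have h0 := eq_zero_of_extreme hd h1 (by rwa [smul_neg, ← sub_eq_add_neg] at h2)
    have := (smul_eq_zero.1 h0).resolve_left (ne_of_gt (Set.mem_Ioi.1 hδ))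
    exact sub_eq_zero.1 this
  let E : (Fin N → ℝ) → Set (Fin N → ℝ) := fun d =>
    {m ∈ D.Delta | ∀ u ∈ U, emb u ⬝ᵥ d = 0 → emb u ⬝ᵥ m = -1}
  have hvE : ∀ d, emb v ∈ E d := fun d => ⟨hvD, fun u hu _ => ((hUm u).1 hu).2 _ rfl⟩
  have hmov : ∀ d ∈ K, ∃ δ : ℝ, 0 < δ ∧ emb v + δ • d ∈ E d := by
    intro d hd
    obtain ⟨δ, h1, hδ⟩ := ((eventually_smul_mem hvD
      (fun u hu => hd.1 u ((hUm u).2 hu))).and self_mem_nhdsWithin).exists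
    exact ⟨δ, hδ, h1, fun u hu h0 => by
      rw [dotProduct_add, dotProduct_smul, h0, ((hUm u).1 hu).2 _ rfl]; simp⟩
  have hsub : ∀ d ∈ K.extremePoints ℝ, ∀ m ∈ E d, m - emb v = (h ⬝ᵥ (m - emb v)) • d := by
    intro d hd m hm
    refine hline d hd _ fun u hu h0 => ?_
    rw [dotProduct_sub, hm.2 u hu h0, ((hUm u).1 hu).2 _ rfl]; simp
  have hedge : ∀ d ∈ K.extremePoints ℝ, E d ∈ edgesAt D.Delta (emb v) := by
    intro d hd
    have hdK : d ∈ K := extremePoints_subset hd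
    have hd0 : d ≠ 0 := by
      rintro rfl; simpa using hdK.2
    obtain ⟨δ, hδ, hmem⟩ := hmov d hdK
    refine ⟨?_, ?_, hvE d⟩
    · have : E d = D.fc (E d) := by
        refine le_antisymm (subset_fc fun m hm => hm.1) fun m hm => ⟨hm.1, fun u hu h0 => ?_⟩
        exact hm.2 u ⟨((hUm u).1 hu).1, fun x hx => hx.2 u hu h0⟩
      rw [this]
      exact isFace_fc ⟨_, hvE d⟩ fun m hm => hm.1
    · have : vectorSpan ℝ (E d) = Submodule.span ℝ {d} := by
        apply le_antisymm
        · rw [vectorSpan_def, Submodule.span_le]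
          rintro _ ⟨x, hx, y, hy, rfl⟩
          rw [SetLike.mem_coe, Submodule.mem_span_singleton]
          refine ⟨h ⬝ᵥ (x - emb v) - h ⬝ᵥ (y - emb v), ?_⟩
          change _ = x - y
          rw [sub_smul, ← hsub d hd x hx, ← hsub d hd y hy]; abel
        · rw [Submodule.span_le, Set.singleton_subset_iff]
          have := vsub_mem_vectorSpan ℝ hmem (hvE d)
          rw [vsub_eq_sub, add_sub_cancel_left] at this
          have h2 := Submodule.smul_mem _ δ⁻¹ this
          rwa [smul_smul, inv_mul_cancel₀ hδ.ne', one_smul] at h2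
      rw [dim, this, finrank_span_singleton hd0]
  -- Different extreme points span different edges, so finiteness of the edges passes to the extreme
  -- points and the hull in Krein–Milman is already closed.
  have hinj : Set.InjOn E (K.extremePoints ℝ) := by
    intro d₁ h₁ d₂ h₂ heq
    obtain ⟨δ, hδ, hmem⟩ := hmov d₁ (extremePoints_subset h₁)
    have hmem2 := hmem
    rw [heq] at hmem2
    have := hsub d₂ h₂ _ hmem2
    rw [add_sub_cancel_left, dotProduct_smul, (extremePoints_subset h₁).2, smul_eq_mul,
      mul_one] at this
    exact smul_right_injective _ hδ.ne' this
  have hextfin : (K.extremePoints ℝ).Finite := by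
    refine Set.Finite.of_finite_image (hfin.subset ?_) hinj
    rintro _ ⟨d, hd, rfl⟩
    exact hedge d hd
  have hKM : K = convexHull ℝ (K.extremePoints ℝ) := by
    have := closure_convexHull_extremePoints hKcpt hKconv
    rw [(hextfin.isClosed_convexHull ℝ).closure_eq] at this
    exact this.symm
  set S := Submodule.span NNReal {x | ∃ e ∈ edgesAt D.Delta (emb v), emb v + x ∈ e} with hS
  have hSsmul : ∀ c : ℝ, 0 ≤ c → ∀ x ∈ S, c • x ∈ S := fun c hc x hx =>
    S.smul_mem (⟨c, hc⟩ : NNReal) hx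
  have hextS : K.extremePoints ℝ ⊆ S := by
    intro d hd
    obtain ⟨δ, hδ, hmem⟩ := hmov d (extremePoints_subset hd)
    have : δ • d ∈ S := Submodule.subset_span ⟨E d, hedge d hd, hmem⟩
    have h2 := hSsmul δ⁻¹ (inv_nonneg.2 hδ.le) _ this
    rwa [smul_smul, inv_mul_cancel₀ hδ.ne', one_smul] at h2
  have hKS : K ⊆ S := by
    rw [hKM]
    refine convexHull_min hextS ?_
    intro x hx y hy a b ha hb _
    exact S.add_mem (hSsmul a ha x hx) (hSsmul b hb y hy)
  intro d hd
  have hd' : ∀ u ∈ U, 0 ≤ emb u ⬝ᵥ d := fun u hu => hd u ((hUm u).1 hu)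
  have hnn : 0 ≤ h ⬝ᵥ d := by rw [hdot]; exact Finset.sum_nonneg hd'
  rcases hnn.eq_or_lt with h0 | hpos
  · rw [hdot] at h0
    have := (Finset.sum_eq_zero_iff_of_nonneg hd').1 h0.symm
    rw [eq_zero_of_vertex hv fun u hu => this u ((hUm u).2 hu)]
    exact Submodule.zero_mem _
  · have : (h ⬝ᵥ d)⁻¹ • d ∈ K := by
      refine ⟨fun u hu => ?_, ?_⟩
      · rw [dotProduct_smul]; exact mul_nonneg (inv_nonneg.2 hnn) (hd' u hu)
      · rw [dotProduct_smul, smul_eq_mul, inv_mul_cancel₀ hpos.ne']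
    have h2 := hSsmul _ hnn _ (hKS this)
    rwa [smul_smul, mul_inv_cancel₀ hpos.ne', one_smul] at h2

theorem neg_dotProduct_pos_of_le {h : Fin N → ℝ} {c : ℝ} (hle : ∀ m ∈ D.Delta, c ≤ h ⬝ᵥ m)
    {d : Fin N → ℝ} (hd : h ⬝ᵥ d < 0) : c < 0 := by
  obtain ⟨δ, h1, hδ⟩ := ((eventually_smul_mem_of_interior D.zero_mem_interior d).and
    self_mem_nhdsWithin).exists
  have := hle _ h1
  rw [zero_add, dotProduct_smul, smul_eq_mul] at this
  exact this.trans_lt (mul_neg_of_pos_of_neg hδ hd)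

/-- At a vertex, the primitive vectors of the edges form a basis of the lattice, and the dual basis
consists of the normals of the facets through the vertex. -/
theorem exists_vertex_basis {v : Fin N → ℤ} (hv : emb v ∈ D.Delta.extremePoints ℝ) :
    ∃ g : Module.Basis (Fin N) ℤ (Fin N → ℤ), (∀ i, emb (v + g i) ∈ D.Delta) ∧
      D.nrm {emb v} = Set.range (dualVec g) := by
  classical
  have hvD : emb v ∈ D.Delta := extremePoints_subset hv
  have hns := D.nonsingular v hv
  change (edgesAt D.Delta (emb v)).ncard = N ∧ AddSubgroup.closure
    {w : Fin N → ℤ | ∃ e ∈ edgesAt D.Delta (emb v), emb (v + w) ∈ e} = ⊤ at hns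
  choose! γ hγ hγ' using fun e (he : e ∈ edgesAt D.Delta (emb v)) => exists_edge_generator hv he
  obtain ⟨f, hf⟩ : ∃ f : Fin N → Set (Fin N → ℝ), Set.range f = edgesAt D.Delta (emb v) := by
    -- For N = 0 the cardinality condition does not give finiteness, but dimension excludes edges.
    rcases Nat.eq_zero_or_pos N with hN | hN
    · subst hN
      refine ⟨Fin.elim0, ?_⟩
      have hempty : ∀ e, e ∉ edgesAt D.Delta (emb v) := by
        rintro e ⟨-, h, -⟩
        have : Module.finrank ℝ (vectorSpan ℝ e) ≤ 0 := by
          have := Submodule.finrank_le (vectorSpan ℝ e)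
          simpa using this
        rw [dim] at h; omega
      rw [Set.eq_empty_of_forall_notMem hempty]
      exact Set.range_eq_empty _
    · have hfin : (edgesAt D.Delta (emb v)).Finite :=
        Set.finite_of_ncard_pos (hns.1.symm ▸ hN :)
      have : Fintype (edgesAt D.Delta (emb v)) := hfin.fintype
      have hcard : Fintype.card (edgesAt D.Delta (emb v)) = N := by
        rw [← Nat.card_eq_fintype_card]; exact hns.1
      let eqv := (Fintype.equivFinOfCardEq hcard).symm
      refine ⟨fun i => eqv i, ?_⟩
      rw [← Function.comp_def, Set.range_comp, eqv.surjective.range_eq, Set.image_univ,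
        Subtype.range_coe]
  have hfe : ∀ i, f i ∈ edgesAt D.Delta (emb v) := fun i => hf ▸ Set.mem_range_self i
  obtain ⟨g, hg⟩ := exists_basis_of_generators (fun i => γ (f i)) (by
    rw [eq_top_iff, ← AddSubgroup.toIntSubmodule.map_top, ← hns.2]
    intro w hw
    change w ∈ AddSubgroup.closure _ at hw
    have hle : AddSubgroup.closure {w : Fin N → ℤ | ∃ e ∈ edgesAt D.Delta (emb v),
        emb (v + w) ∈ e} ≤ (Submodule.span ℤ (Set.range fun i => γ (f i))).toAddSubgroup := by
      rw [AddSubgroup.closure_le]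
      rintro w ⟨e, he, hwe⟩
      obtain ⟨n, rfl⟩ := hγ' e he w hwe
      obtain ⟨i, rfl⟩ : e ∈ Set.range f := hf ▸ he
      exact Submodule.smul_mem _ n (Submodule.subset_span ⟨i, rfl⟩)
    exact hle hw)
  have hmem : ∀ i, emb (v + g i) ∈ f i := fun i => by
    rcases hγ _ (hfe i) with h | h
    · exact absurd ((hg i).trans h) (g.ne_zero i)
    · rw [hg i]; exact h
  have hmemD : ∀ i, emb (v + g i) ∈ D.Delta := fun i => (hfe i).1.2.subset (hmem i)
  -- the dual basis is nonnegative on the tangent cone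
  have hdual : ∀ d, (∀ u ∈ D.nrm {emb v}, 0 ≤ emb u ⬝ᵥ d) → ∀ i, 0 ≤ emb (dualVec g i) ⬝ᵥ d := by
    intro d hd i
    have := vertex_slice v hv d hd
    clear hd
    induction this using Submodule.span_induction with
    | mem x hx =>
      obtain ⟨e, he, hx⟩ := hx
      obtain ⟨j, rfl⟩ : e ∈ Set.range f := hf ▸ he
      -- both `x` and `g j` span the edge
      have h1 : emb (g j) ∈ vectorSpan ℝ (f j) := by
        have := vsub_mem_vectorSpan ℝ (hmem j) (hfe j).2.2
        rwa [emb_add, vsub_eq_sub, add_sub_cancel_left] at this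
      have h2 : x ∈ vectorSpan ℝ (f j) := by
        have := vsub_mem_vectorSpan ℝ hx (hfe j).2.2
        rwa [vsub_eq_sub, add_sub_cancel_left] at this
      have hne : emb (g j) ≠ 0 := fun h => g.ne_zero j (emb_injective (by rw [h, emb_zero]))
      obtain ⟨c, hc⟩ := (finrank_eq_one_iff_of_nonzero' (⟨emb (g j), h1⟩ : vectorSpan ℝ (f j))
        (by simpa using hne)).1 (hfe j).2.1 ⟨x, h2⟩
      have hc' : x = c • emb (g j) := (congrArg Subtype.val hc).symm
      have hc0 : 0 ≤ c := by
        by_contra hneg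
        have hneg := not_le.1 hneg
        have hall : ∀ u ∈ D.nrm {emb v}, emb u ⬝ᵥ emb (g j) = 0 := by
          intro u hu
          have h3 := normals_ge hu.1 (hmemD j)
          have h4 := normals_ge hu.1 ((hfe j).1.2.subset hx)
          rw [emb_add, dotProduct_add, hu.2 _ rfl] at h3
          rw [hc', dotProduct_add, hu.2 _ rfl, dotProduct_smul, smul_eq_mul] at h4
          nlinarith
        exact hne (eq_zero_of_vertex hv hall)
      rw [hc', dotProduct_smul, emb_dotProduct, dualVec_dotProduct_basis, smul_eq_mul]
      refine mul_nonneg hc0 ?_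
      split_ifs <;> simp
    | zero => simp
    | add x y _ _ hx hy => rw [dotProduct_add]; exact add_nonneg hx hy
    | smul c x _ hx =>
      rw [dotProduct_smul]
      exact mul_nonneg c.2 hx
  have hge : ∀ i, ∀ m ∈ D.Delta, emb (dualVec g i) ⬝ᵥ emb v ≤ emb (dualVec g i) ⬝ᵥ m := by
    intro i m hm
    have := hdual (m - emb v) (fun u hu => by
      rw [dotProduct_sub, hu.2 _ rfl]; linarith [normals_ge hu.1 hm]) i
    rw [dotProduct_sub] at this; linarith
  -- The dual vector is minimal on Δ at v, with negative minimum, so some normal b is tight wherever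
  -- it is minimal. In particular b vanishes on the other edge vectors and is an integral multiple
  -- of the dual vector; its value -1 at v forces the factor to be 1.
  have hmemnrm : ∀ i, dualVec g i ∈ D.nrm {emb v} := by
    intro i
    have hneg : emb (dualVec g i) ⬝ᵥ emb v < 0 :=
      neg_dotProduct_pos_of_le (hge i) (d := -emb (g i)) (by
        rw [dotProduct_neg, emb_dotProduct, dualVec_dotProduct_basis]; simp)
    obtain ⟨B, w, -, hw1, -, hBn, hBt⟩ := exists_normals_of_min (D := D)
      (h := emb (dualVec g i)) (γ := -(emb (dualVec g i) ⬝ᵥ emb v)) (by linarith)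
      (fun m hm => by rw [neg_neg]; exact hge i m hm) hvD (by rw [neg_neg])
    obtain ⟨b, hb⟩ : B.Nonempty := by
      rw [Finset.nonempty_iff_ne_empty]; rintro rfl; simp at hw1
    have hbv : emb b ⬝ᵥ emb v = -1 := hBt _ hvD (by rw [neg_neg]) b hb
    have hbg : ∀ j, j ≠ i → b ⬝ᵥ g j = 0 := by
      intro j hj
      have := hBt _ (hmemD j) (by
        rw [neg_neg, emb_add, dotProduct_add, emb_dotProduct _ (g j), dualVec_dotProduct_basis,
          if_neg hj.symm]; simp) b hb
      rw [emb_add, dotProduct_add, hbv, emb_dotProduct] at this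
      have : ((b ⬝ᵥ g j : ℤ) : ℝ) = 0 := by linarith
      exact_mod_cast this
    have hbe : b = (b ⬝ᵥ g i) • dualVec g i := by
      refine eq_of_dotProduct_basis g fun j => ?_
      rw [smul_dotProduct, dualVec_dotProduct_basis]
      by_cases h : i = j
      · subst h; simp
      · rw [hbg j (Ne.symm h), if_neg h]; simp
    have h1 : (b ⬝ᵥ g i) * (dualVec g i ⬝ᵥ v) = -1 := by
      have : b ⬝ᵥ v = -1 := by
        rw [emb_dotProduct] at hbv; exact_mod_cast hbv
      conv_lhs at this => rw [hbe]
      rwa [smul_dotProduct, smul_eq_mul] at this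
    have h2 : dualVec g i ⬝ᵥ v < 0 := by
      rw [emb_dotProduct] at hneg; exact_mod_cast hneg
    have h3 : b ⬝ᵥ g i = 1 := by
      have := Int.isUnit_iff.1 (IsUnit.of_mul_eq_one (-(dualVec g i ⬝ᵥ v)) (a := b ⬝ᵥ g i)
        (by linarith))
      rcases this with h | h
      · exact h
      · rw [h] at h1; linarith
    rw [h3, one_smul] at hbe
    rw [← hbe]
    exact ⟨hBn b hb, by simpa using hbv⟩
  refine ⟨g, hmemD, Set.Subset.antisymm ?_ (Set.range_subset_iff.2 hmemnrm)⟩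
  -- Conversely, the values of u on the edge vectors are nonnegative integers. Since v is minus the
  -- sum of the edge vectors and u·v = -1, they add up to 1, so exactly one of them is 1.
  intro u hu
  have hn : ∀ j, 0 ≤ u ⬝ᵥ g j := fun j => by
    have h3 := normals_ge hu.1 (hmemD j)
    rw [emb_add, dotProduct_add, hu.2 _ rfl, emb_dotProduct] at h3
    have : (0 : ℝ) ≤ ((u ⬝ᵥ g j : ℤ) : ℝ) := by linarith
    exact_mod_cast this
  have hrepr : ∀ i, g.repr v i = -1 := fun i => by
    rw [← dualVec_dotProduct]
    have := (hmemnrm i).2 _ rfl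
    rw [emb_dotProduct] at this
    exact_mod_cast this
  have hsum : ∑ j, u ⬝ᵥ g j = 1 := by
    have h1 : (u ⬝ᵥ v : ℤ) = -1 := by
      have := hu.2 _ rfl
      rw [emb_dotProduct] at this
      exact_mod_cast this
    have h2 : v = -∑ j, g j := by
      rw [← g.sum_repr v]; simp [hrepr]
    rw [h2, dotProduct_neg, dotProduct_sum] at h1
    linarith
  obtain ⟨i, hi⟩ : ∃ i, 1 ≤ u ⬝ᵥ g i := by
    by_contra hcon
    push Not at hcon
    have : ∑ j, u ⬝ᵥ g j = 0 := Finset.sum_eq_zero fun j _ => by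
      have := hn j; have := hcon j; omega
    omega
  refine ⟨i, (eq_of_dotProduct_basis g fun j => ?_).symm⟩
  rw [dualVec_dotProduct_basis]
  have h1 : u ⬝ᵥ g i + ∑ k ∈ Finset.univ.erase i, u ⬝ᵥ g k = 1 := by
    rw [Finset.add_sum_erase _ (fun k => u ⬝ᵥ g k) (Finset.mem_univ i), hsum]
  have h2 : 0 ≤ ∑ k ∈ Finset.univ.erase i, u ⬝ᵥ g k := Finset.sum_nonneg fun k _ => hn k
  by_cases h : i = j
  · subst h; rw [if_pos rfl]; omega
  · rw [if_neg h]
    have h3 : u ⬝ᵥ g j ≤ ∑ k ∈ Finset.univ.erase i, u ⬝ᵥ g k :=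
      Finset.single_le_sum (f := fun k => u ⬝ᵥ g k) (fun k _ => hn k)
        (Finset.mem_erase.2 ⟨Ne.symm h, Finset.mem_univ j⟩)
    have := hn j
    omega

end FamilyData

end TorusFib

namespace TorusFib

variable {N : ℕ}

/-! ### Faces -/

theorem dualVec_injective (b : Module.Basis (Fin N) ℤ (Fin N → ℤ)) :
    Function.Injective (dualVec b) := by
  intro i j h
  by_contra hne
  have h1 := dualVec_dotProduct_basis b i i
  rw [h, dualVec_dotProduct_basis, if_neg (Ne.symm hne)] at h1
  simp at h1

theorem exists_sub_smul_mem_of_intrinsicInterior {C : Set (Fin N → ℝ)} {s x : Fin N → ℝ}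
    (hs : s ∈ intrinsicInterior ℝ C) (hx : x ∈ C) : ∃ δ : ℝ, 0 < δ ∧ s - δ • (x - s) ∈ C := by
  obtain ⟨y, hy, rfl⟩ := mem_intrinsicInterior.1 hs
  have hx' : x ∈ affineSpan ℝ C := subset_affineSpan ℝ _ hx
  let f : ℝ → affineSpan ℝ C := fun δ => ⟨AffineMap.lineMap (y : Fin N → ℝ) x (-δ),
    AffineMap.lineMap_mem _ y.2 hx'⟩
  have hf : Continuous f := by
    refine Continuous.subtype_mk ?_ _
    simp only [AffineMap.lineMap_apply, vsub_eq_sub, vadd_eq_add]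
    fun_prop
  have hf0 : f 0 = y := by ext; simp [f]
  have h1 : ∀ᶠ δ in 𝓝[>] (0 : ℝ), (f δ : Fin N → ℝ) ∈ C := by
    have := hf.tendsto 0
    rw [hf0] at this
    exact (this.mono_left nhdsWithin_le_nhds) (mem_interior_iff_mem_nhds.1 hy)
  obtain ⟨δ, h2, h3⟩ := (h1.and self_mem_nhdsWithin).exists
  refine ⟨δ, h3, ?_⟩
  convert h2 using 1
  simp [f, AffineMap.lineMap_apply]
  abel

namespace FamilyData

variable {D : FamilyData N}

theorem exists_weights {m : Fin N → ℝ} (hm : m ∈ D.Delta) :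
    ∃ a : (Fin N → ℤ) → ℝ, (∀ w ∈ D.A, 0 ≤ a w) ∧ ∑ w ∈ D.A, a w = 1 ∧
      ∑ w ∈ D.A, a w • emb w = m := by
  classical
  have : m ∈ convexHull ℝ ((D.A.image emb : Finset (Fin N → ℝ)) : Set (Fin N → ℝ)) := by
    rw [Finset.coe_image]; exact hm
  obtain ⟨w, hw0, hw1, hw⟩ := (Finset.mem_convexHull').1 this
  rw [Finset.sum_image (fun a _ b _ h => emb_injective h)] at hw1 hw
  exact ⟨fun v => w (emb v), fun v hv => hw0 _ (Finset.mem_image_of_mem _ hv), hw1, hw⟩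

/-- A facet contains a convex combination with positive weights if and only if it contains all
points that are combined. -/
theorem dotProduct_eq_neg_one_iff {ι : Type*} {S : Finset ι} {x : ι → Fin N → ℝ} {a : ι → ℝ}
    (ha : ∀ i ∈ S, 0 < a i) (ha1 : ∑ i ∈ S, a i = 1) (hx : ∀ i ∈ S, x i ∈ D.Delta)
    {u : Fin N → ℤ} (hu : u ∈ D.normals) :
    emb u ⬝ᵥ (∑ i ∈ S, a i • x i) = -1 ↔ ∀ i ∈ S, emb u ⬝ᵥ x i = -1 := by
  have e : emb u ⬝ᵥ (∑ i ∈ S, a i • x i) + 1 = ∑ i ∈ S, a i * (emb u ⬝ᵥ x i + 1) := by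
    rw [dotProduct_sum]
    simp_rw [dotProduct_smul, smul_eq_mul, mul_add, mul_one, Finset.sum_add_distrib, ha1]
  have hnn : ∀ i ∈ S, 0 ≤ a i * (emb u ⬝ᵥ x i + 1) := fun i hi =>
    mul_nonneg (ha i hi).le (by linarith [normals_ge hu (hx i hi)])
  rw [← add_eq_zero_iff_eq_neg, e, Finset.sum_eq_zero_iff_of_nonneg hnn]
  refine forall₂_congr fun i hi => ?_
  rw [mul_eq_zero, or_iff_right (ha i hi).ne', add_eq_zero_iff_eq_neg]

theorem nrm_sum {ι : Type*} {S : Finset ι} {x : ι → Fin N → ℝ} {a : ι → ℝ}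
    (ha : ∀ i ∈ S, 0 < a i) (ha1 : ∑ i ∈ S, a i = 1) (hx : ∀ i ∈ S, x i ∈ D.Delta) :
    D.nrm {∑ i ∈ S, a i • x i} = D.nrm (x '' S) := by
  ext u
  refine and_congr_right fun hu => ?_
  simp only [Set.mem_singleton_iff, forall_eq]
  rw [dotProduct_eq_neg_one_iff ha ha1 hx hu]
  simp

theorem mem_interior_iff {s : Fin N → ℝ} : s ∈ interior D.Delta ↔ s ∈ D.Delta ∧ D.nrm {s} = ∅ := by
  constructor
  · intro hs
    refine ⟨interior_subset hs, Set.eq_empty_of_forall_notMem fun u hu => ?_⟩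
    obtain ⟨δ, h1, hδ⟩ := ((eventually_smul_mem_of_interior hs s).and self_mem_nhdsWithin).exists
    have h2 := normals_ge hu.1 h1
    rw [dotProduct_add, dotProduct_smul, hu.2 s rfl, smul_eq_mul] at h2
    have : (0 : ℝ) < δ := hδ
    linarith
  · rintro ⟨hs, hempty⟩
    rw [mem_interior]
    refine ⟨⋂ u ∈ D.normals, {m | -1 < emb u ⬝ᵥ m}, ?_, ?_, ?_⟩
    · intro m hm
      rw [mem_Delta_iff]
      intro u hu
      exact (Set.mem_iInter₂.1 hm u hu).le
    · exact finite_normals.isOpen_biInter fun u _ =>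
        isOpen_lt continuous_const (continuous_dotProduct_right _)
    · refine Set.mem_iInter₂.2 fun u hu => lt_of_le_of_ne (normals_ge hu hs) fun h => ?_
      have : u ∈ D.nrm {s} := ⟨hu, by simpa using h.symm⟩
      rw [hempty] at this; exact this

theorem mem_frontier_iff {s : Fin N → ℝ} :
    s ∈ frontier D.Delta ↔ s ∈ D.Delta ∧ (D.nrm {s}).Nonempty := by
  rw [frontier, D.isCompact_Delta.isClosed.closure_eq, Set.mem_sdiff, mem_interior_iff,
    Set.nonempty_iff_ne_empty]
  tauto

theorem frontier_subset : frontier D.Delta ⊆ D.Delta := fun _ h => (mem_frontier_iff.1 h).1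

theorem exists_vertex {X : Set (Fin N → ℝ)} (hX : X.Nonempty) (hXD : X ⊆ D.Delta) :
    ∃ v ∈ D.A, emb v ∈ D.Delta.extremePoints ℝ ∧ emb v ∈ D.fc X := by
  have hF := isFace_fc hX hXD
  obtain ⟨x, hx⟩ := (hF.2.isCompact D.isCompact_Delta).extremePoints_nonempty hF.1
  have hx' : x ∈ D.Delta.extremePoints ℝ := hF.2.isExtreme.extremePoints_subset_extremePoints hx
  obtain ⟨v, hv, rfl⟩ := extremePoints_convexHull_subset hx'
  exact ⟨v, hv, hx', extremePoints_subset hx⟩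

/-- At a vertex of the face the edge basis splits: a dual vector either is a normal of the face, or
its edge vector stays in the face. Dimension counts and tangent spaces of faces are read off from
this splitting. -/
theorem exists_face_basis {X : Set (Fin N → ℝ)} (hX : X.Nonempty) (hXD : X ⊆ D.Delta) :
    ∃ v ∈ D.A, ∃ g : Module.Basis (Fin N) ℤ (Fin N → ℤ), emb v ∈ D.fc X ∧
      (∀ i, emb (v + g i) ∈ D.Delta) ∧ D.nrm {emb v} = Set.range (dualVec g) ∧
      D.nrm X ⊆ Set.range (dualVec g) ∧ ∀ i, dualVec g i ∉ D.nrm X → emb (v + g i) ∈ D.fc X := by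
  obtain ⟨v, hvA, hv, hvX⟩ := exists_vertex hX hXD
  obtain ⟨g, hg, hr⟩ := exists_vertex_basis hv
  have hsub : D.nrm X ⊆ Set.range (dualVec g) := by
    rw [← hr]
    exact fun u hu => ⟨hu.1, by simpa using hvX.2 u hu⟩
  refine ⟨v, hvA, g, hvX, hg, hr, hsub, fun i hi => ⟨hg i, fun u hu => ?_⟩⟩
  obtain ⟨j, rfl⟩ := hsub hu
  rw [emb_add, dotProduct_add, hvX.2 _ hu, emb_dotProduct, dualVec_dotProduct_basis, if_neg]
  · simp
  · rintro rfl; exact hi hu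

theorem mem_vectorSpan_fc_iff {X : Set (Fin N → ℝ)} (hX : X.Nonempty) (hXD : X ⊆ D.Delta)
    {d : Fin N → ℝ} : d ∈ vectorSpan ℝ (D.fc X) ↔ ∀ u ∈ D.nrm X, emb u ⬝ᵥ d = 0 := by
  constructor
  · intro hd u hu
    rw [vectorSpan_def] at hd
    induction hd using Submodule.span_induction with
    | mem x hx =>
      obtain ⟨y, hy, z, hz, rfl⟩ := hx
      change emb u ⬝ᵥ (y - z) = 0
      rw [dotProduct_sub, hy.2 u hu, hz.2 u hu, sub_self]
    | zero => simp
    | add x y _ _ hx hy => rw [dotProduct_add, hx, hy, add_zero]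
    | smul c x _ hx => rw [dotProduct_smul, hx, smul_zero]
  · intro hd
    obtain ⟨v, -, g, hv, -, -, -, hg⟩ := exists_face_basis hX hXD
    rw [← sum_emb_dualVec g d]
    refine Submodule.sum_mem _ fun i _ => ?_
    by_cases hi : dualVec g i ∈ D.nrm X
    · rw [hd _ hi, zero_smul]; exact Submodule.zero_mem _
    · have := vsub_mem_vectorSpan ℝ (hg i hi) hv
      rw [emb_add, vsub_eq_sub, add_sub_cancel_left] at this
      exact Submodule.smul_mem _ _ this

/-- The normals of the facets through a face are part of a dual basis, hence independent, so their
number is the codimension. -/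
theorem dim_fc_add {X : Set (Fin N → ℝ)} (hX : X.Nonempty) (hXD : X ⊆ D.Delta) :
    dim (D.fc X) + (D.nrm X).ncard = N := by
  classical
  obtain ⟨v, -, g, -, -, -, hsub, -⟩ := exists_face_basis hX hXD
  have h := finrank_ker_dualVec g (vectorSpan ℝ (D.fc X))
    (Finset.univ.filter fun i => dualVec g i ∈ D.nrm X) (fun d => by
      rw [mem_vectorSpan_fc_iff hX hXD]
      constructor
      · intro h i hi; exact h _ (Finset.mem_filter.1 hi).2
      · intro h u hu
        obtain ⟨i, rfl⟩ := hsub hu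
        exact h i (by simpa using hu))
  have hc : (Finset.univ.filter fun i => dualVec g i ∈ D.nrm X).card = (D.nrm X).ncard := by
    have : D.nrm X = dualVec g '' ((Finset.univ.filter fun i => dualVec g i ∈ D.nrm X :
        Finset (Fin N)) : Set (Fin N)) := by
      ext u
      constructor
      · intro hu
        obtain ⟨i, rfl⟩ := hsub hu
        exact ⟨i, by simpa using hu, rfl⟩
      · rintro ⟨i, hi, rfl⟩
        simpa using hi
    conv_rhs => rw [this]
    rw [Set.ncard_image_of_injective _ (dualVec_injective g), Set.ncard_coe_finset]
  rw [hc] at h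
  exact h

/-- If a second normal were tight on the face of u, the two would be different dual vectors at a
vertex of this face. The edge step dual to the second stays in the face of u but leaves the second
hyperplane. -/
theorem isFacetNormal_of_mem {u : Fin N → ℤ} (hu : u ∈ D.normals) : IsFacetNormal D.Delta u := by
  have hne : (facetOf D.Delta u).Nonempty := hu.2
  have hsub : facetOf D.Delta u ⊆ D.Delta := fun m hm => hm.1
  have humem : u ∈ D.nrm (facetOf D.Delta u) := ⟨hu, fun x hx => hx.2⟩
  obtain ⟨v, -, g, hv, hg, hr, hs, -⟩ := exists_face_basis hne hsub
  have heq : D.nrm (facetOf D.Delta u) = {u} := by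
    refine Set.Subset.antisymm (fun u' hu' => ?_) (Set.singleton_subset_iff.2 humem)
    obtain ⟨i, rfl⟩ := hs humem
    obtain ⟨j, rfl⟩ := hs hu'
    by_contra hne
    have hij : i ≠ j := fun h => hne (by rw [h]; rfl)
    have h1 : emb (v + g j) ∈ facetOf D.Delta (dualVec g i) := by
      refine ⟨hg j, ?_⟩
      change emb (dualVec g i) ⬝ᵥ emb (v + g j) = -1
      rw [emb_add, dotProduct_add, hv.2 _ humem, emb_dotProduct, dualVec_dotProduct_basis,
        if_neg hij]
      simp
    have h2 := hu'.2 _ h1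
    rw [emb_add, dotProduct_add, hv.2 _ hu', emb_dotProduct, dualVec_dotProduct_basis,
      if_pos rfl] at h2
    norm_num at h2
  have hfc : D.fc (facetOf D.Delta u) = facetOf D.Delta u :=
    Set.Subset.antisymm (fun m hm => ⟨hm.1, hm.2 u humem⟩) (subset_fc hsub)
  refine ⟨hu.1, hne, ?_⟩
  have := dim_fc_add hne hsub
  rwa [hfc, heq, Set.ncard_singleton] at this

theorem mem_normals_of_isFacetNormal {u : Fin N → ℤ} (hu : IsFacetNormal D.Delta u) :
    u ∈ D.normals := ⟨hu.1, hu.2.1⟩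

/-- From a relatively interior point one can step a little away from any x in X, and a normal tight
at the point but not at x would then be violated. Conversely, the remaining normals are strict near
a point whose tight normals are just those of the face. So relative interiors of faces are recorded
by `D.nrm`. -/
theorem mem_intrinsicInterior_fc_iff {X : Set (Fin N → ℝ)} (hX : X.Nonempty)
    (hXD : X ⊆ D.Delta) {s : Fin N → ℝ} :
    s ∈ intrinsicInterior ℝ (D.fc X) ↔ s ∈ D.Delta ∧ D.nrm {s} = D.nrm X := by
  constructor
  · intro hs
    have hsX : s ∈ D.fc X := intrinsicInterior_subset hs
    refine ⟨hsX.1, Set.Subset.antisymm (fun u hu => ⟨hu.1, fun x hx => ?_⟩)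
      fun u hu => ⟨hu.1, by simpa using hsX.2 u hu⟩⟩
    obtain ⟨δ, hδ, hmem⟩ := exists_sub_smul_mem_of_intrinsicInterior hs (subset_fc hXD hx)
    have h1 := normals_ge hu.1 hmem.1
    have h2 := normals_ge hu.1 (hXD hx)
    rw [dotProduct_sub, dotProduct_smul, dotProduct_sub, hu.2 s rfl, smul_eq_mul] at h1
    nlinarith
  · rintro ⟨hsD, hs⟩
    have hsX : s ∈ D.fc X := ⟨hsD, fun u hu => (hs ▸ hu : u ∈ D.nrm {s}).2 s rfl⟩
    rw [mem_intrinsicInterior]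
    refine ⟨⟨s, subset_affineSpan ℝ _ hsX⟩, ?_, rfl⟩
    rw [mem_interior]
    refine ⟨(↑) ⁻¹' (⋂ u ∈ D.normals \ D.nrm X, {m | -1 < emb u ⬝ᵥ m}), ?_, ?_, ?_⟩
    · rintro ⟨m, hm⟩ hmem
      have heq : ∀ u ∈ D.nrm X, emb u ⬝ᵥ m = -1 := by
        intro u hu
        have h1 := AffineSubspace.vsub_mem_direction hm (subset_affineSpan ℝ _ hsX)
        rw [direction_affineSpan, mem_vectorSpan_fc_iff hX hXD] at h1
        have := h1 u hu
        rw [vsub_eq_sub, dotProduct_sub, hsX.2 u hu] at this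
        linarith
      refine ⟨mem_Delta_iff.2 fun u hu => ?_, heq⟩
      by_cases h : u ∈ D.nrm X
      · exact (heq u h).ge
      · exact (Set.mem_iInter₂.1 hmem u ⟨hu, h⟩).le
    · exact ((finite_normals.subset Set.sdiff_subset).isOpen_biInter fun u _ =>
        isOpen_lt continuous_const (continuous_dotProduct_right _)).preimage continuous_subtype_val
    · refine Set.mem_iInter₂.2 fun u hu => lt_of_le_of_ne (normals_ge hu.1 hsD) fun h => hu.2 ?_
      rw [← hs]
      exact ⟨hu.1, by simpa using h.symm⟩

theorem fc_congr {X Y : Set (Fin N → ℝ)} (h : D.nrm X = D.nrm Y) : D.fc X = D.fc Y := by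
  rw [fc, fc, h]

/-- The points of `A` in the face spanned by `X`. -/
noncomputable def faceA (D : FamilyData N) (X : Set (Fin N → ℝ)) : Finset (Fin N → ℤ) :=
  open Classical in D.A.filter fun w => emb w ∈ D.fc X

theorem mem_faceA {X : Set (Fin N → ℝ)} {w : Fin N → ℤ} :
    w ∈ D.faceA X ↔ w ∈ D.A ∧ emb w ∈ D.fc X := by
  classical
  rw [faceA, Finset.mem_filter]

theorem faceA_subset {X : Set (Fin N → ℝ)} : D.faceA X ⊆ D.A := fun _ h => (mem_faceA.1 h).1

/-- A point of A outside the face has weight zero in any convex representation, since a normal tight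
on a combination is tight on every point of positive weight. -/
theorem exists_weights_faceA {X : Set (Fin N → ℝ)} {m : Fin N → ℝ} (hm : m ∈ D.fc X) :
    ∃ a : (Fin N → ℤ) → ℝ, (∀ w ∈ D.faceA X, 0 ≤ a w) ∧ ∑ w ∈ D.faceA X, a w = 1 ∧
      ∑ w ∈ D.faceA X, a w • emb w = m := by
  classical
  obtain ⟨a, ha0, ha1, ham⟩ := exists_weights hm.1
  have hz : ∀ w ∈ D.A, w ∉ D.faceA X → a w = 0 := by
    intro w hw hwX
    by_contra hne
    have hpos : 0 < a w := lt_of_le_of_ne (ha0 w hw) (Ne.symm hne)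
    refine hwX (mem_faceA.2 ⟨hw, D.emb_mem_Delta hw, fun u hu => ?_⟩)
    have h1 := hm.2 u hu
    rw [← ham, ← Finset.sum_filter_of_ne (p := fun w => a w ≠ 0)
      (fun w _ h h0 => h (by rw [h0, zero_smul]))] at h1
    rw [dotProduct_eq_neg_one_iff (fun i hi => ?_) ?_ (fun i hi => ?_) hu.1] at h1
    · exact h1 w (Finset.mem_filter.2 ⟨hw, hne⟩)
    · rw [Finset.sum_filter_ne_zero, ha1]
    · rw [Finset.mem_filter] at hi
      exact lt_of_le_of_ne (ha0 i hi.1) (Ne.symm hi.2)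
    · exact D.emb_mem_Delta (Finset.mem_filter.1 hi).1
  refine ⟨a, fun w hw => ha0 w (faceA_subset hw), ?_, ?_⟩
  · rw [Finset.sum_subset faceA_subset hz, ha1]
  · rw [Finset.sum_subset faceA_subset fun w hw hwX => by rw [hz w hw hwX, zero_smul], ham]

theorem faceA_nonempty {X : Set (Fin N → ℝ)} (hX : X.Nonempty) (hXD : X ⊆ D.Delta) :
    (D.faceA X).Nonempty := by
  obtain ⟨v, hvA, -, hvX⟩ := exists_vertex hX hXD
  exact ⟨v, mem_faceA.2 ⟨hvA, hvX⟩⟩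

/-! ### The simplices of the boundary -/

theorem mem_bdry {τ : Finset (Fin N → ℝ)} : τ ∈ D.bdry ↔
    (∀ x ∈ τ, ∃ w ∈ D.A, emb w = x) ∧ τ ∈ D.T.faces ∧
      convexHull ℝ (τ : Set (Fin N → ℝ)) ⊆ frontier D.Delta := by
  classical
  rw [bdry, Finset.mem_filter, Finset.mem_powerset]
  refine and_congr_left' ⟨fun h x hx => ?_, fun h x hx => ?_⟩
  · exact Finset.mem_image.1 (h hx)
  · exact Finset.mem_image.2 (h x hx)

theorem bdry_nonempty {τ : Finset (Fin N → ℝ)} (hτ : τ ∈ D.bdry) :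
    (τ : Set (Fin N → ℝ)).Nonempty := D.T.nonempty_of_mem_faces (mem_bdry.1 hτ).2.1

theorem bdry_subset {τ : Finset (Fin N → ℝ)} (hτ : τ ∈ D.bdry) :
    (τ : Set (Fin N → ℝ)) ⊆ D.Delta :=
  (subset_convexHull ℝ _).trans ((mem_bdry.1 hτ).2.2.trans frontier_subset)

theorem Theta_eq {τ : Finset (Fin N → ℝ)} (hτ : τ ∈ D.bdry) : D.Theta τ = D.fc τ :=
  minFace_eq_fc (bdry_nonempty hτ) (bdry_subset hτ)

theorem nrm_bdry_nonempty {τ : Finset (Fin N → ℝ)} (hτ : τ ∈ D.bdry) :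
    (D.nrm (τ : Set (Fin N → ℝ))).Nonempty := by
  have hc : (0 : ℝ) < τ.card := by
    exact_mod_cast Finset.card_pos.2 (by simpa using bdry_nonempty hτ)
  have ha1 : ∑ _x ∈ τ, (τ.card : ℝ)⁻¹ = 1 := by
    rw [Finset.sum_const, nsmul_eq_mul, mul_inv_cancel₀ hc.ne']
  have hmem : ∑ x ∈ τ, (τ.card : ℝ)⁻¹ • x ∈ convexHull ℝ (τ : Set (Fin N → ℝ)) :=
    (convex_convexHull ℝ _).sum_mem (fun _ _ => by positivity) ha1
      fun x hx => subset_convexHull ℝ _ hx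
  have h1 := (mem_frontier_iff.1 ((mem_bdry.1 hτ).2.2 hmem)).2
  rwa [nrm_sum (x := fun x => x) (fun _ _ => by positivity) ha1 (fun x hx => bdry_subset hτ hx),
    Set.image_id'] at h1

end FamilyData

end TorusFib

namespace TorusFib

variable {N : ℕ}

/-! ### Existence of associated coordinates -/

/-- The lattice vectors in a real subspace. -/
def latticePart (W : Submodule ℝ (Fin N → ℝ)) : Submodule ℤ (Fin N → ℤ) where
  carrier := {v | emb v ∈ W}
  zero_mem' := by simp
  add_mem' := by
    intro v w hv hw
    change emb (v + w) ∈ W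
    rw [emb_add]; exact W.add_mem hv hw
  smul_mem' := by
    intro n v hv
    change emb (n • v) ∈ W
    rw [emb_smul]; exact W.smul_mem _ hv

theorem mem_latticePart {W : Submodule ℝ (Fin N → ℝ)} {v : Fin N → ℤ} :
    v ∈ latticePart W ↔ emb v ∈ W := Iff.rfl

/-- Sublattices cut out by real subspaces are saturated: the quotient is torsion-free, hence free,
and a basis of the smaller lattice extends. -/
theorem exists_basis_latticePart {W₁ W₂ : Submodule ℝ (Fin N → ℝ)} (h : W₁ ≤ W₂) :
    ∃ (n₁ n₂ : ℕ) (b : Module.Basis (Fin n₁ ⊕ Fin n₂) ℤ (latticePart W₂)),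
      Submodule.span ℤ (Set.range fun i => (b (Sum.inl i) : Fin N → ℤ)) = latticePart W₁ := by
  set S := (latticePart W₁).comap (latticePart W₂).subtype with hS
  have htf : Module.IsTorsionFree ℤ (latticePart W₂ ⧸ S) := by
    refine Module.IsTorsionFree.of_smul_eq_zero fun n q hn => ?_
    obtain ⟨x, rfl⟩ := Submodule.Quotient.mk_surjective S q
    rw [← Submodule.Quotient.mk_smul, Submodule.Quotient.mk_eq_zero] at hn
    rw [Submodule.Quotient.mk_eq_zero]
    by_cases h0 : n = 0
    · exact Or.inl h0
    right
    have h1 : emb (n • (x : Fin N → ℤ)) ∈ W₁ := hn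
    rw [emb_smul] at h1
    have h2 := W₁.smul_mem (n : ℝ)⁻¹ h1
    rwa [smul_smul, inv_mul_cancel₀ (by exact_mod_cast h0), one_smul] at h2
  have hfree : Module.Free ℤ (latticePart W₂ ⧸ S) := inferInstance
  let b₁ := Module.finBasis ℤ S
  let b₂ := Module.finBasis ℤ (latticePart W₂ ⧸ S)
  refine ⟨_, _, b₁.sumQuot b₂, ?_⟩
  have h1 : (fun i => ((b₁.sumQuot b₂) (Sum.inl i) : Fin N → ℤ)) =
      (latticePart W₂).subtype ∘ S.subtype ∘ b₁ := by
    funext i; simp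
  rw [h1, Set.range_comp, Set.range_comp, ← Submodule.map_span, ← Submodule.map_span, b₁.span_eq,
    Submodule.map_top, Submodule.range_subtype, hS, Submodule.map_comap_subtype]
  exact inf_eq_right.2 fun v hv => h hv

namespace FamilyData

variable {D : FamilyData N}

/-- A basis of the lattice parallel to τ is extended to that of Θ_τ and completed by vectors dual to
the normals through Θ_τ. Edge vectors at a vertex of Θ_τ have the right duality, and one correction
arranges their sum. -/
theorem exists_tauCoords {τ : Finset (Fin N → ℝ)} (hτ : τ ∈ D.bdry) : Nonempty (TauCoords D τ) := by
  classical
  have hne := bdry_nonempty hτ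
  have hsubD := bdry_subset hτ
  obtain ⟨v, -, g, -, -, -, hsub, -⟩ := exists_face_basis hne hsubD
  set I : Finset (Fin N) := Finset.univ.filter fun i => dualVec g i ∈ D.nrm τ with hI
  have hIm : ∀ i, i ∈ I ↔ dualVec g i ∈ D.nrm τ := fun i => by simp [hI]
  have hnrmI : D.nrm (τ : Set (Fin N → ℝ)) = dualVec g '' (I : Set (Fin N)) := by
    ext u
    constructor
    · intro hu
      obtain ⟨i, rfl⟩ := hsub hu
      exact ⟨i, (hIm i).2 hu, rfl⟩
    · rintro ⟨i, hi, rfl⟩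
      exact (hIm i).1 hi
  have hIcard : (D.nrm (τ : Set (Fin N → ℝ))).ncard = I.card := by
    rw [hnrmI, Set.ncard_image_of_injective _ (dualVec_injective g), Set.ncard_coe_finset]
  have hdim : dim (D.Theta τ) + I.card = N := by
    rw [Theta_eq hτ, ← hIcard]; exact dim_fc_add hne hsubD
  obtain ⟨i₀, hi₀⟩ : I.Nonempty := by
    obtain ⟨u, hu⟩ := nrm_bdry_nonempty hτ
    obtain ⟨i, rfl⟩ := hsub hu
    exact ⟨i, (hIm i).2 hu⟩
  obtain ⟨x, hx⟩ := hne
  obtain ⟨Om, -, rfl⟩ := (mem_bdry.1 hτ).1 x hx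
  have hOm : ∀ i ∈ I, dualVec g i ⬝ᵥ Om = -1 := fun i hi => by
    have := ((hIm i).1 hi).2 _ hx
    rw [emb_dotProduct] at this
    exact_mod_cast this
  -- The vector Ω + ∑ g_j is annihilated by all normals through τ, so subtracting it from a single
  -- g_{i₀} keeps the duality and makes the sum equal to -Ω.
  let e : Fin N → Fin N → ℤ := fun i => g i - if i = i₀ then Om + ∑ j ∈ I, g j else 0
  have hsum : ∀ i ∈ I, dualVec g i ⬝ᵥ (Om + ∑ j ∈ I, g j) = 0 := fun i hi => by
    rw [dotProduct_add, hOm i hi, dotProduct_sum]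
    simp_rw [dualVec_dotProduct_basis]
    simp [hi]
  have he : ∀ i ∈ I, ∀ j ∈ I, dualVec g i ⬝ᵥ e j = if i = j then 1 else 0 := by
    intro i hi j hj
    simp only [e, dotProduct_sub, dualVec_dotProduct_basis]
    split_ifs <;> simp [hsum i hi]
  have hesum : ∑ i ∈ I, e i = -Om := by
    simp only [e, Finset.sum_sub_distrib, Finset.sum_ite_eq', hi₀, if_true]
    abel
  have hW : vectorSpan ℝ (τ : Set (Fin N → ℝ)) ≤ vectorSpan ℝ (D.Theta τ) := by
    rw [Theta_eq hτ]; exact vectorSpan_mono ℝ (subset_fc hsubD)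
  have hmem2 : ∀ d, d ∈ vectorSpan ℝ (D.Theta τ) ↔ ∀ i ∈ I, emb (dualVec g i) ⬝ᵥ d = 0 := by
    intro d
    rw [Theta_eq hτ, mem_vectorSpan_fc_iff ⟨_, hx⟩ hsubD, hnrmI]
    simp
  have hlat2 : ∀ w, w ∈ latticePart (vectorSpan ℝ (D.Theta τ)) ↔
      ∀ i ∈ I, dualVec g i ⬝ᵥ w = 0 := by
    intro w
    rw [mem_latticePart, hmem2]
    simp_rw [emb_dotProduct]
    exact_mod_cast Iff.rfl
  obtain ⟨n₁, n₂, b, hb⟩ := exists_basis_latticePart hW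
  -- the basis of the full lattice
  let β : (Fin n₁ ⊕ Fin n₂) ⊕ I → Fin N → ℤ := Sum.elim (fun i => b i) fun i => e i
  have hβ0 : ∀ i ∈ I, ∀ j, dualVec g i ⬝ᵥ (b j : Fin N → ℤ) = 0 := fun i hi j =>
    (hlat2 _).1 (b j).2 i hi
  have hli : LinearIndependent ℤ β := by
    rw [Fintype.linearIndependent_iff]
    intro c hc
    rw [Fintype.sum_sum_type] at hc
    have h2 : ∀ i : I, c (Sum.inr i) = 0 := by
      intro i
      have := congrArg (fun w => dualVec g i ⬝ᵥ w) hc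
      simp only [dotProduct_add, dotProduct_sum, dotProduct_smul, β, Sum.elim_inl, Sum.elim_inr,
        hβ0 i i.2, smul_zero, Finset.sum_const_zero, zero_add, dotProduct_zero] at this
      rw [Finset.sum_eq_single i] at this
      · rw [he i i.2 i i.2] at this; simpa using this
      · intro j _ hj
        rw [he i i.2 j j.2, if_neg (fun h => hj (Subtype.ext h.symm)), smul_zero]
      · simp
    have h1 : ∀ i, c (Sum.inl i) = 0 := by
      have : ∑ i, c (Sum.inl i) • b i = 0 := by
        ext1
        simp only [β, Sum.elim_inl, h2, zero_smul, Finset.sum_const_zero, add_zero] at hc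
        simpa using hc
      exact Fintype.linearIndependent_iff.1 b.linearIndependent _ this
    rintro (i | i)
    · exact h1 i
    · exact h2 i
  have hbspan : Submodule.span ℤ (Set.range fun i => (b i : Fin N → ℤ)) =
      latticePart (vectorSpan ℝ (D.Theta τ)) := by
    have : (fun i => (b i : Fin N → ℤ)) = (latticePart _).subtype ∘ b := rfl
    rw [this, Set.range_comp, ← Submodule.map_span, b.span_eq, Submodule.map_top,
      Submodule.range_subtype]
  have hspan : ⊤ ≤ Submodule.span ℤ (Set.range β) := by
    intro m _
    have h1 : m - ∑ i ∈ I, (dualVec g i ⬝ᵥ m) • e i ∈ Submodule.span ℤ (Set.range β) := by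
      have : m - ∑ i ∈ I, (dualVec g i ⬝ᵥ m) • e i ∈
          latticePart (vectorSpan ℝ (D.Theta τ)) := by
        rw [hlat2]
        intro i hi
        rw [dotProduct_sub, dotProduct_sum, Finset.sum_congr rfl fun j hj => by
          rw [dotProduct_smul, he i hi j hj]]
        simp [hi]
      rw [← hbspan] at this
      refine Submodule.span_mono ?_ this
      rintro _ ⟨i, rfl⟩
      exact ⟨Sum.inl i, rfl⟩
    have h2 : ∑ i ∈ I, (dualVec g i ⬝ᵥ m) • e i ∈ Submodule.span ℤ (Set.range β) :=
      Submodule.sum_mem _ fun i hi => Submodule.smul_mem _ _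
        (Submodule.subset_span ⟨Sum.inr ⟨i, hi⟩, rfl⟩)
    simpa using Submodule.add_mem _ h1 h2
  let B := Module.Basis.mk hli hspan
  have hB : ∀ i, B i = β i := fun i => Module.Basis.mk_apply hli hspan i
  have hcard : n₁ + n₂ + I.card = N := by
    have := Module.finrank_eq_card_basis B
    simpa using this.symm
  have hl : dim (D.Theta τ) = n₁ + n₂ := by omega
  let ε : (Fin n₁ ⊕ Fin n₂) ⊕ I ≃ Fin N :=
    ((Equiv.sumCongr finSumFinEquiv I.equivFin).trans finSumFinEquiv).trans (finCongr hcard)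
  have hε1 : ∀ i, ((ε (Sum.inl (Sum.inl i)) : Fin N) : ℕ) = i := fun i => by simp [ε]
  have hε2 : ∀ i, ((ε (Sum.inl (Sum.inr i)) : Fin N) : ℕ) = n₁ + i := fun i => by simp [ε]
  have hε3 : ∀ i, ((ε (Sum.inr i) : Fin N) : ℕ) = n₁ + n₂ + I.equivFin i := fun i => by simp [ε]
  let b' := B.reindex ε
  have hb' : ∀ x, b' (ε x) = β x := fun x => by
    simp only [b', Module.Basis.reindex_apply, Equiv.symm_apply_apply, hB]
  -- τ is affinely independent, so its direction space has one dimension less than it has vertices.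
  have hn₁ : n₁ + 1 = τ.card := by
    have hli' : LinearIndependent ℝ fun i : Fin n₁ => emb (b' (ε (Sum.inl (Sum.inl i)))) :=
      (linearIndependent_emb_basis b').comp (fun i => ε (Sum.inl (Sum.inl i)))
        (ε.injective.comp (Sum.inl_injective.comp Sum.inl_injective))
    have hspan' : Submodule.span ℝ (Set.range fun i : Fin n₁ =>
        emb (b' (ε (Sum.inl (Sum.inl i))))) = vectorSpan ℝ (τ : Set (Fin N → ℝ)) := by
      apply le_antisymm
      · rw [Submodule.span_le]
        rintro _ ⟨i, rfl⟩
        have : (b (Sum.inl i) : Fin N → ℤ) ∈ latticePart (vectorSpan ℝ (τ : Set (Fin N → ℝ))) := by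
          rw [← hb]; exact Submodule.subset_span ⟨i, rfl⟩
        simp only [hb']
        exact this
      · rw [vectorSpan_def, Submodule.span_le]
        rintro _ ⟨p, hp, q, hq, rfl⟩
        obtain ⟨p, -, rfl⟩ := (mem_bdry.1 hτ).1 p hp
        obtain ⟨q, -, rfl⟩ := (mem_bdry.1 hτ).1 q hq
        have h1 : p - q ∈ latticePart (vectorSpan ℝ (τ : Set (Fin N → ℝ))) := by
          rw [mem_latticePart, emb_sub]
          exact vsub_mem_vectorSpan ℝ hp hq
        rw [← hb] at h1
        change emb p - emb q ∈ _
        rw [← emb_sub]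
        clear hp hq
        generalize p - q = w at h1
        induction h1 using Submodule.span_induction with
        | mem x hx =>
          obtain ⟨i, rfl⟩ := hx
          exact Submodule.subset_span ⟨i, by simp only [hb']; rfl⟩
        | zero => rw [emb_zero]; exact Submodule.zero_mem _
        | add x y _ _ hx hy => rw [emb_add]; exact Submodule.add_mem _ hx hy
        | smul c x _ hx => rw [emb_smul]; exact Submodule.smul_mem _ _ hx
    have h1 := finrank_span_eq_card hli'
    rw [hspan', Fintype.card_fin] at h1
    have : Nonempty τ := ⟨⟨_, hx⟩⟩
    have h2 := (D.T.indep (mem_bdry.1 hτ).2.1).finrank_vectorSpan_add_one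
    have h3 : vectorSpan ℝ (Set.range ((↑) : τ → Fin N → ℝ)) =
        vectorSpan ℝ (τ : Set (Fin N → ℝ)) := by
      congr 1; exact Subtype.range_coe
    rw [Fintype.card_coe, h3] at h2
    omega
  refine ⟨⟨hτ, Om, hx, b', ?_, ?_, ?_, ?_⟩⟩
  · have : b' '' {i : Fin N | (i : ℕ) + 1 < τ.card} =
        Set.range fun i => (b (Sum.inl i) : Fin N → ℤ) := by
      ext w
      constructor
      · rintro ⟨j, hj, rfl⟩
        obtain ⟨(i | i) | i, rfl⟩ := ε.surjective j
        · exact ⟨i, by rw [hb']; rfl⟩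
        · have := hε2 i
          change (ε _ : ℕ) + 1 < _ at hj
          omega
        · have := hε3 i
          change (ε _ : ℕ) + 1 < _ at hj
          omega
      · rintro ⟨i, rfl⟩
        refine ⟨ε (Sum.inl (Sum.inl i)), ?_, hb' _⟩
        change (ε _ : ℕ) + 1 < _
        have := hε1 i
        omega
    rw [this, hb]
    rfl
  · have : b' '' {i : Fin N | (i : ℕ) < dim (D.Theta τ)} =
        Set.range fun i => (b i : Fin N → ℤ) := by
      ext w
      constructor
      · rintro ⟨j, hj, rfl⟩
        obtain ⟨i | i, rfl⟩ := ε.surjective j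
        · exact ⟨i, by rw [hb']; rfl⟩
        · have := hε3 i
          change (ε _ : ℕ) < _ at hj
          omega
      · rintro ⟨i, rfl⟩
        refine ⟨ε (Sum.inl i), ?_, hb' _⟩
        change (ε _ : ℕ) < _
        rcases i with i | i
        · have := hε1 i; omega
        · have := hε2 i; omega
    rw [this, hbspan]
    rfl
  · rw [← hesum, ← Finset.sum_coe_sort I]
    symm
    refine Finset.sum_bij (fun i _ => ε (Sum.inr i)) ?_ ?_ ?_ ?_
    · intro i _
      rw [Finset.mem_filter]
      have := hε3 i
      exact ⟨Finset.mem_univ _, by omega⟩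
    · intro i _ j _ h
      exact Sum.inr_injective (ε.injective h)
    · intro j hj
      obtain ⟨(i | i) | i, rfl⟩ := ε.surjective j
      · have := hε1 i; have := (Finset.mem_filter.1 hj).2; omega
      · have := hε2 i; have := (Finset.mem_filter.1 hj).2; omega
      · exact ⟨i, Finset.mem_univ _, rfl⟩
    · intro i _
      rw [hb']
      rfl
  · intro j hj
    obtain ⟨(i | i) | i, rfl⟩ := ε.surjective j
    · have := hε1 i; omega
    · have := hε2 i; omega
    · have hi := (hIm i).1 i.2
      refine ⟨dualVec g i, isFacetNormal_of_mem hi.1, ?_, fun j => ?_⟩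
      · rw [Theta_eq hτ]
        exact fun m hm => ⟨hm.1, hm.2 _ hi⟩
      · change dualVec g i ⬝ᵥ b' j = _
        obtain ⟨k | k, rfl⟩ := ε.surjective j
        · rw [hb', if_neg (by simp)]
          exact hβ0 i i.2 k
        · rw [hb']
          change dualVec g i ⬝ᵥ e k = _
          rw [he i i.2 k k.2]
          refine if_congr ⟨fun h => by rw [Subtype.ext h], fun h => ?_⟩ rfl rfl
          have := Sum.inr_injective (ε.injective h)
          rw [this]

end FamilyData

end TorusFib

namespace TorusFib

variable {N : ℕ}

/-! ### Gibbs measures on the points of `A` and the moment map -/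

/-- The weight of `w` in the Gibbs measure with parameter `ξ`. -/
noncomputable def wt (D : FamilyData N) (t : ℂ) (ξ : Fin N → ℝ) (w : Fin N → ℤ) : ℝ :=
  ‖t ^ D.lam w‖ * Real.exp (ξ ⬝ᵥ emb w)

/-- The Gibbs measure on `S` with parameter `ξ` has mean `m`. -/
def IsGibbs (D : FamilyData N) (t : ℂ) (S : Finset (Fin N → ℤ)) (ξ m : Fin N → ℝ) : Prop :=
  ∑ w ∈ S, wt D t ξ w • (emb w - m) = 0

variable {D : FamilyData N} {t : ℂ}

theorem wt_pos (ht : t ≠ 0) (ξ : Fin N → ℝ) (w : Fin N → ℤ) : 0 < wt D t ξ w :=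
  mul_pos (norm_pos_iff.2 (zpow_ne_zero _ ht)) (Real.exp_pos _)

theorem IsGibbs.sum_eq {S : Finset (Fin N → ℤ)} (hS : S.Nonempty) (ht : t ≠ 0) {ξ m : Fin N → ℝ}
    (h : IsGibbs D t S ξ m) :
    0 < ∑ w ∈ S, wt D t ξ w ∧
    ∑ w ∈ S, (wt D t ξ w / ∑ w ∈ S, wt D t ξ w) = 1 ∧
      ∑ w ∈ S, (wt D t ξ w / ∑ w ∈ S, wt D t ξ w) • emb w = m := by
  have hZ : 0 < ∑ w ∈ S, wt D t ξ w := Finset.sum_pos (fun w _ => wt_pos ht ξ w) hS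
  refine ⟨hZ, by rw [← Finset.sum_div, div_self hZ.ne'], ?_⟩
  unfold IsGibbs at h
  simp_rw [smul_sub] at h
  rw [Finset.sum_sub_distrib, ← Finset.sum_smul, sub_eq_zero] at h
  simp_rw [div_eq_inv_mul, mul_smul]
  rw [← Finset.smul_sum, h, smul_smul, inv_mul_cancel₀ hZ.ne', one_smul]

theorem isGibbs_congr {S : Finset (Fin N → ℤ)} {ξ ξ' m : Fin N → ℝ} {C : ℝ}
    (hC : ∀ w ∈ S, ξ' ⬝ᵥ emb w = ξ ⬝ᵥ emb w + C) :
    IsGibbs D t S ξ' m ↔ IsGibbs D t S ξ m := by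
  have : ∑ w ∈ S, wt D t ξ' w • (emb w - m) =
      Real.exp C • ∑ w ∈ S, wt D t ξ w • (emb w - m) := by
    rw [Finset.smul_sum]
    refine Finset.sum_congr rfl fun w hw => ?_
    rw [wt, hC w hw, Real.exp_add, smul_smul, wt]
    congr 1; ring
  unfold IsGibbs
  rw [this, smul_eq_zero, or_iff_right (Real.exp_ne_zero C)]

namespace FamilyData

theorem dotProduct_eq_of_faceA {X : Set (Fin N → ℝ)} {ξ : Fin N → ℝ} {C : ℝ}
    (h : ∀ w ∈ D.faceA X, ξ ⬝ᵥ emb w = C) {x : Fin N → ℝ} (hx : x ∈ D.fc X) : ξ ⬝ᵥ x = C := by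
  obtain ⟨a, -, ha1, rfl⟩ := exists_weights_faceA hx
  rw [dotProduct_sum, Finset.sum_congr rfl fun w hw => by rw [dotProduct_smul, h w hw],
    ← Finset.sum_smul, ha1, one_smul]

theorem dotProduct_le_of_faceA {X : Set (Fin N → ℝ)} {ξ : Fin N → ℝ} {C : ℝ}
    (h : ∀ w ∈ D.faceA X, ξ ⬝ᵥ emb w ≤ C) {x : Fin N → ℝ} (hx : x ∈ D.fc X) : ξ ⬝ᵥ x ≤ C := by
  obtain ⟨a, ha0, ha1, rfl⟩ := exists_weights_faceA hx
  rw [dotProduct_sum]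
  calc ∑ w ∈ D.faceA X, ξ ⬝ᵥ (a w • emb w) ≤ ∑ w ∈ D.faceA X, a w * C :=
        Finset.sum_le_sum fun w hw => by
          rw [dotProduct_smul, smul_eq_mul]
          exact mul_le_mul_of_nonneg_left (h w hw) (ha0 w hw)
    _ = C := by rw [← Finset.sum_mul, ha1, one_mul]

theorem dotProduct_vectorSpan_eq_zero {X : Set (Fin N → ℝ)} {ξ : Fin N → ℝ} {C : ℝ}
    (h : ∀ w ∈ D.faceA X, ξ ⬝ᵥ emb w = C) {d : Fin N → ℝ} (hd : d ∈ vectorSpan ℝ (D.fc X)) :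
    ξ ⬝ᵥ d = 0 := by
  rw [vectorSpan_def] at hd
  induction hd using Submodule.span_induction with
  | mem x hx =>
    obtain ⟨y, hy, z, hz, rfl⟩ := hx
    change ξ ⬝ᵥ (y - z) = 0
    rw [dotProduct_sub, dotProduct_eq_of_faceA h hy, dotProduct_eq_of_faceA h hz, sub_self]
  | zero => simp
  | add x y _ _ hx hy => rw [dotProduct_add, hx, hy, add_zero]
  | smul c x _ hx => rw [dotProduct_smul, hx, smul_zero]

theorem nrm_emb_faceA {X : Set (Fin N → ℝ)} (hXD : X ⊆ D.Delta) :
    D.nrm (emb '' (D.faceA X : Set (Fin N → ℤ))) = D.nrm X := by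
  refine Set.Subset.antisymm (fun u hu => ⟨hu.1, fun x hx => ?_⟩) fun u hu => ⟨hu.1, ?_⟩
  · exact dotProduct_eq_of_faceA (fun w hw => hu.2 _ ⟨w, hw, rfl⟩) (subset_fc hXD hx)
  · rintro _ ⟨w, hw, rfl⟩
    exact (mem_faceA.1 hw).2.2 u hu

end FamilyData

open FamilyData

/-- All weights are positive, so a normal is tight at the mean only if it is tight on every point of
A in the face. -/
theorem IsGibbs.nrm_eq {X : Set (Fin N → ℝ)} (hX : X.Nonempty) (hXD : X ⊆ D.Delta) (ht : t ≠ 0)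
    {ξ m : Fin N → ℝ} (h : IsGibbs D t (D.faceA X) ξ m) : m ∈ D.Delta ∧ D.nrm {m} = D.nrm X := by
  obtain ⟨hZ, h1, hm⟩ := h.sum_eq (faceA_nonempty hX hXD) ht
  have hp : ∀ w ∈ D.faceA X, 0 < wt D t ξ w / ∑ w ∈ D.faceA X, wt D t ξ w := fun w _ =>
    div_pos (wt_pos ht ξ w) hZ
  have hD : ∀ w ∈ D.faceA X, emb w ∈ D.Delta := fun w hw => D.emb_mem_Delta (faceA_subset hw)
  constructor
  · rw [← hm]
    exact D.convex_Delta.sum_mem (fun w hw => (hp w hw).le) h1 hD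
  · rw [← nrm_emb_faceA hXD, ← nrm_sum hp h1 hD, hm]

theorem faceA_eq_of_nrm_eq {X Y : Set (Fin N → ℝ)} (h : D.nrm X = D.nrm Y) :
    D.faceA X = D.faceA Y := by
  ext w; rw [mem_faceA, mem_faceA, fc_congr h]

/-- The parameter of a measure on a face matters only up to functionals constant on the face:
equality of exponents on the points of A passes to all directions of the face. -/
theorem IsGibbs.unique {X : Set (Fin N → ℝ)} (hX : X.Nonempty) (hXD : X ⊆ D.Delta) (ht : t ≠ 0)
    {ξ₁ ξ₂ m₁ m₂ : Fin N → ℝ} (h₁ : IsGibbs D t (D.faceA X) ξ₁ m₁)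
    (h₂ : IsGibbs D t (D.faceA X) ξ₂ m₂) (h : (ξ₁ - ξ₂) ⬝ᵥ (m₁ - m₂) ≤ 0) :
    m₁ = m₂ ∧ ∀ d ∈ vectorSpan ℝ (D.fc X), (ξ₁ - ξ₂) ⬝ᵥ d = 0 := by
  have hS := faceA_nonempty hX hXD
  obtain ⟨h1, h2⟩ := gibbs_mono hS (x := emb) (a := fun w => ‖t ^ D.lam w‖)
    (fun w _ => norm_pos_iff.2 (zpow_ne_zero _ ht)) h₁ h₂ h
  obtain ⟨w₀, hw₀⟩ := hS
  exact ⟨h1, fun d hd => dotProduct_vectorSpan_eq_zero (fun w hw => h2 w hw w₀ hw₀) hd⟩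

/-- Coercivity holds because m is relatively interior to its minimal face: if no point of A in the
face lies beyond m in direction η, stepping from m away from w shows that η takes the same value at
w and at m. -/
theorem exists_isGibbs (ht : t ≠ 0) {m : Fin N → ℝ} (hm : m ∈ D.Delta) :
    ∃ ξ, IsGibbs D t (D.faceA {m}) ξ m := by
  have hX : ({m} : Set (Fin N → ℝ)).Nonempty := ⟨m, rfl⟩
  have hXD : ({m} : Set (Fin N → ℝ)) ⊆ D.Delta := by simpa using hm
  obtain ⟨ξ, m', h1, h2, -⟩ := exists_gibbs (faceA_nonempty hX hXD) emb
    (a := fun w => ‖t ^ D.lam w‖) (fun w _ => norm_pos_iff.2 (zpow_ne_zero _ ht)) {m}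
    (Finset.mem_singleton_self m) 0 (by
      intro η
      by_cases hex : ∃ w ∈ D.faceA {m}, η ⬝ᵥ m < η ⬝ᵥ emb w
      · exact Or.inl hex
      push Not at hex
      refine Or.inr ⟨fun w hw => le_antisymm (hex w hw) ?_, by simp⟩
      have hw' := (mem_faceA.1 hw).2
      have hz : ∀ u ∈ D.nrm {m}, emb u ⬝ᵥ (m - emb w) = 0 := fun u hu => by
        rw [dotProduct_sub, hu.2 m rfl, hw'.2 u hu, sub_self]
      obtain ⟨δ, h3, hδ⟩ := ((eventually_smul_mem hm fun u hu => (hz u hu).ge).and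
        self_mem_nhdsWithin).exists
      have h4 : m + δ • (m - emb w) ∈ D.fc {m} := ⟨h3, fun u hu => by
        rw [dotProduct_add, dotProduct_smul, hz u hu, hu.2 m rfl]; simp⟩
      have h5 := dotProduct_le_of_faceA hex h4
      rw [dotProduct_add, dotProduct_smul, dotProduct_sub, smul_eq_mul] at h5
      have hδ' : 0 < δ := hδ
      nlinarith)
  have : m' = m := by simpa using h2
  subst this
  exact ⟨ξ, h1⟩

theorem smul_mem_interior {ε : ℝ} (hε : 0 < ε) (hε1 : ε < 1) {x : Fin N → ℝ} (hx : x ∈ D.Delta) :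
    ε • x ∈ interior D.Delta := by
  have hge : ∀ u ∈ D.normals, -1 < emb u ⬝ᵥ (ε • x) := fun u hu => by
    rw [dotProduct_smul, smul_eq_mul]
    have := normals_ge hu hx
    nlinarith
  refine mem_interior_iff.2 ⟨mem_Delta_iff.2 fun u hu => (hge u hu).le,
    Set.eq_empty_of_forall_notMem fun u hu => ?_⟩
  have := hge u hu.1
  rw [hu.2 _ rfl] at this
  exact lt_irrefl _ this

/-- No facet contains 0, so the face spanned by {0} is Δ itself; {0} serves below as the label of
the open orbit. -/
theorem nrm_zero : D.nrm {0} = ∅ := Set.eq_empty_of_forall_notMem fun u hu => by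
  have := hu.2 0 rfl
  simp at this

theorem zero_subset : ({0} : Set (Fin N → ℝ)) ⊆ D.Delta :=
  Set.singleton_subset_iff.2 D.zero_mem_Delta

theorem faceA_zero : D.faceA {0} = D.A := by
  ext w
  rw [mem_faceA]
  refine ⟨fun h => h.1, fun h => ⟨h, D.emb_mem_Delta h, fun u hu => ?_⟩⟩
  rw [nrm_zero] at hu
  exact absurd hu (Set.notMem_empty u)

theorem A_nonempty : D.A.Nonempty := ⟨0, D.zero_mem⟩

theorem vectorSpan_fc_zero (d : Fin N → ℝ) : d ∈ vectorSpan ℝ (D.fc {0}) := by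
  rw [mem_vectorSpan_fc_iff (Set.singleton_nonempty 0) zero_subset, nrm_zero]
  simp

/-- Uniqueness of Gibbs parameters on all of `A`. -/
theorem IsGibbs.unique_A (ht : t ≠ 0) {ξ₁ ξ₂ m₁ m₂ : Fin N → ℝ} (h₁ : IsGibbs D t D.A ξ₁ m₁)
    (h₂ : IsGibbs D t D.A ξ₂ m₂) (h : (ξ₁ - ξ₂) ⬝ᵥ (m₁ - m₂) ≤ 0) : m₁ = m₂ ∧ ξ₁ = ξ₂ := by
  rw [← faceA_zero] at h₁ h₂
  obtain ⟨h1, h2⟩ := IsGibbs.unique (Set.singleton_nonempty 0) zero_subset ht h₁ h₂ h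
  refine ⟨h1, sub_eq_zero.1 (dotProduct_eq_zero _ fun d => h2 d (vectorSpan_fc_zero d))⟩

theorem IsGibbs.mem_interior (ht : t ≠ 0) {ξ m : Fin N → ℝ} (h : IsGibbs D t D.A ξ m) :
    m ∈ D.Delta ∧ D.nrm {m} = ∅ := by
  rw [← faceA_zero] at h
  have := IsGibbs.nrm_eq (Set.singleton_nonempty 0) zero_subset ht h
  rwa [nrm_zero] at this

/-- The point of the shrunken face that is nearest to `ξ` in the sense of the Legendre transform. -/
theorem exists_isGibbs_variational (ht : t ≠ 0) {ε : ℝ} (hε : 0 < ε) (hε1 : ε < 1)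
    {s : Fin N → ℝ} (hs : s ∈ D.Delta) (ξ : Fin N → ℝ) :
    ∃ ξ' s', s' ∈ D.fc {s} ∧ IsGibbs D t D.A ξ' (ε • s') ∧
      ∀ x ∈ D.fc {s}, (ξ - ξ') ⬝ᵥ x ≤ (ξ - ξ') ⬝ᵥ s' := by
  classical
  have hX : ({s} : Set (Fin N → ℝ)).Nonempty := ⟨s, rfl⟩
  have hXD : ({s} : Set (Fin N → ℝ)) ⊆ D.Delta := by simpa using hs
  obtain ⟨w₀, hw₀⟩ := faceA_nonempty hX hXD
  obtain ⟨ξ', m, h1, h2, h3⟩ := exists_gibbs A_nonempty emb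
    (a := fun w => ‖t ^ D.lam w‖) (fun w _ => norm_pos_iff.2 (zpow_ne_zero _ ht))
    ((D.faceA {s}).image fun w => ε • emb w) (k₀ := ε • emb w₀)
    (Finset.mem_image_of_mem _ hw₀) ξ (by
      intro η
      by_cases h0 : η = 0
      · subst h0; right; simp
      left
      by_contra hcon
      push Not at hcon
      -- The points of the shrunken face are interior to Δ, so a nonzero η cannot attain its maximum
      -- over A there.
      obtain ⟨δ, hδ, hδ0⟩ := ((eventually_smul_mem_of_interior
        (smul_mem_interior hε hε1 (D.emb_mem_Delta (faceA_subset hw₀))) η).and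
        self_mem_nhdsWithin).exists
      have hδ0 : 0 < δ := hδ0
      have h4 : η ⬝ᵥ (ε • emb w₀ + δ • η) ≤ η ⬝ᵥ (ε • emb w₀) := by
        refine dotProduct_le_of_faceA (D := D) (X := {0}) ?_ ?_
        · rw [faceA_zero]; exact hcon
        · exact ⟨hδ, by rw [nrm_zero]; simp⟩
      rw [dotProduct_add, dotProduct_smul _ η η, smul_eq_mul] at h4
      have h5 : η ⬝ᵥ η ≤ 0 := by nlinarith
      exact h0 (dotProduct_self_eq_zero.1 (le_antisymm h5
        (Finset.sum_nonneg fun i _ => mul_self_nonneg _))))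
  have hconv : Convex ℝ (D.fc {s}) := (isFace_fc hX hXD).2.convex D.convex_Delta
  have hm : m ∈ ε • D.fc {s} := by
    refine convexHull_min ?_ (hconv.smul ε) h2
    intro x hx
    obtain ⟨w, hw, rfl⟩ := Finset.mem_image.1 hx
    exact Set.smul_mem_smul_set (mem_faceA.1 hw).2
  obtain ⟨s', hs', rfl⟩ := hm
  refine ⟨ξ', s', hs', h1, fun x hx => ?_⟩
  refine dotProduct_le_of_faceA (X := {s}) (fun w hw => ?_) hx
  have := h3 (ε • emb w) (Finset.mem_image_of_mem _ hw)
  change (ξ - ξ') ⬝ᵥ (ε • emb w) ≤ (ξ - ξ') ⬝ᵥ (ε • s') at this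
  rw [dotProduct_smul, dotProduct_smul, smul_eq_mul, smul_eq_mul] at this
  exact le_of_mul_le_mul_left this hε

/-! ### The moment map -/

theorem hom_smul (a : ℂ) (v : D.LatticePt → ℂ) (w : Fin N → ℤ) :
    hom D (a • v) w = a * hom D v w := by
  unfold hom; split_ifs <;> simp

theorem momentHom_smul {a : ℂ} (ha : a ≠ 0) (v : D.LatticePt → ℂ) :
    momentHom D t (a • v) = momentHom D t v := by
  have ha' : ‖a‖ ≠ 0 := norm_ne_zero_iff.2 ha
  unfold momentHom
  have e : ∀ w, ‖t ^ D.lam w‖ * ‖hom D (a • v) w‖ = ‖a‖ * (‖t ^ D.lam w‖ * ‖hom D v w‖) := by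
    intro w; rw [hom_smul, norm_mul]; ring
  simp_rw [e, mul_smul ‖a‖, ← Finset.mul_sum, ← Finset.smul_sum]
  rw [smul_smul, mul_inv, mul_right_comm, inv_mul_cancel₀ ha', one_mul]

theorem exists_rep_mk (v : D.LatticePt → ℂ) (hv : v ≠ 0) :
    ∃ a : ℂ, a ≠ 0 ∧ (Projectivization.mk ℂ v hv).rep = a • v := by
  obtain ⟨a, ha⟩ := Projectivization.exists_smul_eq_mk_rep ℂ v hv
  exact ⟨a, a.ne_zero, ha.symm⟩

theorem moment_mk (v : D.LatticePt → ℂ) (hv : v ≠ 0) :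
    moment D t (Projectivization.mk ℂ v hv) = momentHom D t v := by
  obtain ⟨a, ha, he⟩ := exists_rep_mk v hv
  rw [moment, he, momentHom_smul ha]

theorem momentHom_eq_iff {v : D.LatticePt → ℂ} {m : Fin N → ℝ}
    (hpos : 0 < ∑ w ∈ D.A, ‖t ^ D.lam w‖ * ‖hom D v w‖) :
    momentHom D t v = m ↔ ∑ w ∈ D.A, (‖t ^ D.lam w‖ * ‖hom D v w‖) • (emb w - m) = 0 := by
  unfold momentHom
  simp_rw [smul_sub]
  rw [Finset.sum_sub_distrib, ← Finset.sum_smul, sub_eq_zero, inv_smul_eq_iff₀ hpos.ne']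

end TorusFib

namespace TorusFib

variable {N : ℕ} {D : FamilyData N} {t : ℂ} {τ : Finset (Fin N → ℝ)}

open FamilyData

namespace TauCoords

/-! ### Associated coordinates and normals -/

/-- The dual basis of the exponents of the coordinates. -/
noncomputable def dual (c : TauCoords D τ) (i : Fin N) : Fin N → ℤ := dualVec c.b i

variable (c : TauCoords D τ)

theorem dual_injective : Function.Injective c.dual := dualVec_injective c.b

theorem expo_eq (w : Fin N → ℤ) (i : Fin N) : c.expo w i = c.dual i ⬝ᵥ (w - c.Om) :=
  (dualVec_dotProduct c.b i _).symm

theorem dual_mem {i : Fin N} (hi : dim (D.Theta τ) ≤ i) : c.dual i ∈ D.nrm τ := by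
  obtain ⟨u, hu, hsub, hdual⟩ := c.normal i hi
  have : u = c.dual i := eq_of_dotProduct_basis c.b fun j => by
    rw [dual, dualVec_dotProduct_basis]
    rw [show u ⬝ᵥ c.b j = _ from hdual j]
    exact if_congr eq_comm rfl rfl
  rw [← this]
  refine ⟨mem_normals_of_isFacetNormal hu, fun x hx => ?_⟩
  rw [Theta_eq c.mem_bdry] at hsub
  exact (hsub (subset_fc (bdry_subset c.mem_bdry) hx)).2

/-- The dual vectors of the N - l normal coordinates are distinct normals through τ, and
`dim_fc_add` leaves no room for others. -/
theorem nrm_eq : D.nrm τ = c.dual '' {i | dim (D.Theta τ) ≤ i} := by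
  symm
  refine Set.eq_of_subset_of_ncard_le ?_ ?_ finite_nrm
  · rintro _ ⟨i, hi, rfl⟩
    exact c.dual_mem hi
  · rw [Set.ncard_image_of_injective _ c.dual_injective]
    have h1 := dim_fc_add (bdry_nonempty c.mem_bdry) (bdry_subset c.mem_bdry)
    rw [← Theta_eq c.mem_bdry] at h1
    have h2 : ({i : Fin N | dim (D.Theta τ) ≤ i}).ncard = N - dim (D.Theta τ) := by
      have : {i : Fin N | dim (D.Theta τ) ≤ i} =
          ((Finset.univ.filter fun i : Fin N => dim (D.Theta τ) ≤ i : Finset (Fin N)) :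
            Set (Fin N)) := by ext; simp
      rw [this, Set.ncard_coe_finset]
      have h3 := Finset.card_filter_add_card_filter_not (s := (Finset.univ : Finset (Fin N)))
        (fun i => (i : ℕ) < dim (D.Theta τ))
      rw [Fin.card_filter_val_lt, Finset.card_univ, Fintype.card_fin] at h3
      simp_rw [not_lt] at h3
      omega
    omega

theorem dual_mem_iff {i : Fin N} : c.dual i ∈ D.nrm τ ↔ dim (D.Theta τ) ≤ i := by
  rw [c.nrm_eq, c.dual_injective.mem_set_image]; rfl

theorem dual_Om {i : Fin N} (hi : dim (D.Theta τ) ≤ i) : c.dual i ⬝ᵥ c.Om = -1 := by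
  have := (c.dual_mem hi).2 _ c.Om_mem
  rw [emb_dotProduct] at this
  exact_mod_cast this

theorem expo_of_le {i : Fin N} (hi : dim (D.Theta τ) ≤ i) (w : Fin N → ℤ) :
    c.expo w i = c.dual i ⬝ᵥ w + 1 := by
  rw [expo_eq, dotProduct_sub, c.dual_Om hi]; ring

theorem expo_nonneg {i : Fin N} (hi : dim (D.Theta τ) ≤ i) {w : Fin N → ℤ}
    (hw : emb w ∈ D.Delta) : 0 ≤ c.expo w i := by
  have := normals_ge (c.dual_mem hi).1 hw
  rw [emb_dotProduct] at this
  have : (-1 : ℤ) ≤ c.dual i ⬝ᵥ w := by exact_mod_cast this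
  rw [c.expo_of_le hi]; omega

theorem expo_eq_zero_iff {i : Fin N} (hi : dim (D.Theta τ) ≤ i) {w : Fin N → ℤ} :
    c.expo w i = 0 ↔ emb (c.dual i) ⬝ᵥ emb w = -1 := by
  rw [c.expo_of_le hi, emb_dotProduct]
  constructor
  · intro h
    have : c.dual i ⬝ᵥ w = -1 := by omega
    rw [this]; norm_num
  · intro h
    have : c.dual i ⬝ᵥ w = -1 := by exact_mod_cast h
    omega

theorem expo_Om (i : Fin N) : c.expo c.Om i = 0 := by simp [expo]

/-- Because the normal basis vectors add up to -Ω, the monomial of the lattice point 0 is the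
product of the normal coordinates; this produces the left-hand side of the local equation. -/
theorem expo_zero (i : Fin N) : c.expo 0 i = if dim (D.Theta τ) ≤ i then 1 else 0 := by
  have h := congrArg (fun w => c.dual i ⬝ᵥ w) c.sum_eq
  simp only [dotProduct_sum, dual, dualVec_dotProduct_basis, dotProduct_neg] at h
  rw [expo_eq, zero_sub, dotProduct_neg, dual, ← h]
  simp

theorem sum_expo (ξ : Fin N → ℝ) (w : Fin N → ℤ) :
    ∑ i, (c.expo w i : ℝ) * (ξ ⬝ᵥ emb (c.b i)) = ξ ⬝ᵥ emb w - ξ ⬝ᵥ emb c.Om := by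
  rw [← dotProduct_sub, ← emb_sub, dotProduct_emb_eq_sum_repr c.b]
  rfl

theorem Om_mem_Delta : emb c.Om ∈ D.Delta := bdry_subset c.mem_bdry c.Om_mem

/-! ### Absolute values of coordinates -/

open Classical in
/-- The absolute values of the coordinates of a point in the orbit of the face spanned by `X`. -/
noncomputable def absOf (X : Set (Fin N → ℝ)) (ξ : Fin N → ℝ) (i : Fin N) : ℝ :=
  if c.dual i ∈ D.nrm X then 0 else Real.exp (ξ ⬝ᵥ emb (c.b i))

theorem absOf_nonneg (X : Set (Fin N → ℝ)) (ξ : Fin N → ℝ) (i : Fin N) : 0 ≤ c.absOf X ξ i := by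
  unfold absOf; split_ifs <;> positivity

theorem absOf_eq_zero_iff {X : Set (Fin N → ℝ)} {ξ : Fin N → ℝ} {i : Fin N} :
    c.absOf X ξ i = 0 ↔ c.dual i ∈ D.nrm X := by
  unfold absOf; split_ifs with h <;> simp [h, Real.exp_ne_zero]

theorem absOf_of_notMem {X : Set (Fin N → ℝ)} {ξ : Fin N → ℝ} {i : Fin N}
    (h : c.dual i ∉ D.nrm X) : c.absOf X ξ i = Real.exp (ξ ⬝ᵥ emb (c.b i)) := if_neg h

theorem absOf_of_mem {X : Set (Fin N → ℝ)} {ξ : Fin N → ℝ} {i : Fin N}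
    (h : c.dual i ∈ D.nrm X) : c.absOf X ξ i = 0 := if_pos h

-- A coordinate that vanishes on the orbit has exponent zero precisely at the lattice points on its
-- divisor. There 0 ^ 0 = 1 is the right value, and all monomials off the face are zero.
open Classical in
theorem prod_absOf {X : Set (Fin N → ℝ)} (hX : D.nrm X ⊆ D.nrm τ) (ξ : Fin N → ℝ)
    {w : Fin N → ℤ} (hw : emb w ∈ D.Delta) :
    ∏ i, c.absOf X ξ i ^ c.expo w i =
      if emb w ∈ D.fc X then Real.exp (ξ ⬝ᵥ emb w - ξ ⬝ᵥ emb c.Om) else 0 := by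
  split_ifs with h
  · rw [← c.sum_expo, Real.exp_sum]
    refine Finset.prod_congr rfl fun i _ => ?_
    by_cases hi : c.dual i ∈ D.nrm X
    · rw [(c.expo_eq_zero_iff (c.dual_mem_iff.1 (hX hi))).2 (h.2 _ hi)]
      simp
    · rw [c.absOf_of_notMem hi, ← Real.rpow_intCast, ← Real.exp_mul, mul_comm]
  · obtain ⟨u, hu, hne⟩ : ∃ u ∈ D.nrm X, emb u ⬝ᵥ emb w ≠ -1 := by
      by_contra hcon
      push Not at hcon
      exact h ⟨hw, hcon⟩
    obtain ⟨i, hi, rfl⟩ := c.nrm_eq ▸ hX hu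
    refine Finset.prod_eq_zero (Finset.mem_univ i) ?_
    rw [c.absOf_of_mem hu, zero_zpow _ fun h0 => hne ((c.expo_eq_zero_iff hi).1 h0)]

/-- The homogeneous coordinates of the points of the chart. -/
noncomputable def vec (y : Fin N → ℂ) (w : D.LatticePt) : ℂ := ∏ i, y i ^ c.expo w.1 i

theorem vec_Om (y : Fin N → ℂ) : c.vec y ⟨c.Om, c.Om_mem_Delta⟩ = 1 := by
  simp [vec, c.expo_Om]

theorem vec_ne_zero (y : Fin N → ℂ) : c.vec y ≠ 0 := fun h => by
  have := congrFun h ⟨c.Om, c.Om_mem_Delta⟩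
  rw [c.vec_Om] at this
  exact one_ne_zero this

theorem chart_eq (y : Fin N → ℂ) : c.chart y = Projectivization.mk ℂ (c.vec y) (c.vec_ne_zero y) :=
  rfl

theorem hom_vec (y : Fin N → ℂ) {w : Fin N → ℤ} (hw : emb w ∈ D.Delta) :
    hom D (c.vec y) w = ∏ i, y i ^ c.expo w i := by
  rw [hom, dif_pos hw]; rfl

theorem norm_hom_vec (y : Fin N → ℂ) {w : Fin N → ℤ} (hw : emb w ∈ D.Delta) :
    ‖hom D (c.vec y) w‖ = ∏ i, ‖y i‖ ^ c.expo w i := by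
  rw [c.hom_vec y hw, norm_prod]
  simp_rw [norm_zpow]

theorem moment_chart_congr {y y' : Fin N → ℂ} (h : ∀ i, ‖y i‖ = ‖y' i‖) :
    moment D t (c.chart y) = moment D t (c.chart y') := by
  rw [chart_eq, chart_eq, moment_mk, moment_mk]
  have e : ∀ w ∈ D.A, ‖hom D (c.vec y) w‖ = ‖hom D (c.vec y') w‖ := fun w hw => by
    rw [c.norm_hom_vec y (D.emb_mem_Delta hw), c.norm_hom_vec y' (D.emb_mem_Delta hw)]
    simp_rw [h]
  have e1 : ∑ w ∈ D.A, ‖t ^ D.lam w‖ * ‖hom D (c.vec y) w‖ =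
      ∑ w ∈ D.A, ‖t ^ D.lam w‖ * ‖hom D (c.vec y') w‖ :=
    Finset.sum_congr rfl fun w hw => by rw [e w hw]
  have e2 : ∑ w ∈ D.A, (‖t ^ D.lam w‖ * ‖hom D (c.vec y) w‖) • emb w =
      ∑ w ∈ D.A, (‖t ^ D.lam w‖ * ‖hom D (c.vec y') w‖) • emb w :=
    Finset.sum_congr rfl fun w hw => by rw [e w hw]
  rw [momentHom, momentHom, e1, e2]

theorem norm_hom_vec_of_absOf {X : Set (Fin N → ℝ)} (hX : D.nrm X ⊆ D.nrm τ) {ξ : Fin N → ℝ}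
    {y : Fin N → ℂ} (hy : ∀ i, ‖y i‖ = c.absOf X ξ i) {w : Fin N → ℤ} (hw : w ∈ D.faceA X) :
    ‖hom D (c.vec y) w‖ = Real.exp (-(ξ ⬝ᵥ emb c.Om)) * Real.exp (ξ ⬝ᵥ emb w) := by
  have hwD := D.emb_mem_Delta (faceA_subset hw)
  rw [c.norm_hom_vec y hwD]
  simp_rw [hy]
  rw [c.prod_absOf hX ξ hwD, if_pos (mem_faceA.1 hw).2, ← Real.exp_add]
  congr 1; ring

theorem norm_hom_vec_of_notMem {X : Set (Fin N → ℝ)} (hX : D.nrm X ⊆ D.nrm τ) {ξ : Fin N → ℝ}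
    {y : Fin N → ℂ} (hy : ∀ i, ‖y i‖ = c.absOf X ξ i) {w : Fin N → ℤ} (hwA : w ∈ D.A)
    (hw : w ∉ D.faceA X) : ‖hom D (c.vec y) w‖ = 0 := by
  have hwD := D.emb_mem_Delta hwA
  rw [c.norm_hom_vec y hwD]
  simp_rw [hy]
  rw [c.prod_absOf hX ξ hwD, if_neg fun h => hw (mem_faceA.2 ⟨hwA, h⟩)]

/-- With |y_i| = exp(ξ·b_i) for the nonvanishing coordinates, |x^{w-Ω}| is exp(ξ·w) up to a factor
common to all w, so the weights of the moment map are Gibbs weights on the points of A in the face.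
-/
theorem moment_chart_eq_iff (ht : t ≠ 0) {X : Set (Fin N → ℝ)} (hX : X.Nonempty)
    (hXD : X ⊆ D.Delta) (hXτ : D.nrm X ⊆ D.nrm τ) {ξ m : Fin N → ℝ} {y : Fin N → ℂ}
    (hy : ∀ i, ‖y i‖ = c.absOf X ξ i) :
    moment D t (c.chart y) = m ↔ IsGibbs D t (D.faceA X) ξ m := by
  rw [chart_eq, moment_mk]
  have e1 : ∀ w ∈ D.faceA X, ‖t ^ D.lam w‖ * ‖hom D (c.vec y) w‖ =
      Real.exp (-(ξ ⬝ᵥ emb c.Om)) * wt D t ξ w := fun w hw => by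
    rw [c.norm_hom_vec_of_absOf hXτ hy hw, wt]; ring
  have e2 : ∀ w ∈ D.A, w ∉ D.faceA X → ‖t ^ D.lam w‖ * ‖hom D (c.vec y) w‖ = 0 :=
    fun w hwA hw => by rw [c.norm_hom_vec_of_notMem hXτ hy hwA hw, mul_zero]
  have hpos : 0 < ∑ w ∈ D.A, ‖t ^ D.lam w‖ * ‖hom D (c.vec y) w‖ := by
    rw [← Finset.sum_subset faceA_subset e2, Finset.sum_congr rfl e1]
    exact Finset.sum_pos (fun w _ => mul_pos (Real.exp_pos _) (wt_pos ht ξ w))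
      (faceA_nonempty hX hXD)
  rw [momentHom_eq_iff hpos, ← Finset.sum_subset faceA_subset fun w hwA hw => by
    rw [e2 w hwA hw, zero_smul], Finset.sum_congr rfl fun w hw => by rw [e1 w hw, mul_smul],
    ← Finset.smul_sum, smul_eq_zero, or_iff_right (Real.exp_ne_zero _)]
  rfl

/-- The face cut out by some of the facets through `τ`. -/
theorem exists_face_of_facets (Z : Set (Fin N)) (hZ : ∀ i ∈ Z, dim (D.Theta τ) ≤ (i : ℕ)) :
    ∃ X : Set (Fin N → ℝ), X.Nonempty ∧ X ⊆ D.Delta ∧ D.nrm X ⊆ D.nrm τ ∧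
      ∀ i, c.dual i ∈ D.nrm X ↔ i ∈ Z := by
  have hne := bdry_nonempty c.mem_bdry
  have hsub := bdry_subset c.mem_bdry
  set X : Set (Fin N → ℝ) := {m ∈ D.Delta | ∀ i ∈ Z, emb (c.dual i) ⬝ᵥ m = -1} with hXdef
  have hτX : (τ : Set (Fin N → ℝ)) ⊆ X := fun x hx =>
    ⟨hsub hx, fun i hi => (c.dual_mem (hZ i hi)).2 x hx⟩
  have hXτ : D.nrm X ⊆ D.nrm τ := nrm_anti hτX
  refine ⟨X, hne.mono hτX, fun m hm => hm.1, hXτ, fun i => ⟨fun hi => ?_, fun hi =>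
    ⟨(c.dual_mem (hZ i hi)).1, fun x hx => hx.2 i hi⟩⟩⟩
  by_contra hiZ
  obtain ⟨v, -, g, hv, hg, -, hr, -⟩ := exists_face_basis hne hsub
  obtain ⟨j, hj⟩ := hr (hXτ hi)
  have hmem : emb (v + g j) ∈ X := by
    refine ⟨hg j, fun i' hi' => ?_⟩
    have h1 := c.dual_mem (hZ i' hi')
    obtain ⟨j', hj'⟩ := hr h1
    have hne : j' ≠ j := by
      rintro rfl
      exact hiZ (c.dual_injective (hj.symm.trans hj') ▸ hi')
    rw [emb_add, dotProduct_add, hv.2 _ h1, ← hj', emb_dotProduct, dualVec_dotProduct_basis,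
      if_neg hne]
    simp
  have h2 := hi.2 _ hmem
  rw [emb_add, dotProduct_add, hv.2 _ (hXτ hi), ← hj, emb_dotProduct, dualVec_dotProduct_basis,
    if_pos rfl] at h2
  norm_num at h2

theorem isAbsCoord_absOf (ht : t ≠ 0) {m ξ : Fin N → ℝ} (hm : m ∈ D.Delta)
    (hmτ : D.nrm {m} ⊆ D.nrm τ) (h : IsGibbs D t (D.faceA {m}) ξ m) :
    c.IsAbsCoord t m (c.absOf {m} ξ) := by
  refine ⟨c.absOf_nonneg _ _, fun i hi => ?_, ?_⟩
  · rw [c.absOf_of_notMem fun h => ?_]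
    · exact Real.exp_pos _
    · have := c.dual_mem_iff.1 (hmτ h); omega
  · refine (c.moment_chart_eq_iff ht (Set.singleton_nonempty m) (Set.singleton_subset_iff.2 hm)
      hmτ fun i => ?_).2 h
    rw [Complex.norm_real, Real.norm_of_nonneg (c.absOf_nonneg _ _ _)]

/-- The vanishing coordinates single out a face, and the logarithms of the others give ξ. Thus
coordinates of points of Δ and Gibbs parameters on minimal faces are interchangeable. -/
theorem IsAbsCoord.exists_absOf {c : TauCoords D τ} (ht : t ≠ 0) {m r : Fin N → ℝ}
    (h : c.IsAbsCoord t m r) : m ∈ D.Delta ∧ D.nrm {m} ⊆ D.nrm τ ∧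
      ∃ ξ, IsGibbs D t (D.faceA {m}) ξ m ∧ r = c.absOf {m} ξ := by
  obtain ⟨h0, h1, h2⟩ := h
  obtain ⟨X, hX, hXD, hXτ, hXi⟩ := c.exists_face_of_facets {i | r i = 0} (fun i hi => by
    by_contra hlt
    have := h1 i (not_le.1 hlt)
    have hi' : r i = 0 := hi
    linarith)
  obtain ⟨ξ, hξ⟩ := exists_dotProduct_basis c.b fun i => Real.log (r i)
  have hr : ∀ i, r i = c.absOf X ξ i := by
    intro i
    by_cases hi : c.dual i ∈ D.nrm X
    · rw [c.absOf_of_mem hi]; exact (hXi i).1 hi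
    · rw [c.absOf_of_notMem hi, hξ, Real.exp_log]
      exact lt_of_le_of_ne (h0 i) fun h => hi ((hXi i).2 h.symm)
  have hG := (c.moment_chart_eq_iff ht hX hXD hXτ (ξ := ξ) (m := m) fun i => by
    rw [Complex.norm_real, Real.norm_of_nonneg (h0 i), hr i]).1 h2
  obtain ⟨hm, hnrm⟩ := hG.nrm_eq hX hXD ht
  refine ⟨hm, hnrm ▸ hXτ, ξ, by rwa [faceA_eq_of_nrm_eq hnrm], ?_⟩
  funext i
  rw [hr i, absOf, absOf, hnrm]

theorem emb_b_mem_vectorSpan {X : Set (Fin N → ℝ)} (hX : X.Nonempty) (hXD : X ⊆ D.Delta)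
    (hXτ : D.nrm X ⊆ D.nrm τ) {i : Fin N} (hi : c.dual i ∉ D.nrm X) :
    emb (c.b i) ∈ vectorSpan ℝ (D.fc X) := by
  rw [mem_vectorSpan_fc_iff hX hXD]
  intro u hu
  obtain ⟨j, hj, rfl⟩ := c.nrm_eq ▸ hXτ hu
  rw [emb_dotProduct, dual, dualVec_dotProduct_basis, if_neg]
  · simp
  · rintro rfl; exact hi hu

theorem IsAbsCoord.unique {c : TauCoords D τ} (ht : t ≠ 0) {m r r' : Fin N → ℝ}
    (h : c.IsAbsCoord t m r) (h' : c.IsAbsCoord t m r') : r = r' := by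
  obtain ⟨hm, hτ, ξ, hξ, rfl⟩ := h.exists_absOf ht
  obtain ⟨-, -, ξ', hξ', rfl⟩ := h'.exists_absOf ht
  have hX := Set.singleton_nonempty m
  have hXD := Set.singleton_subset_iff.2 hm
  obtain ⟨-, h2⟩ := IsGibbs.unique hX hXD ht hξ hξ' (by simp)
  funext i
  by_cases hi : c.dual i ∈ D.nrm {m}
  · rw [c.absOf_of_mem hi, c.absOf_of_mem hi]
  · rw [c.absOf_of_notMem hi, c.absOf_of_notMem hi]
    have := h2 _ (c.emb_b_mem_vectorSpan hX hXD hτ hi)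
    rw [sub_dotProduct, sub_eq_zero] at this
    rw [this]

theorem IsAbsCoord.point_unique {c : TauCoords D τ} {m m' r : Fin N → ℝ}
    (h : c.IsAbsCoord t m r) (h' : c.IsAbsCoord t m' r) : m = m' := h.2.2.symm.trans h'.2.2

end TauCoords

end TorusFib

namespace TorusFib

variable {N : ℕ} {D : FamilyData N} {t : ℂ}

namespace FamilyData

/-! ### Carriers in the triangulation -/

/-- `a` is the system of barycentric coordinates of the point `x`, and `σ` is its carrier. -/
structure IsBary (D : FamilyData N) (σ : Finset (Fin N → ℝ)) (a : (Fin N → ℝ) → ℝ)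
    (x : Fin N → ℝ) : Prop where
  mem_faces : σ ∈ D.T.faces
  pos : ∀ v ∈ σ, 0 < a v
  zero : ∀ v ∉ σ, a v = 0
  sum_one : ∑ v ∈ σ, a v = 1
  sum_eq : ∑ v ∈ σ, a v • v = x

theorem mem_vertices_of_mem {σ : Finset (Fin N → ℝ)} (hσ : σ ∈ D.T.faces) {v : Fin N → ℝ}
    (hv : v ∈ σ) : v ∈ D.T.vertices :=
  D.T.down_closed hσ (Finset.singleton_subset_iff.2 hv) (Finset.singleton_nonempty _)

theorem face_subset_image {σ : Finset (Fin N → ℝ)} (hσ : σ ∈ D.T.faces) :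
    (σ : Set (Fin N → ℝ)) ⊆ emb '' (D.A : Set (Fin N → ℤ)) := fun _ hv =>
  D.T_vertices (mem_vertices_of_mem hσ hv)

theorem face_subset_Delta {σ : Finset (Fin N → ℝ)} (hσ : σ ∈ D.T.faces) :
    (σ : Set (Fin N → ℝ)) ⊆ D.Delta := (face_subset_image hσ).trans (subset_convexHull ℝ _)

theorem finite_faces : D.T.faces.Finite := by
  classical
  refine ((D.A.image emb).powerset.finite_toSet).subset fun σ hσ => ?_
  rw [Finset.mem_coe, Finset.mem_powerset]
  intro v hv
  obtain ⟨w, hw, rfl⟩ := face_subset_image hσ hv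
  exact Finset.mem_image_of_mem _ hw

theorem eq_zero_of_sum {σ : Finset (Fin N → ℝ)} (hσ : σ ∈ D.T.faces) {c : (Fin N → ℝ) → ℝ}
    (h0 : ∑ v ∈ σ, c v = 0) (h1 : ∑ v ∈ σ, c v • v = 0) : ∀ v ∈ σ, c v = 0 :=
  (D.T.indep hσ).eq_zero_of_sum_eq_zero_subtype h0 h1

theorem exists_isBary {x : Fin N → ℝ} (hx : x ∈ D.Delta) : ∃ σ a, D.IsBary σ a x := by
  classical
  have hx' : x ∈ D.T.space := by rw [D.T_space]; exact hx
  obtain ⟨C, hC, hxC⟩ := Geometry.SimplicialComplex.mem_space_iff.1 hx'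
  obtain ⟨w, hw0, hw1, hw⟩ := Finset.mem_convexHull'.1 hxC
  have hs : ∑ v ∈ C.filter (fun v => w v ≠ 0), w v = 1 := by rw [Finset.sum_filter_ne_zero, hw1]
  have hne : (C.filter fun v => w v ≠ 0).Nonempty := by
    rw [Finset.nonempty_iff_ne_empty]
    intro h
    rw [h, Finset.sum_empty] at hs
    exact zero_ne_one hs
  refine ⟨C.filter (fun v => w v ≠ 0), fun v => if v ∈ C then w v else 0,
    D.T.down_closed hC (Finset.filter_subset _ _) hne, fun v hv => ?_, fun v hv => ?_, ?_, ?_⟩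
  · obtain ⟨h1, h2⟩ := Finset.mem_filter.1 hv
    simp only [if_pos h1]
    exact lt_of_le_of_ne (hw0 v h1) (Ne.symm h2)
  · by_cases h : v ∈ C
    · simp only [if_pos h]
      by_contra h2
      exact hv (Finset.mem_filter.2 ⟨h, h2⟩)
    · simp only [if_neg h]
  · rw [← hs]
    exact Finset.sum_congr rfl fun v hv => if_pos (Finset.mem_filter.1 hv).1
  · rw [← hw]
    have e : ∑ v ∈ C.filter (fun v => w v ≠ 0), (if v ∈ C then w v else 0) • v =
        ∑ v ∈ C.filter (fun v => w v ≠ 0), w v • v :=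
      Finset.sum_congr rfl fun v hv => by rw [if_pos (Finset.mem_filter.1 hv).1]
    rw [e]
    exact Finset.sum_filter_of_ne fun v _ h0 h1 => h0 (by rw [h1, zero_smul])

variable {σ σ' : Finset (Fin N → ℝ)} {a a' : (Fin N → ℝ) → ℝ} {x : Fin N → ℝ}

theorem IsBary.nonempty (h : D.IsBary σ a x) : σ.Nonempty := D.T.nonempty_of_mem_faces h.mem_faces

theorem IsBary.nonneg (h : D.IsBary σ a x) (v : Fin N → ℝ) : 0 ≤ a v := by
  by_cases hv : v ∈ σ
  · exact (h.pos v hv).le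
  · exact (h.zero v hv).ge

theorem IsBary.mem_convexHull (h : D.IsBary σ a x) : x ∈ convexHull ℝ (σ : Set (Fin N → ℝ)) :=
  Finset.mem_convexHull'.2 ⟨a, fun v _ => h.nonneg v, h.sum_one, h.sum_eq⟩

theorem IsBary.mem_Delta (h : D.IsBary σ a x) : x ∈ D.Delta :=
  convexHull_min (face_subset_Delta h.mem_faces) D.convex_Delta h.mem_convexHull

theorem IsBary.sum_superset (h : D.IsBary σ a x) {C : Finset (Fin N → ℝ)} (hC : σ ⊆ C) :
    ∑ v ∈ C, a v = 1 ∧ ∑ v ∈ C, a v • v = x := by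
  constructor
  · rw [← h.sum_one]
    exact (Finset.sum_subset hC fun v _ hv => h.zero v hv).symm
  · rw [← h.sum_eq]
    exact (Finset.sum_subset hC fun v _ hv => by rw [h.zero v hv, zero_smul]).symm

/-- x lies in the common face of σ and C; affine independence of σ makes its positive coordinates
the only ones, so they are all supported in C. -/
theorem IsBary.subset_of_mem_convexHull (h : D.IsBary σ a x) {C : Finset (Fin N → ℝ)}
    (hC : C ∈ D.T.faces) (hx : x ∈ convexHull ℝ (C : Set (Fin N → ℝ))) : σ ⊆ C := by
  classical
  have h1 := D.T.inter_subset_convexHull h.mem_faces hC ⟨h.mem_convexHull, hx⟩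
  rw [← Finset.coe_inter] at h1
  obtain ⟨w, -, hw1, hw⟩ := Finset.mem_convexHull'.1 h1
  have e1 : ∑ v ∈ σ, (if v ∈ C then w v else 0) = 1 := by
    rw [← Finset.sum_filter, Finset.filter_mem_eq_inter, hw1]
  have e2 : ∑ v ∈ σ, (if v ∈ C then w v else 0) • v = x := by
    simp_rw [ite_smul, zero_smul]
    rw [← Finset.sum_filter, Finset.filter_mem_eq_inter, hw]
  have := eq_zero_of_sum h.mem_faces (c := fun v => a v - if v ∈ C then w v else 0)
    (by rw [Finset.sum_sub_distrib, e1, h.sum_one, sub_self])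
    (by simp_rw [sub_smul]; rw [Finset.sum_sub_distrib, e2, h.sum_eq, sub_self])
  intro v hv
  by_contra hvC
  have h2 := this v hv
  simp only [if_neg hvC, sub_zero] at h2
  exact (h.pos v hv).ne' h2

theorem IsBary.unique (h : D.IsBary σ a x) (h' : D.IsBary σ' a' x) : σ = σ' ∧ a = a' := by
  have e : σ = σ' := Finset.Subset.antisymm (h.subset_of_mem_convexHull h'.mem_faces h'.mem_convexHull)
    (h'.subset_of_mem_convexHull h.mem_faces h.mem_convexHull)
  subst e
  refine ⟨rfl, funext fun v => ?_⟩
  by_cases hv : v ∈ σ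
  · have := eq_zero_of_sum h.mem_faces (c := fun v => a v - a' v)
      (by rw [Finset.sum_sub_distrib, h.sum_one, h'.sum_one, sub_self])
      (by simp_rw [sub_smul]; rw [Finset.sum_sub_distrib, h.sum_eq, h'.sum_eq, sub_self]) v hv
    exact sub_eq_zero.1 this
  · rw [h.zero v hv, h'.zero v hv]

theorem exists_facet (hσ : σ ∈ D.T.faces) : ∃ C ∈ D.T.facets, σ ⊆ C := by
  obtain ⟨C, hle, hC⟩ := finite_faces.exists_le_maximal hσ
  exact ⟨C, ⟨hC.1, fun s hs hCs => Finset.Subset.antisymm hCs (hC.2 hs hCs)⟩, hle⟩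

open Classical in
theorem insert_zero_mem (hσ : σ ∈ D.T.faces) : insert 0 σ ∈ D.T.faces := by
  obtain ⟨C, hC, hσC⟩ := exists_facet hσ
  exact D.T.down_closed hC.1 (Finset.insert_subset (D.T_central C hC) hσC)
    (Finset.insert_nonempty _ _)

/-- Centrality of T: adjoining the origin to a simplex again gives a simplex, so contraction toward
the origin moves weight to the vertex 0 and rescales the other coordinates. -/
theorem IsBary.smul (h : D.IsBary σ a x) {θ : ℝ} (h0 : 0 < θ) (h1 : θ < 1) :
    ∃ σ', D.IsBary σ' (fun v => θ * a v + if v = 0 then 1 - θ else 0) (θ • x) := by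
  classical
  have hs := h.sum_superset (Finset.subset_insert 0 σ)
  have hpos : ∀ v, 0 ≤ if v = (0 : Fin N → ℝ) then 1 - θ else 0 := fun v => by
    split_ifs <;> linarith
  refine ⟨insert 0 σ, insert_zero_mem h.mem_faces, fun v hv => ?_, fun v hv => ?_, ?_, ?_⟩
  · rcases Finset.mem_insert.1 hv with rfl | hv
    · have := h.nonneg 0
      simp only [if_true]
      nlinarith
    · have := h.pos v hv
      have := hpos v
      positivity
  · rw [Finset.mem_insert, not_or] at hv
    simp only [h.zero v hv.2, if_neg hv.1]
    ring
  · rw [Finset.sum_add_distrib, ← Finset.mul_sum, hs.1, Finset.sum_ite_eq',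
      if_pos (Finset.mem_insert_self _ _)]
    ring
  · simp_rw [add_smul, mul_smul]
    rw [Finset.sum_add_distrib, ← Finset.smul_sum, hs.2]
    simp

theorem IsBary.nrm_eq (h : D.IsBary σ a x) : D.nrm {x} = D.nrm (σ : Set (Fin N → ℝ)) := by
  rw [← h.sum_eq, nrm_sum h.pos h.sum_one fun v hv => face_subset_Delta h.mem_faces hv]
  simp

/-- The normals tight at x are tight on its whole carrier, hence at every point of the simplex it
spans. -/
theorem IsBary.mem_bdry (h : D.IsBary σ a x) (hx : x ∈ frontier D.Delta) : σ ∈ D.bdry := by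
  refine TorusFib.FamilyData.mem_bdry.2 ⟨fun v hv => ?_, h.mem_faces, fun y hy => ?_⟩
  · obtain ⟨w, hw, rfl⟩ := face_subset_image h.mem_faces hv
    exact ⟨w, hw, rfl⟩
  · have hyD := convexHull_min (face_subset_Delta h.mem_faces) D.convex_Delta hy
    refine mem_frontier_iff.2 ⟨hyD, (mem_frontier_iff.1 hx).2.mono ?_⟩
    rw [h.nrm_eq]
    obtain ⟨σ₁, a₁, h₁⟩ := exists_isBary hyD
    rw [h₁.nrm_eq]
    exact nrm_anti (Finset.coe_subset.2 (h₁.subset_of_mem_convexHull h.mem_faces hy))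

theorem zero_notMem_of_bdry (hτ : σ ∈ D.bdry) : (0 : Fin N → ℝ) ∉ σ := fun h => by
  obtain ⟨u, hu⟩ := nrm_bdry_nonempty hτ
  have := hu.2 0 h
  simp at this

end FamilyData

end TorusFib

namespace TorusFib

variable {N : ℕ} {D : FamilyData N} {t : ℂ}

namespace FamilyData

variable {σ C : Finset (Fin N → ℝ)} {a : (Fin N → ℝ) → ℝ} {x : Fin N → ℝ}

/-! ### Supporting functions of the triangulation -/

theorem isBary_center (hσ : σ ∈ D.T.faces) :
    ∃ (a : (Fin N → ℝ) → ℝ) (y : Fin N → ℝ), D.IsBary σ a y := by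
  classical
  have hc : (0 : ℝ) < σ.card := by
    exact_mod_cast Finset.card_pos.2 (D.T.nonempty_of_mem_faces hσ)
  refine ⟨fun v => if v ∈ σ then (σ.card : ℝ)⁻¹ else 0, _, hσ, fun v hv => ?_, fun v hv => ?_, ?_,
    rfl⟩
  · simp only [if_pos hv]
    positivity
  · simp only [if_neg hv]
  · have : ∑ v ∈ σ, (if v ∈ σ then (σ.card : ℝ)⁻¹ else 0) = ∑ _v ∈ σ, (σ.card : ℝ)⁻¹ :=
      Finset.sum_congr rfl fun v hv => if_pos hv
    rw [this, Finset.sum_const, nsmul_eq_mul, mul_inv_cancel₀ hc.ne']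

/-- A point with all coordinates in C positive is interior to Δ, because C contains 0, and it avoids
the closed union of the simplices not containing C; by maximality, nearby points belong to C. -/
theorem eventually_mem_convexHull_facet (hC : C ∈ D.T.facets) {y : Fin N → ℝ}
    (hy : D.IsBary C a y) (d : Fin N → ℝ) :
    ∀ᶠ δ in 𝓝[>] (0 : ℝ), y + δ • d ∈ convexHull ℝ (C : Set (Fin N → ℝ)) := by
  have hint : y ∈ interior D.Delta := by
    refine mem_interior_iff.2 ⟨hy.mem_Delta, ?_⟩
    rw [hy.nrm_eq]
    refine Set.eq_empty_of_forall_notMem fun u hu => ?_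
    have := hu.2 0 (D.T_central C hC)
    simp at this
  have h1 := eventually_smul_mem_of_interior hint (d := d)
  have hclosed : IsClosed (⋃ C' ∈ {C' ∈ D.T.faces | ¬ C ⊆ C'},
      convexHull ℝ (C' : Set (Fin N → ℝ))) :=
    (finite_faces.subset fun _ h => h.1).isClosed_biUnion fun C' _ =>
      C'.finite_toSet.isClosed_convexHull ℝ
  have hy' : y ∈ (⋃ C' ∈ {C' ∈ D.T.faces | ¬ C ⊆ C'}, convexHull ℝ (C' : Set (Fin N → ℝ)))ᶜ := by
    intro h
    obtain ⟨C', hC', h⟩ := Set.mem_iUnion₂.1 h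
    exact hC'.2 (hy.subset_of_mem_convexHull hC'.1 h)
  have hcont : Continuous fun δ : ℝ => y + δ • d := by fun_prop
  have h2 : ∀ᶠ δ in 𝓝 (0 : ℝ), y + δ • d ∈
      (⋃ C' ∈ {C' ∈ D.T.faces | ¬ C ⊆ C'}, convexHull ℝ (C' : Set (Fin N → ℝ)))ᶜ :=
    hcont.continuousAt.eventually_mem (hclosed.isOpen_compl.mem_nhds (by simpa using hy'))
  filter_upwards [h1, h2.filter_mono nhdsWithin_le_nhds] with δ h1 h2
  obtain ⟨σ, b, hb⟩ := exists_isBary h1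
  by_cases h : C ⊆ σ
  · rw [hC.2 hb.mem_faces h]
    exact hb.mem_convexHull
  · exact absurd (Set.mem_iUnion₂.2 ⟨σ, ⟨hb.mem_faces, h⟩, hb.mem_convexHull⟩) h2

/-- The affine function that agrees with `lam` at the vertices of a maximal simplex lies above
`lam` elsewhere. -/
theorem exists_support (hC : C ∈ D.T.facets) : ∃ g : (Fin N → ℝ) →ᵃ[ℝ] ℝ,
    (∀ w ∈ D.A, emb w ∈ C → g (emb w) = D.lam w) ∧
      ∀ w ∈ D.A, emb w ∉ C → (D.lam w : ℝ) < g (emb w) := by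
  obtain ⟨psi, h1, h2, h3, h4, h5⟩ := D.lam_interior
  obtain ⟨g, hg⟩ := h1 C hC.1
  obtain ⟨a, y, hy⟩ := isBary_center hC.1
  -- Concavity on the segment from x through y to a point beyond y that still lies in the simplex,
  -- where psi and g agree.
  have hle : ∀ x ∈ D.Delta, psi x ≤ g x := by
    intro x hx
    obtain ⟨δ, hδ, hδ0⟩ :=
      ((eventually_mem_convexHull_facet hC hy (y - x)).and self_mem_nhdsWithin).exists
    have hδ0 : 0 < δ := hδ0
    have hz := convexHull_min (face_subset_Delta hC.1) D.convex_Delta hδ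
    have h1δ : (0 : ℝ) < 1 + δ := by linarith
    have ey : (δ / (1 + δ)) • x + (1 / (1 + δ)) • (y + δ • (y - x)) = y := by
      ext i
      simp only [Pi.add_apply, Pi.smul_apply, Pi.sub_apply, smul_eq_mul]
      field_simp
      ring
    have hab : δ / (1 + δ) + 1 / (1 + δ) = 1 := by field_simp; ring
    have hc := h4.2 hx hz (by positivity) (by positivity) hab
    have ha := Convex.combo_affine_apply (f := g) (x := x) (y := y + δ • (y - x)) hab
    rw [ey] at hc ha
    rw [hg hδ, hg hy.mem_convexHull, ha] at hc
    simp only [smul_eq_mul] at hc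
    have hp : 0 < δ / (1 + δ) := by positivity
    nlinarith
  refine ⟨g, fun w hw hwC => ?_, fun w hw hwC => ?_⟩
  · rw [← hg (subset_convexHull ℝ _ hwC)]
    exact h2 w hw (mem_vertices_of_mem hC.1 hwC)
  · have hl := hle _ (D.emb_mem_Delta hw)
    by_cases hv : emb w ∈ D.T.vertices
    · rw [← h2 w hw hv]
      refine lt_of_le_of_ne hl fun he => hwC ?_
      exact (D.T.vertex_mem_convexHull_iff hv hC.1).1 (h5 C hC g hg _ (D.emb_mem_Delta hw) he)
    · exact (h3 w hw hv).trans_le hl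

theorem exists_coord (hC : C ∈ D.T.faces) {v : Fin N → ℝ} (hv : v ∈ C) :
    ∃ f : (Fin N → ℝ) →ᵃ[ℝ] ℝ, f v = 1 ∧ ∀ v' ∈ C, v' ≠ v → f v' = 0 := by
  obtain ⟨s, hs, hi, htop⟩ := exists_subset_affineIndependent_affineSpan_eq_top
    (k := ℝ) (s := (C : Set (Fin N → ℝ))) (D.T.indep hC)
  let b : AffineBasis s ℝ (Fin N → ℝ) := ⟨fun p => p, hi, by simpa using htop⟩
  refine ⟨b.coord ⟨v, hs hv⟩, b.coord_apply_eq ⟨v, hs hv⟩, fun v' hv' hne => ?_⟩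
  exact b.coord_apply_ne (i := ⟨v, hs hv⟩) (j := ⟨v', hs hv'⟩) fun h =>
    hne (congrArg Subtype.val h).symm

theorem affine_sum (f : (Fin N → ℝ) →ᵃ[ℝ] ℝ) {ι : Type*} {S : Finset ι} {p : ι → ℝ}
    (z : ι → Fin N → ℝ) (h1 : ∑ i ∈ S, p i = 1) :
    f (∑ i ∈ S, p i • z i) = ∑ i ∈ S, p i * f (z i) := by
  rw [← Finset.affineCombination_eq_linear_combination S z p h1, Finset.map_affineCombination _ _ _ h1,
    Finset.affineCombination_eq_linear_combination _ _ _ h1]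
  simp

theorem neg_one_le_mul_log {p : ℝ} (hp : 0 < p) : -1 ≤ p * Real.log p := by
  have := Real.one_sub_inv_le_log_of_pos hp
  have h2 := mul_le_mul_of_nonneg_left this hp.le
  rw [mul_sub, mul_inv_cancel₀ hp.ne'] at h2
  linarith

theorem IsBary.sum_lattice (h : D.IsBary σ a x) {S : Finset (Fin N → ℤ)}
    (hS : (σ : Set (Fin N → ℝ)) ⊆ emb '' (S : Set (Fin N → ℤ))) :
    ∑ w ∈ S, a (emb w) = 1 ∧ ∑ w ∈ S, a (emb w) • emb w = x := by
  classical
  have := h.sum_superset (C := S.image emb) fun v hv => by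
    obtain ⟨w, hw, rfl⟩ := hS hv
    exact Finset.mem_image_of_mem _ hw
  rwa [Finset.sum_image fun _ _ _ _ h => emb_injective h,
    Finset.sum_image fun _ _ _ _ h => emb_injective h] at this

/-- The part of a Gibbs measure far from the supporting function is small. -/
theorem sum_gap_le {S : Finset (Fin N → ℤ)} (hS : S.Nonempty) (ht : 1 < ‖t‖)
    {ξ m : Fin N → ℝ} (hG : IsGibbs D t S ξ m) (h : D.IsBary σ a m)
    (hσ : (σ : Set (Fin N → ℝ)) ⊆ emb '' (S : Set (Fin N → ℤ))) {g : (Fin N → ℝ) →ᵃ[ℝ] ℝ}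
    (hg : ∀ w ∈ S, emb w ∈ σ → g (emb w) = D.lam w) :
    Real.log ‖t‖ * ∑ w ∈ S, wt D t ξ w / (∑ w ∈ S, wt D t ξ w) * (g (emb w) - D.lam w) ≤
      S.card := by
  have ht0 : t ≠ 0 := norm_pos_iff.1 (by linarith)
  obtain ⟨hZ, hp1, hpm⟩ := hG.sum_eq hS ht0
  obtain ⟨hq1, hqm⟩ := h.sum_lattice hσ
  set Z := ∑ w ∈ S, wt D t ξ w with hZdef
  set p : (Fin N → ℤ) → ℝ := fun w => wt D t ξ w / Z with hp
  have hpp : ∀ w, 0 < p w := fun w => div_pos (wt_pos ht0 ξ w) hZ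
  have hple : ∀ w ∈ S, p w ≤ 1 := fun w hw => by
    rw [← hp1]
    exact Finset.single_le_sum (f := p) (fun w _ => (hpp w).le) hw
  have hlog : ∀ w, Real.log (p w) = D.lam w * Real.log ‖t‖ + ξ ⬝ᵥ emb w - Real.log Z := by
    intro w
    have h1 : 0 < ‖t ^ D.lam w‖ := norm_pos_iff.2 (zpow_ne_zero _ ht0)
    rw [hp, Real.log_div (wt_pos ht0 ξ w).ne' hZ.ne', wt, Real.log_mul h1.ne' (Real.exp_ne_zero _),
      Real.log_exp, norm_zpow, Real.log_zpow]
  -- Apart from the term λ(w) log|t|, log p is affine in w, so its average against r depends only on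
  -- the mean of r and the average of λ. It is applied to p, where the average is at least -|S|, and
  -- to the barycentric coordinates, where it is at most 0.
  have key : ∀ r : (Fin N → ℤ) → ℝ, ∑ w ∈ S, r w = 1 → ∑ w ∈ S, r w • emb w = m →
      ∑ w ∈ S, r w * Real.log (p w) = Real.log ‖t‖ * ∑ w ∈ S, r w * D.lam w +
        ξ ⬝ᵥ m - Real.log Z := by
    intro r hr hm
    have e1 : ξ ⬝ᵥ m = ∑ w ∈ S, r w * (ξ ⬝ᵥ emb w) := by
      rw [← hm, dotProduct_sum]
      simp_rw [dotProduct_smul, smul_eq_mul]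
    have e2 : Real.log Z = ∑ w ∈ S, r w * Real.log Z := by rw [← Finset.sum_mul, hr, one_mul]
    rw [e1, e2, Finset.mul_sum, ← Finset.sum_add_distrib, ← Finset.sum_sub_distrib]
    refine Finset.sum_congr rfl fun w _ => ?_
    rw [hlog]
    ring
  have k1 := key p hp1 hpm
  have k2 := key _ hq1 hqm
  have b1 : -(S.card : ℝ) ≤ ∑ w ∈ S, p w * Real.log (p w) := by
    have : ∑ _w ∈ S, (-1 : ℝ) ≤ ∑ w ∈ S, p w * Real.log (p w) :=
      Finset.sum_le_sum fun w _ => neg_one_le_mul_log (hpp w)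
    simpa using this
  have b2 : ∑ w ∈ S, a (emb w) * Real.log (p w) ≤ 0 :=
    Finset.sum_nonpos fun w hw => mul_nonpos_of_nonneg_of_nonpos (h.nonneg _)
      (Real.log_nonpos (hpp w).le (hple w hw))
  have g1 : ∑ w ∈ S, p w * g (emb w) = g m := by rw [← affine_sum g emb hp1, hpm]
  have g2 : ∑ w ∈ S, a (emb w) * D.lam w = g m := by
    rw [← hqm, affine_sum g emb hq1]
    refine Finset.sum_congr rfl fun w hw => ?_
    by_cases hwσ : emb w ∈ σ
    · rw [hg w hw hwσ]
    · rw [h.zero _ hwσ, zero_mul, zero_mul]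
  simp_rw [mul_sub]
  rw [Finset.sum_sub_distrib, mul_sub]
  change Real.log ‖t‖ * ∑ w ∈ S, p w * g (emb w) - Real.log ‖t‖ * ∑ w ∈ S, p w * D.lam w ≤ _
  rw [g1, ← g2]
  linarith

/-- The supporting function exceeds λ by at least δ off C, so by `sum_gap_le` the mass off C is
O(1/log|t|). On C, test p - a against the affine functions dual to the vertices of C: both measures
have the same mean, so each difference is controlled by the mass off C. -/
theorem exists_concentration_facet (hC : C ∈ D.T.facets) : ∃ K : ℝ, 0 < K ∧ ∀ t : ℂ, 1 < ‖t‖ →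
    ∀ S ⊆ D.A, S.Nonempty → ∀ ξ m, IsGibbs D t S ξ m → ∀ σ a, D.IsBary σ a m → σ ⊆ C →
      (σ : Set (Fin N → ℝ)) ⊆ emb '' (S : Set (Fin N → ℤ)) → ∀ w ∈ S,
        |wt D t ξ w / (∑ w ∈ S, wt D t ξ w) - a (emb w)| ≤ K / Real.log ‖t‖ := by
  classical
  obtain ⟨g, hg1, hg2⟩ := exists_support hC
  obtain ⟨δ, hδ, hgap⟩ : ∃ δ : ℝ, 0 < δ ∧ ∀ w ∈ D.A, emb w ∉ C → δ ≤ g (emb w) - D.lam w := by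
    by_cases hne : (D.A.filter fun w => emb w ∉ C).Nonempty
    · obtain ⟨w₀, hw₀, hmin⟩ := Finset.exists_min_image _ (fun w => g (emb w) - D.lam w) hne
      obtain ⟨h1, h2⟩ := Finset.mem_filter.1 hw₀
      exact ⟨_, sub_pos.2 (hg2 w₀ h1 h2), fun w hw hwC => hmin w (Finset.mem_filter.2 ⟨hw, hwC⟩)⟩
    · exact ⟨1, one_pos, fun w hw hwC => absurd ⟨w, Finset.mem_filter.2 ⟨hw, hwC⟩⟩ hne⟩
  have hf : ∀ v : Fin N → ℝ, ∃ f : (Fin N → ℝ) →ᵃ[ℝ] ℝ, v ∈ C →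
      f v = 1 ∧ ∀ v' ∈ C, v' ≠ v → f v' = 0 := fun v => by
    by_cases hv : v ∈ C
    · obtain ⟨f, hf⟩ := exists_coord hC.1 hv
      exact ⟨f, fun _ => hf⟩
    · exact ⟨g, fun h => absurd h hv⟩
  choose f hf using hf
  -- The summand 1 gives M ≥ 1, which lets the same constant cover the points off C.
  set M : ℝ := 1 + ∑ v ∈ C, ∑ w ∈ D.A, |f v (emb w)| with hM
  have hM1 : 1 ≤ M := le_add_of_nonneg_right
    (Finset.sum_nonneg fun v _ => Finset.sum_nonneg fun w _ => abs_nonneg _)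
  have hMf : ∀ v ∈ C, ∀ w ∈ D.A, |f v (emb w)| ≤ M := fun v hv w hw => by
    have h1 := Finset.single_le_sum (f := fun w => |f v (emb w)|) (fun w _ => abs_nonneg _) hw
    have h2 := Finset.single_le_sum (f := fun v => ∑ w ∈ D.A, |f v (emb w)|)
      (fun v _ => Finset.sum_nonneg fun w _ => abs_nonneg _) hv
    exact h1.trans (h2.trans (by rw [hM]; linarith))
  have hA : (0 : ℝ) < D.A.card := by exact_mod_cast Finset.card_pos.2 (A_nonempty (D := D))
  refine ⟨M * (D.A.card / δ), by positivity, ?_⟩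
  intro t ht S hSA hS ξ m hG σ a h hσC hσS w hw
  have ht0 : t ≠ 0 := norm_pos_iff.1 (by linarith)
  have hlog : 0 < Real.log ‖t‖ := Real.log_pos ht
  have hgapsum := sum_gap_le hS ht hG h hσS fun w hw hwσ => hg1 w (hSA hw) (hσC hwσ)
  obtain ⟨hZ, hp1, hpm⟩ := hG.sum_eq hS ht0
  obtain ⟨hq1, hqm⟩ := h.sum_lattice hσS
  set Z := ∑ w ∈ S, wt D t ξ w with hZdef
  set p : (Fin N → ℤ) → ℝ := fun w => wt D t ξ w / Z with hp
  have hpp : ∀ w, 0 < p w := fun w => div_pos (wt_pos ht0 ξ w) hZ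
  change |p w - a (emb w)| ≤ _
  have hout : ∑ w ∈ S.filter (fun w => emb w ∉ C), p w ≤ D.A.card / δ / Real.log ‖t‖ := by
    rw [div_div, le_div_iff₀ (by positivity)]
    have h1 : ∑ w ∈ S.filter (fun w => emb w ∉ C), p w * δ ≤
        ∑ w ∈ S, p w * (g (emb w) - D.lam w) := by
      refine (Finset.sum_le_sum fun w hw => ?_).trans
        (Finset.sum_le_sum_of_subset_of_nonneg (Finset.filter_subset _ _) fun w hw _ => ?_)
      · obtain ⟨h1, h2⟩ := Finset.mem_filter.1 hw
        exact mul_le_mul_of_nonneg_left (hgap w (hSA h1) h2) (hpp w).le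
      · refine mul_nonneg (hpp w).le ?_
        by_cases hwC : emb w ∈ C
        · rw [hg1 w (hSA hw) hwC, sub_self]
        · linarith [hgap w (hSA hw) hwC]
    have h2 : (S.card : ℝ) ≤ D.A.card := by exact_mod_cast Finset.card_le_card hSA
    rw [← Finset.sum_mul] at h1
    have h3 := mul_le_mul_of_nonneg_left h1 hlog.le
    nlinarith
  rw [mul_div_assoc]
  by_cases hwC : emb w ∈ C
  · have e1 : ∑ w' ∈ S, (p w' - a (emb w')) * f (emb w) (emb w') = 0 := by
      simp_rw [sub_mul]
      rw [Finset.sum_sub_distrib, ← affine_sum _ emb hp1, ← affine_sum _ emb hq1, hpm, hqm, sub_self]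
    rw [← Finset.sum_filter_add_sum_filter_not S (fun w => emb w ∈ C)] at e1
    have e2 : ∑ w' ∈ S.filter (fun w => emb w ∈ C), (p w' - a (emb w')) * f (emb w) (emb w') =
        p w - a (emb w) := by
      rw [Finset.sum_eq_single w]
      · rw [(hf _ hwC).1, mul_one]
      · intro w' hw' hne
        rw [(hf _ hwC).2 _ (Finset.mem_filter.1 hw').2 fun h => hne (emb_injective h), mul_zero]
      · exact fun h => absurd (Finset.mem_filter.2 ⟨hw, hwC⟩) h
    rw [e2] at e1
    have e3 : p w - a (emb w) = -∑ w' ∈ S.filter (fun w => emb w ∉ C),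
        (p w' - a (emb w')) * f (emb w) (emb w') := by linarith
    rw [e3, abs_neg]
    refine (Finset.abs_sum_le_sum_abs _ _).trans (le_trans ?_
      (mul_le_mul_of_nonneg_left hout (by linarith)))
    rw [Finset.mul_sum]
    refine Finset.sum_le_sum fun w' hw' => ?_
    obtain ⟨h1, h2⟩ := Finset.mem_filter.1 hw'
    rw [h.zero _ fun h => h2 (hσC h), sub_zero, abs_mul, abs_of_pos (hpp w'), mul_comm]
    exact mul_le_mul_of_nonneg_right (hMf _ hwC _ (hSA h1)) (hpp w').le
  · rw [h.zero _ fun h => hwC (hσC h), sub_zero, abs_of_pos (hpp w)]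
    have h1 := Finset.single_le_sum (f := p) (fun w _ => (hpp w).le)
      (Finset.mem_filter.2 ⟨hw, hwC⟩ : w ∈ S.filter fun w => emb w ∉ C)
    have h2 : 0 ≤ D.A.card / δ / Real.log ‖t‖ := by positivity
    nlinarith

/-- For large `‖t‖` the Gibbs measure of mean `m` is close to the barycentric coordinates of `m`. -/
theorem exists_concentration (D : FamilyData N) : ∃ K : ℝ, 0 < K ∧ ∀ t : ℂ, 1 < ‖t‖ →
    ∀ S ⊆ D.A, S.Nonempty → ∀ ξ m, IsGibbs D t S ξ m → ∀ σ a, D.IsBary σ a m →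
      (σ : Set (Fin N → ℝ)) ⊆ emb '' (S : Set (Fin N → ℤ)) → ∀ w ∈ S,
        |wt D t ξ w / (∑ w ∈ S, wt D t ξ w) - a (emb w)| ≤ K / Real.log ‖t‖ := by
  choose! K hK0 hK using fun C (hC : C ∈ D.T.facets) => exists_concentration_facet hC
  have hfin : D.T.facets.Finite := finite_faces.subset D.T.facets_subset
  refine ⟨1 + ∑ C ∈ hfin.toFinset, K C, ?_, ?_⟩
  · have : 0 ≤ ∑ C ∈ hfin.toFinset, K C :=
      Finset.sum_nonneg fun C hC => (hK0 C (hfin.mem_toFinset.1 hC)).le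
    linarith
  · intro t ht S hSA hS ξ m hG σ a h hσS w hw
    obtain ⟨C, hC, hσC⟩ := exists_facet h.mem_faces
    refine (hK C hC t ht S hSA hS ξ m hG σ a h hσC hσS w hw).trans ?_
    refine div_le_div_of_nonneg_right ?_ (Real.log_pos ht).le
    have := Finset.single_le_sum (f := K) (fun C hC => (hK0 C (hfin.mem_toFinset.1 hC)).le)
      (hfin.mem_toFinset.2 hC)
    linarith

end FamilyData

end TorusFib

namespace TorusFib

variable {N : ℕ} {D : FamilyData N} {t : ℂ}

open FamilyData

/-! ### Cells of the cover -/

variable {V : Finset (Fin N → ℝ) → Set (Fin N → ℝ)} {τ : Finset (Fin N → ℝ)}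

namespace IsSmallCover

theorem subset_frontier (hV : IsSmallCover D V) (hτ : τ ∈ D.bdry) : V τ ⊆ frontier D.Delta := by
  obtain ⟨O, -, hO⟩ := hV.isOpen τ hτ
  rw [hO]
  exact Set.inter_subset_right

theorem closure_subset_frontier (hV : IsSmallCover D V) (hτ : τ ∈ D.bdry) :
    closure (V τ) ⊆ frontier D.Delta :=
  closure_minimal (hV.subset_frontier hτ) isClosed_frontier

theorem W_subset_frontier (hV : IsSmallCover D V) (hτ : τ ∈ D.bdry) :
    W D V τ ⊆ frontier D.Delta := fun _ hs => hV.closure_subset_frontier hτ hs.1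

/-- The barycentric coordinates with respect to the vertices of `τ` are bounded below on `V τ`. -/
theorem exists_le_bary_vertex (hV : IsSmallCover D V) (hτ : τ ∈ D.bdry) {v : Fin N → ℝ}
    (hv : v ∈ τ) : ∃ c : ℝ, 0 < c ∧ ∀ s ∈ closure (V τ), ∀ σ a, D.IsBary σ a s → c ≤ a v := by
  classical
  set Q : Set (Fin N → ℝ) := ⋃ τ' ∈ {τ' ∈ (D.bdry : Set (Finset (Fin N → ℝ))) | v ∉ τ'},
    convexHull ℝ (τ' : Set (Fin N → ℝ)) with hQ
  have hQc : IsClosed Q := (D.bdry.finite_toSet.subset fun _ h => h.1).isClosed_biUnion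
    fun τ' _ => τ'.finite_toSet.isClosed_convexHull ℝ
  have hVc : IsCompact (closure (V τ)) := D.isCompact_Delta.of_isClosed_subset isClosed_closure
    ((hV.closure_subset_frontier hτ).trans frontier_subset)
  have hdisj : Disjoint (closure (V τ)) Q := by
    rw [hQ, Set.disjoint_iUnion₂_right]
    exact fun τ' hτ' => hV.star τ hτ τ' hτ'.1 fun h => hτ'.2 (h hv)
  obtain ⟨δ, hδ, hth⟩ := hdisj.exists_thickenings hVc hQc
  obtain ⟨M, hM⟩ := D.isCompact_Delta.isBounded.exists_norm_le
  have hM0 : 0 ≤ M := (norm_nonneg _).trans (hM _ D.zero_mem_Delta)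
  -- Projecting s from v to the opposite face moves it by a_v·(v - x), of norm at most a_v(2M + 1),
  -- into a boundary simplex not containing v, which is at distance at least δ. The value 1 covers
  -- the case that v is the whole carrier.
  refine ⟨min 1 (δ / (2 * M + 1)), by positivity, fun s hs σ a h => ?_⟩
  have hσ := h.mem_bdry (hV.closure_subset_frontier hτ hs)
  have hvσ : v ∈ σ := by
    by_contra hvσ
    exact hdisj.le_bot ⟨hs, Set.mem_iUnion₂.2 ⟨σ, ⟨hσ, hvσ⟩, h.mem_convexHull⟩⟩
  have hsum := Finset.add_sum_erase σ a hvσ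
  have hsum' := Finset.add_sum_erase σ (fun v => a v • v) hvσ
  rw [h.sum_one] at hsum
  rw [h.sum_eq] at hsum'
  by_cases hne : (σ.erase v).Nonempty
  · have hpos : 0 < ∑ w ∈ σ.erase v, a w :=
      Finset.sum_pos (fun w hw => h.pos w (Finset.mem_of_mem_erase hw)) hne
    have hb : ∑ w ∈ σ.erase v, a w = 1 - a v := by linarith
    set b := 1 - a v with hbdef
    set x : Fin N → ℝ := ∑ w ∈ σ.erase v, (b⁻¹ * a w) • w with hx
    have hface : σ.erase v ∈ D.T.faces :=
      D.T.down_closed h.mem_faces (Finset.erase_subset _ _) hne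
    have hxc : x ∈ convexHull ℝ ((σ.erase v : Finset (Fin N → ℝ)) : Set (Fin N → ℝ)) := by
      refine Finset.mem_convexHull'.2 ⟨fun w => b⁻¹ * a w, fun w hw => ?_, ?_, rfl⟩
      · have := h.nonneg w
        rw [hb] at hpos
        positivity
      · rw [← Finset.mul_sum, hb]
        rw [hb] at hpos
        exact inv_mul_cancel₀ hpos.ne'
    have hxD : x ∈ D.Delta :=
      convexHull_min (face_subset_Delta hface) D.convex_Delta hxc
    have hbd : σ.erase v ∈ D.bdry := by
      refine mem_bdry.2 ⟨fun y hy => (mem_bdry.1 hσ).1 y (Finset.mem_of_mem_erase hy), hface, ?_⟩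
      exact (convexHull_mono (Finset.coe_subset.2 (Finset.erase_subset _ _))).trans
        (mem_bdry.1 hσ).2.2
    have hxQ : x ∈ Q := Set.mem_iUnion₂.2 ⟨_, ⟨hbd, Finset.notMem_erase _ _⟩, hxc⟩
    rw [hb] at hpos
    have hsx : s - x = a v • (v - x) := by
      have : ∑ w ∈ σ.erase v, a w • w = b • x := by
        rw [hx, Finset.smul_sum]
        refine Finset.sum_congr rfl fun w _ => ?_
        rw [smul_smul, mul_inv_cancel_left₀ hpos.ne']
      rw [← hsum', this, hbdef]
      module
    have hdist : δ ≤ dist s x := by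
      by_contra hlt
      refine Set.disjoint_left.1 hth (Metric.self_subset_thickening hδ _ hs) ?_
      exact Metric.mem_thickening_iff.2 ⟨x, hxQ, not_le.1 hlt⟩
    rw [dist_eq_norm, hsx, norm_smul, Real.norm_of_nonneg (h.nonneg v)] at hdist
    have hvx : ‖v - x‖ ≤ 2 * M + 1 := by
      have := norm_sub_le v x
      have := hM v (bdry_subset hσ hvσ)
      have := hM x hxD
      linarith
    refine (min_le_right _ _).trans ((div_le_iff₀ (by positivity)).2 (hdist.trans ?_))
    exact mul_le_mul_of_nonneg_left hvx (h.nonneg v)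
  · rw [Finset.not_nonempty_iff_eq_empty] at hne
    rw [hne, Finset.sum_empty, add_zero] at hsum
    rw [hsum]
    exact min_le_left _ _

theorem exists_le_bary (hV : IsSmallCover D V) : ∃ c : ℝ, 0 < c ∧ ∀ τ ∈ D.bdry, ∀ v ∈ τ,
    ∀ s ∈ closure (V τ), ∀ σ a, D.IsBary σ a s → c ≤ a v := by
  classical
  choose! c hc0 hc using fun (q : Finset (Fin N → ℝ) × (Fin N → ℝ))
    (hq : q.1 ∈ D.bdry ∧ q.2 ∈ q.1) => hV.exists_le_bary_vertex hq.1 hq.2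
  set Q : Finset (Finset (Fin N → ℝ) × (Fin N → ℝ)) :=
    (D.bdry ×ˢ (D.A.image emb)).filter fun q => q.2 ∈ q.1 with hQ
  have hmem : ∀ q : Finset (Fin N → ℝ) × (Fin N → ℝ), q.1 ∈ D.bdry → q.2 ∈ q.1 → q ∈ Q := by
    intro q h1 h2
    refine Finset.mem_filter.2 ⟨Finset.mem_product.2 ⟨h1, ?_⟩, h2⟩
    obtain ⟨w, hw, he⟩ := (mem_bdry.1 h1).1 _ h2
    exact he ▸ Finset.mem_image_of_mem _ hw
  have hQ' : ∀ q ∈ Q, q.1 ∈ D.bdry ∧ q.2 ∈ q.1 := fun q hq => by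
    obtain ⟨h1, h2⟩ := Finset.mem_filter.1 hq
    exact ⟨(Finset.mem_product.1 h1).1, h2⟩
  by_cases hne : Q.Nonempty
  · obtain ⟨q₀, hq₀, hmin⟩ := Finset.exists_min_image Q c hne
    refine ⟨c q₀, hc0 _ (hQ' _ hq₀), fun τ hτ v hv s hs σ a h => ?_⟩
    exact (hmin _ (hmem (τ, v) hτ hv)).trans (hc (τ, v) ⟨hτ, hv⟩ s hs σ a h)
  · exact ⟨1, one_pos, fun τ hτ v hv => absurd ⟨_, hmem (τ, v) hτ hv⟩ hne⟩

end IsSmallCover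

namespace IsPartition

variable {ρ0 : Finset (Fin N → ℝ) → (Fin N → ℝ) → ℝ} {s : Fin N → ℝ}

/-- If ρ⁰_{τ'} is nonzero at s, the relatively open set V_{τ'} contains s and so meets V_τ, which
makes τ and τ' comparable; proper supersets of τ are excluded in the definition of W_τ. -/
theorem subset_of_ne_zero (hρ : IsPartition D V ρ0) (hV : IsSmallCover D V) (hτ : τ ∈ D.bdry)
    (hs : s ∈ W D V τ) {τ' : Finset (Fin N → ℝ)} (hτ' : τ' ∈ D.bdry) (h : ρ0 τ' s ≠ 0) :
    τ' ⊆ τ := by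
  have hsV : s ∈ V τ' := hρ.subord τ' hτ' (subset_closure ⟨hV.W_subset_frontier hτ hs, h⟩)
  obtain ⟨O, hO, hVO⟩ := hV.isOpen τ' hτ'
  have hsO : s ∈ O := by rw [hVO] at hsV; exact hsV.1
  obtain ⟨y, hyO, hyV⟩ := mem_closure_iff.1 hs.1 O hO hsO
  have hyV' : y ∈ V τ' := by rw [hVO]; exact ⟨hyO, hV.subset_frontier hτ hyV⟩
  rcases hV.nested τ hτ τ' hτ' ⟨y, hyV, hyV'⟩ with h1 | h1
  · by_contra h2
    exact hs.2 (Set.mem_iUnion₂.2 ⟨τ', ⟨hτ', ⟨h1, h2⟩⟩, hsV⟩)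
  · exact h1

theorem rho_eq_zero (hρ : IsPartition D V ρ0) (hV : IsSmallCover D V) (hτ : τ ∈ D.bdry)
    (hs : s ∈ W D V τ) {w : Fin N → ℤ} (hw0 : w ≠ 0) (hw : emb w ∉ τ) : rho D ρ0 w s = 0 := by
  classical
  rw [rho, if_neg hw0]
  refine Finset.sum_eq_zero fun τ' hτ' => ?_
  obtain ⟨h1, h2⟩ := Finset.mem_filter.1 hτ'
  by_contra h
  exact hw (hρ.subset_of_ne_zero hV hτ hs h1 h h2)

theorem rho_mem_Icc (hρ : IsPartition D V ρ0) (hs : s ∈ frontier D.Delta) (w : Fin N → ℤ) :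
    rho D ρ0 w s ∈ Set.Icc (0 : ℝ) 1 := by
  classical
  rw [rho]
  split_ifs with h
  · exact ⟨zero_le_one, le_rfl⟩
  · refine ⟨Finset.sum_nonneg fun τ' hτ' => hρ.nonneg τ' (Finset.mem_filter.1 hτ').1 s hs, ?_⟩
    rw [← hρ.sum_one s hs]
    exact Finset.sum_le_sum_of_subset_of_nonneg (Finset.filter_subset _ _)
      fun τ' hτ' _ => hρ.nonneg τ' hτ' s hs

/-- Some ρ⁰_{τ'} is positive at s, and τ' is a face of τ, so each of its vertices will do. This
keeps P_t from being the zero polynomial. -/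
theorem exists_rho_pos (hρ : IsPartition D V ρ0) (hV : IsSmallCover D V) (hτ : τ ∈ D.bdry)
    (hs : s ∈ W D V τ) : ∃ w ∈ D.A, emb w ∈ τ ∧ 0 < rho D ρ0 w s := by
  classical
  have hsf := hV.W_subset_frontier hτ hs
  obtain ⟨τ', hτ', h⟩ : ∃ τ' ∈ D.bdry, ρ0 τ' s ≠ 0 := by
    by_contra hcon
    push Not at hcon
    have := hρ.sum_one s hsf
    rw [Finset.sum_eq_zero hcon] at this
    exact zero_ne_one this
  have hsub := hρ.subset_of_ne_zero hV hτ hs hτ' h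
  obtain ⟨v, hv⟩ := D.T.nonempty_of_mem_faces (mem_bdry.1 hτ').2.1
  obtain ⟨w, hw, rfl⟩ := (mem_bdry.1 hτ').1 v hv
  refine ⟨w, hw, hsub hv, ?_⟩
  have hw0 : w ≠ 0 := by
    rintro rfl
    rw [emb_zero] at hv
    exact zero_notMem_of_bdry hτ' hv
  rw [rho, if_neg hw0]
  refine (lt_of_le_of_ne (hρ.nonneg τ' hτ' s hsf) h.symm).trans_le ?_
  exact Finset.single_le_sum (f := fun τ' => ρ0 τ' s)
    (fun τ' hτ' => hρ.nonneg τ' (Finset.mem_filter.1 hτ').1 s hsf)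
    (Finset.mem_filter.2 ⟨hτ', hv⟩)

end IsPartition

/-! ### The central ball -/

/-- The factor 4 leaves barycentric weight at least 3/4 at the origin, so that more than half
remains after a concentration error below 1/4. -/
theorem exists_ball (D : FamilyData N) : ∃ β₀ : ℝ, 0 < β₀ ∧ ∀ β : ℝ, 0 < β → β < β₀ →
    ∀ m ∈ centralBall N β, (4 : ℝ) • m ∈ D.Delta := by
  have h : {m : Fin N → ℝ | (4 : ℝ) • m ∈ D.Delta} ∈ 𝓝 (0 : Fin N → ℝ) := by
    have hc : ContinuousAt (fun m : Fin N → ℝ => (4 : ℝ) • m) 0 := by fun_prop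
    exact hc.preimage_mem_nhds (by simpa using mem_interior_iff_mem_nhds.1 D.zero_mem_interior)
  obtain ⟨r, hr, hsub⟩ := Metric.mem_nhds_iff.1 h
  refine ⟨r, hr, fun β hβ hβr m hm => hsub ?_⟩
  rw [mem_ball_zero_iff, pi_norm_lt_iff hr]
  intro i
  have h1 : m i ^ 2 ≤ ∑ i, m i ^ 2 :=
    Finset.single_le_sum (f := fun i => m i ^ 2) (fun i _ => sq_nonneg _) (Finset.mem_univ i)
  have h2 : ∑ i, m i ^ 2 < β ^ 2 := hm
  rw [Real.norm_eq_abs]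
  exact (abs_lt_of_sq_lt_sq (h1.trans_lt h2) hβ.le).trans hβr

theorem FamilyData.frontier_nonempty (hτ : τ ∈ D.bdry) : (frontier D.Delta).Nonempty :=
  (bdry_nonempty hτ).mono ((subset_convexHull ℝ _).trans (mem_bdry.1 hτ).2.2)

/-- Central points have most of their barycentric weight at the origin. -/
theorem FamilyData.IsBary.le_zero_of_central {σ : Finset (Fin N → ℝ)} {a : (Fin N → ℝ) → ℝ}
    {m : Fin N → ℝ} (h : D.IsBary σ a m) (h4 : (4 : ℝ) • m ∈ D.Delta) : 3 / 4 ≤ a 0 := by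
  obtain ⟨σ', a', h'⟩ := exists_isBary h4
  obtain ⟨σ₁, h1⟩ := h'.smul (θ := 1 / 4) (by norm_num) (by norm_num)
  rw [smul_smul, show (1 / 4 * 4 : ℝ) = 1 by norm_num, one_smul] at h1
  rw [(h.unique h1).2]
  have := h'.nonneg 0
  simp only [if_true]
  linarith

theorem FamilyData.lt_one_of_smul_subset {β ε : ℝ} (hτ : τ ∈ D.bdry)
    (h4 : ∀ m ∈ centralBall N β, (4 : ℝ) • m ∈ D.Delta)
    (hsub : ε • D.Delta ⊆ centralBall N β) : ε < 1 := by
  obtain ⟨x, hx⟩ := frontier_nonempty hτ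
  obtain ⟨hxD, u, hu⟩ := mem_frontier_iff.1 hx
  have h1 := normals_ge hu.1 (h4 _ (hsub (Set.smul_mem_smul_set hxD)))
  rw [dotProduct_smul, dotProduct_smul, hu.2 x rfl] at h1
  simp only [smul_eq_mul] at h1
  linarith

end TorusFib

namespace TorusFib

variable {N : ℕ} {D : FamilyData N} {t : ℂ} {τ : Finset (Fin N → ℝ)}

open FamilyData

/-! ### Rays from the boundary to the shrunken polytope -/

/-- The combination of the normals at `x` with coefficients `f`. -/
noncomputable def shift (D : FamilyData N) (x : Fin N → ℝ) (f : (Fin N → ℤ) → ℝ) : Fin N → ℝ :=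
  ∑ j ∈ (finite_nrm (D := D) (X := {x})).toFinset, f j • emb j

theorem shift_congr {x : Fin N → ℝ} {f g : (Fin N → ℤ) → ℝ} (h : ∀ j ∈ D.nrm {x}, f j = g j) :
    shift D x f = shift D x g :=
  Finset.sum_congr rfl fun j hj => by rw [h j (finite_nrm.mem_toFinset.1 hj)]

-- Adding multiples of the normals at x changes the logarithms of exactly those coordinates that are
-- normal to the face of x.
open Classical in
theorem TauCoords.shift_dotProduct (c : TauCoords D τ) {x : Fin N → ℝ}
    (hx : D.nrm {x} ⊆ D.nrm τ) (f : (Fin N → ℤ) → ℝ) (i : Fin N) :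
    shift D x f ⬝ᵥ emb (c.b i) = if c.dual i ∈ D.nrm {x} then f (c.dual i) else 0 := by
  have key : ∀ j ∈ D.nrm {x}, emb j ⬝ᵥ emb (c.b i) = if j = c.dual i then 1 else 0 := by
    intro j hj
    obtain ⟨i', -, rfl⟩ := c.nrm_eq ▸ hx hj
    rw [emb_dotProduct, dual, dualVec_dotProduct_basis, ← dual]
    by_cases h : i' = i
    · rw [if_pos h, if_pos (by rw [h])]; simp
    · rw [if_neg h, if_neg fun h' => h (c.dual_injective h')]; simp
  rw [shift, sum_dotProduct]
  have : ∑ j ∈ (finite_nrm (D := D) (X := {x})).toFinset, (f j • emb j) ⬝ᵥ emb (c.b i) =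
      ∑ j ∈ (finite_nrm (D := D) (X := {x})).toFinset, if c.dual i = j then f j else 0 :=
    Finset.sum_congr rfl fun j hj => by
      rw [smul_dotProduct, key j (finite_nrm.mem_toFinset.1 hj), smul_eq_mul]
      by_cases h : j = c.dual i
      · rw [if_pos h, if_pos h.symm, mul_one]
      · rw [if_neg h, if_neg (Ne.symm h), mul_zero]
  rw [this, Finset.sum_ite_eq]
  simp only [Set.Finite.mem_toFinset]

/-- Nonpositive multiples of the inner normals at x form the outer normal cone; this supplies the
variational inequality along a ray. -/
theorem shift_dotProduct_sub_nonpos {x y : Fin N → ℝ} (hy : y ∈ D.Delta) {f : (Fin N → ℤ) → ℝ}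
    (hf : ∀ j ∈ D.nrm {x}, f j ≤ 0) : shift D x f ⬝ᵥ (y - x) ≤ 0 := by
  rw [shift, sum_dotProduct]
  refine Finset.sum_nonpos fun j hj => ?_
  have hj := finite_nrm.mem_toFinset.1 hj
  rw [smul_dotProduct, dotProduct_sub, hj.2 x rfl, smul_eq_mul]
  have := normals_ge hj.1 hy
  exact mul_nonpos_of_nonpos_of_nonneg (hf j hj) (by linarith)

theorem TauCoords.isGibbs_congr (c : TauCoords D τ) {X : Set (Fin N → ℝ)}
    (hX : D.nrm X ⊆ D.nrm τ) {ξ₁ ξ₂ m : Fin N → ℝ}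
    (h : ∀ i, c.dual i ∉ D.nrm X → ξ₁ ⬝ᵥ emb (c.b i) = ξ₂ ⬝ᵥ emb (c.b i)) :
    IsGibbs D t (D.faceA X) ξ₁ m ↔ IsGibbs D t (D.faceA X) ξ₂ m := by
  refine TorusFib.isGibbs_congr (C := ξ₁ ⬝ᵥ emb c.Om - ξ₂ ⬝ᵥ emb c.Om) fun w hw => ?_
  have : ∑ i, (c.expo w i : ℝ) * (ξ₁ ⬝ᵥ emb (c.b i)) =
      ∑ i, (c.expo w i : ℝ) * (ξ₂ ⬝ᵥ emb (c.b i)) := by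
    refine Finset.sum_congr rfl fun i _ => ?_
    by_cases hi : c.dual i ∈ D.nrm X
    · rw [(c.expo_eq_zero_iff (c.dual_mem_iff.1 (hX hi))).2 ((mem_faceA.1 hw).2.2 _ hi)]
      simp
    · rw [h i hi]
  rw [c.sum_expo, c.sum_expo] at this
  linarith

theorem exists_chart {x : Fin N → ℝ} (hx : x ∈ frontier D.Delta) :
    ∃ τ ∈ D.bdry, ∃ _ : TauCoords D τ, D.nrm (τ : Set (Fin N → ℝ)) = D.nrm {x} := by
  obtain ⟨σ, a, h⟩ := exists_isBary (frontier_subset hx)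
  obtain ⟨c⟩ := exists_tauCoords (h.mem_bdry hx)
  exact ⟨σ, h.mem_bdry hx, c, h.nrm_eq.symm⟩

/-- Data of the normal ray through the boundary point `s`: it starts at the point `ε • s'` with
Gibbs parameter `ξ'`, and `κ` gives the ratios of the normal coordinates of `s` and `ε • s'`. -/
structure IsRay (D : FamilyData N) (t : ℂ) (ε : ℝ) (s s' ξ' : Fin N → ℝ)
    (κ : (Fin N → ℤ) → ℝ) : Prop where
  mem : s' ∈ D.fc {s}
  gibbs' : IsGibbs D t D.A ξ' (ε • s')
  kappa : ∀ j ∈ D.nrm {s'}, κ j ∈ Set.Icc (0 : ℝ) 1 ∧ (κ j = 0 ↔ j ∈ D.nrm {s})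
  gibbs : IsGibbs D t (D.faceA {s}) (ξ' + shift D s' fun j => Real.log (κ j)) s

/-- The Gibbs parameters of the points of a ray. -/
noncomputable def rayParam (D : FamilyData N) (s' ξ' : Fin N → ℝ) (κ : (Fin N → ℤ) → ℝ) (u : ℝ) :
    Fin N → ℝ := ξ' + shift D s' fun j => Real.log ((1 - u) * κ j + u)

/-- `m` lies on the ray. -/
def OnRay (D : FamilyData N) (t : ℂ) (s s' ξ' : Fin N → ℝ) (κ : (Fin N → ℤ) → ℝ)
    (m : Fin N → ℝ) : Prop :=
  m = s ∨ ∃ u ∈ Set.Ioc (0 : ℝ) 1, IsGibbs D t D.A (rayParam D s' ξ' κ u) m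

namespace IsRay

variable {ε : ℝ} {s s' ξ' : Fin N → ℝ} {κ : (Fin N → ℤ) → ℝ}

theorem nrm_subset (h : IsRay D t ε s s' ξ' κ) : D.nrm {s} ⊆ D.nrm {s'} := fun u hu =>
  ⟨hu.1, fun x hx => by rw [Set.mem_singleton_iff.1 hx]; exact h.mem.2 u hu⟩

theorem mem_Delta (h : IsRay D t ε s s' ξ' κ) : s' ∈ D.Delta := h.mem.1

theorem mem_frontier (h : IsRay D t ε s s' ξ' κ) (hs : s ∈ frontier D.Delta) :
    s' ∈ frontier D.Delta :=
  mem_frontier_iff.2 ⟨h.mem_Delta, (mem_frontier_iff.1 hs).2.mono h.nrm_subset⟩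

theorem pos (h : IsRay D t ε s s' ξ' κ) {u : ℝ} (hu : u ∈ Set.Ioc (0 : ℝ) 1) {j : Fin N → ℤ}
    (hj : j ∈ D.nrm {s'}) : 0 < (1 - u) * κ j + u ∧ (1 - u) * κ j + u ≤ 1 := by
  obtain ⟨⟨h0, h1⟩, -⟩ := h.kappa j hj
  obtain ⟨h2, h3⟩ := hu
  have : 0 ≤ (1 - u) * κ j := mul_nonneg (by linarith) h0
  exact ⟨by linarith, by nlinarith⟩

/-- As for the nearest point of a convex set: the sum of the two inequalities contradicts strict
monotonicity of the Gibbs mean unless the feet coincide. -/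
theorem eq_of_vi (ht : t ≠ 0) (hε : 0 < ε) {s₁ s₁' s₂ s₂' ξ₁' ξ₂' : Fin N → ℝ}
    {κ₁ κ₂ : (Fin N → ℤ) → ℝ} (h₁ : IsRay D t ε s₁ s₁' ξ₁' κ₁) (h₂ : IsRay D t ε s₂ s₂' ξ₂' κ₂)
    {ξ : Fin N → ℝ} (v₁ : (ξ - ξ₁') ⬝ᵥ (s₂' - s₁') ≤ 0) (v₂ : (ξ - ξ₂') ⬝ᵥ (s₁' - s₂') ≤ 0) :
    s₁' = s₂' ∧ ξ₁' = ξ₂' := by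
  obtain ⟨e1, e2⟩ := IsGibbs.unique_A ht h₁.gibbs' h₂.gibbs' (by
    rw [← smul_sub, dotProduct_smul, smul_eq_mul]
    refine mul_nonpos_of_nonneg_of_nonpos hε.le ?_
    simp only [sub_dotProduct, dotProduct_sub] at v₁ v₂ ⊢
    linarith)
  exact ⟨smul_right_injective _ hε.ne' e1, e2⟩

/-- The coefficients log κ_j are nonpositive since κ_j ≤ 1; where κ_j = 0 the convention log 0 = 0
simply contributes nothing. -/
theorem vi (h : IsRay D t ε s s' ξ' κ) {x : Fin N → ℝ} (hx : x ∈ D.Delta) :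
    (ξ' + (shift D s' fun j => Real.log (κ j)) - ξ') ⬝ᵥ (x - s') ≤ 0 := by
  rw [add_sub_cancel_left]
  exact shift_dotProduct_sub_nonpos hx fun j hj =>
    Real.log_nonpos (h.kappa j hj).1.1 (h.kappa j hj).1.2

theorem kappa_pos (h : IsRay D t ε s s' ξ' κ) {j : Fin N → ℤ} (hj : j ∈ D.nrm {s'})
    (hjs : j ∉ D.nrm {s}) : 0 < κ j :=
  lt_of_le_of_ne (h.kappa j hj).1.1 fun h0 => hjs ((h.kappa j hj).2.1 h0.symm)

/-- The point s fixes its parameter only up to functionals constant on its face. Both feet lie in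
that face, so the variational inequality can be transferred between the two parameters. The ratios κ
are then compared in a chart at the foot. -/
theorem unique (ht : t ≠ 0) (hε : 0 < ε) (hs : s ∈ frontier D.Delta)
    {s₁' s₂' ξ₁' ξ₂' : Fin N → ℝ}
    {κ₁ κ₂ : (Fin N → ℤ) → ℝ} (h₁ : IsRay D t ε s s₁' ξ₁' κ₁) (h₂ : IsRay D t ε s s₂' ξ₂' κ₂) :
    s₁' = s₂' ∧ ξ₁' = ξ₂' ∧ ∀ j ∈ D.nrm {s₁'}, κ₁ j = κ₂ j := by
  have hX := Set.singleton_nonempty s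
  have hXD := Set.singleton_subset_iff.2 (frontier_subset hs)
  obtain ⟨-, hd⟩ := IsGibbs.unique hX hXD ht h₁.gibbs h₂.gibbs (by simp)
  have hsp : ∀ x ∈ D.fc {s}, ∀ y ∈ D.fc {s}, x - y ∈ vectorSpan ℝ (D.fc {s}) :=
    fun x hx y hy => vsub_mem_vectorSpan ℝ hx hy
  obtain ⟨rfl, rfl⟩ := eq_of_vi ht hε h₁ h₂ (h₁.vi h₂.mem_Delta) (by
    have e := hd _ (hsp _ h₁.mem _ h₂.mem)
    have v := h₂.vi h₁.mem_Delta
    simp only [sub_dotProduct] at e v ⊢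
    linarith)
  refine ⟨rfl, rfl, fun j hj => ?_⟩
  by_cases hjs : j ∈ D.nrm {s}
  · rw [((h₁.kappa j hj).2).2 hjs, ((h₂.kappa j hj).2).2 hjs]
  · obtain ⟨τ, -, c, hc⟩ := exists_chart (h₁.mem_frontier hs)
    obtain ⟨i, -, rfl⟩ := c.nrm_eq ▸ (hc.symm ▸ hj)
    have e := hd _ (c.emb_b_mem_vectorSpan hX hXD (h₁.nrm_subset.trans hc.ge) hjs)
    rw [add_sub_add_left_eq_sub, sub_dotProduct, c.shift_dotProduct hc.ge, c.shift_dotProduct hc.ge,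
      if_pos hj, if_pos hj, sub_eq_zero] at e
    exact Real.log_injOn_pos (h₁.kappa_pos hj hjs) (h₂.kappa_pos hj hjs) e

/-- Rays through different boundary points meet at most at their starting points. -/
theorem disjoint (ht : t ≠ 0) (hε : 0 < ε) {s₁ s₂ s₁' s₂' ξ₁' ξ₂' m : Fin N → ℝ}
    {κ₁ κ₂ : (Fin N → ℤ) → ℝ} (hs₁ : s₁ ∈ frontier D.Delta) (hs₂ : s₂ ∈ frontier D.Delta)
    (h₁ : IsRay D t ε s₁ s₁' ξ₁' κ₁) (h₂ : IsRay D t ε s₂ s₂' ξ₂' κ₂)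
    (o₁ : OnRay D t s₁ s₁' ξ₁' κ₁ m) (o₂ : OnRay D t s₂ s₂' ξ₂' κ₂ m) (hm : m ≠ ε • s₁') :
    s₁ = s₂ := by
  -- Means of measures on all of A are interior, so a boundary point cannot lie in the open part of
  -- another ray.
  have hne : ∀ s ∈ frontier D.Delta, ∀ ξ, ¬ IsGibbs D t D.A ξ s := fun s hs ξ h => by
    have h1 := (mem_frontier_iff.1 hs).2
    rw [(IsGibbs.mem_interior ht h).2] at h1
    exact Set.not_nonempty_empty h1
  rcases o₁ with e₁ | ⟨u₁, hu₁, g₁⟩ <;> rcases o₂ with e₂ | ⟨u₂, hu₂, g₂⟩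
  · exact e₁.symm.trans e₂
  · exact absurd (e₁ ▸ g₂) (hne s₁ hs₁ _)
  · exact absurd (e₂ ▸ g₁) (hne s₂ hs₂ _)
  obtain ⟨-, e⟩ := IsGibbs.unique_A ht g₁ g₂ (by simp)
  have v₁ : (rayParam D s₁' ξ₁' κ₁ u₁ - ξ₁') ⬝ᵥ (s₂' - s₁') ≤ 0 := by
    rw [rayParam, add_sub_cancel_left]
    exact shift_dotProduct_sub_nonpos h₂.mem_Delta fun j hj =>
      Real.log_nonpos (h₁.pos hu₁ hj).1.le (h₁.pos hu₁ hj).2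
  have v₂ : (rayParam D s₁' ξ₁' κ₁ u₁ - ξ₂') ⬝ᵥ (s₁' - s₂') ≤ 0 := by
    rw [e, rayParam, add_sub_cancel_left]
    exact shift_dotProduct_sub_nonpos h₁.mem_Delta fun j hj =>
      Real.log_nonpos (h₂.pos hu₂ hj).1.le (h₂.pos hu₂ hj).2
  obtain ⟨rfl, rfl⟩ := eq_of_vi ht hε h₁ h₂ v₁ v₂
  have hk : ∀ j ∈ D.nrm {s₁'}, (1 - u₁) * κ₁ j + u₁ = (1 - u₂) * κ₂ j + u₂ := by
    intro j hj
    obtain ⟨τ, -, c, hc⟩ := exists_chart (h₁.mem_frontier hs₁)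
    obtain ⟨i, -, rfl⟩ := c.nrm_eq ▸ (hc.symm ▸ hj)
    have e' := congrArg (fun ξ => ξ ⬝ᵥ emb (c.b i)) e
    simp only [rayParam, add_dotProduct] at e'
    rw [c.shift_dotProduct hc.ge, c.shift_dotProduct hc.ge, if_pos hj, if_pos hj,
      add_right_inj] at e'
    exact Real.log_injOn_pos (h₁.pos hu₁ hj).1 (h₂.pos hu₂ hj).1 e'
  -- At a normal through s₁ the ratio κ₁ vanishes, so u₁ = (1 - u₂)κ₂ + u₂ ≥ u₂; the other
  -- inequality comes from a normal through s₂.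
  have hu : u₁ = u₂ := by
    obtain ⟨j₁, hj₁⟩ := (mem_frontier_iff.1 hs₁).2
    obtain ⟨j₂, hj₂⟩ := (mem_frontier_iff.1 hs₂).2
    have k₁ := hk j₁ (h₁.nrm_subset hj₁)
    have k₂ := hk j₂ (h₂.nrm_subset hj₂)
    rw [((h₁.kappa _ (h₁.nrm_subset hj₁)).2).2 hj₁] at k₁
    rw [((h₂.kappa _ (h₂.nrm_subset hj₂)).2).2 hj₂] at k₂
    have p₁ := mul_nonneg (sub_nonneg.2 hu₂.2) (h₂.kappa _ (h₁.nrm_subset hj₁)).1.1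
    have p₂ := mul_nonneg (sub_nonneg.2 hu₁.2) (h₁.kappa _ (h₂.nrm_subset hj₂)).1.1
    linarith
  subst hu
  have hlt : u₁ < 1 := by
    refine lt_of_le_of_ne hu₁.2 fun h1 => hm ?_
    subst h1
    have : rayParam D s₁' ξ₁' κ₁ 1 = ξ₁' := by
      rw [rayParam]
      simp [shift]
    rw [this] at g₁
    exact (IsGibbs.unique_A ht g₁ h₁.gibbs' (by simp)).1
  have hκ : ∀ j ∈ D.nrm {s₁'}, κ₁ j = κ₂ j := fun j hj => by
    have := hk j hj
    have h0 : (1 - u₁) ≠ 0 := by linarith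
    exact mul_left_cancel₀ h0 (by linarith)
  have hnrm : D.nrm {s₁} = D.nrm {s₂} := by
    ext j
    constructor <;> intro hj
    · have hj' := h₁.nrm_subset hj
      exact (h₂.kappa j hj').2.1 (hκ j hj' ▸ (h₁.kappa j hj').2.2 hj)
    · have hj' := h₂.nrm_subset hj
      exact (h₁.kappa j hj').2.1 ((hκ j hj').trans ((h₂.kappa j hj').2.2 hj))
  have g := h₁.gibbs
  rw [faceA_eq_of_nrm_eq hnrm, shift_congr (g := fun j => Real.log (κ₂ j))
    fun j hj => by rw [hκ j hj]] at g
  exact (IsGibbs.unique (Set.singleton_nonempty s₂)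
    (Set.singleton_subset_iff.2 (frontier_subset hs₂)) ht g h₂.gibbs (by simp)).1

end IsRay

/-- The foot comes from `exists_isGibbs_variational`. In a chart at the foot, maximality of ξ - ξ'
is the Kuhn–Tucker condition: zero along the face of s', nonpositive along inward directions within
the face of s. The ratios κ are the exponentials. -/
theorem exists_isRay (ht : t ≠ 0) {ε : ℝ} (hε : 0 < ε) (hε1 : ε < 1) {s : Fin N → ℝ}
    (hs : s ∈ frontier D.Delta) {ξ : Fin N → ℝ} (hξ : IsGibbs D t (D.faceA {s}) ξ s) :
    ∃ s' ξ' κ, IsRay D t ε s s' ξ' κ ∧ ∀ x ∈ D.fc {s}, (ξ - ξ') ⬝ᵥ x ≤ (ξ - ξ') ⬝ᵥ s' := by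
  classical
  obtain ⟨ξ', s', hs', hG, hvi⟩ := exists_isGibbs_variational ht hε hε1 (frontier_subset hs) ξ
  have hsub : D.nrm {s} ⊆ D.nrm {s'} := fun u hu =>
    ⟨hu.1, fun x hx => by rw [Set.mem_singleton_iff.1 hx]; exact hs'.2 u hu⟩
  have hs'f : s' ∈ frontier D.Delta :=
    mem_frontier_iff.2 ⟨hs'.1, (mem_frontier_iff.1 hs).2.mono hsub⟩
  obtain ⟨τ, -, c, hc⟩ := exists_chart hs'f
  have hdot : ∀ j ∈ D.nrm {s'}, ∀ i, emb j ⬝ᵥ emb (c.b i) = if j = c.dual i then 1 else 0 := by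
    intro j hj i
    obtain ⟨i', -, rfl⟩ := c.nrm_eq ▸ hc.ge hj
    rw [emb_dotProduct, TauCoords.dual, dualVec_dotProduct_basis, ← TauCoords.dual]
    by_cases h : i' = i
    · rw [if_pos h, if_pos (by rw [h])]; simp
    · rw [if_neg h, if_neg fun h' => h (c.dual_injective h')]; simp
  -- Directions that point into Δ at s' and stay in the face of s are admissible variations.
  have hdir : ∀ d : Fin N → ℝ, (∀ u ∈ D.nrm {s'}, 0 ≤ emb u ⬝ᵥ d) →
      (∀ u ∈ D.nrm {s}, emb u ⬝ᵥ d = 0) → (ξ - ξ') ⬝ᵥ d ≤ 0 := by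
    intro d h1 h2
    obtain ⟨δ, hδ, hδ0⟩ := ((eventually_smul_mem hs'.1 h1).and self_mem_nhdsWithin).exists
    have hδ0 : 0 < δ := hδ0
    have := hvi (s' + δ • d) ⟨hδ, fun u hu => by
      rw [dotProduct_add, dotProduct_smul, h2 u hu, smul_zero, add_zero]; exact hs'.2 u hu⟩
    rw [dotProduct_add, dotProduct_smul, smul_eq_mul] at this
    by_contra hcon
    have := mul_pos hδ0 (not_le.1 hcon)
    linarith
  have hle : ∀ i, c.dual i ∉ D.nrm {s} → (ξ - ξ') ⬝ᵥ emb (c.b i) ≤ 0 := fun i hi => by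
    refine hdir _ (fun u hu => ?_) fun u hu => ?_
    · rw [hdot u hu]; split_ifs <;> norm_num
    · rw [hdot u (hsub hu), if_neg (by rintro rfl; exact hi hu)]
  have heq : ∀ i, c.dual i ∉ D.nrm {s'} → (ξ - ξ') ⬝ᵥ emb (c.b i) = 0 := fun i hi => by
    refine le_antisymm (hle i fun h => hi (hsub h)) ?_
    have := hdir (-emb (c.b i)) (fun u hu => by
        rw [dotProduct_neg, hdot u hu, if_neg (by rintro rfl; exact hi hu), neg_zero])
      fun u hu => by
        rw [dotProduct_neg, hdot u (hsub hu), if_neg (by rintro rfl; exact hi (hsub hu)), neg_zero]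
    rw [dotProduct_neg] at this
    linarith
  -- Coordinates normal to the face of s vanish at s, so their ratio to the foot is 0.
  set f : Fin N → ℝ := fun i =>
    if c.dual i ∈ D.nrm {s} then 0 else Real.exp ((ξ - ξ') ⬝ᵥ emb (c.b i)) with hf
  have hext : ∀ i, Function.extend c.dual f 0 (c.dual i) = f i := c.dual_injective.extend_apply _ _
  refine ⟨s', ξ', Function.extend c.dual f 0, ⟨hs', hG, fun j hj => ?_, ?_⟩, hvi⟩
  · obtain ⟨i, -, rfl⟩ := c.nrm_eq ▸ hc.ge hj
    rw [hext, hf]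
    by_cases hi : c.dual i ∈ D.nrm {s}
    · simp [hi]
    · simp only [if_neg hi]
      exact ⟨⟨(Real.exp_pos _).le, Real.exp_le_one_iff.2 (hle i hi)⟩,
        ⟨fun h => absurd h (Real.exp_ne_zero _), fun h => absurd h hi⟩⟩
  · refine (c.isGibbs_congr (hsub.trans hc.ge) fun i hi => ?_).1 hξ
    rw [add_dotProduct, c.shift_dotProduct hc.ge]
    by_cases hi' : c.dual i ∈ D.nrm {s'}
    · rw [if_pos hi', hext, hf]
      simp only [if_neg hi]
      rw [Real.log_exp, sub_dotProduct]
      ring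
    · have := heq i hi'
      rw [sub_dotProduct] at this
      rw [if_neg hi']
      linarith

end TorusFib

namespace TorusFib

variable {N : ℕ} {D : FamilyData N} {t : ℂ} {τ : Finset (Fin N → ℝ)}

open FamilyData

/-! ### Intervals in terms of rays -/

theorem mem_intrinsicInterior_smul_fc_iff {X : Set (Fin N → ℝ)} (hX : X.Nonempty)
    (hXD : X ⊆ D.Delta) {ε : ℝ} (hε : ε ≠ 0) {x : Fin N → ℝ} :
    x ∈ intrinsicInterior ℝ (ε • D.fc X) ↔
      ∃ s', ε • s' = x ∧ s' ∈ D.Delta ∧ D.nrm {s'} = D.nrm X := by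
  have h := AffineEquiv.intrinsicInterior_image
    (LinearEquiv.smulOfNeZero ℝ (Fin N → ℝ) ε hε).toAffineEquiv (D.fc X)
  have e : ((LinearEquiv.smulOfNeZero ℝ (Fin N → ℝ) ε hε).toAffineEquiv :
      (Fin N → ℝ) → (Fin N → ℝ)) = fun x => ε • x := rfl
  rw [e, Set.image_smul, Set.image_smul] at h
  rw [h, Set.mem_smul_set]
  refine exists_congr fun s' => ?_
  rw [mem_intrinsicInterior_fc_iff hX hXD, and_comm]

namespace TauCoords

variable (c : TauCoords D τ)

theorem absOf_zero (ξ : Fin N → ℝ) (i : Fin N) :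
    c.absOf {0} ξ i = Real.exp (ξ ⬝ᵥ emb (c.b i)) :=
  c.absOf_of_notMem (by rw [nrm_zero]; exact Set.notMem_empty _)

theorem isAbsCoord_absOf_zero (ht : t ≠ 0) {ξ m : Fin N → ℝ} :
    c.IsAbsCoord t m (c.absOf {0} ξ) ↔ IsGibbs D t D.A ξ m := by
  have key : moment D t (c.chart fun i => (c.absOf {0} ξ i : ℂ)) = m ↔
      IsGibbs D t (D.faceA {0}) ξ m :=
    c.moment_chart_eq_iff ht (Set.singleton_nonempty 0) zero_subset (by rw [nrm_zero]; simp)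
      fun i => by rw [Complex.norm_real, Real.norm_of_nonneg (c.absOf_nonneg _ _ _)]
  rw [faceA_zero] at key
  rw [← key]
  refine ⟨fun h => h.2.2, fun h => ⟨c.absOf_nonneg _ _, fun i _ => ?_, h⟩⟩
  rw [c.absOf_zero]
  exact Real.exp_pos _

end TauCoords

namespace IsRay

variable {ε : ℝ} {s s' ξ' : Fin N → ℝ} {κ : (Fin N → ℤ) → ℝ}

open Classical in
theorem start_eq (h : IsRay D t ε s s' ξ' κ) (c : TauCoords D τ) (hJ : D.nrm {s'} ⊆ D.nrm τ)
    (i : Fin N) : c.absOf {s} (ξ' + shift D s' fun j => Real.log (κ j)) i =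
      (if c.dual i ∈ D.nrm {s'} then κ (c.dual i) else 1) * c.absOf {0} ξ' i := by
  rw [c.absOf_zero]
  by_cases hi : c.dual i ∈ D.nrm {s}
  · rw [c.absOf_of_mem hi, if_pos (h.nrm_subset hi), ((h.kappa _ (h.nrm_subset hi)).2).2 hi,
      zero_mul]
  · rw [c.absOf_of_notMem hi, add_dotProduct, c.shift_dotProduct hJ, Real.exp_add, mul_comm]
    by_cases hi' : c.dual i ∈ D.nrm {s'}
    · rw [if_pos hi', if_pos hi', Real.exp_log (h.kappa_pos hi' hi)]
    · rw [if_neg hi', if_neg hi', Real.exp_zero]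

/-- A straight segment in the |y_i| keeps the tangential coordinates fixed and multiplies the normal
ones of the foot by (1 - u)κ + u, which is a shift of ξ' by normals. -/
theorem path_eq (h : IsRay D t ε s s' ξ' κ) (c : TauCoords D τ) (hJ : D.nrm {s'} ⊆ D.nrm τ)
    {u : ℝ} (hu : u ∈ Set.Ioc (0 : ℝ) 1) (i : Fin N) :
    (1 - u) * c.absOf {s} (ξ' + shift D s' fun j => Real.log (κ j)) i + u * c.absOf {0} ξ' i =
      c.absOf {0} (rayParam D s' ξ' κ u) i := by
  classical
  rw [h.start_eq c hJ, c.absOf_zero, c.absOf_zero, rayParam, add_dotProduct,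
    c.shift_dotProduct hJ, Real.exp_add]
  by_cases hi' : c.dual i ∈ D.nrm {s'}
  · rw [if_pos hi', if_pos hi', Real.exp_log (h.pos hu hi').1]
    ring
  · rw [if_neg hi', if_neg hi', Real.exp_zero]
    ring

theorem isAbsCoord_start (h : IsRay D t ε s s' ξ' κ) (ht : t ≠ 0) (hs : s ∈ D.Delta)
    (c : TauCoords D τ) (hJ : D.nrm {s'} ⊆ D.nrm τ) :
    c.IsAbsCoord t s (c.absOf {s} (ξ' + shift D s' fun j => Real.log (κ j))) :=
  c.isAbsCoord_absOf ht hs (h.nrm_subset.trans hJ) h.gibbs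

theorem isAbsCoord_end (h : IsRay D t ε s s' ξ' κ) (ht : t ≠ 0) (c : TauCoords D τ) :
    c.IsAbsCoord t (ε • s') (c.absOf {0} ξ') := (c.isAbsCoord_absOf_zero ht).2 h.gibbs'

theorem onRay_iff (h : IsRay D t ε s s' ξ' κ) (ht : t ≠ 0) (hs : s ∈ D.Delta) (c : TauCoords D τ)
    (hJ : D.nrm {s'} ⊆ D.nrm τ) {m : Fin N → ℝ} : OnRay D t s s' ξ' κ m ↔
      ∃ u ∈ Set.Icc (0 : ℝ) 1, c.IsAbsCoord t m fun i =>
        (1 - u) * c.absOf {s} (ξ' + shift D s' fun j => Real.log (κ j)) i +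
          u * c.absOf {0} ξ' i := by
  have e0 : (fun i => (1 - (0 : ℝ)) * c.absOf {s} (ξ' + shift D s' fun j => Real.log (κ j)) i +
      0 * c.absOf {0} ξ' i) = c.absOf {s} (ξ' + shift D s' fun j => Real.log (κ j)) := by
    funext i; ring
  have hst := h.isAbsCoord_start ht hs c hJ
  constructor
  · rintro (rfl | ⟨u, hu, hG⟩)
    · exact ⟨0, ⟨le_rfl, zero_le_one⟩, e0.symm ▸ hst⟩
    · refine ⟨u, ⟨hu.1.le, hu.2⟩, ?_⟩
      simp_rw [h.path_eq c hJ hu]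
      exact (c.isAbsCoord_absOf_zero ht).2 hG
  · rintro ⟨u, hu, hm⟩
    rcases hu.1.eq_or_lt with rfl | hu0
    · rw [e0] at hm
      exact Or.inl (hm.point_unique hst)
    · have hu' : u ∈ Set.Ioc (0 : ℝ) 1 := ⟨hu0, hu.2⟩
      simp_rw [h.path_eq c hJ hu'] at hm
      exact Or.inr ⟨u, hu', (c.isAbsCoord_absOf_zero ht).1 hm⟩

theorem inCone (h : IsRay D t ε s s' ξ' κ) (ht : t ≠ 0) (hε : 0 < ε) (hs : s ∈ D.Delta)
    (c : TauCoords D τ) (hJ : D.nrm (τ : Set (Fin N → ℝ)) = D.nrm {s'}) :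
    c.InCone t ε (ε • s') s (c.absOf {0} ξ')
      (c.absOf {s} (ξ' + shift D s' fun j => Real.log (κ j))) := by
  classical
  refine ⟨?_, h.isAbsCoord_end ht c, h.isAbsCoord_start ht hs c hJ.ge, fun i hi => ?_,
    fun i hi => ?_⟩
  · rw [Theta_eq c.mem_bdry, mem_intrinsicInterior_smul_fc_iff (bdry_nonempty c.mem_bdry)
      (bdry_subset c.mem_bdry) hε.ne']
    exact ⟨s', rfl, h.mem_Delta, hJ.symm⟩
  · rw [h.start_eq c hJ.ge, if_neg, one_mul]
    rw [← hJ, c.dual_mem_iff]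
    omega
  · have hi' : c.dual i ∈ D.nrm {s'} := hJ ▸ c.dual_mem hi
    rw [h.start_eq c hJ.ge, if_pos hi']
    exact mul_le_of_le_one_left (c.absOf_nonneg _ _ _) (h.kappa _ hi').1.2

end IsRay

/-- The inequalities between normal coordinates say that the ratios κ are at most 1, and equality of
the tangential coordinates says that the parameters differ by normals at the foot only. -/
theorem TauCoords.InCone.exists_isRay {c : TauCoords D τ} (ht : t ≠ 0) {ε : ℝ} (hε : 0 < ε)
    (hε1 : ε < 1) {m' s r' r : Fin N → ℝ} (h : c.InCone t ε m' s r' r) :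
    ∃ s' ξ' κ, m' = ε • s' ∧ D.nrm {s'} = D.nrm τ ∧ IsRay D t ε s s' ξ' κ := by
  classical
  obtain ⟨h1, h2, h3, h4, h5⟩ := h
  rw [Theta_eq c.mem_bdry, mem_intrinsicInterior_smul_fc_iff (bdry_nonempty c.mem_bdry)
    (bdry_subset c.mem_bdry) hε.ne'] at h1
  obtain ⟨s', rfl, hs'D, hs'⟩ := h1
  obtain ⟨hm, -, ξ', hξ', rfl⟩ := h2.exists_absOf ht
  have hint := mem_interior_iff.1 (smul_mem_interior hε hε1 hs'D)
  have hn0 : D.nrm {ε • s'} = D.nrm {0} := by rw [hint.2, nrm_zero]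
  rw [faceA_eq_of_nrm_eq hn0, faceA_zero] at hξ'
  obtain ⟨hs, hsτ, ξ, hξ, rfl⟩ := h3.exists_absOf ht
  have hr' : ∀ i, c.absOf {ε • s'} ξ' i = Real.exp (ξ' ⬝ᵥ emb (c.b i)) := fun i =>
    c.absOf_of_notMem (by rw [hint.2]; exact Set.notMem_empty _)
  simp only [hr'] at h4 h5
  set f : Fin N → ℝ := fun i =>
    if c.dual i ∈ D.nrm {s} then 0 else Real.exp ((ξ - ξ') ⬝ᵥ emb (c.b i)) with hf
  have hext : ∀ i, Function.extend c.dual f 0 (c.dual i) = f i := c.dual_injective.extend_apply _ _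
  refine ⟨s', ξ', Function.extend c.dual f 0, rfl, hs', ⟨hs'D, fun u hu => ?_⟩, hξ', fun j hj => ?_,
    ?_⟩
  · exact (hs'.ge (hsτ hu)).2 s' rfl
  · obtain ⟨i, hi, rfl⟩ := c.nrm_eq ▸ hs'.le hj
    rw [hext, hf]
    by_cases his : c.dual i ∈ D.nrm {s}
    · simp [his]
    · simp only [if_neg his]
      have := h5 i hi
      rw [c.absOf_of_notMem his, Real.exp_le_exp] at this
      refine ⟨⟨(Real.exp_pos _).le, Real.exp_le_one_iff.2 ?_⟩,
        ⟨fun h => absurd h (Real.exp_ne_zero _), fun h => absurd h his⟩⟩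
      rw [sub_dotProduct]
      linarith
  · refine (c.isGibbs_congr hsτ fun i hi => ?_).1 hξ
    rw [add_dotProduct, c.shift_dotProduct hs'.le]
    by_cases hi' : c.dual i ∈ D.nrm {s'}
    · rw [if_pos hi', hext, hf]
      simp only [if_neg hi]
      rw [Real.log_exp, sub_dotProduct]
      ring
    · rw [hs', c.dual_mem_iff, not_le] at hi'
      have := h4 i hi'
      rw [c.absOf_of_notMem hi, Real.exp_eq_exp] at this
      rw [if_neg, add_zero, this]
      rw [hs', c.dual_mem_iff]
      omega

/-- The definition of I_s quantifies over charts, while rays do not mention them; this removes the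
dependence on the chart. -/
theorem mem_interval_iff (ht : t ≠ 0) {β ε : ℝ} (hε : 0 < ε) (hε1 : ε < 1) {s m : Fin N → ℝ}
    (hs : s ∈ frontier D.Delta) : m ∈ interval D t β ε s ↔
      m ∉ centralBall N β ∧ ∃ s' ξ' κ, IsRay D t ε s s' ξ' κ ∧ OnRay D t s s' ξ' κ m := by
  have hsD := frontier_subset hs
  constructor
  · rintro ⟨hm, τ, hτ, c, m', r', r, hc, u, hu, hmu⟩
    refine ⟨hm, ?_⟩
    obtain ⟨s', ξ', κ, rfl, hJ, hR⟩ := hc.exists_isRay ht hε hε1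
    refine ⟨s', ξ', κ, hR, (hR.onRay_iff ht hsD c hJ.le).2 ⟨u, hu, ?_⟩⟩
    rw [← hc.2.2.1.unique ht (hR.isAbsCoord_start ht hsD c hJ.le),
      ← hc.2.1.unique ht (hR.isAbsCoord_end ht c)]
    exact hmu
  · rintro ⟨hm, s', ξ', κ, hR, hO⟩
    obtain ⟨τ, hτ, c, hc⟩ := exists_chart (hR.mem_frontier hs)
    obtain ⟨u, hu, hmu⟩ := (hR.onRay_iff ht hsD c hc.ge).1 hO
    exact ⟨hm, τ, hτ, c, _, _, _, hR.inCone ht hε hsD c hc, u, hu, hmu⟩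

/-- Intervals of different boundary points are disjoint. -/
theorem interval_disjoint (ht : t ≠ 0) {β ε : ℝ} (hε : 0 < ε) (hε1 : ε < 1)
    (hsub : ε • D.Delta ⊆ centralBall N β) {s₁ s₂ m : Fin N → ℝ} (hs₁ : s₁ ∈ frontier D.Delta)
    (hs₂ : s₂ ∈ frontier D.Delta) (h₁ : m ∈ interval D t β ε s₁) (h₂ : m ∈ interval D t β ε s₂) :
    s₁ = s₂ := by
  rw [mem_interval_iff ht hε hε1 hs₁] at h₁
  rw [mem_interval_iff ht hε hε1 hs₂] at h₂
  obtain ⟨hm, s₁', ξ₁', κ₁, hR₁, hO₁⟩ := h₁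
  obtain ⟨-, s₂', ξ₂', κ₂, hR₂, hO₂⟩ := h₂
  refine IsRay.disjoint ht hε hs₁ hs₂ hR₁ hR₂ hO₁ hO₂ ?_
  rintro rfl
  exact hm (hsub (Set.smul_mem_smul_set hR₁.mem_Delta))

/-- Passing from ξ to ξ' multiplies the weight of w by exp(-(ξ - ξ')·w), so the ratio of v to w can
only grow when ξ - ξ' is at least as large at w as at v. -/
theorem wt_le_of_dotProduct_le (ht : t ≠ 0) {ξ ξ' : Fin N → ℝ} {v w : Fin N → ℤ} {c Z : ℝ}
    (hc : 0 ≤ c) (hw : wt D t ξ w ≤ Z) (hv : c * Z ≤ wt D t ξ v)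
    (h : (ξ - ξ') ⬝ᵥ emb v ≤ (ξ - ξ') ⬝ᵥ emb w) : c * wt D t ξ' w ≤ wt D t ξ' v := by
  have hsplit : ∀ w, wt D t ξ' w = wt D t ξ w * Real.exp (-((ξ - ξ') ⬝ᵥ emb w)) := fun w => by
    rw [wt, wt, mul_assoc, ← Real.exp_add, sub_dotProduct]
    congr 2; ring
  have hZ : 0 ≤ Z := (wt_pos ht ξ w).le.trans hw
  rw [hsplit, hsplit v]
  calc c * (wt D t ξ w * Real.exp (-((ξ - ξ') ⬝ᵥ emb w)))
      ≤ c * (Z * Real.exp (-((ξ - ξ') ⬝ᵥ emb v))) := by gcongr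
    _ = (c * Z) * Real.exp (-((ξ - ξ') ⬝ᵥ emb v)) := by ring
    _ ≤ _ := by gcongr

set_option maxHeartbeats 1000000 in
/-- For large `‖t‖` the rays through the cell `W τ` start over the star of `τ`. -/
theorem exists_isRay_of_mem_W {V : Finset (Fin N → ℝ) → Set (Fin N → ℝ)} (hV : IsSmallCover D V)
    {ε : ℝ} (hε : 0 < ε) (hε1 : ε < 1) : ∃ R : ℝ, 1 < R ∧ ∀ t : ℂ, R ≤ ‖t‖ → ∀ τ ∈ D.bdry,
      ∀ s ∈ W D V τ, ∃ s' ξ' κ, IsRay D t ε s s' ξ' κ ∧ D.nrm {s'} ⊆ D.nrm τ := by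
  classical
  obtain ⟨c, hc0, hc⟩ := hV.exists_le_bary
  obtain ⟨K, hK, hconc⟩ := exists_concentration D
  have hA : (0 : ℝ) < D.A.card := by exact_mod_cast Finset.card_pos.2 (A_nonempty (D := D))
  -- The concentration error must leave weight c/2 at a vertex of τ in the measure at s, weight
  -- ε/(2|A|) at some vertex in the measure at εs', and be at most half the product of these two
  -- bounds.
  set q : ℝ := min (c / 2) (min (ε / (2 * D.A.card)) (c / 2 * (ε / (2 * D.A.card)) / 2)) with hq
  have hq0 : 0 < q := by positivity
  have hq1 : q ≤ c / 2 := min_le_left _ _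
  have hq2 : q ≤ ε / (2 * D.A.card) := (min_le_right _ _).trans (min_le_left _ _)
  have hq3 : q ≤ c / 2 * (ε / (2 * D.A.card)) / 2 := (min_le_right _ _).trans (min_le_right _ _)
  clear_value q
  refine ⟨Real.exp (K / q) + 1, by linarith [Real.exp_pos (K / q)], fun t ht τ hτ s hs => ?_⟩
  have ht1 : 1 < ‖t‖ := by linarith [Real.exp_pos (K / q)]
  have ht0 : t ≠ 0 := norm_pos_iff.1 (by linarith)
  have hlog : 0 < Real.log ‖t‖ := Real.log_pos ht1
  have hKq : K / Real.log ‖t‖ ≤ q := by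
    rw [div_le_iff₀ hlog, mul_comm, ← div_le_iff₀ hq0]
    exact (Real.le_log_iff_exp_le (by linarith)).2 (by linarith)
  have hsf := hV.W_subset_frontier hτ hs
  have hsD := frontier_subset hsf
  obtain ⟨ξ, hξ⟩ := exists_isGibbs ht0 hsD
  obtain ⟨s', ξ', κ, hR, hvi⟩ := exists_isRay ht0 hε hε1 hsf hξ
  refine ⟨s', ξ', κ, hR, ?_⟩
  obtain ⟨σ, a, hσ⟩ := exists_isBary hsD
  obtain ⟨σ', a', hσ'⟩ := exists_isBary hR.mem_Delta
  rw [hσ'.nrm_eq]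
  refine nrm_anti (Finset.coe_subset.2 fun v hv => ?_)
  -- Suppose a vertex v of τ is missing from the carrier of s'. Then v has weight at most q at εs',
  -- while some y in the carrier has weight at least ε/(2|A|). But ξ - ξ' is maximal at y on the
  -- face of s and v has weight at least c/2 at s, so the weight of v at εs' is at least c/2 times
  -- that of y.
  by_contra hvσ'
  have hav := hc τ hτ v hv s hs.1 σ a hσ
  have hfaceσ : ∀ v ∈ σ, v ∈ D.fc {s} := fun v hv => by
    refine ⟨face_subset_Delta hσ.mem_faces hv, fun u hu => ?_⟩
    rw [hσ.nrm_eq] at hu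
    exact hu.2 v hv
  have hfaceσ' : ∀ v ∈ σ', v ∈ D.fc {s} := fun v hv => by
    refine ⟨face_subset_Delta hσ'.mem_faces hv, fun u hu => ?_⟩
    have := hR.nrm_subset hu
    rw [hσ'.nrm_eq] at this
    exact this.2 v hv
  have hvσ : v ∈ σ := by
    by_contra h
    rw [hσ.zero v h] at hav
    linarith
  have hX := Set.singleton_nonempty s
  have hXD := Set.singleton_subset_iff.2 hsD
  have hσS : (σ : Set (Fin N → ℝ)) ⊆ emb '' (D.faceA {s} : Set (Fin N → ℤ)) := fun y hy => by
    obtain ⟨w, hw, rfl⟩ := face_subset_image hσ.mem_faces hy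
    exact ⟨w, mem_faceA.2 ⟨hw, hfaceσ _ hy⟩, rfl⟩
  obtain ⟨wv, hwv, rfl⟩ := hσS hvσ
  have hwvA : wv ∈ D.A := faceA_subset hwv
  have hv0 : emb wv ≠ (0 : Fin N → ℝ) := fun h => zero_notMem_of_bdry hτ (h ▸ hv)
  -- the Gibbs measure at `s`
  have c1 := hconc t ht1 _ faceA_subset (faceA_nonempty hX hXD) ξ s hξ σ a hσ hσS wv hwv
  have hp1 : c / 2 ≤ wt D t ξ wv / ∑ w ∈ D.faceA {s}, wt D t ξ w := by
    have := (abs_le.1 c1).1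
    linarith
  -- a vertex of large weight at `s'`
  obtain ⟨y, hy, hay⟩ : ∃ y ∈ σ', 1 / (D.A.card : ℝ) ≤ a' y := by
    by_contra hcon
    push Not at hcon
    have h1 := Finset.sum_lt_sum_of_nonempty hσ'.nonempty hcon
    rw [hσ'.sum_one, Finset.sum_const, nsmul_eq_mul, mul_one_div, lt_div_iff₀ hA, one_mul] at h1
    have h2 : σ'.card ≤ D.A.card := by
      refine (Finset.card_le_card (t := D.A.image emb) fun z hz => ?_).trans Finset.card_image_le
      obtain ⟨w, hw, rfl⟩ := face_subset_image hσ'.mem_faces hz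
      exact Finset.mem_image_of_mem _ hw
    have h3 : (σ'.card : ℝ) ≤ D.A.card := by exact_mod_cast h2
    linarith
  obtain ⟨wy, hwy, rfl⟩ := face_subset_image hσ'.mem_faces hy
  have hwyF : wy ∈ D.faceA {s} := mem_faceA.2 ⟨hwy, hfaceσ' _ hy⟩
  obtain ⟨ρ, hρ⟩ := hσ'.smul hε hε1
  have hρS : (ρ : Set (Fin N → ℝ)) ⊆ emb '' (D.A : Set (Fin N → ℤ)) :=
    face_subset_image hρ.mem_faces
  have c2 := hconc t ht1 D.A le_rfl A_nonempty ξ' _ hR.gibbs' ρ _ hρ hρS wy hwy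
  have c3 := hconc t ht1 D.A le_rfl A_nonempty ξ' _ hR.gibbs' ρ _ hρ hρS wv hwvA
  set Z' := ∑ w ∈ D.A, wt D t ξ' w with hZ'
  have hZ'0 : 0 < Z' := (hR.gibbs'.sum_eq A_nonempty ht0).1
  rw [if_neg hv0, hσ'.zero _ hvσ', mul_zero, add_zero, sub_zero] at c3
  have hp3 : wt D t ξ' wv / Z' ≤ q := (le_abs_self _).trans (c3.trans hKq)
  have hp2 : ε / (2 * D.A.card) ≤ wt D t ξ' wy / Z' := by
    have h1 := (abs_le.1 c2).1
    have h2 : (0 : ℝ) ≤ if emb wy = (0 : Fin N → ℝ) then 1 - ε else 0 := by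
      split_ifs <;> linarith
    have h4 := mul_le_mul_of_nonneg_left hay hε.le
    have h5 : ε * (1 / (D.A.card : ℝ)) = 2 * (ε / (2 * D.A.card)) := by field_simp
    linarith
  -- compare the weights
  have hmax : (ξ - ξ') ⬝ᵥ emb wv ≤ (ξ - ξ') ⬝ᵥ emb wy := by
    -- s' is a positive combination of its carrier, so every vertex of the carrier attains the
    -- maximum too.
    have h1 : ∑ z ∈ σ', a' z * ((ξ - ξ') ⬝ᵥ s' - (ξ - ξ') ⬝ᵥ z) = 0 := by
      simp_rw [mul_sub]
      rw [Finset.sum_sub_distrib, ← Finset.sum_mul, hσ'.sum_one, one_mul]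
      conv_lhs => rw [← hσ'.sum_eq, dotProduct_sum]
      simp_rw [dotProduct_smul, smul_eq_mul]
      rw [sub_self]
    rw [Finset.sum_eq_zero_iff_of_nonneg fun z hz =>
      mul_nonneg (hσ'.nonneg z) (sub_nonneg.2 (hvi z (hfaceσ' z hz)))] at h1
    have h2 := (mul_eq_zero.1 (h1 _ hy)).resolve_left (hσ'.pos _ hy).ne'
    have h3 := hvi _ (hfaceσ _ hvσ)
    linarith only [h2, h3]
  set Z := ∑ w ∈ D.faceA {s}, wt D t ξ w with hZ
  have hZ0 : 0 < Z := (hξ.sum_eq (faceA_nonempty hX hXD) ht0).1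
  have hle : wt D t ξ wy ≤ Z :=
    Finset.single_le_sum (f := wt D t ξ) (fun w _ => (wt_pos ht0 ξ w).le) hwyF
  have hfin := wt_le_of_dotProduct_le ht0 (half_pos hc0).le hle
    ((le_div_iff₀ hZ0).1 hp1) hmax
  have h6 : c / 2 * (wt D t ξ' wy / Z') ≤ wt D t ξ' wv / Z' := by
    rw [← mul_div_assoc]
    exact div_le_div_of_nonneg_right hfin hZ'0.le
  have h8 := mul_le_mul_of_nonneg_left hp2 (half_pos hc0).le
  have h9 : 0 < c / 2 * (ε / (2 * D.A.card)) := by positivity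
  linarith only [h6, h8, h9, hp3, hq3]

end TorusFib

namespace TorusFib

variable {N : ℕ} {D : FamilyData N} {t : ℂ} {τ : Finset (Fin N → ℝ)}

open FamilyData

/-! ### The topology of projective space -/

section Projective

variable {ι : Type}

theorem isQuotientMap_mk' :
    Topology.IsQuotientMap (Projectivization.mk' ℂ : {v : ι → ℂ // v ≠ 0} → ℙ ℂ (ι → ℂ)) :=
  ⟨⟨rfl⟩, Quotient.mk_surjective⟩

/-- The saturation of an open set is the union of its scalar multiples. -/
theorem isOpenMap_mk' :
    IsOpenMap (Projectivization.mk' ℂ : {v : ι → ℂ // v ≠ 0} → ℙ ℂ (ι → ℂ)) := by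
  intro O hO
  rw [← isQuotientMap_mk'.isOpen_preimage]
  have : Projectivization.mk' ℂ ⁻¹' (Projectivization.mk' ℂ '' O) =
      ⋃ a : ℂˣ, {v : {v : ι → ℂ // v ≠ 0} |
        (⟨a • v.1, (smul_ne_zero_iff_ne a).2 v.2⟩ : {v : ι → ℂ // v ≠ 0}) ∈ O} := by
    ext ⟨v, hv⟩
    rw [Set.mem_iUnion]
    constructor
    · rintro ⟨⟨w, hw⟩, hwO, he⟩
      obtain ⟨a, rfl⟩ := (Projectivization.mk_eq_mk_iff ℂ w v hw hv).1 he
      exact ⟨a, hwO⟩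
    · rintro ⟨a, ha⟩
      exact ⟨_, ha, (Projectivization.mk_eq_mk_iff ℂ _ _ _ hv).2 ⟨a, rfl⟩⟩
  rw [this]
  refine isOpen_iUnion fun a => hO.preimage ?_
  exact Continuous.subtype_mk (continuous_subtype_val.const_smul a) _

theorem mk_mem_closure_iff {S : Set (ℙ ℂ (ι → ℂ))} {v : ι → ℂ} {hv : v ≠ 0}
    (h : Projectivization.mk ℂ v hv ∈ closure S) :
    v ∈ closure {w | ∃ hw : w ≠ 0, Projectivization.mk ℂ w hw ∈ S} := by
  rw [mem_closure_iff] at h ⊢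
  intro O hO hvO
  obtain ⟨_, ⟨⟨w, hw⟩, hwO, rfl⟩, hwS⟩ := h _
    (isOpenMap_mk' _ (hO.preimage continuous_subtype_val)) ⟨⟨v, hv⟩, hvO, rfl⟩
  exact ⟨w, hwO, hw, hwS⟩

end Projective

/-- Monomial identities on the torus pass to the toric variety in this form, without global
continuity. -/
theorem eq_of_mem_closure {X Y : Type*} [TopologicalSpace X] [TopologicalSpace Y] [T2Space Y]
    {S : Set X} {x : X} (hx : x ∈ closure S) {f g : X → Y} (hf : ContinuousAt f x)
    (hg : ContinuousAt g x) (h : ∀ y ∈ S, f y = g y) : f x = g x := by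
  have := mem_closure_iff_nhdsWithin_neBot.1 hx
  exact tendsto_nhds_unique_of_eventuallyEq (hf.tendsto.mono_left nhdsWithin_le_nhds)
    (hg.tendsto.mono_left nhdsWithin_le_nhds)
    (Filter.eventually_of_mem self_mem_nhdsWithin h)

/-! ### Characters of the torus -/

/-- The monomial `x^w`. -/
noncomputable def chi (x : Fin N → ℂˣ) (w : Fin N → ℤ) : ℂˣ := ∏ i, x i ^ w i

theorem chi_add (x : Fin N → ℂˣ) (v w : Fin N → ℤ) : chi x (v + w) = chi x v * chi x w := by
  simp only [chi, Pi.add_apply, zpow_add, Finset.prod_mul_distrib]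

theorem chi_zero (x : Fin N → ℂˣ) : chi x 0 = 1 := by simp [chi]

theorem chi_smul (x : Fin N → ℂˣ) (n : ℤ) (w : Fin N → ℤ) : chi x (n • w) = chi x w ^ n := by
  simp only [chi, Pi.smul_apply, smul_eq_mul, ← Finset.prod_zpow, ← zpow_mul, mul_comm]

theorem chi_sum (x : Fin N → ℂˣ) {ι : Type*} (s : Finset ι) (f : ι → Fin N → ℤ) :
    chi x (∑ i ∈ s, f i) = ∏ i ∈ s, chi x (f i) := by
  classical
  induction s using Finset.induction_on with
  | empty => simp [chi_zero]
  | insert a s ha ih => rw [Finset.sum_insert ha, chi_add, ih, Finset.prod_insert ha]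

theorem norm_chi (x : Fin N → ℂˣ) : ∃ ℓ : Fin N → ℝ, ∀ w, ‖(chi x w : ℂ)‖ = Real.exp (ℓ ⬝ᵥ emb w) := by
  refine ⟨fun i => Real.log ‖(x i : ℂ)‖, fun w => ?_⟩
  rw [chi, Units.coe_prod, norm_prod, dotProduct, Real.exp_sum]
  refine Finset.prod_congr rfl fun i _ => ?_
  have : 0 < ‖(x i : ℂ)‖ := norm_pos_iff.2 (x i).ne_zero
  rw [Units.val_zpow_eq_zpow_val, norm_zpow, Real.exp_mul, Real.exp_log this]
  simp [emb]

theorem prod_zpow_eq_zpow_sum {G ι : Type*} [CommGroup G] (s : Finset ι) (y : G) (n : ι → ℤ) :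
    ∏ i ∈ s, y ^ n i = y ^ ∑ i ∈ s, n i := by
  classical
  induction s using Finset.induction_on with
  | empty => simp
  | insert a s ha ih => rw [Finset.prod_insert ha, Finset.sum_insert ha, ih, zpow_add]

theorem exists_chi_eq (b : Module.Basis (Fin N) ℤ (Fin N → ℤ)) (y : Fin N → ℂˣ) :
    ∃ x, ∀ w, chi x w = ∏ i, y i ^ b.repr w i := by
  refine ⟨fun a => ∏ i, y i ^ b.repr (Pi.single a 1) i, fun w => ?_⟩
  have : w = ∑ a, w a • (Pi.single a 1 : Fin N → ℤ) := by
    ext j; simp [Finset.sum_apply, Pi.single_apply]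
  conv_rhs => rw [this]
  simp only [chi, map_sum, map_smul, Finsupp.coe_finsetSum, Finset.sum_apply, Finsupp.smul_apply,
    smul_eq_mul]
  simp_rw [← Finset.prod_zpow, ← zpow_mul]
  rw [Finset.prod_comm]
  refine Finset.prod_congr rfl fun i _ => ?_
  rw [← prod_zpow_eq_zpow_sum]
  simp_rw [mul_comm]

/-! ### The toric variety -/

theorem mem_closure_torus {v : D.LatticePt → ℂ} {hv : v ≠ 0}
    (h : Projectivization.mk ℂ v hv ∈ toricVariety D) :
    v ∈ closure {w | ∃ a : ℂ, a ≠ 0 ∧ ∃ x : Fin N → ℂˣ, ∀ p, w p = a * chi x p.1} := by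
  refine closure_mono ?_ (mk_mem_closure_iff h)
  rintro w ⟨hw, x, hx⟩
  obtain ⟨a, ha⟩ := (Projectivization.mk_eq_mk_iff ℂ _ _ _ _).1 hx.symm
  refine ⟨a, a.ne_zero, x, fun p => ?_⟩
  have := congrFun ha p
  rw [← this]
  rfl

theorem continuous_hom (w : Fin N → ℤ) : Continuous fun v : D.LatticePt → ℂ => hom D v w := by
  unfold hom
  split_ifs with h
  · exact continuous_apply _
  · exact continuous_const

/-- Affine relations between lattice points are multiplicative relations between the absolute values
of the coordinates. -/
theorem prod_rpow_eq {v : D.LatticePt → ℂ} {hv : v ≠ 0}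
    (h : Projectivization.mk ℂ v hv ∈ toricVariety D) {S : Finset (Fin N → ℤ)}
    (hS : ∀ w ∈ S, emb w ∈ D.Delta) {p q : (Fin N → ℤ) → ℝ} (hp : ∀ w ∈ S, 0 ≤ p w)
    (hq : ∀ w ∈ S, 0 ≤ q w) (hp1 : ∑ w ∈ S, p w = 1) (hq1 : ∑ w ∈ S, q w = 1)
    (hpq : ∑ w ∈ S, p w • emb w = ∑ w ∈ S, q w • emb w) :
    ∏ w ∈ S, ‖hom D v w‖ ^ p w = ∏ w ∈ S, ‖hom D v w‖ ^ q w := by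
  have hcont : ∀ r : (Fin N → ℤ) → ℝ, (∀ w ∈ S, 0 ≤ r w) →
      Continuous fun v : D.LatticePt → ℂ => ∏ w ∈ S, ‖hom D v w‖ ^ r w := fun r hr =>
    continuous_finsetProd _ fun w hw =>
      (continuous_hom w).norm.rpow_const fun _ => Or.inr (hr w hw)
  refine eq_of_mem_closure (mem_closure_torus h) (hcont p hp).continuousAt
    (hcont q hq).continuousAt ?_
  rintro v' ⟨a, ha, x, hx⟩
  obtain ⟨ℓ, hℓ⟩ := norm_chi x
  have ha' : 0 < ‖a‖ := norm_pos_iff.2 ha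
  have key : ∀ r : (Fin N → ℤ) → ℝ, ∑ w ∈ S, r w = 1 → ∏ w ∈ S, ‖hom D v' w‖ ^ r w =
      ‖a‖ * Real.exp (ℓ ⬝ᵥ ∑ w ∈ S, r w • emb w) := by
    intro r hr
    rw [dotProduct_sum, Real.exp_sum, ← Real.rpow_one ‖a‖, ← hr,
      Real.rpow_sum_of_pos ha', ← Finset.prod_mul_distrib]
    refine Finset.prod_congr rfl fun w hw => ?_
    rw [hom, dif_pos (hS w hw), hx, norm_mul, hℓ, Real.mul_rpow ha'.le (Real.exp_pos _).le,
      ← Real.exp_mul, dotProduct_smul, smul_eq_mul, mul_comm (ℓ ⬝ᵥ emb w)]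
  rw [key p hp1, key q hq1, hpq]

/-- Some coordinate corresponding to a point of `A` does not vanish. -/
theorem sum_norm_hom_pos {v : D.LatticePt → ℂ} {hv : v ≠ 0}
    (h : Projectivization.mk ℂ v hv ∈ toricVariety D) (ht : t ≠ 0) :
    0 < ∑ w ∈ D.A, ‖t ^ D.lam w‖ * ‖hom D v w‖ := by
  classical
  have hpos : ∀ w, 0 < ‖t ^ D.lam w‖ := fun w => norm_pos_iff.2 (zpow_ne_zero _ ht)
  refine lt_of_le_of_ne (Finset.sum_nonneg fun w _ => by positivity) fun h0 => hv ?_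
  rw [eq_comm, Finset.sum_eq_zero_iff_of_nonneg fun w _ => by positivity] at h0
  funext ⟨w₀, hw₀⟩
  by_cases hw₀A : w₀ ∈ D.A
  · have := (mul_eq_zero.1 (h0 w₀ hw₀A)).resolve_left (hpos _).ne'
    rw [hom, dif_pos hw₀, norm_eq_zero] at this
    exact this
  obtain ⟨a, ha0, ha1, ham⟩ := exists_weights hw₀
  -- Outside A, w₀ is a convex combination of points of A, so |x^{w₀}| is the corresponding weighted
  -- geometric mean of coordinates that are all zero.
  have e := prod_rpow_eq h (S := insert w₀ D.A) (p := fun w => if w = w₀ then 1 else 0)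
    (q := fun w => if w = w₀ then 0 else a w)
    (fun w hw => by
      rcases Finset.mem_insert.1 hw with rfl | hw
      · exact hw₀
      · exact D.emb_mem_Delta hw)
    (fun w _ => by split_ifs <;> norm_num)
    (fun w hw => by
      split_ifs with h
      · exact le_rfl
      · exact ha0 w ((Finset.mem_insert.1 hw).resolve_left h))
    (by simp)
    (by
      rw [Finset.sum_insert hw₀A, if_pos rfl, zero_add, ← ha1]
      exact Finset.sum_congr rfl fun w hw => if_neg (by rintro rfl; exact hw₀A hw))
    (by
      rw [Finset.sum_insert hw₀A, Finset.sum_insert hw₀A, if_pos rfl, if_pos rfl, zero_smul,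
        zero_add, one_smul]
      have e1 : ∑ w ∈ D.A, (if w = w₀ then (1 : ℝ) else 0) • emb w = 0 :=
        Finset.sum_eq_zero fun w hw => by
          rw [if_neg (by rintro rfl; exact hw₀A hw), zero_smul]
      have e2 : ∑ w ∈ D.A, (if w = w₀ then (0 : ℝ) else a w) • emb w = ∑ w ∈ D.A, a w • emb w :=
        Finset.sum_congr rfl fun w hw => by
          rw [if_neg (by rintro rfl; exact hw₀A hw)]
      rw [e1, e2, ham, add_zero])
  have hl : ∏ w ∈ insert w₀ D.A, ‖hom D v w‖ ^ (if w = w₀ then (1 : ℝ) else 0) = ‖hom D v w₀‖ := by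
    rw [Finset.prod_insert hw₀A, if_pos rfl, Real.rpow_one]
    rw [Finset.prod_eq_one, mul_one]
    intro w hw
    rw [if_neg (by rintro rfl; exact hw₀A hw), Real.rpow_zero]
  have hr : ∏ w ∈ insert w₀ D.A, ‖hom D v w‖ ^ (if w = w₀ then (0 : ℝ) else a w) = 0 := by
    obtain ⟨w₁, hw₁, hne⟩ : ∃ w ∈ D.A, a w ≠ 0 := by
      by_contra hcon
      push Not at hcon
      rw [Finset.sum_eq_zero hcon] at ha1
      exact zero_ne_one ha1
    refine Finset.prod_eq_zero (Finset.mem_insert_of_mem hw₁) ?_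
    rw [if_neg (by rintro rfl; exact hw₀A hw₁),
      (mul_eq_zero.1 (h0 w₁ hw₁)).resolve_left (hpos _).ne', Real.zero_rpow hne]
  rw [hl, hr, hom, dif_pos hw₀, norm_eq_zero] at e
  exact e

/-- The coordinates of the lattice points in the minimal face of the moment do not vanish. -/
theorem hom_ne_zero_of_moment {v : D.LatticePt → ℂ} {hv : v ≠ 0}
    (h : Projectivization.mk ℂ v hv ∈ toricVariety D) (ht : t ≠ 0) {m : Fin N → ℝ}
    (hm : moment D t (Projectivization.mk ℂ v hv) = m) {w₀ : Fin N → ℤ}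
    (hw₀ : emb w₀ ∈ D.fc {m}) : hom D v w₀ ≠ 0 := by
  classical
  have hpos : ∀ w, 0 < ‖t ^ D.lam w‖ := fun w => norm_pos_iff.2 (zpow_ne_zero _ ht)
  have hZ := sum_norm_hom_pos h ht
  rw [moment_mk, momentHom] at hm
  set Z := ∑ w ∈ D.A, ‖t ^ D.lam w‖ * ‖hom D v w‖ with hZdef
  set p : (Fin N → ℤ) → ℝ := fun w => Z⁻¹ * (‖t ^ D.lam w‖ * ‖hom D v w‖) with hp
  have hp0 : ∀ w, 0 ≤ p w := fun w => by positivity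
  have hp1 : ∑ w ∈ D.A, p w = 1 := by
    rw [hp, ← Finset.mul_sum, inv_mul_cancel₀ hZ.ne']
  have hpm : ∑ w ∈ D.A, p w • emb w = m := by
    rw [← hm, Finset.smul_sum]
    simp_rw [hp, mul_smul]
  have hpne : ∀ w, p w ≠ 0 → hom D v w ≠ 0 := fun w hw h0 => hw (by simp [hp, h0])
  have hmD : m ∈ D.Delta := hpm ▸ D.convex_Delta.sum_mem (fun w _ => hp0 w) hp1
    fun w hw => D.emb_mem_Delta hw
  -- `m` is a proper convex combination of `w₀` and another point
  have hrel : m ∈ intrinsicInterior ℝ (D.fc {m}) :=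
    (mem_intrinsicInterior_fc_iff (Set.singleton_nonempty m) (Set.singleton_subset_iff.2 hmD)).2
      ⟨hmD, rfl⟩
  obtain ⟨δ, hδ, hz⟩ := exists_sub_smul_mem_of_intrinsicInterior hrel hw₀
  obtain ⟨a, ha0, ha1, ham⟩ := exists_weights hz.1
  set S := insert w₀ D.A with hS
  set p' : (Fin N → ℤ) → ℝ := fun w => if w ∈ D.A then p w else 0 with hp'
  set q : (Fin N → ℤ) → ℝ := fun w =>
    (1 + δ)⁻¹ * ((if w ∈ D.A then a w else 0) + if w = w₀ then δ else 0) with hq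
  have hsum : ∀ f : (Fin N → ℤ) → ℝ, ∑ w ∈ S, (if w ∈ D.A then f w else 0) = ∑ w ∈ D.A, f w := by
    intro f
    rw [← Finset.sum_filter]
    congr 1
    ext w
    simp only [hS, Finset.mem_filter, Finset.mem_insert]
    tauto
  have hsum' : ∀ f : (Fin N → ℤ) → ℝ, ∑ w ∈ S, (if w ∈ D.A then f w else 0) • emb w =
      ∑ w ∈ D.A, f w • emb w := by
    intro f
    simp_rw [ite_smul, zero_smul]
    rw [← Finset.sum_filter]
    congr 1
    ext w
    simp only [hS, Finset.mem_filter, Finset.mem_insert]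
    tauto
  have h1δ : (1 + δ) ≠ 0 := by positivity
  have hw₀S : w₀ ∈ S := Finset.mem_insert_self _ _
  have hq0 : ∀ w ∈ S, 0 ≤ q w := fun w _ => by
    refine mul_nonneg (by positivity) (add_nonneg ?_ ?_)
    · split_ifs with h
      · exact ha0 w h
      · exact le_rfl
    · split_ifs
      · exact hδ.le
      · exact le_rfl
  have e := prod_rpow_eq h (S := S) (p := p') (q := q)
    (fun w hw => by
      rcases Finset.mem_insert.1 hw with rfl | hw
      · exact hw₀.1
      · exact D.emb_mem_Delta hw)
    (fun w _ => by rw [hp']; dsimp only; split_ifs <;> simp [hp0])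
    hq0 (by rw [hp', hsum, hp1])
    (by
      rw [hq, ← Finset.mul_sum, Finset.sum_add_distrib, hsum, ha1, Finset.sum_ite_eq', if_pos hw₀S,
        inv_mul_cancel₀ h1δ])
    (by
      rw [hp', hsum', hpm]
      simp_rw [hq, mul_smul]
      rw [← Finset.smul_sum]
      simp_rw [add_smul]
      rw [Finset.sum_add_distrib, hsum', ham]
      simp_rw [ite_smul, zero_smul]
      rw [Finset.sum_ite_eq', if_pos hw₀S]
      have : m - δ • (emb w₀ - m) + δ • emb w₀ = (1 + δ) • m := by module
      rw [this, smul_smul, inv_mul_cancel₀ h1δ, one_smul])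
  -- Both p' and q have mean m. If x^{w₀} vanished, so would the q-product, as q is positive at w₀;
  -- but p' is supported on nonvanishing coordinates, and 0 ^ 0 = 1 in the remaining factors, so the
  -- p'-product is nonzero.
  intro h0
  have hq₀ : q w₀ ≠ 0 := by
    have h1 : 0 ≤ if w₀ ∈ D.A then a w₀ else 0 := by
      split_ifs with h
      · exact ha0 _ h
      · exact le_rfl
    rw [hq]
    simp only [if_true]
    positivity
  rw [Finset.prod_eq_zero (f := fun w => ‖hom D v w‖ ^ q w) hw₀S
    (by rw [h0, norm_zero, Real.zero_rpow hq₀]), Finset.prod_eq_zero_iff] at e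
  obtain ⟨w, -, hw⟩ := e
  rw [Real.rpow_eq_zero_iff_of_nonneg (norm_nonneg _), norm_eq_zero, hp'] at hw
  dsimp only at hw
  obtain ⟨h1, h2⟩ := hw
  split_ifs at h2
  · exact hpne w h2 h1
  · exact h2 rfl

end TorusFib

namespace TorusFib

variable {N : ℕ} {D : FamilyData N} {t : ℂ} {τ : Finset (Fin N → ℝ)}

open FamilyData

/-! ### The affine charts -/

theorem mem_closure_units (y : Fin N → ℂ) : y ∈ closure {y : Fin N → ℂ | ∀ i, y i ≠ 0} := by
  have : {y : Fin N → ℂ | ∀ i, y i ≠ 0} = Set.univ.pi fun _ => ({0}ᶜ : Set ℂ) := by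
    ext y; simp [Set.mem_pi]
  rw [this, closure_pi_set]
  intro i _
  exact dense_compl_singleton (0 : ℂ) (y i)

/-- The domain of the associated coordinates. -/
def coordDom (D : FamilyData N) (τ : Finset (Fin N → ℝ)) : Set (Fin N → ℂ) :=
  {y | ∀ i : Fin N, (i : ℕ) < dim (D.Theta τ) → y i ≠ 0}

namespace TauCoords

variable (c : TauCoords D τ)

theorem continuousAt_monomial {y : Fin N → ℂ} (hy : y ∈ coordDom D τ) {w : Fin N → ℤ}
    (hw : emb w ∈ D.Delta) : ContinuousAt (fun y : Fin N → ℂ => ∏ i, y i ^ c.expo w i) y := by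
  refine tendsto_finsetProd _ fun i _ => ?_
  refine ContinuousAt.zpow₀ (continuous_apply i).continuousAt _ ?_
  by_cases h : (i : ℕ) < dim (D.Theta τ)
  · exact Or.inl (hy i h)
  · exact Or.inr (c.expo_nonneg (not_lt.1 h) hw)

theorem continuousAt_vec {y : Fin N → ℂ} (hy : y ∈ coordDom D τ) : ContinuousAt c.vec y :=
  continuousAt_pi.2 fun w => c.continuousAt_monomial hy w.2

theorem continuousAt_chart {y : Fin N → ℂ} (hy : y ∈ coordDom D τ) : ContinuousAt c.chart y := by
  have h : ContinuousAt (fun y => (⟨c.vec y, c.vec_ne_zero y⟩ : {v : D.LatticePt → ℂ // v ≠ 0})) y :=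
    Topology.IsEmbedding.subtypeVal.continuousAt_iff.2 (c.continuousAt_vec hy)
  exact ContinuousAt.comp (g := Projectivization.mk' ℂ)
    (isQuotientMap_mk'.continuous.continuousAt) h

theorem chart_eq_mk {v : D.LatticePt → ℂ} (hv : v ≠ 0) {y : Fin N → ℂ} {a : ℂ}
    (h : v = a • c.vec y) : Projectivization.mk ℂ v hv = c.chart y := by
  rw [c.chart_eq, Projectivization.mk_eq_mk_iff']
  exact ⟨a, h.symm⟩

theorem exists_torus_of_units {y : Fin N → ℂ} (hy : ∀ i, y i ≠ 0) : ∃ x : Fin N → ℂˣ,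
    c.chart y = torusMap D x ∧ (∃ a : ℂ, a ≠ 0 ∧ ∀ p, c.vec y p = a * chi x p.1) ∧
      ∀ i, (chi x (c.b i) : ℂ) = y i := by
  obtain ⟨x, hx⟩ := exists_chi_eq c.b fun i => Units.mk0 (y i) (hy i)
  have hx' : ∀ w, (chi x w : ℂ) = ∏ i, y i ^ c.b.repr w i := fun w => by
    rw [hx, Units.coe_prod]
    simp only [Units.val_zpow_eq_zpow_val, Units.val_mk0]
  have hvec : ∀ p, c.vec y p = (((chi x c.Om)⁻¹ : ℂˣ) : ℂ) * chi x p.1 := fun p => by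
    have h1 : chi x p.1 = chi x c.Om * chi x (p.1 - c.Om) := by
      rw [← chi_add, add_sub_cancel]
    rw [h1, Units.val_mul, ← mul_assoc, Units.inv_mul, one_mul, hx']
    rfl
  refine ⟨x, ?_, ⟨_, Units.ne_zero _, hvec⟩, fun i => ?_⟩
  · rw [c.chart_eq, torusMap, Projectivization.mk_eq_mk_iff']
    exact ⟨_, funext fun p => (hvec p).symm⟩
  · rw [hx', Finset.prod_eq_single i]
    · simp
    · intro j _ hj
      rw [c.b.repr_self, Finsupp.single_eq_of_ne hj, zpow_zero]
    · simp

theorem chart_mem_toricVariety {y : Fin N → ℂ} (hy : y ∈ coordDom D τ) : c.chart y ∈ toricVariety D := by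
  refine closure_mono ?_
    ((c.continuousAt_chart hy).continuousWithinAt.mem_closure_image (mem_closure_units y))
  rintro _ ⟨y', hy', rfl⟩
  obtain ⟨x, hx, -⟩ := c.exists_torus_of_units hy'
  exact ⟨x, hx.symm⟩

theorem hom_vec_ne_zero {y : Fin N → ℂ} (hy : y ∈ coordDom D τ) {w : Fin N → ℤ} (hw : emb w ∈ D.fc τ) :
    hom D (c.vec y) w ≠ 0 := by
  rw [c.hom_vec y hw.1]
  refine Finset.prod_ne_zero_iff.2 fun i _ => ?_
  by_cases h : (i : ℕ) < dim (D.Theta τ)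
  · exact zpow_ne_zero _ (hy i h)
  · rw [(c.expo_eq_zero_iff (not_lt.1 h)).2 (hw.2 _ (c.dual_mem (not_lt.1 h))), zpow_zero]
    exact one_ne_zero

/-- The coordinates as functions on projective space. -/
theorem exists_coordMap : ∃ (U : Set (ℙ ℂ (D.LatticePt → ℂ)))
    (Y : ℙ ℂ (D.LatticePt → ℂ) → Fin N → ℂ), IsOpen U ∧ ContinuousOn Y U ∧
      (∀ x ∈ toricVariety D, x ∈ U → Y x ∈ coordDom D τ ∧ c.chart (Y x) = x) ∧
      (∀ y ∈ coordDom D τ, c.chart y ∈ U ∧ Y (c.chart y) = y) ∧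
      ∀ v hv, (∀ w : Fin N → ℤ, emb w ∈ D.fc τ → hom D v w ≠ 0) →
        Projectivization.mk ℂ v hv ∈ U := by
  obtain ⟨v₀, -, g, hv₀, hg, -, hsub, hgfc⟩ :=
    exists_face_basis (bdry_nonempty c.mem_bdry) (bdry_subset c.mem_bdry)
  -- Ω + b_i need not lie in Δ, so y_i is written through the ratios x^{v₀ + g_j}/x^{v₀} at a vertex
  -- v₀ of Θ_τ. The exponent of a ratio that may vanish is nonnegative, and it is zero for the
  -- invertible coordinates.
  set n : Fin N → Fin N → ℤ := fun i j => dualVec g j ⬝ᵥ c.b i with hn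
  have hn0 : ∀ i j, dualVec g j ∈ D.nrm τ →
      0 ≤ n i j ∧ ((i : ℕ) < dim (D.Theta τ) → n i j = 0) := by
    intro i j hj
    obtain ⟨i', hi', he⟩ := c.nrm_eq ▸ hj
    have hi' : dim (D.Theta τ) ≤ (i' : ℕ) := hi'
    have : n i j = if i' = i then 1 else 0 := by
      rw [hn]
      dsimp only
      rw [← he, dual, dualVec_dotProduct_basis]
    rw [this]
    refine ⟨by split_ifs <;> norm_num, fun hi => if_neg ?_⟩
    rintro rfl
    omega
  set Y₀ : (D.LatticePt → ℂ) → Fin N → ℂ := fun v i =>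
    ∏ j, (hom D v (v₀ + g j) / hom D v v₀) ^ n i j with hY₀
  set G : Set (D.LatticePt → ℂ) :=
    {v | hom D v v₀ ≠ 0 ∧ ∀ j, dualVec g j ∉ D.nrm τ → hom D v (v₀ + g j) ≠ 0} with hG
  have hGopen : IsOpen G := by
    refine (isOpen_ne_fun (continuous_hom v₀) continuous_const).inter (?_ : IsOpen
      {v : D.LatticePt → ℂ | ∀ j, dualVec g j ∉ D.nrm τ → hom D v (v₀ + g j) ≠ 0})
    have : {v : D.LatticePt → ℂ | ∀ j, dualVec g j ∉ D.nrm τ → hom D v (v₀ + g j) ≠ 0} =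
        ⋂ j, {v | dualVec g j ∉ D.nrm τ → hom D v (v₀ + g j) ≠ 0} := by ext; simp
    rw [this]
    refine isOpen_iInter_of_finite fun j => ?_
    by_cases h : dualVec g j ∉ D.nrm τ
    · simpa only [h, not_false_eq_true, true_imp_iff] using
        isOpen_ne_fun (continuous_hom _) continuous_const
    · simp [h]
  have hGsmul : ∀ v (a : ℂ), a ≠ 0 → (a • v ∈ G ↔ v ∈ G) := by
    intro v a ha
    simp only [hG, Set.mem_ofPred_eq, hom_smul, ne_eq, mul_eq_zero, ha, false_or]
  have hYsmul : ∀ v (a : ℂ), a ≠ 0 → Y₀ (a • v) = Y₀ v := by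
    intro v a ha
    funext i
    simp only [hY₀, hom_smul, mul_div_mul_left _ _ ha]
  have hYcont : ∀ v ∈ G, ContinuousAt Y₀ v := by
    intro v hv
    refine continuousAt_pi.2 fun i => tendsto_finsetProd _ fun j _ => ?_
    refine ContinuousAt.zpow₀ ((continuous_hom _).continuousAt.div
      (continuous_hom _).continuousAt hv.1) _ ?_
    by_cases h : dualVec g j ∈ D.nrm τ
    · exact Or.inr (hn0 i j h).1
    · exact Or.inl (div_ne_zero (hv.2 j h) hv.1)
  have hYdom : ∀ v ∈ G, Y₀ v ∈ coordDom D τ := by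
    intro v hv i hi
    refine Finset.prod_ne_zero_iff.2 fun j _ => ?_
    by_cases h : dualVec g j ∈ D.nrm τ
    · rw [(hn0 i j h).2 hi, zpow_zero]
      exact one_ne_zero
    · exact zpow_ne_zero _ (div_ne_zero (hv.2 j h) hv.1)
  have hYtorus : ∀ (v : D.LatticePt → ℂ) (a : ℂ) (x : Fin N → ℂˣ), a ≠ 0 →
      (∀ p, v p = a * chi x p.1) → ∀ i, Y₀ v i = chi x (c.b i) := by
    intro v a x ha hv i
    have h1 : ∀ j, hom D v (v₀ + g j) / hom D v v₀ = chi x (g j) := fun j => by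
      rw [hom, hom, dif_pos (hg j), dif_pos hv₀.1, hv, hv, mul_div_mul_left _ _ ha, chi_add,
        Units.val_mul, mul_div_cancel_left₀ _ (Units.ne_zero _)]
    have h2 : c.b i = ∑ j, n i j • g j := by
      conv_lhs => rw [← g.sum_repr (c.b i)]
      exact Finset.sum_congr rfl fun j _ => by rw [hn]; dsimp only; rw [dualVec_dotProduct]
    rw [h2, chi_sum, Units.coe_prod, hY₀]
    dsimp only
    refine Finset.prod_congr rfl fun j _ => ?_
    rw [h1, chi_smul, Units.val_zpow_eq_zpow_val]
  have hrep : ∀ v hv, ∃ a : ℂ, a ≠ 0 ∧ (Projectivization.mk ℂ v hv).rep = a • v :=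
    fun v hv => exists_rep_mk (D := D) v hv
  have hUmk : ∀ v hv, (Projectivization.mk ℂ v hv).rep ∈ G ↔ v ∈ G := fun v hv => by
    obtain ⟨a, ha, e⟩ := hrep v hv
    rw [e, hGsmul v a ha]
  have hYmk : ∀ v hv, Y₀ (Projectivization.mk ℂ v hv).rep = Y₀ v := fun v hv => by
    obtain ⟨a, ha, e⟩ := hrep v hv
    rw [e, hYsmul v a ha]
  have hpre : Projectivization.mk' ℂ ⁻¹' {x : ℙ ℂ (D.LatticePt → ℂ) | x.rep ∈ G} =
      (Subtype.val : {v : D.LatticePt → ℂ // v ≠ 0} → _) ⁻¹' G := by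
    ext ⟨v, hv⟩
    exact hUmk v hv
  have hUopen : IsOpen {x : ℙ ℂ (D.LatticePt → ℂ) | x.rep ∈ G} := by
    rw [← isQuotientMap_mk'.isOpen_preimage, hpre]
    exact hGopen.preimage continuous_subtype_val
  refine ⟨{x | x.rep ∈ G}, fun x => Y₀ x.rep, hUopen, ?_, ?_, ?_, ?_⟩
  · rw [isQuotientMap_mk'.continuousOn_isOpen_iff hUopen, hpre]
    have : ((fun x : ℙ ℂ (D.LatticePt → ℂ) => Y₀ x.rep) ∘ Projectivization.mk' ℂ) =
        fun v : {v : D.LatticePt → ℂ // v ≠ 0} => Y₀ v.1 := by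
      funext ⟨v, hv⟩
      exact hYmk v hv
    rw [this]
    intro v hv
    exact (ContinuousAt.comp (g := Y₀) (hYcont _ hv)
      continuous_subtype_val.continuousAt).continuousWithinAt
  · intro x
    induction x using Projectivization.ind with
    | h v hv =>
    intro hx hxU
    have hvG := (hUmk v hv).1 hxU
    change Y₀ (Projectivization.mk ℂ v hv).rep ∈ coordDom D τ ∧ c.chart (Y₀ (Projectivization.mk ℂ v hv).rep)
      = _
    rw [hYmk v hv]
    refine ⟨hYdom v hvG, (c.chart_eq_mk hv (a := hom D v c.Om) ?_).symm⟩
    funext w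
    -- On the torus x^w equals x^Ω times the monomial in y; both sides are continuous on the chart
    -- domain.
    have key := eq_of_mem_closure (mem_closure_torus hx) (f := fun v => hom D v w.1)
      (g := fun v => hom D v c.Om * ∏ i, Y₀ v i ^ c.expo w.1 i)
      (continuous_hom _).continuousAt ((continuous_hom _).continuousAt.mul
        (ContinuousAt.comp (g := fun y : Fin N → ℂ => ∏ i, y i ^ c.expo w.1 i)
          (c.continuousAt_monomial (hYdom v hvG) w.2) (hYcont v hvG)))
      (by
        rintro v' ⟨a, ha, x, hx⟩
        have h1 : w.1 = c.Om + ∑ i, c.expo w.1 i • c.b i := by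
          have := c.b.sum_repr (w.1 - c.Om)
          rw [show ∑ i, c.expo w.1 i • c.b i = w.1 - c.Om from this, add_sub_cancel]
        have h2 : (chi x w.1 : ℂ) = chi x c.Om * ∏ i, (chi x (c.b i) : ℂ) ^ c.expo w.1 i := by
          conv_lhs => rw [h1, chi_add, chi_sum, Units.val_mul, Units.coe_prod]
          simp only [chi_smul, Units.val_zpow_eq_zpow_val]
        rw [hom, dif_pos w.2, hom, dif_pos c.Om_mem_Delta, hx, hx, h2, mul_assoc]
        simp_rw [hYtorus v' a x ha hx])
    rw [hom, dif_pos w.2] at key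
    exact key
  · intro y hy
    have hvG : c.vec y ∈ G :=
      ⟨c.hom_vec_ne_zero hy hv₀, fun j hj => c.hom_vec_ne_zero hy (hgfc j hj)⟩
    refine ⟨(hUmk _ (c.vec_ne_zero y)).2 hvG, (hYmk _ (c.vec_ne_zero y)).trans ?_⟩
    -- The identity is clear where all coordinates are nonzero, and these points are dense.
    refine eq_of_mem_closure (mem_closure_units y) (f := fun y => Y₀ (c.vec y)) (g := fun y => y)
      (ContinuousAt.comp (hYcont _ hvG) (c.continuousAt_vec hy)) continuousAt_id ?_
    intro y' hy'
    obtain ⟨x, -, ⟨a, ha, hx⟩, hb⟩ := c.exists_torus_of_units hy'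
    funext i
    rw [hYtorus _ a x ha hx, hb]
  · intro v hv h
    exact (hUmk v hv).2 ⟨h _ hv₀, fun j hj => h _ (hgfc j hj)⟩

end TauCoords

end TorusFib

namespace TorusFib

/-! ### The local model of the fibers -/

/-- The data of the local model: the coordinates `y` run over the tori with radii
`(1 - u) r + u r'`, subject to the equation `c₀ ∏_{i ≥ l} y_i = P(y_1, …, y_l)`. -/
structure Model (N l : ℕ) where
  r : Fin N → ℝ
  r' : Fin N → ℝ
  i₀ : Fin N
  le_i₀ : l ≤ (i₀ : ℕ)
  r_nonneg : ∀ i, 0 ≤ r i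
  r_le : ∀ i, r i ≤ r' i
  r'_pos : ∀ i, 0 < r' i
  r_eq : ∀ i : Fin N, (i : ℕ) < l → r i = r' i
  r_i₀ : r i₀ = 0
  c₀ : ℂ
  c₀_ne : c₀ ≠ 0
  P : ({i : Fin N // (i : ℕ) < l} → ℂ) → ℂ
  smooth : ∀ Y ∈ baseTorus l r, ContDiffAt ℝ ∞ P Y
  norm_lt : ∀ Y ∈ baseTorus l r,
    ‖P Y‖ < ‖c₀‖ * ∏ i ∈ Finset.univ.filter (fun i : Fin N => l ≤ (i : ℕ)), r' i

namespace Model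

variable {N l : ℕ} (m : Model N l)

/-- The radii. -/
def rad (u : ℝ) (i : Fin N) : ℝ := (1 - u) * m.r i + u * m.r' i

/-- The points of the model. -/
def space : Set (Fin N → ℂ) :=
  {y | ∃ u ∈ Set.Icc (0 : ℝ) 1, (∀ i, ‖y i‖ = m.rad u i) ∧
    m.c₀ * ∏ i ∈ Finset.univ.filter (fun i : Fin N => l ≤ (i : ℕ)), y i = m.P fun i => y i.1}

/-- The indices of the free normal coordinates. -/
def J : Finset (Fin N) := Finset.univ.filter fun i : Fin N => l ≤ (i : ℕ) ∧ i ≠ m.i₀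

theorem mem_J {i : Fin N} : i ∈ m.J ↔ l ≤ (i : ℕ) ∧ i ≠ m.i₀ := by simp [J]

theorem prod_filter {R : Type*} [CommMonoid R] (f : Fin N → R) :
    ∏ i ∈ Finset.univ.filter (fun i : Fin N => l ≤ (i : ℕ)), f i = f m.i₀ * ∏ i ∈ m.J, f i := by
  have : Finset.univ.filter (fun i : Fin N => l ≤ (i : ℕ)) = insert m.i₀ m.J := by
    ext i
    simp only [Finset.mem_filter, Finset.mem_univ, true_and, Finset.mem_insert, m.mem_J]
    constructor
    · intro h
      by_cases h' : i = m.i₀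
      · exact Or.inl h'
      · exact Or.inr ⟨h, h'⟩
    · rintro (rfl | h)
      · exact m.le_i₀
      · exact h.1
  rw [this, Finset.prod_insert fun h => (m.mem_J.1 h).2 rfl]

theorem rad_eq (u : ℝ) (i : Fin N) : m.rad u i = m.r i + u * (m.r' i - m.r i) := by
  rw [rad]; ring

theorem rad_zero (i : Fin N) : m.rad 0 i = m.r i := by simp [rad]

theorem rad_one (i : Fin N) : m.rad 1 i = m.r' i := by simp [rad]

theorem rad_i₀ (u : ℝ) : m.rad u m.i₀ = u * m.r' m.i₀ := by rw [rad, m.r_i₀, mul_zero, zero_add]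

theorem rad_of_lt (u : ℝ) {i : Fin N} (hi : (i : ℕ) < l) : m.rad u i = m.r i := by
  rw [rad_eq, m.r_eq i hi]; ring

theorem rad_nonneg {u : ℝ} (hu : 0 ≤ u) (i : Fin N) : 0 ≤ m.rad u i := by
  rw [rad_eq]
  have := m.r_nonneg i
  have := m.r_le i
  have := mul_nonneg hu (sub_nonneg.2 (m.r_le i))
  linarith

theorem rad_mono {u v : ℝ} (h : u ≤ v) (i : Fin N) : m.rad u i ≤ m.rad v i := by
  rw [rad_eq, rad_eq]
  have := mul_le_mul_of_nonneg_right h (sub_nonneg.2 (m.r_le i))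
  linarith

theorem rad_pos {u : ℝ} (hu : 0 < u) (i : Fin N) : 0 < m.rad u i := by
  rw [rad_eq]
  have h1 := m.r_nonneg i
  have h2 := m.r'_pos i
  rcases h1.eq_or_lt with h | h
  · rw [← h]; simp only [sub_zero, zero_add]; positivity
  · have := mul_nonneg hu.le (sub_nonneg.2 (m.r_le i))
    linarith

/-- The product of the radii of the free normal coordinates. -/
def K (u : ℝ) : ℝ := ∏ i ∈ m.J, m.rad u i

theorem K_mono {u v : ℝ} (hu : 0 ≤ u) (h : u ≤ v) : m.K u ≤ m.K v :=
  Finset.prod_le_prod (fun i _ => m.rad_nonneg hu i) fun i _ => m.rad_mono h i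

theorem K_pos {u : ℝ} (hu : 0 < u) : 0 < m.K u := Finset.prod_pos fun i _ => m.rad_pos hu i

theorem K_nonneg {u : ℝ} (hu : 0 ≤ u) : 0 ≤ m.K u :=
  Finset.prod_nonneg fun i _ => m.rad_nonneg hu i

theorem contDiff_K : ContDiff ℝ ∞ m.K := by
  unfold K rad
  fun_prop

/-- The product of the radii of the normal coordinates, extended to negative parameters. -/
noncomputable def H (u : ℝ) : ℝ := max u 0 * m.r' m.i₀ * m.K (max u 0) + min u 0

theorem H_of_nonneg {u : ℝ} (hu : 0 ≤ u) : m.H u = u * m.r' m.i₀ * m.K u := by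
  rw [H, max_eq_left hu, min_eq_right hu, add_zero]

theorem H_of_nonpos {u : ℝ} (hu : u ≤ 0) : m.H u = u := by
  rw [H, max_eq_right hu, min_eq_left hu]; ring

theorem continuous_H : Continuous m.H := by
  have := m.contDiff_K.continuous
  unfold H
  fun_prop

theorem strictMono_H : StrictMono m.H := by
  intro u v huv
  rcases le_total v 0 with hv | hv
  · rw [m.H_of_nonpos hv, m.H_of_nonpos (huv.le.trans hv)]
    exact huv
  rcases le_total u 0 with hu | hu
  · rw [m.H_of_nonpos hu, m.H_of_nonneg hv]
    rcases hu.eq_or_lt with rfl | hu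
    · have := m.K_pos huv
      have := m.r'_pos m.i₀
      positivity
    · have := m.K_nonneg hv
      have := (m.r'_pos m.i₀).le
      have : 0 ≤ v * m.r' m.i₀ * m.K v := by positivity
      linarith
  · rw [m.H_of_nonneg hu, m.H_of_nonneg hv]
    have hv : 0 < v := hu.trans_lt huv
    have h1 := m.K_mono hu huv.le
    have h2 := m.K_pos hv
    have h3 := m.r'_pos m.i₀
    calc u * m.r' m.i₀ * m.K u ≤ u * m.r' m.i₀ * m.K v := by gcongr
      _ < v * m.r' m.i₀ * m.K v := by gcongr

/-- Continuing H by the identity on negative parameters makes it a homeomorphism of the whole line,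
so its inverse is continuous at 0 with no boundary case. -/
theorem surjective_H : Function.Surjective m.H := by
  refine m.continuous_H.surjective ?_ ?_
  · have h1 : Filter.Tendsto (fun u : ℝ => u * (m.r' m.i₀ * m.K 1)) Filter.atTop Filter.atTop :=
      Filter.tendsto_id.atTop_mul_const (mul_pos (m.r'_pos _) (m.K_pos one_pos))
    refine Filter.tendsto_atTop_mono' _ ?_ h1
    filter_upwards [Filter.eventually_ge_atTop 1] with u hu
    have hu0 : (0 : ℝ) ≤ u := by linarith
    rw [m.H_of_nonneg hu0, mul_assoc]
    have := m.K_mono zero_le_one hu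
    have := (m.r'_pos m.i₀).le
    gcongr
  · refine Filter.tendsto_id.congr' ?_
    filter_upwards [Filter.eventually_le_atBot 0] with u hu
    exact (m.H_of_nonpos hu).symm

/-- `H` as a homeomorphism. -/
noncomputable def homeoH : ℝ ≃ₜ ℝ :=
  (StrictMono.orderIsoOfSurjective m.H m.strictMono_H m.surjective_H).toHomeomorph

/-- The parameter determined by the first `l` coordinates. -/
noncomputable def par (Y : {i : Fin N // (i : ℕ) < l} → ℂ) : ℝ :=
  m.homeoH.symm (‖m.P Y‖ / ‖m.c₀‖)

theorem H_par (Y : {i : Fin N // (i : ℕ) < l} → ℂ) : m.H (m.par Y) = ‖m.P Y‖ / ‖m.c₀‖ :=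
  m.homeoH.apply_symm_apply _

theorem par_eq {Y : {i : Fin N // (i : ℕ) < l} → ℂ} {u : ℝ} (h : m.H u = ‖m.P Y‖ / ‖m.c₀‖) :
    m.par Y = u := m.strictMono_H.injective ((m.H_par Y).trans h.symm)

theorem par_nonneg (Y : {i : Fin N // (i : ℕ) < l} → ℂ) : 0 ≤ m.par Y := by
  by_contra h
  have h1 := m.H_par Y
  rw [m.H_of_nonpos (not_le.1 h).le] at h1
  exact h (h1 ▸ by positivity)

theorem par_eq_zero_iff {Y : {i : Fin N // (i : ℕ) < l} → ℂ} : m.par Y = 0 ↔ m.P Y = 0 := by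
  have hc := norm_ne_zero_iff.2 m.c₀_ne
  constructor
  · intro h
    have h1 := m.H_par Y
    rw [h, m.H_of_nonpos le_rfl, eq_comm, div_eq_zero_iff] at h1
    exact norm_eq_zero.1 (h1.resolve_right hc)
  · intro h
    refine m.par_eq ?_
    rw [m.H_of_nonpos le_rfl, h, norm_zero, zero_div]

theorem par_pos {Y : {i : Fin N // (i : ℕ) < l} → ℂ} (h : m.P Y ≠ 0) : 0 < m.par Y :=
  lt_of_le_of_ne (m.par_nonneg Y) fun h0 => h (m.par_eq_zero_iff.1 h0.symm)

theorem par_lt_one {Y : {i : Fin N // (i : ℕ) < l} → ℂ} (hY : Y ∈ baseTorus l m.r) :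
    m.par Y < 1 := by
  rw [← m.strictMono_H.lt_iff_lt, m.H_par, m.H_of_nonneg zero_le_one, one_mul,
    div_lt_iff₀ (norm_pos_iff.2 m.c₀_ne), mul_comm]
  have h := m.norm_lt Y hY
  rw [m.prod_filter] at h
  rw [K]
  simp_rw [m.rad_one]
  exact h

theorem continuous_P : Continuous fun Y : baseTorus l m.r => m.P Y :=
  continuous_iff_continuousAt.2 fun Y =>
    (m.smooth Y.1 Y.2).continuousAt.comp continuous_subtype_val.continuousAt

theorem continuous_par : Continuous fun Y : baseTorus l m.r => m.par Y :=
  m.homeoH.symm.continuous.comp (m.continuous_P.norm.div_const _)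

/-- The phase of the right-hand side of the equation. -/
noncomputable def phase (Y : {i : Fin N // (i : ℕ) < l} → ℂ) : ℂ :=
  (m.P Y / m.c₀) / ‖m.P Y / m.c₀‖

theorem norm_phase {Y : {i : Fin N // (i : ℕ) < l} → ℂ} (h : m.P Y ≠ 0) : ‖m.phase Y‖ = 1 := by
  have h1 : ‖m.P Y / m.c₀‖ ≠ 0 := norm_ne_zero_iff.2 (div_ne_zero h m.c₀_ne)
  rw [phase, norm_div, Complex.norm_real, norm_norm, div_self h1]

theorem norm_phase_le (Y : {i : Fin N // (i : ℕ) < l} → ℂ) : ‖m.phase Y‖ ≤ 1 := by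
  by_cases h : m.P Y = 0
  · simp [phase, h]
  · exact (m.norm_phase h).le

/-- The phase may jump at the zeros of P, but it is bounded and the radius of y_{i₀} tends to zero
there. -/
theorem continuous_rad_phase :
    Continuous fun Y : baseTorus l m.r => (m.rad (m.par Y) m.i₀ : ℂ) * m.phase Y := by
  rw [continuous_iff_continuousAt]
  intro Y
  have hrad : Continuous fun Y : baseTorus l m.r => m.rad (m.par Y) m.i₀ := by
    simp_rw [m.rad_i₀]
    exact m.continuous_par.mul_const _
  have hq : Continuous fun Y : baseTorus l m.r => m.P Y / m.c₀ := m.continuous_P.div_const _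
  by_cases h : m.P Y = 0
  · have h0 : (m.rad (m.par Y) m.i₀ : ℂ) * m.phase Y = 0 := by simp [phase, h]
    rw [ContinuousAt, h0]
    refine squeeze_zero_norm (a := fun Y : baseTorus l m.r => m.rad (m.par Y) m.i₀)
      (fun Y => ?_) ?_
    · rw [norm_mul, Complex.norm_real, Real.norm_of_nonneg (m.rad_nonneg (m.par_nonneg _) _)]
      exact mul_le_of_le_one_right (m.rad_nonneg (m.par_nonneg _) _) (m.norm_phase_le _)
    · have := hrad.tendsto Y
      rwa [m.par_eq_zero_iff.2 h, m.rad_i₀, zero_mul] at this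
  · refine ((Complex.continuous_ofReal.comp hrad).continuousAt).mul (hq.continuousAt.div
      (Complex.continuous_ofReal.comp hq.norm).continuousAt ?_)
    simp only [ne_eq, Complex.ofReal_eq_zero, norm_eq_zero]
    exact div_ne_zero h m.c₀_ne

/-- The parametrization of the model. -/
noncomputable def param (Y : {i : Fin N // (i : ℕ) < l} → ℂ) (ζ : Fin N → Circle) (i : Fin N) : ℂ :=
  if h : (i : ℕ) < l then Y ⟨i, h⟩
  else if i = m.i₀ then m.rad (m.par Y) m.i₀ * m.phase Y * ∏ j ∈ m.J, (((ζ j)⁻¹ : Circle) : ℂ)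
  else m.rad (m.par Y) i * ζ i

theorem param_of_lt (Y : {i : Fin N // (i : ℕ) < l} → ℂ) (ζ : Fin N → Circle) {i : Fin N}
    (h : (i : ℕ) < l) : m.param Y ζ i = Y ⟨i, h⟩ := dif_pos h

theorem param_i₀ (Y : {i : Fin N // (i : ℕ) < l} → ℂ) (ζ : Fin N → Circle) : m.param Y ζ m.i₀ =
    m.rad (m.par Y) m.i₀ * m.phase Y * ∏ j ∈ m.J, (((ζ j)⁻¹ : Circle) : ℂ) := by
  rw [param, dif_neg (not_lt.2 m.le_i₀), if_pos rfl]

theorem param_of_mem (Y : {i : Fin N // (i : ℕ) < l} → ℂ) (ζ : Fin N → Circle) {i : Fin N}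
    (h : i ∈ m.J) : m.param Y ζ i = m.rad (m.par Y) i * ζ i := by
  rw [param, dif_neg (not_lt.2 (m.mem_J.1 h).1), if_neg (m.mem_J.1 h).2]

theorem cases_index (i : Fin N) : (i : ℕ) < l ∨ i = m.i₀ ∨ i ∈ m.J := by
  by_cases h : (i : ℕ) < l
  · exact Or.inl h
  by_cases h' : i = m.i₀
  · exact Or.inr (Or.inl h')
  · exact Or.inr (Or.inr (m.mem_J.2 ⟨not_lt.1 h, h'⟩))

theorem continuous_param :
    Continuous fun q : baseTorus l m.r × (Fin N → Circle) => m.param q.1 q.2 := by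
  refine continuous_pi fun i => ?_
  rcases m.cases_index i with h | rfl | h
  · simp_rw [m.param_of_lt _ _ h]
    exact (continuous_apply (⟨i, h⟩ : {i : Fin N // (i : ℕ) < l})).comp
      (continuous_subtype_val.comp continuous_fst)
  · simp_rw [m.param_i₀]
    refine (m.continuous_rad_phase.comp continuous_fst).mul ?_
    exact continuous_finsetProd _ fun j _ => by fun_prop
  · simp_rw [m.param_of_mem _ _ h]
    have : Continuous fun Y : baseTorus l m.r => m.rad (m.par Y) i := by
      unfold rad
      have := m.continuous_par
      fun_prop
    have := this.comp (continuous_fst (X := baseTorus l m.r) (Y := Fin N → Circle))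
    refine (Complex.continuous_ofReal.comp this).mul ?_
    fun_prop

theorem norm_param {Y : {i : Fin N // (i : ℕ) < l} → ℂ} (hY : Y ∈ baseTorus l m.r)
    (ζ : Fin N → Circle) (i : Fin N) : ‖m.param Y ζ i‖ = m.rad (m.par Y) i := by
  have h0 : ∀ i, ‖(m.rad (m.par Y) i : ℂ)‖ = m.rad (m.par Y) i := fun i => by
    rw [Complex.norm_real, Real.norm_of_nonneg (m.rad_nonneg (m.par_nonneg _) _)]
  rcases m.cases_index i with h | rfl | h
  · rw [m.param_of_lt _ _ h, m.rad_of_lt _ h]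
    exact hY ⟨i, h⟩
  · rw [m.param_i₀, norm_mul, norm_mul, h0, norm_prod]
    simp only [Circle.norm_coe, Finset.prod_const_one, mul_one]
    by_cases hP : m.P Y = 0
    · rw [m.par_eq_zero_iff.2 hP, m.rad_i₀, zero_mul, zero_mul]
    · rw [m.norm_phase hP, mul_one]
  · rw [m.param_of_mem _ _ h, norm_mul, h0, Circle.norm_coe, mul_one]

theorem param_restrict (Y : {i : Fin N // (i : ℕ) < l} → ℂ) (ζ : Fin N → Circle) :
    (fun i : {i : Fin N // (i : ℕ) < l} => m.param Y ζ i.1) = Y :=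
  funext fun i => m.param_of_lt Y ζ i.2

/-- The parameter u is chosen to match the absolute values of the two sides; the argument of y_{i₀}
compensates the free arguments of the other normal coordinates. -/
theorem param_mem {Y : {i : Fin N // (i : ℕ) < l} → ℂ} (hY : Y ∈ baseTorus l m.r)
    (ζ : Fin N → Circle) : m.param Y ζ ∈ m.space := by
  refine ⟨m.par Y, ⟨m.par_nonneg Y, (m.par_lt_one hY).le⟩, m.norm_param hY ζ, ?_⟩
  rw [m.param_restrict, m.prod_filter, m.param_i₀]
  have h1 : ∏ i ∈ m.J, m.param Y ζ i = (m.K (m.par Y) : ℂ) * ∏ i ∈ m.J, (ζ i : ℂ) := by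
    rw [K, Complex.ofReal_prod, ← Finset.prod_mul_distrib]
    exact Finset.prod_congr rfl fun i hi => m.param_of_mem Y ζ hi
  have h2 : (∏ j ∈ m.J, (((ζ j)⁻¹ : Circle) : ℂ)) * ∏ i ∈ m.J, (ζ i : ℂ) = 1 := by
    rw [← Finset.prod_mul_distrib]
    refine Finset.prod_eq_one fun i _ => ?_
    rw [Circle.coe_inv, inv_mul_cancel₀ (Circle.coe_ne_zero _)]
  rw [h1]
  by_cases hP : m.P Y = 0
  · rw [hP, m.par_eq_zero_iff.2 hP, m.rad_i₀]
    simp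
  have h3 : m.rad (m.par Y) m.i₀ * m.K (m.par Y) = ‖m.P Y / m.c₀‖ := by
    rw [norm_div, ← m.H_par, m.H_of_nonneg (m.par_nonneg Y), m.rad_i₀]
  have h4 : (‖m.P Y / m.c₀‖ : ℂ) ≠ 0 :=
    Complex.ofReal_ne_zero.2 (norm_ne_zero_iff.2 (div_ne_zero hP m.c₀_ne))
  calc m.c₀ * ((m.rad (m.par Y) m.i₀ : ℂ) * m.phase Y * (∏ j ∈ m.J, (((ζ j)⁻¹ : Circle) : ℂ)) *
        ((m.K (m.par Y) : ℂ) * ∏ i ∈ m.J, (ζ i : ℂ)))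
      = m.c₀ * (((m.rad (m.par Y) m.i₀ * m.K (m.par Y) : ℝ) : ℂ) * m.phase Y) *
        ((∏ j ∈ m.J, (((ζ j)⁻¹ : Circle) : ℂ)) * ∏ i ∈ m.J, (ζ i : ℂ)) := by
          push_cast; ring
    _ = m.P Y := by
      rw [h2, h3, mul_one, phase, mul_div_cancel₀ _ h4, mul_div_cancel₀ _ m.c₀_ne]

theorem exists_param {y : Fin N → ℂ} (hy : y ∈ m.space) :
    (fun i : {i : Fin N // (i : ℕ) < l} => y i.1) ∈ baseTorus l m.r ∧
      ∃ ζ : Fin N → Circle, m.param (fun i => y i.1) ζ = y := by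
  obtain ⟨u, hu, hn, he⟩ := hy
  have hY : (fun i : {i : Fin N // (i : ℕ) < l} => y i.1) ∈ baseTorus l m.r := fun i => by
    rw [hn, m.rad_of_lt _ i.2]
  refine ⟨hY, ?_⟩
  set Y : {i : Fin N // (i : ℕ) < l} → ℂ := fun i => y i.1 with hYdef
  have hpar : m.par Y = u := by
    refine m.par_eq ?_
    rw [← he, norm_mul, mul_div_cancel_left₀ _ (norm_ne_zero_iff.2 m.c₀_ne), norm_prod]
    simp_rw [hn]
    rw [m.prod_filter, m.H_of_nonneg hu.1, m.rad_i₀, K]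
  have hphase : ∀ z : ℂ, ∃ ζ : Circle, z = ‖z‖ * ζ := by
    intro z
    refine ⟨Circle.exp z.arg, ?_⟩
    rw [Circle.coe_exp]
    exact (Complex.norm_mul_exp_arg_mul_I z).symm
  choose φ hφ using hphase
  refine ⟨fun i => φ (y i), ?_⟩
  have hJ : ∀ i ∈ m.J, m.param Y (fun i => φ (y i)) i = y i := fun i hi => by
    rw [m.param_of_mem _ _ hi, hpar, ← hn]
    exact (hφ _).symm
  have hlt : ∀ i : Fin N, (i : ℕ) < l → m.param Y (fun i => φ (y i)) i = y i := fun i hi =>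
    m.param_of_lt _ _ hi
  funext i
  rcases m.cases_index i with h | rfl | h
  · exact hlt i h
  -- Where P vanishes, u = 0 and y_{i₀} = 0; elsewhere the remaining normal coordinates are nonzero
  -- and the equation determines y_{i₀}.
  · by_cases hP : m.P Y = 0
    · have h0 : ‖y m.i₀‖ = 0 := by
        rw [hn, ← hpar, m.par_eq_zero_iff.2 hP, m.rad_zero, m.r_i₀]
      rw [norm_eq_zero.1 h0, ← norm_eq_zero, m.norm_param hY, hpar, ← hn, h0]
    · obtain ⟨v, -, -, he'⟩ := m.param_mem hY fun i => φ (y i)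
      rw [m.param_restrict, ← he, m.prod_filter, m.prod_filter, Finset.prod_congr rfl hJ] at he'
      have hu0 : 0 < u := hpar ▸ m.par_pos hP
      have hne : ∏ i ∈ m.J, y i ≠ 0 := Finset.prod_ne_zero_iff.2 fun i _ => by
        rw [← norm_pos_iff, hn]
        exact m.rad_pos hu0 i
      exact mul_right_cancel₀ hne (mul_left_cancel₀ m.c₀_ne he')
  · exact hJ i h

theorem param_injOn {Y : {i : Fin N // (i : ℕ) < l} → ℂ} {ζ ζ' : Fin N → Circle}
    (h : m.param Y ζ = m.param Y ζ') {i : Fin N} (hi : i ∈ m.J) (h0 : m.r i ≠ 0 ∨ m.P Y ≠ 0) :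
    ζ i = ζ' i := by
  have h1 := congrFun h i
  rw [m.param_of_mem _ _ hi, m.param_of_mem _ _ hi] at h1
  have hne : (m.rad (m.par Y) i : ℂ) ≠ 0 := by
    rw [Complex.ofReal_ne_zero]
    rcases h0 with h0 | h0
    · have h2 := m.rad_mono (m.par_nonneg Y) i
      rw [m.rad_zero] at h2
      exact ((lt_of_le_of_ne (m.r_nonneg i) (Ne.symm h0)).trans_le h2).ne'
    · exact (m.rad_pos (m.par_pos h0) i).ne'
  exact Circle.ext (mul_left_cancel₀ hne h1)

/-- The argument of a normal coordinate is visible exactly when its radius is nonzero. Over P = 0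
the parameter is 0, so coordinates with zero initial radius vanish and their circles collapse. -/
theorem param_congr {Y : {i : Fin N // (i : ℕ) < l} → ℂ} {ζ ζ' : Fin N → Circle}
    (h : ∀ i ∈ m.J, m.r i ≠ 0 ∨ m.P Y ≠ 0 → ζ i = ζ' i) : m.param Y ζ = m.param Y ζ' := by
  funext i
  rcases m.cases_index i with hi | rfl | hi
  · rw [m.param_of_lt _ _ hi, m.param_of_lt _ _ hi]
  · rw [m.param_i₀, m.param_i₀]
    by_cases hP : m.P Y = 0
    · rw [m.par_eq_zero_iff.2 hP, m.rad_i₀]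
      simp
    · congr 1
      refine Finset.prod_congr rfl fun i hi => ?_
      rw [h i hi (Or.inr hP)]
  · rw [m.param_of_mem _ _ hi, m.param_of_mem _ _ hi]
    by_cases h0 : m.r i ≠ 0 ∨ m.P Y ≠ 0
    · rw [h i hi h0]
    · push Not at h0
      rw [m.par_eq_zero_iff.2 h0.2, m.rad_zero, h0.1]
      simp

end Model

end TorusFib

namespace TorusFib

/-! ### The topology of the local model -/

/-- A compact parametrization compatible with a projection trivializes the projection over every
set over which it is bijective on fibers. -/
theorem exists_homeo_of_parametrization {B F M : Type*} [TopologicalSpace B] [TopologicalSpace F]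
    [TopologicalSpace M] [CompactSpace B] [CompactSpace F] [T2Space M] {Ψ : B × F → M}
    (hΨ : Continuous Ψ) {p : M → B} (hpΨ : ∀ b f, p (Ψ (b, f)) = b) {A : Set B}
    (hsurj : ∀ x, p x ∈ A → ∃ f, Ψ (p x, f) = x)
    (hinj : ∀ b ∈ A, ∀ f f', Ψ (b, f) = Ψ (b, f') → f = f') :
    ∃ e : {x // p x ∈ A} ≃ₜ {b // b ∈ A} × F, ∀ x, ((e x).1 : B) = p x := by
  let Ψ' : {b // b ∈ A} × F → {x // p x ∈ A} := fun q =>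
    ⟨Ψ (q.1.1, q.2), by rw [hpΨ]; exact q.1.2⟩
  have hc : Continuous Ψ' := by
    refine Continuous.subtype_mk (hΨ.comp ?_) _
    fun_prop
  have hbij : Function.Bijective Ψ' := by
    constructor
    · rintro ⟨⟨b, hb⟩, f⟩ ⟨⟨b', hb'⟩, f'⟩ h
      have h1 : Ψ (b, f) = Ψ (b', f') := congrArg Subtype.val h
      have h2 : b = b' := by rw [← hpΨ b f, h1, hpΨ]
      subst h2
      rw [hinj b hb f f' h1]
    · rintro ⟨x, hx⟩
      obtain ⟨f, hf⟩ := hsurj x hx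
      exact ⟨(⟨p x, hx⟩, f), Subtype.ext hf⟩
  -- A closed subset over A is the trace of a compact subset of B × F, whose image in the Hausdorff
  -- space M is closed.
  have hcl : IsClosedMap Ψ' := by
    intro K hK
    have hind : Topology.IsInducing (Prod.map Subtype.val id : {b // b ∈ A} × F → B × F) :=
      Topology.IsInducing.subtypeVal.prodMap Topology.IsInducing.id
    obtain ⟨K₀, hK₀, rfl⟩ := hind.isClosed_iff.1 hK
    have h1 : IsClosed (Subtype.val ⁻¹' (Ψ '' K₀) : Set {x // p x ∈ A}) :=
      ((hK₀.isCompact.image hΨ).isClosed).preimage continuous_subtype_val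
    convert h1 using 1
    ext ⟨x, hx⟩
    constructor
    · rintro ⟨q, hq, h⟩
      exact ⟨_, hq, congrArg Subtype.val h⟩
    · rintro ⟨⟨b, f⟩, hq, h⟩
      have hb : b ∈ A := by
        have : p x = b := by rw [← hpΨ b f]; exact congrArg p h.symm
        exact this ▸ hx
      exact ⟨(⟨b, hb⟩, f), hq, Subtype.ext h⟩
  let e := (Equiv.ofBijective Ψ' hbij).toHomeomorphOfContinuousClosed hc hcl
  refine ⟨e.symm, fun x => ?_⟩
  obtain ⟨q, rfl⟩ := e.surjective x
  rw [e.symm_apply_apply]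
  exact (hpΨ _ _).symm

/-- Extend a family of points of the circle by `1`. -/
noncomputable def extendOne {ι : Type*} {q : ι → Prop} [DecidablePred q] {n : ℕ}
    (e : {i // q i} ≃ Fin n) (θ : Torus n) (i : ι) : Circle :=
  if h : q i then θ (e ⟨i, h⟩) else 1

section extendOne

variable {ι : Type*} {q : ι → Prop} [DecidablePred q] {n : ℕ} (e : {i // q i} ≃ Fin n)

theorem extendOne_of_mem (θ : Torus n) {i : ι} (h : q i) : extendOne e θ i = θ (e ⟨i, h⟩) :=
  dif_pos h

theorem extendOne_of_notMem (θ : Torus n) {i : ι} (h : ¬ q i) : extendOne e θ i = 1 := dif_neg h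

theorem continuous_extendOne : Continuous (extendOne e) := by
  refine continuous_pi fun i => ?_
  by_cases h : q i
  · simp_rw [extendOne_of_mem e _ h]; fun_prop
  · simp_rw [extendOne_of_notMem e _ h]; fun_prop

theorem extendOne_injective {θ θ' : Torus n}
    (h : ∀ i, q i → extendOne e θ i = extendOne e θ' i) : θ = θ' := by
  funext a
  have h1 := h (e.symm a).1 (e.symm a).2
  rw [extendOne_of_mem e _ (e.symm a).2, extendOne_of_mem e _ (e.symm a).2] at h1
  simpa using h1

theorem extendOne_restrict (ζ : ι → Circle) {i : ι} (h : q i) :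
    extendOne e (fun a => ζ (e.symm a).1) i = ζ i := by
  rw [extendOne_of_mem e _ h, Equiv.symm_apply_apply]

end extendOne

theorem nonempty_equiv_fin {ι : Type*} (s : Finset ι) {n : ℕ} (h : s.card = n) :
    Nonempty ({i // i ∈ s} ≃ Fin n) := ⟨s.equivFinOfCardEq h⟩

theorem isCompact_baseTorus {N : ℕ} (l : ℕ) (r : Fin N → ℝ) : IsCompact (baseTorus l r) := by
  have : baseTorus l r = Set.univ.pi fun i => Metric.sphere (0 : ℂ) (r i.1) := by
    ext Y
    simp only [baseTorus, Set.mem_univ_pi, mem_sphere_zero_iff_norm]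
    rfl
  rw [this]
  exact isCompact_univ_pi fun i => isCompact_sphere _ _

instance {N : ℕ} (l : ℕ) (r : Fin N → ℝ) : CompactSpace (baseTorus l r) :=
  isCompact_iff_compactSpace.1 (isCompact_baseTorus l r)

theorem card_filter_le_val (N l : ℕ) :
    (Finset.univ.filter fun i : Fin N => l ≤ (i : ℕ)).card = N - l := by
  rw [← Finset.card_map Fin.valEmbedding, ← Nat.card_Ico]
  congr 1
  ext i
  simp only [Finset.mem_map, Finset.mem_filter, Finset.mem_univ, true_and, Finset.mem_Ico,
    Fin.valEmbedding_apply]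
  constructor
  · rintro ⟨a, ha, rfl⟩
    exact ⟨ha, a.2⟩
  · rintro ⟨h1, h2⟩
    exact ⟨⟨i, h2⟩, h1, rfl⟩

namespace Model

variable {N l : ℕ} (m : Model N l)

theorem card_J : m.J.card = N - 1 - l := by
  have h2 : Finset.univ.filter (fun i : Fin N => l ≤ (i : ℕ)) = insert m.i₀ m.J := by
    ext i
    simp only [Finset.mem_filter, Finset.mem_univ, true_and, Finset.mem_insert, m.mem_J]
    have := m.le_i₀
    by_cases h' : i = m.i₀
    · subst h'; simpa using this
    · simp [h']
  have h3 := card_filter_le_val N l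
  rw [h2, Finset.card_insert_of_notMem fun h => (m.mem_J.1 h).2 rfl] at h3
  omega

/-- The free normal coordinates with nonvanishing initial radius. -/
noncomputable def Jpos : Finset (Fin N) := m.J.filter fun i => m.r i ≠ 0

/-- The free normal coordinates with vanishing initial radius. -/
noncomputable def Jzero : Finset (Fin N) := m.J.filter fun i => m.r i = 0

theorem mem_Jpos {i : Fin N} : i ∈ m.Jpos ↔ i ∈ m.J ∧ m.r i ≠ 0 := Finset.mem_filter

theorem mem_Jzero {i : Fin N} : i ∈ m.Jzero ↔ i ∈ m.J ∧ m.r i = 0 := Finset.mem_filter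

theorem le_of_r_eq_zero {i : Fin N} (h : m.r i = 0) : l ≤ (i : ℕ) := by
  by_contra h'
  have h1 := m.r_eq i (not_le.1 h')
  have h2 := m.r'_pos i
  rw [← h1, h] at h2
  exact lt_irrefl _ h2

/-- The additional vanishing radius is that of i₀, whose argument is never free. -/
theorem card_Jzero_add_one :
    m.Jzero.card + 1 = (Finset.univ.filter fun i => m.r i = 0).card := by
  have : Finset.univ.filter (fun i => m.r i = 0) = insert m.i₀ m.Jzero := by
    ext i
    simp only [Finset.mem_filter, Finset.mem_univ, true_and, Finset.mem_insert, m.mem_Jzero,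
      m.mem_J]
    constructor
    · intro h
      by_cases h' : i = m.i₀
      · exact Or.inl h'
      · exact Or.inr ⟨⟨m.le_of_r_eq_zero h, h'⟩, h⟩
    · rintro (rfl | h)
      · exact m.r_i₀
      · exact h.2
  rw [this, Finset.card_insert_of_notMem fun h => (m.mem_J.1 (m.mem_Jzero.1 h).1).2 rfl]

theorem card_Jpos_add_card_Jzero : m.Jpos.card + m.Jzero.card = N - 1 - l := by
  rw [← m.card_J, Jpos, Jzero, add_comm]
  exact Finset.card_filter_add_card_filter_not _

/-- The projection of the model to the first `l` coordinates. -/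
def proj : C(m.space, baseTorus l m.r) :=
  ⟨fun y => ⟨fun i => y.1 i.1, (m.exists_param y.2).1⟩,
    (continuous_pi fun i => (continuous_apply i.1).comp continuous_subtype_val).subtype_mk _⟩

/-- The parametrization of the model as a map of spaces. -/
noncomputable def paramMap (q : baseTorus l m.r × (Fin N → Circle)) : m.space :=
  ⟨m.param q.1 q.2, m.param_mem q.1.2 q.2⟩

theorem continuous_paramMap : Continuous m.paramMap := m.continuous_param.subtype_mk _

theorem proj_paramMap (q : baseTorus l m.r × (Fin N → Circle)) : m.proj (m.paramMap q) = q.1 :=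
  Subtype.ext (m.param_restrict q.1.1 q.2)

theorem exists_paramMap (y : m.space) : ∃ ζ, m.paramMap (m.proj y, ζ) = y := by
  obtain ⟨-, ζ, hζ⟩ := m.exists_param y.2
  exact ⟨ζ, Subtype.ext hζ⟩

/-- The points of the base where the right-hand side of the equation vanishes. -/
def zeros : Set (baseTorus l m.r) := {Y | m.P Y.1 = 0}

theorem exists_homeo_compl :
    ∃ e : {x : m.space // m.proj x ∈ m.zerosᶜ} ≃ₜ {Y // Y ∈ m.zerosᶜ} × Torus (N - 1 - l),
      ∀ x, ((e x).1 : baseTorus l m.r) = m.proj x := by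
  obtain ⟨e⟩ := nonempty_equiv_fin m.J m.card_J
  refine exists_homeo_of_parametrization (Ψ := fun q => m.paramMap (q.1, extendOne e q.2))
    ?_ (fun b f => m.proj_paramMap _) ?_ ?_
  · have := m.continuous_paramMap
    have := continuous_extendOne e
    fun_prop
  · intro x hx
    obtain ⟨ζ, hζ⟩ := m.exists_paramMap x
    refine ⟨fun a => ζ (e.symm a).1, ?_⟩
    rw [← hζ]
    refine Subtype.ext ?_
    simp only [proj_paramMap]
    exact m.param_congr fun i hi _ => extendOne_restrict e ζ hi
  · intro b hb f f' h
    refine extendOne_injective e fun i hi => ?_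
    exact m.param_injOn (congrArg Subtype.val h) hi (Or.inr hb)

/-- Over the zeros of P only the arguments of coordinates with nonzero initial radius survive;
elsewhere all of those indexed by `m.J` do. -/
theorem exists_homeo_zeros {n : ℕ} (hn : m.Jpos.card = n) :
    ∃ e : {x : m.space // m.proj x ∈ m.zeros} ≃ₜ {Y // Y ∈ m.zeros} × Torus n,
      ∀ x, ((e x).1 : baseTorus l m.r) = m.proj x := by
  obtain ⟨e⟩ := nonempty_equiv_fin m.Jpos hn
  refine exists_homeo_of_parametrization (Ψ := fun q => m.paramMap (q.1, extendOne e q.2))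
    ?_ (fun b f => m.proj_paramMap _) ?_ ?_
  · have := m.continuous_paramMap
    have := continuous_extendOne e
    fun_prop
  · intro x hx
    obtain ⟨ζ, hζ⟩ := m.exists_paramMap x
    refine ⟨fun a => ζ (e.symm a).1, ?_⟩
    have hx' : m.P (m.proj x).1 = 0 := hx
    refine Subtype.ext ?_
    conv_rhs => rw [← hζ]
    refine m.param_congr fun i hi h => ?_
    exact extendOne_restrict e ζ (m.mem_Jpos.2 ⟨hi, h.resolve_right (not_not.2 hx')⟩)
  · intro b hb f f' h
    refine extendOne_injective e fun i hi => ?_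
    exact m.param_injOn (congrArg Subtype.val h) (m.mem_Jpos.1 hi).1 (Or.inl (m.mem_Jpos.1 hi).2)

/-- The arguments in `m.Jpos` are visible everywhere and split off as a factor; those in `m.Jzero`
are forgotten exactly over the zeros of P. A continuous bijection from a compact space to a
Hausdorff one does the rest. -/
theorem exists_homeo_collapse {n k : ℕ} (hn : m.Jpos.card = n) (hk : m.Jzero.card = k) :
    ∃ h : m.space ≃ₜ Torus n × Quotient (collapse m.zeros (Torus k)),
      ∀ x, collapseBase _ _ (h x).2 = m.proj x := by
  obtain ⟨e₁⟩ := nonempty_equiv_fin m.Jpos hn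
  obtain ⟨e₂⟩ := nonempty_equiv_fin m.Jzero hk
  have hpos : ∀ θ₁ θ₂, ∀ i ∈ m.Jpos, (extendOne e₁ θ₁ * extendOne e₂ θ₂) i = extendOne e₁ θ₁ i := by
    intro θ₁ θ₂ i hi
    rw [Pi.mul_apply, extendOne_of_notMem e₂ _ fun h => (m.mem_Jpos.1 hi).2 (m.mem_Jzero.1 h).2,
      mul_one]
  have hzero : ∀ θ₁ θ₂, ∀ i ∈ m.Jzero,
      (extendOne e₁ θ₁ * extendOne e₂ θ₂) i = extendOne e₂ θ₂ i := by
    intro θ₁ θ₂ i hi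
    rw [Pi.mul_apply, extendOne_of_notMem e₁ _ fun h => (m.mem_Jpos.1 h).2 (m.mem_Jzero.1 hi).2,
      one_mul]
  let G : Torus n × (baseTorus l m.r × Torus k) → m.space := fun q =>
    m.paramMap (q.2.1, extendOne e₁ q.1 * extendOne e₂ q.2.2)
  have hG : Continuous G := by
    have := m.continuous_paramMap
    have := continuous_extendOne e₁
    have := continuous_extendOne e₂
    fun_prop
  let f : Torus n × Quotient (collapse m.zeros (Torus k)) → m.space := fun z =>
    Quotient.lift (fun q => G (z.1, q)) (by
      rintro ⟨Y, θ⟩ ⟨Y', θ'⟩ ⟨h1, h2⟩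
      obtain rfl : Y = Y' := h1
      refine Subtype.ext (m.param_congr fun i hi h => ?_)
      by_cases hr : m.r i = 0
      · have hPne := h.resolve_left (not_not.2 hr)
        obtain rfl : θ = θ' := h2.resolve_left fun hS => hPne hS
        rfl
      · have hi' := m.mem_Jpos.2 ⟨hi, hr⟩
        exact (hpos _ _ i hi').trans (hpos _ _ i hi').symm) z.2
  -- The torus factor is locally compact, so its product with the quotient map is again a quotient
  -- map.
  have hf : Continuous f :=
    (isQuotientMap_quotient_mk' (s := collapse m.zeros (Torus k))).continuous_lift_prod_right
      (g := f) hG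
  have hproj : ∀ z, collapseBase _ _ z.2 = m.proj (f z) := by
    rintro ⟨θ, z⟩
    obtain ⟨q, rfl⟩ := Quotient.exists_rep z
    exact (m.proj_paramMap (q.1, _)).symm
  have hbij : Function.Bijective f := by
    constructor
    · rintro ⟨θ₁, z⟩ ⟨θ₁', z'⟩ h
      obtain ⟨⟨Y, θ₂⟩, rfl⟩ := Quotient.exists_rep z
      obtain ⟨⟨Y', θ₂'⟩, rfl⟩ := Quotient.exists_rep z'
      have hY : Y = Y' := by
        have h1 := congrArg m.proj h
        rw [← hproj, ← hproj] at h1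
        exact h1
      subst hY
      have hval : m.param Y.1 _ = m.param Y.1 _ := congrArg Subtype.val h
      have h₁ : θ₁ = θ₁' := by
        refine extendOne_injective e₁ fun i hi => ?_
        have := m.param_injOn hval (m.mem_Jpos.1 hi).1 (Or.inl (m.mem_Jpos.1 hi).2)
        simp only at this
        rwa [hpos _ _ i hi, hpos _ _ i hi] at this
      subst h₁
      refine Prod.ext rfl (Quotient.sound ⟨rfl, ?_⟩)
      by_cases hY : Y ∈ m.zeros
      · exact Or.inl hY
      · refine Or.inr (extendOne_injective e₂ fun i hi => ?_)
        have := m.param_injOn hval (m.mem_Jzero.1 hi).1 (Or.inr hY)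
        simp only at this
        rwa [hzero _ _ i hi, hzero _ _ i hi] at this
    · intro x
      obtain ⟨ζ, hζ⟩ := m.exists_paramMap x
      refine ⟨(fun a => ζ (e₁.symm a).1, Quotient.mk _ (m.proj x, fun a => ζ (e₂.symm a).1)), ?_⟩
      refine Subtype.ext ?_
      conv_rhs => rw [← hζ]
      refine m.param_congr fun i hi _ => ?_
      by_cases hr : m.r i = 0
      · have hi' := m.mem_Jzero.2 ⟨hi, hr⟩
        exact (hzero _ _ i hi').trans (extendOne_restrict e₂ ζ hi')
      · have hi' := m.mem_Jpos.2 ⟨hi, hr⟩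
        exact (hpos _ _ i hi').trans (extendOne_restrict e₁ ζ hi')
  let e := Continuous.homeoOfEquivCompactToT2 (f := Equiv.ofBijective f hbij) hf
  refine ⟨e.symm, fun x => ?_⟩
  rw [hproj]
  exact congrArg m.proj (e.apply_symm_apply x)

end Model

end TorusFib

/-! ### Smoothness of the torus parametrization -/

namespace TorusFib

namespace Model

variable {N l : ℕ} (m : Model N l)

/-- In the product rule, differentiating the factor of i₀ gives a positive term and the others are
nonnegative. Nonvanishing of the derivative makes the inverse of H smooth at positive values. -/
theorem exists_hasDerivAt_H {u : ℝ} (hu : 0 < u) : ∃ d : ℝ, d ≠ 0 ∧ HasDerivAt m.H d u := by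
  have h1 : ∀ i ∈ m.J, HasDerivAt (fun u => m.rad u i) (m.r' i - m.r i) u := fun i _ => by
    simp_rw [m.rad_eq]
    simpa using ((hasDerivAt_id u).mul_const (m.r' i - m.r i)).const_add (m.r i)
  have h2 := HasDerivAt.fun_finsetProd h1
  have h3 : 0 ≤ ∑ i ∈ m.J, (∏ j ∈ m.J.erase i, m.rad u j) • (m.r' i - m.r i) :=
    Finset.sum_nonneg fun i _ => mul_nonneg
      (Finset.prod_nonneg fun j _ => m.rad_nonneg hu.le j) (sub_nonneg.2 (m.r_le i))
  have h4 := ((hasDerivAt_id u).mul_const (m.r' m.i₀)).mul h2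
  refine ⟨_, ?_, h4.congr_of_eventuallyEq ?_⟩
  · have h5 := m.K_pos hu
    have h6 := m.r'_pos m.i₀
    rw [K] at h5
    have h7 : 0 < 1 * m.r' m.i₀ * ∏ i ∈ m.J, m.rad u i := by positivity
    have h8 := mul_nonneg (mul_pos hu h6).le h3
    exact (add_pos_of_pos_of_nonneg h7 h8).ne'
  · filter_upwards [lt_mem_nhds hu] with v hv
    exact m.H_of_nonneg hv.le

theorem contDiffAt_H {u : ℝ} (hu : 0 < u) : ContDiffAt ℝ ∞ m.H u := by
  have h : ContDiff ℝ ∞ fun u : ℝ => u * m.r' m.i₀ * m.K u := by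
    have := m.contDiff_K
    fun_prop
  refine h.contDiffAt.congr_of_eventuallyEq ?_
  filter_upwards [lt_mem_nhds hu] with v hv
  exact m.H_of_nonneg hv.le

theorem contDiffAt_par {Y : {i : Fin N // (i : ℕ) < l} → ℂ} (hY : Y ∈ baseTorus l m.r)
    (hP : m.P Y ≠ 0) : ContDiffAt ℝ ∞ m.par Y := by
  have hu := m.par_pos hP
  obtain ⟨d, hd, hd'⟩ := m.exists_hasDerivAt_H hu
  have h1 : ContDiffAt ℝ ∞ m.homeoH.symm (‖m.P Y‖ / ‖m.c₀‖) :=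
    m.homeoH.toOpenPartialHomeomorph.contDiffAt_symm_deriv hd (Set.mem_univ _) hd'
      (m.contDiffAt_H hu)
  have h2 : ContDiffAt ℝ ∞ (fun Y => ‖m.P Y‖ / ‖m.c₀‖) Y :=
    ((m.smooth Y hY).norm ℝ hP).div_const _
  exact h1.comp Y h2

theorem r_pos (hr : ∀ i, i ≠ m.i₀ → m.r i ≠ 0) {i : Fin N} (hi : i ≠ m.i₀) : 0 < m.r i :=
  lt_of_le_of_ne (m.r_nonneg i) (Ne.symm (hr i hi))

/-- The first `l` coordinates with given arguments. -/
noncomputable def baseOf (ζ : Fin N → Circle) (i : {i : Fin N // (i : ℕ) < l}) : ℂ :=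
  m.r i.1 * ζ i.1

theorem baseOf_mem (ζ : Fin N → Circle) : m.baseOf ζ ∈ baseTorus l m.r := fun i => by
  rw [baseOf, norm_mul, Complex.norm_real, Real.norm_of_nonneg (m.r_nonneg _), Circle.norm_coe,
    mul_one]

theorem continuous_baseOf : Continuous m.baseOf := by
  unfold baseOf
  fun_prop

theorem param_baseOf (ζ : Fin N → Circle) {i : Fin N} (hi : i ≠ m.i₀) :
    m.param (m.baseOf ζ) ζ i = m.rad (m.par (m.baseOf ζ)) i * ζ i := by
  rcases m.cases_index i with h | rfl | h
  · rw [m.param_of_lt _ _ h, m.rad_of_lt _ h, baseOf]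
  · exact absurd rfl hi
  · exact m.param_of_mem _ _ h

theorem rad_ne_zero (hr : ∀ i, i ≠ m.i₀ → m.r i ≠ 0) {u : ℝ} (hu : 0 ≤ u) {i : Fin N}
    (hi : i ≠ m.i₀) : m.rad u i ≠ 0 := by
  have h := m.rad_mono hu i
  rw [m.rad_zero] at h
  exact ((m.r_pos hr hi).trans_le h).ne'

/-- If only one radius vanishes initially, the model is a torus. -/
theorem exists_homeo_torus (hr : ∀ i, i ≠ m.i₀ → m.r i ≠ 0) {n : ℕ}
    (e : {i // i ≠ m.i₀} ≃ Fin n) :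
    ∃ Φ : Torus n ≃ₜ m.space, ∀ θ, (Φ θ).1 = m.param (m.baseOf (extendOne e θ)) (extendOne e θ) := by
  let f : Torus n → m.space := fun θ =>
    m.paramMap (⟨m.baseOf (extendOne e θ), m.baseOf_mem _⟩, extendOne e θ)
  have hf : Continuous f := by
    have h1 := continuous_extendOne e
    have h2 : Continuous fun θ : Torus n =>
        (⟨m.baseOf (extendOne e θ), m.baseOf_mem _⟩ : baseTorus l m.r) :=
      (m.continuous_baseOf.comp h1).subtype_mk _
    exact m.continuous_paramMap.comp (h2.prodMk h1)
  have hbij : Function.Bijective f := by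
    constructor
    · intro θ θ' h
      refine extendOne_injective e fun i hi => ?_
      have h1 : m.param _ _ = m.param _ _ := congrArg Subtype.val h
      have hb : m.baseOf (extendOne e θ) = m.baseOf (extendOne e θ') :=
        congrArg Subtype.val ((m.proj_paramMap _).symm.trans
          ((congrArg m.proj h).trans (m.proj_paramMap _)))
      have h2 := congrFun h1 i
      simp only at h2
      rw [m.param_baseOf _ hi, m.param_baseOf _ hi, ← hb] at h2
      exact Circle.ext (mul_left_cancel₀
        (Complex.ofReal_ne_zero.2 (m.rad_ne_zero hr (m.par_nonneg _) hi)) h2)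
    · intro x
      obtain ⟨ζ, hζ⟩ := m.exists_paramMap x
      have hφ : ∀ z : ℂ, ∃ ζ : Circle, z = ‖z‖ * ζ := fun z =>
        ⟨Circle.exp z.arg, by rw [Circle.coe_exp]; exact (Complex.norm_mul_exp_arg_mul_I z).symm⟩
      choose φ hφ using hφ
      -- The angles of the first l coordinates are read off from the point itself, the others from
      -- its parametrization.
      refine ⟨fun a => if (e.symm a : Fin N) < l then φ (x.1 (e.symm a)) else ζ (e.symm a), ?_⟩
      set ξ : Fin N → Circle := fun i => if (i : ℕ) < l then φ (x.1 i) else ζ i with hξ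
      have hext : ∀ i, i ≠ m.i₀ → extendOne e (fun a => ξ (e.symm a)) i = ξ i := fun i hi =>
        extendOne_restrict e ξ hi
      have hbase : m.baseOf (extendOne e fun a => ξ (e.symm a)) = (m.proj x).1 := by
        funext i
        have hi : i.1 ≠ m.i₀ := fun h => absurd i.2 (not_lt.2 (h ▸ m.le_i₀))
        have hi2 : ξ i.1 = φ (x.1 i.1) := if_pos i.2
        rw [baseOf, hext _ hi, hi2, ← (m.proj x).2 i]
        exact (hφ _).symm
      refine Subtype.ext ?_
      conv_rhs => rw [← hζ]
      change m.param (m.baseOf (extendOne e fun a => ξ (e.symm a)))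
        (extendOne e fun a => ξ (e.symm a)) = m.param (m.proj x).1 ζ
      rw [hbase]
      refine m.param_congr fun i hi _ => ?_
      rw [hext i (m.mem_J.1 hi).2]
      exact if_neg (not_lt.2 (m.mem_J.1 hi).1)
  exact ⟨Continuous.homeoOfEquivCompactToT2 (f := Equiv.ofBijective f hbij) hf, fun θ => rfl⟩

/-- The torus parametrization in terms of angles. -/
noncomputable def angleParam {n : ℕ} (e : {i // i ≠ m.i₀} ≃ Fin n) (θ : Fin n → ℝ) : Fin N → ℂ :=
  m.param (m.baseOf (extendOne e fun a => Circle.exp (θ a)))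
    (extendOne e fun a => Circle.exp (θ a))

/-- Every coordinate other than y_{i₀} is a positive radius times exp(iθ). The radii are smooth
either because P ≠ 0 or because they are constant along the ray. The angles are recovered smoothly
from y, so the derivative is injective. -/
theorem contDiffAt_angleParam (hr : ∀ i, i ≠ m.i₀ → m.r i ≠ 0) {n : ℕ}
    (e : {i // i ≠ m.i₀} ≃ Fin n) {θ : Fin n → ℝ}
    (h : m.P (m.baseOf (extendOne e fun a => Circle.exp (θ a))) ≠ 0 ∨
      ∀ i, i ≠ m.i₀ → m.r i = m.r' i) :
    ContDiffAt ℝ ∞ (m.angleParam e) θ ∧ Function.Injective (fderiv ℝ (m.angleParam e) θ) := by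
  have hexp : ∀ i : Fin N, ∀ hi : i ≠ m.i₀, ∀ θ : Fin n → ℝ,
      ((extendOne e (fun a => Circle.exp (θ a)) i : Circle) : ℂ)
        = Complex.exp (θ (e ⟨i, hi⟩) * Complex.I) := fun i hi θ => by
    rw [extendOne_of_mem e _ hi, Circle.coe_exp]
  have hsm : ∀ a : Fin n, ContDiff ℝ ∞ fun θ : Fin n → ℝ => Complex.exp (θ a * Complex.I) := by
    intro a
    have h1 : ContDiff ℝ ∞ fun θ : Fin n → ℝ => ((θ a : ℝ) : ℂ) :=
      Complex.ofRealCLM.contDiff.comp (contDiff_apply ℝ ℝ a)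
    exact (h1.mul contDiff_const).cexp
  have hlt : ∀ i : {i : Fin N // (i : ℕ) < l}, i.1 ≠ m.i₀ := fun i h =>
    absurd i.2 (not_lt.2 (h ▸ m.le_i₀))
  have hbase : ContDiff ℝ ∞ fun θ : Fin n → ℝ =>
      m.baseOf (extendOne e fun a => Circle.exp (θ a)) := by
    rw [contDiff_pi]
    intro i
    simp only [baseOf]
    simp_rw [hexp i.1 (hlt i)]
    exact contDiff_const.mul (hsm _)
  have hrad : ∀ i, i ≠ m.i₀ → ContDiffAt ℝ ∞ (fun θ : Fin n → ℝ =>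
      m.rad (m.par (m.baseOf (extendOne e fun a => Circle.exp (θ a)))) i) θ := by
    intro i hi
    rcases h with h | h
    · have h1 := (m.contDiffAt_par (m.baseOf_mem _) h).comp θ hbase.contDiffAt
      simp_rw [m.rad_eq]
      exact contDiffAt_const.add (h1.mul contDiffAt_const)
    · simp_rw [m.rad_eq, h i hi, sub_self, mul_zero, add_zero]
      exact contDiffAt_const
  have hradne : ∀ θ : Fin n → ℝ, ∀ i, i ≠ m.i₀ →
      m.rad (m.par (m.baseOf (extendOne e fun a => Circle.exp (θ a)))) i ≠ 0 := fun θ i hi =>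
    m.rad_ne_zero hr (m.par_nonneg _) hi
  have hcomp : ∀ i, ∀ hi : i ≠ m.i₀, ∀ θ : Fin n → ℝ, m.angleParam e θ i =
      m.rad (m.par (m.baseOf (extendOne e fun a => Circle.exp (θ a)))) i *
        Complex.exp (θ (e ⟨i, hi⟩) * Complex.I) := fun i hi θ => by
    rw [angleParam, m.param_baseOf _ hi, hexp i hi]
  have hne : ∀ θ : Fin n → ℝ, ∀ i, i ≠ m.i₀ → m.angleParam e θ i ≠ 0 := fun θ i hi => by
    rw [hcomp i hi]
    exact mul_ne_zero (Complex.ofReal_ne_zero.2 (hradne θ i hi)) (Complex.exp_ne_zero _)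
  have hci : ∀ i, i ≠ m.i₀ → ContDiffAt ℝ ∞ (fun θ => m.angleParam e θ i) θ := by
    intro i hi
    simp_rw [hcomp i hi]
    exact (Complex.ofRealCLM.contDiff.contDiffAt.comp θ (hrad i hi)).mul (hsm _).contDiffAt
  have hC : ContDiffAt ℝ ∞ (m.angleParam e) θ := by
    rw [contDiffAt_pi]
    intro i
    by_cases hi : i = m.i₀
    · subst hi
      -- Solving the equation for y_{i₀} avoids the phase of P, which is not smooth at its zeros.
      have heq : ∀ θ : Fin n → ℝ, m.angleParam e θ m.i₀ =
          m.P (m.baseOf (extendOne e fun a => Circle.exp (θ a))) *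
            (m.c₀ * ∏ i ∈ m.J, m.angleParam e θ i)⁻¹ := by
        intro θ
        obtain ⟨-, -, -, he⟩ := m.param_mem (m.baseOf_mem (extendOne e fun a => Circle.exp (θ a)))
          (extendOne e fun a => Circle.exp (θ a))
        rw [m.param_restrict, m.prod_filter] at he
        have hprod : ∏ i ∈ m.J, m.angleParam e θ i ≠ 0 :=
          Finset.prod_ne_zero_iff.2 fun i hi => hne θ i (m.mem_J.1 hi).2
        rw [← div_eq_mul_inv, eq_div_iff (mul_ne_zero m.c₀_ne hprod), ← he]
        simp only [angleParam]
        ring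
      simp_rw [heq]
      refine ((m.smooth _ (m.baseOf_mem _)).comp θ hbase.contDiffAt).mul (ContDiffAt.inv ?_ ?_)
      · exact contDiffAt_const.mul (contDiffAt_prod fun i hi => hci i (m.mem_J.1 hi).2)
      · exact mul_ne_zero m.c₀_ne
          (Finset.prod_ne_zero_iff.2 fun i hi => hne θ i (m.mem_J.1 hi).2)
    · exact hci i hi
  refine ⟨hC, ?_⟩
  rw [injective_iff_map_eq_zero]
  intro v hv
  funext a
  obtain ⟨⟨i, hi⟩, rfl⟩ := e.surjective a
  have hd : HasFDerivAt (m.angleParam e) (fderiv ℝ (m.angleParam e) θ) θ :=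
    (hC.differentiableAt (by simp)).hasFDerivAt
  have hdi := (hasFDerivAt_pi'.1 hd) i
  -- Normalizing y_i to absolute value one removes the radius and leaves exp(iθ), whose derivative
  -- detects the angle.
  have hg : DifferentiableAt ℝ (fun z : ℂ => (‖z‖⁻¹ : ℝ) • z) (m.angleParam e θ i) :=
    ((differentiableAt_id.norm ℝ (hne θ i hi)).inv
      (norm_ne_zero_iff.2 (hne θ i hi))).smul differentiableAt_id
  have h1 := hg.hasFDerivAt.comp θ hdi
  have h2 : (fun θ : Fin n → ℝ => Complex.exp (θ (e ⟨i, hi⟩) * Complex.I))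
      = (fun z : ℂ => (‖z‖⁻¹ : ℝ) • z) ∘ fun θ => m.angleParam e θ i := by
    funext θ
    have hpos : 0 < m.rad (m.par (m.baseOf (extendOne e fun a => Circle.exp (θ a)))) i :=
      lt_of_le_of_ne (m.rad_nonneg (m.par_nonneg _) i) (Ne.symm (hradne θ i hi))
    rw [Function.comp_apply, hcomp i hi, norm_mul, Complex.norm_exp_ofReal_mul_I, mul_one,
      Complex.norm_real, Real.norm_of_nonneg hpos.le,
      Complex.real_smul, Complex.ofReal_inv, inv_mul_cancel_left₀ (Complex.ofReal_ne_zero.2 hpos.ne')]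
  have h3 : HasFDerivAt (fun θ : Fin n → ℝ => ((θ (e ⟨i, hi⟩) : ℝ) : ℂ))
      (Complex.ofRealCLM.comp (ContinuousLinearMap.proj (R := ℝ) (φ := fun _ : Fin n => ℝ)
        (e ⟨i, hi⟩))) θ :=
    (Complex.ofRealCLM.comp (ContinuousLinearMap.proj (R := ℝ) (φ := fun _ : Fin n => ℝ)
        (e ⟨i, hi⟩))).hasFDerivAt
  have h4 := (h3.mul_const Complex.I).cexp
  rw [h2] at h4
  have h5 := DFunLike.congr_fun (h4.unique h1) v
  simp only [ContinuousLinearMap.comp_apply, hv, map_zero, smul_apply,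
    ContinuousLinearMap.proj_apply, Complex.ofRealCLM_apply, smul_eq_mul, mul_eq_zero,
    Complex.exp_ne_zero, false_or, Complex.I_ne_zero, Complex.ofReal_eq_zero] at h5
  simpa using h5

end Model

end TorusFib

namespace TorusFib

/-! ### Laurent polynomials on tori -/

section laurent

variable {ι : Type*} [Fintype ι]

/-- The characters of a vector group given by integral exponents. -/
noncomputable def expChar (n : ι → ℤ) : Multiplicative (ι → ℝ) →* ℂ where
  toFun θ := Complex.exp ((∑ i, n i * θ.toAdd i : ℝ) * Complex.I)
  map_one' := by simp
  map_mul' θ θ' := by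
    rw [← Complex.exp_add, ← add_mul, ← Complex.ofReal_add, ← Finset.sum_add_distrib]
    congr 3
    refine congrArg _ (funext fun i => ?_)
    exact mul_add _ _ _

theorem expChar_apply (n : ι → ℤ) (θ : ι → ℝ) :
    expChar n (Multiplicative.ofAdd θ) = Complex.exp ((∑ i, n i * θ i : ℝ) * Complex.I) := rfl

theorem expChar_injective : Function.Injective (expChar (ι := ι)) := by
  classical
  intro n n' h
  by_contra hne
  obtain ⟨i, hi⟩ := Function.ne_iff.1 hne
  have hd : ((n i : ℝ) - n' i) ≠ 0 := sub_ne_zero.2 (by exact_mod_cast hi)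
  -- At this angle the quotient of the two characters is exp(iπ) = -1.
  have h1 := DFunLike.congr_fun h (Multiplicative.ofAdd (Pi.single i (Real.pi / (n i - n' i))))
  have hs : ∀ k : ι → ℤ, ∑ j, (k j : ℝ) * (Pi.single i (Real.pi / (n i - n' i)) : ι → ℝ) j
      = k i * (Real.pi / (n i - n' i)) := fun k => by
    rw [Finset.sum_eq_single i]
    · rw [Pi.single_eq_same]
    · intro j _ hj
      rw [Pi.single_eq_of_ne hj, mul_zero]
    · simp
  rw [expChar_apply, expChar_apply, hs, hs] at h1
  have h2 : Complex.exp (((n i * (Real.pi / (n i - n' i)) : ℝ) * Complex.I) -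
      ((n' i * (Real.pi / (n i - n' i)) : ℝ) * Complex.I)) = 1 := by
    rw [Complex.exp_sub, h1, div_self (Complex.exp_ne_zero _)]
  rw [← sub_mul, ← Complex.ofReal_sub, ← sub_mul, mul_div_cancel₀ _ hd, Complex.exp_pi_mul_I] at h2
  norm_num at h2

theorem prod_zpow_exp (Y : ι → ℂ) (n : ι → ℤ) (θ : ι → ℝ) :
    ∏ i, (Y i * Complex.exp (θ i * Complex.I)) ^ n i =
      (∏ i, Y i ^ n i) * expChar n (Multiplicative.ofAdd θ) := by
  rw [expChar_apply]
  simp_rw [mul_zpow]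
  rw [Finset.prod_mul_distrib, Complex.ofReal_sum, Finset.sum_mul, Complex.exp_sum]
  congr 1
  refine Finset.prod_congr rfl fun i _ => ?_
  rw [← Complex.exp_int_mul]
  push_cast
  ring_nf

/-- A nonzero Laurent polynomial does not vanish identically on any open subset of a torus. -/
theorem frequently_laurent_ne_zero {κ : Type*} {S : Finset κ} {a : κ → ℂ} {n : κ → ι → ℤ}
    (hn : Set.InjOn n S) (ha : ∃ w ∈ S, a w ≠ 0) {Y : ι → ℂ} (hY : ∀ i, Y i ≠ 0) :
    ∃ᶠ θ : ι → ℝ in 𝓝 0,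
      ∑ w ∈ S, a w * ∏ i, (Y i * Complex.exp (θ i * Complex.I)) ^ n w i ≠ 0 := by
  intro hev
  obtain ⟨w₀, hw₀, hne⟩ := ha
  set g : (ι → ℝ) → ℂ := fun θ => ∑ w ∈ S, a w * ∏ i, (Y i * Complex.exp (θ i * Complex.I)) ^ n w i
    with hg
  have hg' : g = fun θ => ∑ w ∈ S, (a w * ∏ i, Y i ^ n w i) *
      Complex.exp ((∑ i, (n w i : ℂ) * (θ i : ℂ)) * Complex.I) := by
    funext θ
    refine Finset.sum_congr rfl fun w _ => ?_
    rw [prod_zpow_exp, expChar_apply, mul_assoc]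
    push_cast
    rfl
  have hproj : ∀ i, AnalyticOnNhd ℝ (fun θ : ι → ℝ => ((θ i : ℝ) : ℂ)) Set.univ := fun i =>
    (Complex.ofRealCLM.comp (ContinuousLinearMap.proj (R := ℝ) (φ := fun _ : ι => ℝ)
      i)).analyticOnNhd _
  -- By the identity theorem, vanishing near 0 means vanishing everywhere, contrary to the linear
  -- independence of distinct characters.
  have han : AnalyticOnNhd ℝ g Set.univ := by
    rw [hg']
    refine Finset.analyticOnNhd_fun_sum _ fun w _ => ?_
    refine analyticOnNhd_const.mul ?_
    have h1 : AnalyticOnNhd ℝ (fun θ : ι → ℝ => (∑ i, (n w i : ℂ) * (θ i : ℂ)) * Complex.I)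
        Set.univ :=
      (Finset.analyticOnNhd_fun_sum _ fun i _ => analyticOnNhd_const.mul (hproj i)).mul
        analyticOnNhd_const
    intro θ hθ
    exact (analyticAt_cexp.restrictScalars (𝕜 := ℝ)).comp (h1 θ hθ)
  have hzero : g = 0 := by
    refine han.eq_of_eventuallyEq (analyticOnNhd_const (v := (0 : ℂ))) (z₀ := 0) ?_
    filter_upwards [hev] with θ hθ
    exact not_not.1 hθ
  have hli := (linearIndependent_monoidHom (Multiplicative (ι → ℝ)) ℂ).comp
    (fun w : S => expChar (n w)) fun w w' h => Subtype.ext (hn w.2 w'.2 (expChar_injective h))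
  rw [Fintype.linearIndependent_iff] at hli
  have h1 := hli (fun w => a w * ∏ i, Y i ^ n w i) (by
    funext θ
    have h2 := congrFun hzero θ.toAdd
    rw [hg] at h2
    simp only [Pi.zero_apply] at h2
    rw [← Finset.sum_coe_sort] at h2
    rw [Finset.sum_apply, Pi.zero_apply, ← h2]
    refine Finset.sum_congr rfl fun w _ => ?_
    rw [prod_zpow_exp, ← mul_assoc]
    rfl) ⟨w₀, hw₀⟩
  rcases mul_eq_zero.1 h1 with h1 | h1
  · exact hne h1
  · exact Finset.prod_ne_zero_iff.2 (fun i _ => zpow_ne_zero _ (hY i)) h1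

theorem contDiffAt_laurent {κ : Type*} (S : Finset κ) (a : κ → ℂ) (n : κ → ι → ℤ) {Y : ι → ℂ}
    (hY : ∀ i, Y i ≠ 0) : ContDiffAt ℝ ∞ (fun Y : ι → ℂ => ∑ w ∈ S, a w * ∏ i, Y i ^ n w i) Y := by
  refine ContDiffAt.sum fun w _ => contDiffAt_const.mul (contDiffAt_prod fun i _ => ?_)
  have h1 : ContDiffAt ℝ ∞ (fun Y : ι → ℂ => Y i) Y := (contDiff_apply ℝ ℂ i).contDiffAt
  rcases n w i with k | k
  · simp only [Int.ofNat_eq_natCast, zpow_natCast]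
    exact h1.pow k
  · simp only [zpow_negSucc]
    exact (h1.pow (k + 1)).inv (pow_ne_zero _ (hY i))

end laurent

variable {N : ℕ} {D : FamilyData N} {τ : Finset (Fin N → ℝ)}

namespace TauCoords

variable (c : TauCoords D τ) (ρ0 : Finset (Fin N → ℝ) → (Fin N → ℝ) → ℝ) (t : ℂ) (s : Fin N → ℝ)

theorem expo_eq_zero_of_mem {w : Fin N → ℤ} (hw : emb w ∈ τ) {i : Fin N}
    (hi : dim (D.Theta τ) ≤ i) : c.expo w i = 0 :=
  (c.expo_eq_zero_iff hi).2 ((c.dual_mem hi).2 _ hw)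

/-- The exponents of normal coordinates vanish on τ, so the first l exponents distinguish the
vertices of τ. -/
theorem expo_injOn {w w' : Fin N → ℤ} (hw : emb w ∈ τ) (hw' : emb w' ∈ τ)
    (h : ∀ i : Fin N, (i : ℕ) < dim (D.Theta τ) → c.expo w i = c.expo w' i) : w = w' := by
  have h1 : c.b.repr (w - c.Om) = c.b.repr (w' - c.Om) := by
    ext i
    by_cases hi : (i : ℕ) < dim (D.Theta τ)
    · exact h i hi
    · exact (c.expo_eq_zero_of_mem hw (not_lt.1 hi)).trans
        (c.expo_eq_zero_of_mem hw' (not_lt.1 hi)).symm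
  exact sub_left_injective (c.b.repr.injective h1)

theorem contDiffAt_poly {l : ℕ} {Y : {i : Fin N // (i : ℕ) < l} → ℂ} (hY : ∀ i, Y i ≠ 0) :
    ContDiffAt ℝ ∞ (c.poly ρ0 t s) Y :=
  contDiffAt_laurent _ _ _ hY

theorem isOpen_compl_disc {l : ℕ} {r : Fin N → ℝ} (hr : ∀ i : Fin N, (i : ℕ) < l → 0 < r i) :
    IsOpen (c.disc ρ0 t s l r)ᶜ := by
  have hc : Continuous fun Y : baseTorus l r => c.poly ρ0 t s Y.1 := by
    refine continuous_iff_continuousAt.2 fun Y => ?_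
    have hY : ∀ i, Y.1 i ≠ 0 := fun i => by
      rw [← norm_pos_iff, Y.2 i]; exact hr i.1 i.2
    exact (c.contDiffAt_poly ρ0 t s hY).continuousAt.comp continuous_subtype_val.continuousAt
  exact (isClosed_singleton.preimage hc).isOpen_compl

theorem dense_compl_disc (ht : t ≠ 0) {r : Fin N → ℝ}
    (hr : ∀ i : Fin N, (i : ℕ) < dim (D.Theta τ) → 0 < r i)
    (hρ : ∃ w ∈ D.A, emb w ∈ τ ∧ 0 < rho D ρ0 w s) :
    Dense (c.disc ρ0 t s (dim (D.Theta τ)) r)ᶜ := by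
  classical
  intro Y
  have hY : ∀ i, Y.1 i ≠ 0 := fun i => by
    rw [← norm_pos_iff, Y.2 i]; exact hr i.1 i.2
  have hfreq := frequently_laurent_ne_zero (S := D.A.filter fun w => emb w ∈ τ)
    (a := fun w => (rho D ρ0 w s : ℂ) * t ^ D.lam w)
    (n := fun w (i : {i : Fin N // (i : ℕ) < dim (D.Theta τ)}) => c.expo w i.1)
    (fun w hw w' hw' h => c.expo_injOn (Finset.mem_filter.1 hw).2 (Finset.mem_filter.1 hw').2
      fun i hi => congrFun h ⟨i, hi⟩) (by
        obtain ⟨w, hw, hwτ, hpos⟩ := hρ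
        exact ⟨w, Finset.mem_filter.2 ⟨hw, hwτ⟩,
          mul_ne_zero (Complex.ofReal_ne_zero.2 hpos.ne') (zpow_ne_zero _ ht)⟩) hY
  let E : ({i : Fin N // (i : ℕ) < dim (D.Theta τ)} → ℝ) → baseTorus (dim (D.Theta τ)) r := fun θ =>
    ⟨fun i => Y.1 i * Complex.exp (θ i * Complex.I), fun i => by
      rw [norm_mul, Complex.norm_exp_ofReal_mul_I, mul_one]; exact Y.2 i⟩
  have hE : Continuous E := by
    refine Continuous.subtype_mk (continuous_pi fun i => ?_) _
    fun_prop
  have hE0 : E 0 = Y := by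
    refine Subtype.ext (funext fun i => ?_)
    simp [E]
  rw [mem_closure_iff_frequently]
  have htend : Filter.Tendsto E (𝓝 0) (𝓝 Y) := by
    have := hE.tendsto 0
    rwa [hE0] at this
  refine htend.frequently (hfreq.mono fun θ hθ h => hθ ?_)
  have h' : c.poly ρ0 t s (E θ).1 = 0 := h
  rw [poly] at h'
  convert h' using 2

end TauCoords

end TorusFib

namespace TorusFib

variable {N : ℕ} {D : FamilyData N} {t : ℂ} {τ : Finset (Fin N → ℝ)}

open FamilyData

/-! ### The equation in coordinates -/

namespace TauCoords

variable (c : TauCoords D τ)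

theorem prod_lt_eq {R : Type*} [CommGroupWithZero R] {w : Fin N → ℤ} (hw : emb w ∈ τ)
    (y : Fin N → R) : ∏ i : {i : Fin N // (i : ℕ) < dim (D.Theta τ)}, y i.1 ^ c.expo w i.1 =
      ∏ i, y i ^ c.expo w i := by
  have h1 : ∏ i ∈ Finset.univ.filter (fun i : Fin N => (i : ℕ) < dim (D.Theta τ)),
      y i ^ c.expo w i = ∏ i, y i ^ c.expo w i := by
    refine Finset.prod_filter_of_ne fun i _ h => ?_
    by_contra hi
    rw [c.expo_eq_zero_of_mem hw (not_lt.1 hi), zpow_zero] at h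
    exact h rfl
  rw [← h1]
  exact (Finset.prod_subtype _ (fun i => by simp) fun i => y i ^ c.expo w i).symm

theorem prod_expo_zero {R : Type*} [CommGroupWithZero R] (y : Fin N → R) :
    ∏ i, y i ^ c.expo 0 i =
      ∏ i ∈ Finset.univ.filter (fun i : Fin N => dim (D.Theta τ) ≤ (i : ℕ)), y i := by
  rw [Finset.prod_filter]
  refine Finset.prod_congr rfl fun i _ => ?_
  rw [c.expo_zero]
  split_ifs <;> simp

theorem prod_absOf_zero (ξ : Fin N → ℝ) {w : Fin N → ℤ} (hw : emb w ∈ D.Delta) :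
    ∏ i, c.absOf {0} ξ i ^ c.expo w i = Real.exp (ξ ⬝ᵥ emb w - ξ ⬝ᵥ emb c.Om) := by
  classical
  rw [c.prod_absOf (by rw [nrm_zero]; exact Set.empty_subset _) ξ hw, if_pos]
  exact ⟨hw, by rw [nrm_zero]; simp⟩

/-- Over central points the constant term dominates the terms of `τ`. -/
theorem norm_poly_lt {ρ0 : Finset (Fin N → ℝ) → (Fin N → ℝ) → ℝ} {s ξ m : Fin N → ℝ}
    (hρ : ∀ w, rho D ρ0 w s ∈ Set.Icc (0 : ℝ) 1) (ht : t ≠ 0)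
    (hconc : ∀ σ a, D.IsBary σ a m → ∀ w ∈ D.A,
      |wt D t ξ w / (∑ w ∈ D.A, wt D t ξ w) - a (emb w)| < 1 / 4)
    (hm : m ∈ D.Delta) (h4 : (4 : ℝ) • m ∈ D.Delta)
    {Y : {i : Fin N // (i : ℕ) < dim (D.Theta τ)} → ℂ} (hY : ∀ i, ‖Y i‖ = c.absOf {0} ξ i.1) :
    ‖c.poly ρ0 t s Y‖ < ‖t ^ D.lam 0‖ *
      ∏ i ∈ Finset.univ.filter (fun i : Fin N => dim (D.Theta τ) ≤ (i : ℕ)), c.absOf {0} ξ i := by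
  classical
  have hwt := wt_pos (D := D) ht ξ
  set S := D.A.filter fun w => emb w ∈ τ with hS
  have h0S : (0 : Fin N → ℤ) ∉ S := fun h =>
    zero_notMem_of_bdry c.mem_bdry (emb_zero (N := N) ▸ (Finset.mem_filter.1 h).2)
  obtain ⟨σ, a, hσ⟩ := exists_isBary hm
  have ha := hσ.le_zero_of_central h4
  have h1 := (abs_lt.1 (hconc σ a hσ 0 D.zero_mem)).1
  rw [emb_zero] at h1
  have hZ : 0 < ∑ w ∈ D.A, wt D t ξ w := Finset.sum_pos (fun w _ => hwt w) A_nonempty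
  -- 3/4 - 1/4: the origin outweighs all other points of A together.
  have h2 : 1 / 2 < wt D t ξ 0 / ∑ w ∈ D.A, wt D t ξ w := by linarith
  rw [lt_div_iff₀ hZ] at h2
  have h3 : wt D t ξ 0 + ∑ w ∈ S, wt D t ξ w ≤ ∑ w ∈ D.A, wt D t ξ w := by
    rw [← Finset.sum_insert h0S]
    refine Finset.sum_le_sum_of_subset_of_nonneg ?_ fun w _ _ => (hwt w).le
    exact Finset.insert_subset D.zero_mem (Finset.filter_subset _ _)
  have h4 : ∑ w ∈ S, wt D t ξ w < wt D t ξ 0 := by linarith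
  have hterm : ∀ w ∈ S, ‖(rho D ρ0 w s : ℂ) * t ^ D.lam w * ∏ i, Y i ^ c.expo w i.1‖ ≤
      wt D t ξ w * Real.exp (-(ξ ⬝ᵥ emb c.Om)) := by
    intro w hw
    obtain ⟨hwA, hwτ⟩ := Finset.mem_filter.1 hw
    have hp : ‖∏ i, Y i ^ c.expo w i.1‖ = Real.exp (ξ ⬝ᵥ emb w - ξ ⬝ᵥ emb c.Om) := by
      rw [norm_prod, ← c.prod_absOf_zero ξ (D.emb_mem_Delta hwA), ← c.prod_lt_eq hwτ]
      refine Finset.prod_congr rfl fun i _ => ?_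
      rw [norm_zpow, hY]
    rw [norm_mul, norm_mul, hp, Complex.norm_real, Real.norm_of_nonneg (hρ w).1, wt, sub_eq_add_neg,
      Real.exp_add, ← mul_assoc]
    refine mul_le_mul_of_nonneg_right ?_ (Real.exp_pos _).le
    refine mul_le_mul_of_nonneg_right ?_ (Real.exp_pos _).le
    exact mul_le_of_le_one_left (norm_nonneg _) (hρ w).2
  have h0 : ∏ i ∈ Finset.univ.filter (fun i : Fin N => dim (D.Theta τ) ≤ (i : ℕ)),
      c.absOf {0} ξ i = Real.exp (ξ ⬝ᵥ emb 0 - ξ ⬝ᵥ emb c.Om) := by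
    rw [← c.prod_expo_zero, c.prod_absOf_zero ξ (D.emb_mem_Delta D.zero_mem)]
  rw [h0, sub_eq_add_neg, Real.exp_add, ← mul_assoc]
  calc ‖c.poly ρ0 t s Y‖ ≤ ∑ w ∈ S, wt D t ξ w * Real.exp (-(ξ ⬝ᵥ emb c.Om)) := by
        rw [poly]
        refine norm_sum_le_of_le _ fun w hw => hterm w ?_
        convert hw
    _ = (∑ w ∈ S, wt D t ξ w) * Real.exp (-(ξ ⬝ᵥ emb c.Om)) := (Finset.sum_mul _ _ _).symm
    _ < wt D t ξ 0 * Real.exp (-(ξ ⬝ᵥ emb c.Om)) := by gcongr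

/-- In coordinates normalized by x^Ω = 1 the cut-off functions remove every boundary term outside τ,
the terms of τ involve only the first l coordinates, and the origin contributes the product of the
normal coordinates. -/
theorem auxEq_vec {ρ0 : Finset (Fin N → ℝ) → (Fin N → ℝ) → ℝ} {s : Fin N → ℝ}
    (hρ : ∀ w : Fin N → ℤ, w ≠ 0 → emb w ∉ τ → rho D ρ0 w s = 0) (y : Fin N → ℂ) :
    auxEq D ρ0 t s (c.vec y) = t ^ D.lam 0 *
      ∏ i ∈ Finset.univ.filter (fun i : Fin N => dim (D.Theta τ) ≤ (i : ℕ)), y i -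
        c.poly ρ0 t s fun i : {i : Fin N // (i : ℕ) < dim (D.Theta τ)} => y i.1 := by
  classical
  have h0 : rho D ρ0 0 s = 1 := if_pos rfl
  rw [auxEq, poly, h0, c.hom_vec y (D.emb_mem_Delta D.zero_mem), c.prod_expo_zero,
    Complex.ofReal_one, one_mul]
  congr 1
  have hsub : D.A.filter (fun w => emb w ∈ τ) ⊆ D.A.filter fun w => emb w ∈ frontier D.Delta :=
    fun w hw => by
      obtain ⟨h1, h2⟩ := Finset.mem_filter.1 hw
      exact Finset.mem_filter.2 ⟨h1, (FamilyData.mem_bdry.1 c.mem_bdry).2.2 (subset_convexHull ℝ _ h2)⟩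
  have key : ∑ w ∈ D.A.filter (fun w => emb w ∈ τ),
      (rho D ρ0 w s : ℂ) * t ^ D.lam w * hom D (c.vec y) w =
      ∑ w ∈ D.A.filter (fun w => emb w ∈ frontier D.Delta),
      (rho D ρ0 w s : ℂ) * t ^ D.lam w * hom D (c.vec y) w := by
    refine Finset.sum_subset hsub fun w hw hw' => ?_
    obtain ⟨h1, h2⟩ := Finset.mem_filter.1 hw
    have hw0 : w ≠ 0 := by
      rintro rfl
      rw [emb_zero] at h2
      exact h2.2 D.zero_mem_interior
    rw [hρ w hw0 fun h => hw' (Finset.mem_filter.2 ⟨h1, h⟩)]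
    simp
  convert key.symm using 1
  refine Finset.sum_congr (by congr!) fun w hw => ?_
  obtain ⟨h1, h2⟩ := Finset.mem_filter.1 hw
  rw [c.hom_vec y (D.emb_mem_Delta h1), c.prod_lt_eq h2]

end TauCoords

theorem auxEq_smul (ρ0 : Finset (Fin N → ℝ) → (Fin N → ℝ) → ℝ) (s : Fin N → ℝ) (a : ℂ)
    (v : D.LatticePt → ℂ) : auxEq D ρ0 t s (a • v) = a * auxEq D ρ0 t s v := by
  simp only [auxEq, hom_smul]
  rw [mul_sub, Finset.mul_sum]
  congr 1
  · ring
  · exact Finset.sum_congr rfl fun w _ => by ring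

theorem auxEq_rep_chart (c : TauCoords D τ) (ρ0 : Finset (Fin N → ℝ) → (Fin N → ℝ) → ℝ)
    (s : Fin N → ℝ) (y : Fin N → ℂ) :
    auxEq D ρ0 t s (c.chart y).rep = 0 ↔ auxEq D ρ0 t s (c.vec y) = 0 := by
  obtain ⟨a, ha, he⟩ := exists_rep_mk (c.vec y) (c.vec_ne_zero y)
  rw [c.chart_eq, he, auxEq_smul, mul_eq_zero, or_iff_right ha]

/-- The hypersurface takes its cut-off values at some s₁ whose interval contains the moment;
disjointness of the intervals forces s₁ = s. -/
theorem mem_fiber_iff (ht : t ≠ 0) {β ε : ℝ} (hε : 0 < ε) (hε1 : ε < 1)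
    (hsub : ε • D.Delta ⊆ centralBall N β) {ρ0 : Finset (Fin N → ℝ) → (Fin N → ℝ) → ℝ}
    {s : Fin N → ℝ} (hs : s ∈ frontier D.Delta) {x : ℙ ℂ (D.LatticePt → ℂ)} :
    x ∈ fiber D ρ0 t β ε s ↔ x ∈ toricVariety D ∧ moment D t x ∈ interval D t β ε s ∧
      auxEq D ρ0 t s x.rep = 0 := by
  constructor
  · rintro ⟨⟨hx, s₁, hs₁, hm₁, he⟩, hm⟩
    obtain rfl := interval_disjoint ht hε hε1 hsub hs₁ hs hm₁ hm
    exact ⟨hx, hm, he⟩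
  · rintro ⟨hx, hm, he⟩
    exact ⟨⟨hx, s, hs, hm, he⟩, hm⟩

theorem IsRay.mem_interval_iff {ε : ℝ} {s s' ξ' : Fin N → ℝ} {κ : (Fin N → ℤ) → ℝ}
    (h : IsRay D t ε s s' ξ' κ) (ht : t ≠ 0) (hε : 0 < ε) (hε1 : ε < 1)
    (hs : s ∈ frontier D.Delta) (c : TauCoords D τ) (hJ : D.nrm {s'} ⊆ D.nrm τ) {β : ℝ}
    {m : Fin N → ℝ} : m ∈ interval D t β ε s ↔ m ∉ centralBall N β ∧
      ∃ u ∈ Set.Icc (0 : ℝ) 1, c.IsAbsCoord t m fun i =>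
        (1 - u) * c.absOf {s} (ξ' + shift D s' fun j => Real.log (κ j)) i +
          u * c.absOf {0} ξ' i := by
  rw [TorusFib.mem_interval_iff ht hε hε1 hs]
  refine and_congr_right fun _ => ⟨?_, fun hu => ⟨s', ξ', κ, h, ?_⟩⟩
  · rintro ⟨s₁, ξ₁, κ₁, hR, hO⟩
    obtain ⟨rfl, rfl, hκ⟩ := IsRay.unique ht hε hs hR h
    rw [hR.onRay_iff ht (frontier_subset hs) c hJ] at hO
    rwa [shift_congr (f := fun j => Real.log (κ₁ j)) (g := fun j => Real.log (κ j))
      fun j hj => by rw [hκ j hj]] at hO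
  · exact (h.onRay_iff ht (frontier_subset hs) c hJ).2 hu

/-- The fiber over `s` in `τ`-associated coordinates is given by the local model. -/
theorem IsRay.exists_model {ε : ℝ} {s s' ξ' : Fin N → ℝ} {κ : (Fin N → ℤ) → ℝ}
    (h : IsRay D t ε s s' ξ' κ) (ht : t ≠ 0)
    (hs : s ∈ frontier D.Delta) (c : TauCoords D τ) (hJ : D.nrm {s'} ⊆ D.nrm τ)
    {ρ0 : Finset (Fin N → ℝ) → (Fin N → ℝ) → ℝ}
    (hlt : ∀ Y : {i : Fin N // (i : ℕ) < dim (D.Theta τ)} → ℂ, (∀ i, ‖Y i‖ = c.absOf {0} ξ' i.1) →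
      ‖c.poly ρ0 t s Y‖ < ‖t ^ D.lam 0‖ * ∏ i ∈ Finset.univ.filter
        (fun i : Fin N => dim (D.Theta τ) ≤ (i : ℕ)), c.absOf {0} ξ' i) :
    ∃ m : Model N (dim (D.Theta τ)),
      m.r = c.absOf {s} (ξ' + shift D s' fun j => Real.log (κ j)) ∧ m.r' = c.absOf {0} ξ' ∧
      m.c₀ = t ^ D.lam 0 ∧ m.P = c.poly ρ0 t s ∧
      ∀ i, c.dual i ∉ D.nrm {s'} → m.r i = m.r' i := by
  classical
  obtain ⟨-, u, hu⟩ := mem_frontier_iff.1 hs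
  obtain ⟨i₀, hi₀, rfl⟩ := c.nrm_eq ▸ hJ (h.nrm_subset hu)
  have hr' : ∀ i, 0 < c.absOf {0} ξ' i := fun i => by rw [c.absOf_zero]; exact Real.exp_pos _
  have hreq : ∀ i, c.dual i ∉ D.nrm {s'} →
      c.absOf {s} (ξ' + shift D s' fun j => Real.log (κ j)) i = c.absOf {0} ξ' i := fun i hi => by
    rw [h.start_eq c hJ, if_neg hi, one_mul]
  have hreq' : ∀ i : Fin N, (i : ℕ) < dim (D.Theta τ) →
      c.absOf {s} (ξ' + shift D s' fun j => Real.log (κ j)) i = c.absOf {0} ξ' i := fun i hi =>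
    hreq i fun hmem => absurd (c.dual_mem_iff.1 (hJ hmem)) (not_le.2 hi)
  have hbase : ∀ Y ∈ baseTorus (dim (D.Theta τ))
      (c.absOf {s} (ξ' + shift D s' fun j => Real.log (κ j))),
      ∀ i, ‖Y i‖ = c.absOf {0} ξ' i.1 := fun Y hY i => (hY i).trans (hreq' i.1 i.2)
  refine ⟨⟨c.absOf {s} (ξ' + shift D s' fun j => Real.log (κ j)), c.absOf {0} ξ', i₀, hi₀,
    c.absOf_nonneg _ _, fun i => ?_, hr', hreq', c.absOf_of_mem hu, t ^ D.lam 0,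
    zpow_ne_zero _ ht, c.poly ρ0 t s, fun Y hY => c.contDiffAt_poly _ _ _ fun i => ?_,
    fun Y hY => hlt Y (hbase Y hY)⟩, rfl, rfl, rfl, rfl, hreq⟩
  · rw [h.start_eq c hJ]
    split_ifs with hi
    · exact mul_le_of_le_one_left (hr' i).le (h.kappa _ hi).1.2
    · rw [one_mul]
  · rw [← norm_pos_iff, hbase Y hY i]
    exact hr' i.1

/-- The chart carries T_s to the model. The model uses the whole ray, whereas I_s stops at the ball,
but by `hlt` the equation has no solution over the ball. -/
theorem IsRay.exists_homeo_model {β ε : ℝ} {s s' ξ' : Fin N → ℝ} {κ : (Fin N → ℤ) → ℝ}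
    (h : IsRay D t ε s s' ξ' κ) (ht : t ≠ 0) (hε : 0 < ε) (hε1 : ε < 1)
    (hsub : ε • D.Delta ⊆ centralBall N β) (h4 : ∀ m ∈ centralBall N β, (4 : ℝ) • m ∈ D.Delta)
    (hs : s ∈ frontier D.Delta) (c : TauCoords D τ) (hJ : D.nrm {s'} ⊆ D.nrm τ)
    {ρ0 : Finset (Fin N → ℝ) → (Fin N → ℝ) → ℝ}
    (hρ : ∀ w : Fin N → ℤ, w ≠ 0 → emb w ∉ τ → rho D ρ0 w s = 0)
    (hlt : ∀ ξ x, IsGibbs D t D.A ξ x → (4 : ℝ) • x ∈ D.Delta →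
      ∀ Y : {i : Fin N // (i : ℕ) < dim (D.Theta τ)} → ℂ, (∀ i, ‖Y i‖ = c.absOf {0} ξ i.1) →
      ‖c.poly ρ0 t s Y‖ < ‖t ^ D.lam 0‖ * ∏ i ∈ Finset.univ.filter
        (fun i : Fin N => dim (D.Theta τ) ≤ (i : ℕ)), c.absOf {0} ξ i)
    {m : Model N (dim (D.Theta τ))}
    (hr : m.r = c.absOf {s} (ξ' + shift D s' fun j => Real.log (κ j))) (hr' : m.r' = c.absOf {0} ξ')
    (hc : m.c₀ = t ^ D.lam 0) (hP : m.P = c.poly ρ0 t s) :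
    ∃ e : fiber D ρ0 t β ε s ≃ₜ m.space, ∀ x, c.IsCoord x.1 (e x).1 ∧
      ∀ y, c.IsCoord x.1 y → y = (e x).1 := by
  obtain ⟨U, Y, hU, hYc, hYU, hYchart, hmemU⟩ := c.exists_coordMap
  have hpath : ∀ u, (fun i => (1 - u) * c.absOf {s} (ξ' + shift D s' fun j => Real.log (κ j)) i +
      u * c.absOf {0} ξ' i) = m.rad u := fun u => by
    funext i; rw [Model.rad, hr, hr']
  have hrad : ∀ {u : ℝ}, 0 ≤ u → ∀ i : Fin N, (i : ℕ) < dim (D.Theta τ) → 0 < m.rad u i :=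
    fun {u} hu i hi => by
      rw [m.rad_of_lt u hi, m.r_eq i hi]; exact m.r'_pos i
  have habs : ∀ {u : ℝ} {y : Fin N → ℂ}, 0 ≤ u → (∀ i, ‖y i‖ = m.rad u i) →
      c.IsAbsCoord t (moment D t (c.chart y)) (m.rad u) := fun {u y} hu hy =>
    ⟨m.rad_nonneg hu, hrad hu, c.moment_chart_congr fun i => by
      rw [Complex.norm_real, Real.norm_of_nonneg (m.rad_nonneg hu i), hy]⟩
  have hdom : ∀ {u : ℝ} {y : Fin N → ℂ}, 0 ≤ u → (∀ i, ‖y i‖ = m.rad u i) → y ∈ coordDom D τ :=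
    fun {u y} hu hy i hi => by
      rw [← norm_pos_iff, hy]; exact hrad hu i hi
  have hY : ∀ x ∈ fiber D ρ0 t β ε s, x ∈ U ∧ Y x ∈ coordDom D τ ∧ c.chart (Y x) = x ∧
      Y x ∈ m.space := by
    intro x hx
    obtain ⟨hxX, hxm, hxe⟩ := (mem_fiber_iff ht hε hε1 hsub hs).1 hx
    obtain ⟨-, u, hu, hxu⟩ := (h.mem_interval_iff ht hε hε1 hs c hJ).1 hxm
    rw [hpath] at hxu
    obtain ⟨-, hnrm, -⟩ := hxu.exists_absOf ht
    -- The moment lies in the relative interior of a face containing Θ_τ, so all coordinates of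
    -- lattice points in Θ_τ are nonzero.
    have hxU : x ∈ U := by
      induction x with
      | h v hv =>
        exact hmemU v hv fun w hw => hom_ne_zero_of_moment hxX ht rfl
          ⟨hw.1, fun u hu => hw.2 u (hnrm hu)⟩
    obtain ⟨h1, h2⟩ := hYU x hxX hxU
    have hn : ∀ i, ‖Y x i‖ = m.rad u i := by
      have h3 : c.IsAbsCoord t (moment D t x) fun i => ‖Y x i‖ :=
        ⟨fun i => norm_nonneg _, fun i hi => norm_pos_iff.2 (h1 i hi), by
          conv_rhs => rw [← h2]
          exact c.moment_chart_congr fun i => by rw [Complex.norm_real, norm_norm]⟩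
      exact fun i => congrFun (h3.unique ht hxu) i
    refine ⟨hxU, h1, h2, u, hu, hn, ?_⟩
    rw [← h2, auxEq_rep_chart, c.auxEq_vec hρ, sub_eq_zero] at hxe
    rw [hc, hP]
    exact hxe
  have hchart : ∀ y ∈ m.space, y ∈ coordDom D τ ∧ c.chart y ∈ fiber D ρ0 t β ε s := by
    rintro y ⟨u, hu, hn, he⟩
    have hyd := hdom hu.1 hn
    refine ⟨hyd, (mem_fiber_iff ht hε hε1 hsub hs).2 ⟨c.chart_mem_toricVariety hyd,
      (h.mem_interval_iff ht hε hε1 hs c hJ).2 ⟨fun hball => ?_, u, hu, ?_⟩, ?_⟩⟩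
    -- At u = 0 the moment is the boundary point s, which is not central; for u > 0 the constant
    -- term is strictly larger than P in absolute value.
    · have h4m := h4 _ hball
      have hab := habs hu.1 hn
      rcases hu.1.eq_or_lt with rfl | hu0
      · have hst := h.isAbsCoord_start ht (frontier_subset hs) c hJ
        rw [show m.rad 0 = m.r from funext m.rad_zero, hr] at hab
        have hsm : moment D t (c.chart y) = s := hab.2.2.symm.trans hst.2.2
        rw [hsm] at h4m
        obtain ⟨hsD, u, hu⟩ := mem_frontier_iff.1 hs
        have h5 := normals_ge hu.1 h4m
        rw [dotProduct_smul, hu.2 s rfl] at h5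
        simp only [smul_eq_mul] at h5
        linarith
      · have hpe : m.rad u = c.absOf {0} (rayParam D s' ξ' κ u) := by
          rw [← hpath]
          exact funext fun i => h.path_eq c hJ ⟨hu0, hu.2⟩ i
        have hn' := hn
        rw [hpe] at hab hn'
        have hG := (c.isAbsCoord_absOf_zero ht).1 hab
        have h5 := hlt _ _ hG h4m (fun i => y i.1) fun i => hn' i.1
        rw [hP, hc] at he
        rw [← he, norm_mul, norm_prod] at h5
        simp_rw [hn'] at h5
        exact lt_irrefl _ h5
    · rw [hpath]; exact habs hu.1 hn
    · rw [auxEq_rep_chart, c.auxEq_vec hρ, sub_eq_zero]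
      rwa [hP, hc] at he
  let e : fiber D ρ0 t β ε s ≃ₜ m.space :=
    { toFun := fun x => ⟨Y x.1, (hY x.1 x.2).2.2.2⟩
      invFun := fun y => ⟨c.chart y.1, (hchart y.1 y.2).2⟩
      left_inv := fun x => Subtype.ext (hY x.1 x.2).2.2.1
      right_inv := fun y => Subtype.ext (hYchart y.1 (hchart y.1 y.2).1).2
      continuous_toFun := by
        refine Continuous.subtype_mk ?_ _
        exact hYc.comp_continuous continuous_subtype_val fun x => (hY x.1 x.2).1
      continuous_invFun := by
        refine Continuous.subtype_mk (continuous_iff_continuousAt.2 fun y => ?_) _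
        exact ContinuousAt.comp (g := c.chart) (c.continuousAt_chart (hchart y.1 y.2).1)
          continuous_subtype_val.continuousAt }
  refine ⟨e, fun x => ⟨⟨(hY x.1 x.2).2.1, (hY x.1 x.2).2.2.1.symm⟩, fun y hy => ?_⟩⟩
  change y = Y x.1
  rw [hy.2, (hYchart y hy.1).2]

end TorusFib

theorem proposition3p2 {N : ℕ} (D : TorusFib.FamilyData N) :
    -- for a small ball `B` and a mini-copy `Δ' = ε Δ` inside it
    ∃ β₀ : ℝ, 0 < β₀ ∧ ∀ β : ℝ, 0 < β → β < β₀ →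
    ∀ ε : ℝ, 0 < ε → ε • D.Delta ⊆ TorusFib.centralBall N β →
    ∀ V : Finset (Fin N → ℝ) → Set (Fin N → ℝ), TorusFib.IsSmallCover D V →
    -- and for large `|t|`
    ∃ R : ℝ, 0 < R ∧
    ∀ ρ0 : Finset (Fin N → ℝ) → (Fin N → ℝ) → ℝ, TorusFib.IsPartition D V ρ0 →
    ∀ t : ℂ, R ≤ ‖t‖ →
    ∀ τ ∈ D.bdry, ∀ s ∈ TorusFib.W D V τ,
    ∀ F : Set (Fin N → ℝ), TorusFib.IsFace D.Delta F → s ∈ intrinsicInterior ℝ F →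
    ∀ l L : ℕ, l = TorusFib.dim (D.Theta τ) → L = TorusFib.dim F →
      l ≤ L ∧ L < N ∧ Nonempty (TorusFib.TauCoords D τ) ∧
      ∀ c : TorusFib.TauCoords D τ,
      ∃ r : Fin N → ℝ, c.IsAbsCoord t s r ∧
      ∃ p : C(TorusFib.fiber D ρ0 t β ε s, TorusFib.baseTorus l r),
        -- `p` is the projection to the first `l` coordinates
        (∀ x : TorusFib.fiber D ρ0 t β ε s, (∃ y, c.IsCoord x.1 y) ∧
          ∀ y, c.IsCoord x.1 y → ∀ i, (p x).1 i = y i.1) ∧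
        -- the points outside of the discriminant locus are generic
        IsOpen (c.disc ρ0 t s l r)ᶜ ∧ Dense (c.disc ρ0 t s l r)ᶜ ∧
        -- over them `p` is a fibration with fiber `T^{N-1-l}`
        (∃ e : {x : TorusFib.fiber D ρ0 t β ε s // p x ∉ c.disc ρ0 t s l r} ≃ₜ
            {Y : TorusFib.baseTorus l r // Y ∉ c.disc ρ0 t s l r} × TorusFib.Torus (N - 1 - l),
          ∀ x, ((e x).1 : TorusFib.baseTorus l r) = p x) ∧
        -- over the discriminant locus `p` is a fibration with fiber `T^{L-l}`
        (∃ e : {x : TorusFib.fiber D ρ0 t β ε s // p x ∈ c.disc ρ0 t s l r} ≃ₜ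
            {Y : TorusFib.baseTorus l r // Y ∈ c.disc ρ0 t s l r} × TorusFib.Torus (L - l),
          ∀ x, ((e x).1 : TorusFib.baseTorus l r) = p x) ∧
        -- `T_s` is homeomorphic to `T^{L-l} × ((T^l × T^{N-1-L}) / ∼)`, compatibly with `p`
        (∃ h : TorusFib.fiber D ρ0 t β ε s ≃ₜ TorusFib.Torus (L - l) ×
            Quotient (TorusFib.collapse (c.disc ρ0 t s l r) (TorusFib.Torus (N - 1 - L))),
          ∀ x, TorusFib.collapseBase _ _ (h x).2 = p x) ∧
        -- if `s` is interior to a facet, then `T_s` is an `(N-1)`-torus; in coordinates the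
        -- parametrization is a smooth immersion away from the discriminant locus, and everywhere
        -- if `I_s` starts in the interior of the mini-copy of the facet
        (L + 1 = N → ∃ Φ : TorusFib.Torus (N - 1) ≃ₜ TorusFib.fiber D ρ0 t β ε s,
          ∃ Y : (Fin (N - 1) → ℝ) → (Fin N → ℂ), ∀ θ : Fin (N - 1) → ℝ,
            c.IsCoord (Φ (fun i => Circle.exp (θ i))).1 (Y θ) ∧
            ((p (Φ (fun i => Circle.exp (θ i))) ∉ c.disc ρ0 t s l r ∨
                ∃ s' ∈ intrinsicInterior ℝ (ε • F), s ∈ TorusFib.curvedCone D t ε s') →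
              ContDiffAt ℝ ∞ Y θ ∧ Function.Injective (fderiv ℝ Y θ))) := by
  classical
  obtain ⟨β₀, hβ₀, hball⟩ := TorusFib.exists_ball D
  refine ⟨β₀, hβ₀, fun β hβ hββ ε hε hsub V hV => ?_⟩
  have h4 := hball β hβ hββ
  -- Without boundary simplices there is nothing to prove; otherwise ∂Δ is nonempty, which yields ε
  -- < 1.
  by_cases hne : ∃ τ, τ ∈ D.bdry
  swap
  · exact ⟨1, one_pos, fun _ _ _ _ τ hτ => absurd ⟨τ, hτ⟩ hne⟩
  obtain ⟨τ₀, hτ₀⟩ := hne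
  have hε1 : ε < 1 := TorusFib.FamilyData.lt_one_of_smul_subset hτ₀ h4 hsub
  obtain ⟨R₁, hR₁, hray⟩ := TorusFib.exists_isRay_of_mem_W hV hε hε1
  obtain ⟨K, hK, hconc⟩ := TorusFib.FamilyData.exists_concentration D
  -- The second bound brings the concentration error K/log|t| below 1/4.
  refine ⟨max R₁ (Real.exp (4 * K) + 1), by positivity, ?_⟩
  intro ρ0 hρ0 t htR τ hτ s hsW F hF hsF l L hl hL
  subst hl hL
  have htR₁ := (le_max_left _ _).trans htR
  have ht1 : 1 < ‖t‖ := hR₁.trans_le htR₁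
  have ht : t ≠ 0 := norm_pos_iff.1 (one_pos.trans ht1)
  have hlog : K / Real.log ‖t‖ < 1 / 4 := by
    have h1 : 4 * K < Real.log ‖t‖ := by
      rw [Real.lt_log_iff_exp_lt (one_pos.trans ht1)]
      linarith [(le_max_right _ _).trans htR]
    rw [div_lt_iff₀ (Real.log_pos ht1)]
    linarith
  have hsf := hV.W_subset_frontier hτ hsW
  have hsD := TorusFib.FamilyData.frontier_subset hsf
  obtain ⟨s', ξ', κ, hR, hJ⟩ := hray t htR₁ τ hτ s hsW
  have hFfc := TorusFib.FamilyData.IsFace.eq_fc hF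
  have hnF : D.nrm {s} = D.nrm F := by
    rw [hFfc] at hsF
    exact ((TorusFib.FamilyData.mem_intrinsicInterior_fc_iff hF.1 hF.2.subset).1 hsF).2
  have hdimF := TorusFib.FamilyData.dim_fc_add hF.1 hF.2.subset
  rw [← hFfc, ← hnF] at hdimF
  have hdimτ := TorusFib.FamilyData.dim_fc_add (TorusFib.FamilyData.bdry_nonempty hτ)
    (TorusFib.FamilyData.bdry_subset hτ)
  rw [← TorusFib.FamilyData.Theta_eq hτ] at hdimτ
  -- The facets through s are among those through s', and these among those through τ; comparing
  -- codimensions gives l ≤ L, and nonemptiness gives L < N.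
  have hle := Set.ncard_le_ncard (hR.nrm_subset.trans hJ) TorusFib.FamilyData.finite_nrm
  have hpos := (Set.ncard_pos TorusFib.FamilyData.finite_nrm).2
    (TorusFib.FamilyData.mem_frontier_iff.1 hsf).2
  refine ⟨by omega, by omega, TorusFib.FamilyData.exists_tauCoords hτ, fun c => ?_⟩
  have hlt : ∀ ξ x, TorusFib.IsGibbs D t D.A ξ x → (4 : ℝ) • x ∈ D.Delta →
      ∀ Y : {i : Fin N // (i : ℕ) < TorusFib.dim (D.Theta τ)} → ℂ,
      (∀ i, ‖Y i‖ = c.absOf {0} ξ i.1) →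
      ‖c.poly ρ0 t s Y‖ < ‖t ^ D.lam 0‖ * ∏ i ∈ Finset.univ.filter
        (fun i : Fin N => TorusFib.dim (D.Theta τ) ≤ (i : ℕ)), c.absOf {0} ξ i :=
    fun ξ x hG h4x Y hY => c.norm_poly_lt (hρ0.rho_mem_Icc hsf) ht
      (fun σ a hσ w hw => (hconc t ht1 D.A subset_rfl TorusFib.A_nonempty ξ x hG σ a hσ
        (TorusFib.FamilyData.face_subset_image hσ.mem_faces) w hw).trans_lt hlog)
      (hG.mem_interior ht).1 h4x hY
  obtain ⟨m, hr, hr', hc₀, hP, hreq⟩ := hR.exists_model ht hsf c hJ (ρ0 := ρ0)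
    (hlt _ _ hR.gibbs' (h4 _ (hsub (Set.smul_mem_smul_set hR.mem_Delta))))
  obtain ⟨e, he⟩ := hR.exists_homeo_model ht hε hε1 hsub h4 hsf c hJ
    (fun w hw0 hw => hρ0.rho_eq_zero hV hτ hsW hw0 hw) hlt hr hr' hc₀ hP
  have hzeros : m.zeros = c.disc ρ0 t s (TorusFib.dim (D.Theta τ)) m.r := by
    ext Y
    change m.P Y.1 = 0 ↔ c.poly ρ0 t s Y.1 = 0
    rw [hP]
  have hr0 : ∀ i, m.r i = 0 ↔ c.dual i ∈ D.nrm {s} := fun i => by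
    rw [hr, c.absOf_eq_zero_iff]
  -- The coordinates vanishing at s correspond to the N - L facets through s, which gives the torus
  -- dimensions L - l and N - 1 - L.
  have hcard : (Finset.univ.filter fun i => m.r i = 0).card = (D.nrm {s}).ncard := by
    rw [← Set.ncard_coe_finset, ← Set.ncard_image_of_injective _ c.dual_injective]
    congr 1
    ext u
    constructor
    · rintro ⟨i, hi, rfl⟩
      exact (hr0 i).1 (Finset.mem_filter.1 hi).2
    · intro hu
      obtain ⟨i, -, rfl⟩ := c.nrm_eq ▸ hJ (hR.nrm_subset hu)
      exact ⟨i, Finset.mem_coe.2 (Finset.mem_filter.2 ⟨Finset.mem_univ _, (hr0 i).2 hu⟩), rfl⟩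
  have hJzero := m.card_Jzero_add_one
  have hJsum := m.card_Jpos_add_card_Jzero
  have hrpos : ∀ i : Fin N, (i : ℕ) < TorusFib.dim (D.Theta τ) → 0 < m.r i := fun i hi => by
    rw [m.r_eq i hi]; exact m.r'_pos i
  refine ⟨m.r, by rw [hr]; exact hR.isAbsCoord_start ht hsD c hJ,
    m.proj.comp ⟨e, e.continuous⟩, ?_, c.isOpen_compl_disc ρ0 t s hrpos,
    c.dense_compl_disc ρ0 t s ht hrpos (hρ0.exists_rho_pos hV hτ hsW), ?_, ?_, ?_, ?_⟩
  · intro x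
    refine ⟨⟨_, (he x).1⟩, fun y hy i => ?_⟩
    rw [(he x).2 y hy]
    rfl
  · have h := m.exists_homeo_compl
    rw [hzeros] at h
    obtain ⟨f, hf⟩ := h
    exact ⟨(e.subtype fun _ => Iff.rfl).trans f, fun x => hf _⟩
  · have h := m.exists_homeo_zeros (n := TorusFib.dim F - TorusFib.dim (D.Theta τ)) (by omega)
    rw [hzeros] at h
    obtain ⟨f, hf⟩ := h
    exact ⟨(e.subtype fun _ => Iff.rfl).trans f, fun x => hf _⟩
  · have h := m.exists_homeo_collapse (n := TorusFib.dim F - TorusFib.dim (D.Theta τ))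
      (k := N - 1 - TorusFib.dim F) (by omega) (by omega)
    rw [hzeros] at h
    obtain ⟨f, hf⟩ := h
    exact ⟨e.trans f, fun x => hf _⟩
  · intro hLN
    -- Inside a facet only the coordinate of that facet vanishes.
    have hrne : ∀ i, i ≠ m.i₀ → m.r i ≠ 0 := fun i hi hri => by
      have h1 : m.Jzero.card = 0 := by omega
      have h2 : i ∈ m.Jzero := m.mem_Jzero.2 ⟨m.mem_J.2 ⟨m.le_of_r_eq_zero hri, hi⟩, hri⟩
      rw [Finset.card_eq_zero.1 h1] at h2
      exact absurd h2 (Finset.notMem_empty _)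
    have ecard : Fintype.card {i // i ≠ m.i₀} = N - 1 := by
      rw [Fintype.card_subtype_compl, Fintype.card_fin, Fintype.card_subtype_eq]
    obtain ⟨Φ, hΦ⟩ := m.exists_homeo_torus hrne (Fintype.equivFinOfCardEq ecard)
    refine ⟨Φ.trans e.symm, m.angleParam (Fintype.equivFinOfCardEq ecard), fun θ => ⟨?_, ?_⟩⟩
    · have h1 := (he (e.symm (Φ fun i => Circle.exp (θ i)))).1
      rw [e.apply_symm_apply, hΦ] at h1
      exact h1
    · intro h
      refine m.contDiffAt_angleParam hrne _ ?_
      rcases h with h | ⟨m', hm', τ', hτ', c', r₁', r₁, hcone⟩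
      · refine Or.inl fun hP0 => h ?_
        rw [← hzeros]
        change m.P (m.proj (e (e.symm (Φ fun i => Circle.exp (θ i))))).1 = 0
        rw [e.apply_symm_apply]
        convert hP0 using 2
        funext i
        change (Φ fun i => Circle.exp (θ i)).1 i.1 = _
        rw [hΦ]
        exact congrFun (m.param_restrict _ _) i
      -- By uniqueness of the ray, its foot is interior to the copy of the facet, so the facet
      -- normal is the only normal there and every other radius is constant along the ray.
      · obtain ⟨s₁', ξ₁', κ₁, rfl, -, hR₁'⟩ := hcone.exists_isRay ht hε hε1
        obtain ⟨rfl, -, -⟩ := TorusFib.IsRay.unique ht hε hsf hR hR₁'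
        rw [hFfc, TorusFib.mem_intrinsicInterior_smul_fc_iff hF.1 hF.2.subset hε.ne'] at hm'
        obtain ⟨s₂', hs₂', -, hnrm⟩ := hm'
        obtain rfl := smul_right_injective _ hε.ne' hs₂'
        refine Or.inr fun i hi => hreq i fun hmem => hrne i hi ((hr0 i).2 ?_)
        rw [hnF, ← hnrm]
        exact hmem
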